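/- Let $d\ge 1$. Write $D=-i\nabla$ on $\mathbb R^d$ and let $m(D)$ denote the Fourier multiplier with symbol $m$; let $\mathcal P$ be the space of polynomials on $\mathbb R^d$. Fix a smooth radial $\psi:\mathbb R^d\to[0,1]$ with compact support in $\{|\xi|<4/3\}$ and $\psi=1$ on $\{|\xi|\le 3/4\}$, put $\varphi(\xi)=\psi(\xi/2)-\psi(\xi)$, so that $\sum_{j\in\mathbb Z}\varphi(2^{-j}\xi)=1$ for $\xi\neq0$, and $\dot\Delta_j=\varphi(2^{-j}D)$. The homogeneous Besov space $\dot B^s_{\infty,1}$ consists of the $u\in\mathcal S'(\mathbb R^d)/\mathcal P$ with $\|u\|_{\dot B^s_{\infty,1}}=\sum_j2^{sj}\|\dot\Delta_ju\|_{L^\infty}<\infty$. All Besov data below are real-valued. Elements of $\dot B^0_{\infty,1}$ are identified with the bounded functions $\sum_j\dot\Delta_ju$. *Dirichlet–Neumann operators.* Let $\sigma=-1$, $J=(-\infty,0)$ (lower domain, superscript $-$) or $\sigma=+1$, $J=(0,\infty)$ (upper domain, superscript $+$). For $\eta,f\in\dot B^1_{\infty,1}$ let $H(x,z)=e^{-|z||D|}\eta(x)$,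 $\partial_zH=-\sigma|D|H$, and for $v:\mathbb R^d\times J\to\mathbb C$ let $$Q_a[v]=\nabla_xH\cdot\nabla_xv-\frac{|\nabla_xH|^2-\partial_zH}{1+\partial_zH}\,\partial_zv,\qquad Q_b[v]=|D|^{-1}\operatorname{div}_x\big(\nabla_xH\,\partial_zv-\partial_zH\,\nabla_xv\big),$$ $$w[v](x,z)=-\sigma\int_{\{\tau:\ \sigma(\tau-z)>0\}}e^{-|z-\tau||D|}|D|\big(Q_b[v]+\sigma Q_a[v]\big)(x,\tau)\,d\tau,$$ $$\mathcal T[v](x,z)=e^{-|z||D|}f(x)+\int_0^ze^{-|z-z'||D|}\big(w[v]+Q_a[v]\big)(x,z')\,dz' .$$ Here $e^{-|z||D|}f$ is understood up to an additive constant. Let $\mathcal V_*$ be the space of Lipschitz functions $v$ on $\mathbb R^d\times J$, modulo constants, such that $|D|v$ and $\partial_zv$ belong to $L^\infty(J;L^\infty)$ and $\sum_j2^j\int_J\|\dot\Delta_ju(\cdot,z)\|_{L^\infty}dz<\infty$ for $u=|D|v$ and $u=\partial_zv$. If $v\in\mathcal V_*$ is the fixed point of $\mathcal T$ (modulo constants),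 set $$R^\pm(\eta)f=w[v]|_{z=0},\qquad G^\pm(\eta)f=\mp|D|f+R^\pm(\eta)f .$$ *The fixed-point map.* For viscosities $\mu^\pm>0$ and densities $\rho^\pm\in\mathbb R$ put $\llbracket\rho\rrbracket=\rho^--\rho^+$ and $$\mathcal K(\eta)g=\frac{1}{\mu^++\mu^-}\Big(\mu^-|D|^{-1}R^+(\eta)-\mu^+|D|^{-1}R^-(\eta)\Big)g-\frac{\llbracket\rho\rrbracket\,\mu^-}{\mu^++\mu^-}|D|^{-1}G^+(\eta)\eta .$$ **Proposition.** Let $r\ge0$. There are constants $c_*=c_*(d,r)>0$ and $C=C(d,r)>0$ (depending otherwise only on the fixed choice of $\psi$) such that for all $\mu^\pm>0$, all $\rho^\pm$, and all $\eta\in\dot B^1_{\infty,1}\cap\dot B^{1+r}_{\infty,1}$ with $$\||D|\eta\|_{\dot B^0_{\infty,1}}<c_*,$$ $\mathcal K(\eta)$ is a well-defined map of $\dot B^1_{\infty,1}\cap\dot B^{1+r}_{\infty,1}$ into itself, it has a unique fixed point $f^-$ in $\dot B^1_{\infty,1}\cap\dot B^{1+r}_{\infty,1}$, and $$\||D|f^-\|_{\dot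 B^r_{\infty,1}}\le C\,|\llbracket\rho\rrbracket|\,\||D|\eta\|_{\dot B^r_{\infty,1}} .$$ (In the stable case $\rho^+<\rho^-$ one has $|\llbracket\rho\rrbracket|=\llbracket\rho\rrbracket$.) -/

import Mathlib

open scoped SchwartzMap FourierTransform ENNReal NNReal ContDiff

noncomputable section

namespace Muskat

/-- `ℝ^d` with its Euclidean norm. -/
abbrev Rd (d : ℕ) : Type := EuclideanSpace ℝ (Fin d)

variable {d : ℕ}

/-! ## Tempered distributions modulo polynomials -/

/-- The subspace `𝒫(ℝ^d)` of `𝓢'(ℝ^d)` spanned by the (distributions given by) polynomials. -/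
def polynomials (d : ℕ) : Submodule ℂ 𝓢'(Rd d, ℂ) :=
  Submodule.span ℂ {T | ∃ p : MvPolynomial (Fin d) ℂ, ∀ χ : 𝓢(Rd d, ℂ),
    T χ = ∫ x : Rd d, MvPolynomial.eval (fun i => (x i : ℂ)) p * χ x}

/-- `𝓢'(ℝ^d) / 𝒫(ℝ^d)`. -/
abbrev TempModPoly (d : ℕ) : Type := 𝓢'(Rd d, ℂ) ⧸ polynomials d

/-- A class is real-valued if one of its representatives is real on real test functions. -/
def IsReal (u : TempModPoly d) : Prop :=
  ∃ T : 𝓢'(Rd d, ℂ), Submodule.Quotient.mk T = u ∧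
    ∀ χ : 𝓢(Rd d, ℂ), (∀ x, (χ x).im = 0) → (T χ).im = 0

lemma tsupport_lineDeriv_subset (χ : 𝓢(Rd d, ℂ)) (v : Rd d) (h : (0 : Rd d) ∉ tsupport χ) :
    (0 : Rd d) ∉ tsupport (LineDeriv.lineDerivOp v χ : 𝓢(Rd d, ℂ)) := by
  rw [notMem_tsupport_iff_eventuallyEq] at h ⊢
  filter_upwards [h.eventually_nhds] with x hx
  rw [SchwartzMap.lineDerivOp_apply_eq_fderiv]
  have : fderiv ℝ χ x = fderiv ℝ (0 : Rd d → ℂ) x := Filter.EventuallyEq.fderiv_eq hx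
  rw [this]
  simp

/-- Multiplying `𝓕 χ` by a polynomial gives `𝓕 χ'`, where `χ'` still vanishes near the origin. -/
lemma exists_fourier_eq_eval_mul (p : MvPolynomial (Fin d) ℂ) :
    ∀ χ : 𝓢(Rd d, ℂ), (0 : Rd d) ∉ tsupport χ → ∃ χ' : 𝓢(Rd d, ℂ), (0 : Rd d) ∉ tsupport χ' ∧
      ∀ x, MvPolynomial.eval (fun i => (x i : ℂ)) p * (𝓕 χ) x = (𝓕 χ') x := by
  induction p using MvPolynomial.induction_on with
  | C a =>
    intro χ hχ
    refine ⟨a • χ, fun h => hχ (closure_mono (fun x hx => ?_) h), fun x => ?_⟩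
    · intro h0
      apply hx
      simp [h0]
    · rw [FourierTransform.fourier_smul]
      simp
  | add p q hp hq =>
    intro χ hχ
    obtain ⟨χ₁, h₁, e₁⟩ := hp χ hχ
    obtain ⟨χ₂, h₂, e₂⟩ := hq χ hχ
    refine ⟨χ₁ + χ₂, ?_, fun x => ?_⟩
    · rw [notMem_tsupport_iff_eventuallyEq] at h₁ h₂ ⊢
      filter_upwards [h₁, h₂] with x a b
      simp [a, b]
    · rw [FourierTransform.fourier_add]
      simp [add_mul, e₁, e₂]
  | mul_X p i hp =>
    intro χ hχ
    obtain ⟨χ', h', e'⟩ := hp ((2 * Real.pi * Complex.I)⁻¹ •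
      (LineDeriv.lineDerivOp (EuclideanSpace.single i (1 : ℝ)) χ : 𝓢(Rd d, ℂ))) (by
        refine fun h => tsupport_lineDeriv_subset χ (EuclideanSpace.single i 1) hχ
          (closure_mono (fun x hx => ?_) h)
        intro h0
        apply hx
        simp [h0])
    refine ⟨χ', h', fun x => ?_⟩
    rw [← e' x, FourierTransform.fourier_smul, SchwartzMap.fourier_lineDerivOp_eq]
    have hg : (fun y : Rd d => inner ℝ y (EuclideanSpace.single i (1 : ℝ))).HasTemperateGrowth := by
      fun_prop
    have hpi : (2 * Real.pi * Complex.I : ℂ) ≠ 0 := Complex.two_pi_I_ne_zero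
    rw [smul_apply, smul_apply, SchwartzMap.smulLeftCLM_apply_apply hg]
    simp only [map_mul, MvPolynomial.eval_X, EuclideanSpace.inner_single_right, smul_eq_mul,
      Complex.real_smul, one_mul, RCLike.conj_to_real]
    field_simp

/-- A polynomial pairs to zero with `𝓕 χ` when `χ` vanishes near the origin. -/
lemma polynomials_pair_eq_zero (χ : 𝓢(Rd d, ℂ)) (hχ : (0 : Rd d) ∉ tsupport χ) :
    ∀ T ∈ polynomials d, T (𝓕 χ) = 0 := by
  intro T hT
  induction hT using Submodule.span_induction with
  | mem T h =>
    obtain ⟨p, hp⟩ := h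
    obtain ⟨χ', h', e'⟩ := exists_fourier_eq_eval_mul p χ hχ
    rw [hp]
    simp only [e']
    have h1 : (𝓕⁻ (𝓕 χ')) 0 = χ' 0 := by simp
    have h2 : (𝓕⁻ (𝓕 χ')) 0 = ∫ x, (𝓕 χ') x := by
      rw [SchwartzMap.fourierInv_coe, Real.fourierInv_eq]
      simp
    rw [← h2, h1]
    exact image_eq_zero_of_notMem_tsupport h'
  | zero => simp
  | add S T _ _ hS hT =>
    change S (𝓕 χ) + T (𝓕 χ) = 0
    rw [hS, hT, add_zero]
  | smul a T _ hT =>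
    change a • T (𝓕 χ) = 0
    rw [hT, smul_zero]

/-- Evaluation of a tempered distribution at a test function, as a linear functional. -/
def evalAt (χ : 𝓢(Rd d, ℂ)) : 𝓢'(Rd d, ℂ) →ₗ[ℂ] ℂ where
  toFun T := T χ
  map_add' _ _ := rfl
  map_smul' _ _ := rfl

open Classical in
/-- The pairing `⟨û, χ⟩ = ⟨u, 𝓕 χ⟩` of a class `u` modulo polynomials with a test function `χ`
which is smooth, compactly supported and supported away from the origin (and `0` for any other
`χ`; it is only used for such `χ`). -/
def pairHat (u : TempModPoly d) (χ : Rd d → ℂ) : ℂ :=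
  if h : (HasCompactSupport χ ∧ ContDiff ℝ ∞ χ) ∧ (0 : Rd d) ∉ tsupport χ then
    (polynomials d).liftQ (evalAt (𝓕 (h.1.1.toSchwartzMap h.1.2)))
      (fun T hT => polynomials_pair_eq_zero _ h.2 T hT) u
  else 0

/-! ## Fourier multipliers

Symbols are functions of the frequency `ζ` for which `D = -i∇`, so that `ζ = 2π ξ` where `ξ` is the
frequency variable of Mathlib's Fourier transform `∫ exp(-2πi x·ξ) f(x) dx`. -/

/-- `(m(D)u)(x) = ⟨û, exp(2πi x·ξ) m(2πξ)⟩` for `u ∈ 𝓢'/𝒫` and a symbol `m` which is smooth with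
compact support in `ℝ^d ∖ {0}`. -/
def multC (m : Rd d → ℂ) (u : TempModPoly d) (x : Rd d) : ℂ :=
  pairHat u (fun ξ => Complex.exp (2 * Real.pi * Complex.I * (inner ℝ x ξ : ℝ)) *
    m ((2 * Real.pi) • ξ))

/-- `m(D)q` for a function `q`: convolution with the inverse Fourier transform of the symbol. -/
def multF (m : Rd d → ℂ) (q : Rd d → ℂ) (x : Rd d) : ℂ :=
  ∫ y, 𝓕⁻ (fun ξ : Rd d => m ((2 * Real.pi) • ξ)) (x - y) * q y

/-- The symbol `|ζ|` of `|D|`. -/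
def absSym (ζ : Rd d) : ℂ := (‖ζ‖ : ℝ)

/-- The symbol `iζ_k` of `∂_k`. -/
def gradSym (k : Fin d) (ζ : Rd d) : ℂ := Complex.I * (ζ k : ℝ)

/-- The symbol of the Poisson semigroup `exp(-t|D|)`. -/
def poissonSym (t : ℝ) (ζ : Rd d) : ℂ := (Real.exp (-(t * ‖ζ‖)) : ℝ)

/-! ## Littlewood-Paley decomposition and homogeneous Besov spaces -/

/-- A radial low-frequency cut-off `ψ`. The function `φ(ζ) = ψ(ζ/2) - ψ(ζ)` is then a radial
`[0,1]`-valued bump supported in the annulus `3/4 ≤ |ζ| ≤ 8/3`, with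
`∑_j φ(2^{-j}ζ) = 1` for `ζ ≠ 0`. -/
structure IsCutoff (ψ : Rd d → ℝ) : Prop where
  contDiff : ContDiff ℝ ∞ ψ
  radial : ∀ ζ ζ' : Rd d, ‖ζ‖ = ‖ζ'‖ → ψ ζ = ψ ζ'
  mem_Icc : ∀ ζ, ψ ζ ∈ Set.Icc (0 : ℝ) 1
  eq_one : ∀ ζ : Rd d, ‖ζ‖ ≤ 3 / 4 → ψ ζ = 1
  tsupport_subset : tsupport ψ ⊆ Metric.ball 0 (4 / 3)

lemma exists_isCutoff (d : ℕ) : ∃ ψ : Rd d → ℝ, IsCutoff ψ := by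
  refine ⟨fun ζ => Real.smoothTransition (25 / 16 - ‖ζ‖ ^ 2), ?_, ?_, ?_, ?_, ?_⟩
  · exact Real.smoothTransition.contDiff.comp (contDiff_const.sub (contDiff_norm_sq ℝ))
  · intro ζ ζ' h
    simp only [h]
  · exact fun ζ => ⟨Real.smoothTransition.nonneg _, Real.smoothTransition.le_one _⟩
  · intro ζ h
    apply Real.smoothTransition.one_of_one_le
    nlinarith [norm_nonneg ζ]
  · have : tsupport (fun ζ : Rd d => Real.smoothTransition (25 / 16 - ‖ζ‖ ^ 2)) ⊆
        Metric.closedBall 0 (5 / 4) := by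
      apply closure_minimal _ Metric.isClosed_closedBall
      intro ζ h
      rw [mem_closedBall_zero_iff]
      by_contra! h'
      apply h
      apply Real.smoothTransition.zero_of_nonpos
      nlinarith
    exact this.trans (Metric.closedBall_subset_ball (by norm_num))

/-- The symbol `φ(2^{-j}ζ)` of the dyadic block `Δ_j`. -/
def dyadicSym (ψ : Rd d → ℝ) (j : ℤ) (ζ : Rd d) : ℂ :=
  (ψ ((2 : ℝ)⁻¹ • ((2 : ℝ) ^ (-j)) • ζ) - ψ (((2 : ℝ) ^ (-j)) • ζ) : ℝ)

/-- The function `Δ_j m(D) u`, for a class `u` and a symbol `m` smooth away from the origin. -/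
def blockC (ψ : Rd d → ℝ) (m : Rd d → ℂ) (j : ℤ) (u : TempModPoly d) : Rd d → ℂ :=
  multC (fun ζ => m ζ * dyadicSym ψ j ζ) u

/-- The function `Δ_j m(D) q`, for a function `q` and a symbol `m` smooth away from the origin. -/
def blockF (ψ : Rd d → ℝ) (m : Rd d → ℂ) (j : ℤ) (q : Rd d → ℂ) : Rd d → ℂ :=
  multF (fun ζ => m ζ * dyadicSym ψ j ζ) q

/-- The norm `‖m(D)u‖_{Ḃ^s_{∞,1}} = ∑_j 2^{sj} ‖Δ_j m(D)u‖_{L^∞}`. -/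
def besovNorm (ψ : Rd d → ℝ) (m : Rd d → ℂ) (s : ℝ) (u : TempModPoly d) : ℝ≥0∞ :=
  ∑' j : ℤ, (2 : ℝ≥0∞) ^ (s * j) * ⨆ x, ‖blockC ψ m j u x‖ₑ

/-- Real-valued elements of `Ḃ^1_{∞,1} ∩ Ḃ^{1+r}_{∞,1}`. -/
structure MemSpace (ψ : Rd d → ℝ) (r : ℝ) (u : TempModPoly d) : Prop where
  isReal : IsReal u
  base : besovNorm ψ 1 1 u < ⊤
  high : besovNorm ψ 1 (1 + r) u < ⊤

/-- The bounded function `m(D)u = ∑_j Δ_j m(D)u`, for `m(D)u ∈ Ḃ^0_{∞,1} ⊂ L^∞`. -/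
def realize (ψ : Rd d → ℝ) (m : Rd d → ℂ) (u : TempModPoly d) (x : Rd d) : ℂ :=
  ∑' j : ℤ, blockC ψ m j u x

/-! ## The straightened elliptic problem

The sign `σ = -1` stands for the lower domain `{y < η(x)}`, straightened to `z < 0`, and `σ = 1`
for the upper domain `{y > η(x)}`, straightened to `z > 0`; the change of variables is
`y = z + H(x, z)` with `H(x, z) = (exp(-|z||D|) η)(x)`. -/

/-- The range `J` of the vertical variable. -/
def side (σ : ℝ) : Set ℝ := {z | 0 < σ * z}

/-- `∂_k H`. -/
def gradH (ψ : Rd d → ℝ) (η : TempModPoly d) (k : Fin d) (x : Rd d) (z : ℝ) : ℂ :=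
  realize ψ (fun ζ => gradSym k ζ * poissonSym |z| ζ) η x

/-- `∂_z H`, which is `|D|H` for `z < 0` and `-|D|H` for `z > 0`. -/
def dzH (ψ : Rd d → ℝ) (σ : ℝ) (η : TempModPoly d) (x : Rd d) (z : ℝ) : ℂ :=
  -σ * realize ψ (fun ζ => absSym ζ * poissonSym |z| ζ) η x

/-- `∂_k v`. -/
def dx (k : Fin d) (v : Rd d → ℝ → ℂ) (x : Rd d) (z : ℝ) : ℂ :=
  lineDeriv ℝ (fun y => v y z) x (EuclideanSpace.single k 1)

/-- `∂_z v`. -/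
def dz (v : Rd d → ℝ → ℂ) (x : Rd d) (z : ℝ) : ℂ := deriv (v x) z

/-- `Q_a[v] = ∇H·∇v - (|∇H|² - ∂_z H)/(1 + ∂_z H) ∂_z v`. -/
def Qa (ψ : Rd d → ℝ) (σ : ℝ) (η : TempModPoly d) (v : Rd d → ℝ → ℂ) (x : Rd d) (z : ℝ) : ℂ :=
  ∑ k, gradH ψ η k x z * dx k v x z -
    (∑ k, gradH ψ η k x z ^ 2 - dzH ψ σ η x z) / (1 + dzH ψ σ η x z) * dz v x z

/-- The `k`-th component of the vector field `∇H ∂_z v - ∂_z H ∇v`, of which `Q_b[v]` is the image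
under `|D|⁻¹ div`. -/
def Qvec (ψ : Rd d → ℝ) (σ : ℝ) (η : TempModPoly d) (v : Rd d → ℝ → ℂ) (k : Fin d) (x : Rd d)
    (z : ℝ) : ℂ :=
  gradH ψ η k x z * dz v x z - dzH ψ σ η x z * dx k v x z

/-- `exp(-t|D|) |D| (Q_b[v] + σ Q_a[v])` at height `z`, where `|D| Q_b[v] = div (Qvec)`. -/
def source (ψ : Rd d → ℝ) (σ : ℝ) (η : TempModPoly d) (v : Rd d → ℝ → ℂ) (t : ℝ) (x : Rd d)
    (z : ℝ) : ℂ :=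
  ∑ k, multF (fun ζ => gradSym k ζ * poissonSym t ζ) (fun y => Qvec ψ σ η v k y z) x +
    σ * multF (fun ζ => absSym ζ * poissonSym t ζ) (fun y => Qa ψ σ η v y z) x

/-- The solution `w = (∂_z + σ|D|)v - Q_a[v]` of `(∂_z - σ|D|)w = |D|(Q_b[v] + σ Q_a[v])`
which vanishes at infinity.
For `σ = -1`: `w(z) = ∫_{-∞}^z exp(-(z-τ)|D|) |D| (Q_b[v] - Q_a[v])(τ) dτ`.
For `σ = 1`: `w(z) = -∫_z^∞ exp(-(τ-z)|D|) |D| (Q_b[v] + Q_a[v])(τ) dτ`. -/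
def wField (ψ : Rd d → ℝ) (σ : ℝ) (η : TempModPoly d) (v : Rd d → ℝ → ℂ) (x : Rd d) (z : ℝ) : ℂ :=
  -σ * ∫ τ in {τ : ℝ | 0 < σ * (τ - z)}, source ψ σ η v |z - τ| x τ

/-- `exp(-|z||D|) f`, which is defined up to an additive constant; the constant is fixed so that
the function vanishes at `(0, 0)`. -/
def harm (ψ : Rd d → ℝ) (f : TempModPoly d) (x : Rd d) (z : ℝ) : ℂ :=
  ∑' j : ℤ, (blockC ψ (poissonSym |z|) j f x - blockC ψ 1 j f 0)

/-- The operator `𝒯`: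
`𝒯[v](x, z) = exp(-|z||D|) f + ∫_0^z exp(-|z-z'||D|) {w + Q_a[v]}(x, z') dz'`. -/
def opT (ψ : Rd d → ℝ) (σ : ℝ) (η f : TempModPoly d) (v : Rd d → ℝ → ℂ) (x : Rd d) (z : ℝ) : ℂ :=
  harm ψ f x z + ∫ z' in (0 : ℝ)..z,
    multF (poissonSym |z - z'|) (fun y => wField ψ σ η v y z' + Qa ψ σ η v y z') x

/-- The Chemin-Lerner norm `∑_j 2^j ‖Δ_j m(D) u‖_{L^1(J; L^∞)}` of `m(D)u` in `L̃^1(J; Ḃ^1_{∞,1})`. -/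
def cheminLerner (ψ : Rd d → ℝ) (σ : ℝ) (m : Rd d → ℂ) (u : Rd d → ℝ → ℂ) : ℝ≥0∞ :=
  ∑' j : ℤ, (2 : ℝ≥0∞) ^ (j : ℝ) *
    ∫⁻ z in side σ, ⨆ x, ‖blockF ψ m j (fun y => u y z) x‖ₑ

/-- The space `𝒱_*` of all `v` on `ℝ^d × J` such that `|D|v` and `∂_z v` belong to
`X_* = L^∞(J; L^∞) ∩ L̃^1(J; Ḃ^1_{∞,1})`. Such a `v` has `|D|v ∈ L̃^∞(J; Ḃ^0_{∞,1})`, hence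
`∇_x v ∈ L^∞`, so it is a Lipschitz function and its distributional derivatives are its
almost everywhere derivatives. -/
structure MemV (ψ : Rd d → ℝ) (σ : ℝ) (v : Rd d → ℝ → ℂ) : Prop where
  lipschitz : ∃ K : ℝ≥0, LipschitzOnWith K (fun p : Rd d × ℝ => v p.1 p.2) (Set.univ ×ˢ side σ)
  absD_bounded : ∃ M : ℝ, ∀ z ∈ side σ, ∀ x,
    ‖∑' j : ℤ, blockF ψ absSym j (fun y => v y z) x‖ ≤ M
  absD_cheminLerner : cheminLerner ψ σ absSym v < ⊤
  dz_cheminLerner : cheminLerner ψ σ 1 (dz v) < ⊤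

/-- `v ∈ 𝒱_*` is a fixed point of `𝒯`, up to an additive constant. -/
def IsPotential (ψ : Rd d → ℝ) (σ : ℝ) (η f : TempModPoly d) (v : Rd d → ℝ → ℂ) : Prop :=
  MemV ψ σ v ∧ ∃ c : ℂ, ∀ x, ∀ z ∈ side σ, v x z = opT ψ σ η f v x z + c

/-! ## Dirichlet-Neumann operators and the two-phase fixed-point map -/

/-- `R = R^±(η) f`, the trace of `w` at `z = 0` when `v` is the fixed point of `𝒯`. -/
def IsRemainder (ψ : Rd d → ℝ) (σ : ℝ) (η f : TempModPoly d) (R : Rd d → ℂ) : Prop :=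
  ∃ v, IsPotential ψ σ η f v ∧ ∀ x, R x = wField ψ σ η v x 0

/-- `Δ_j m(D) G^±(η) f`, where `G^±(η) f = ∓|D| f + R^±(η) f` and `R = R^±(η) f`. -/
def blockDN (ψ : Rd d → ℝ) (m : Rd d → ℂ) (j : ℤ) (σ : ℝ) (f : TempModPoly d) (R : Rd d → ℂ)
    (x : Rd d) : ℂ :=
  -σ * blockC ψ (m * absSym) j f x + blockF ψ m j R x

/-- `h = 𝒦(η) g` in `𝓢'/𝒫`, that is,
`h = (μ⁻|D|⁻¹R⁺(η)g - μ⁺|D|⁻¹R⁻(η)g)/(μ⁺+μ⁻) - (ρ⁻-ρ⁺)μ⁻/(μ⁺+μ⁻) |D|⁻¹G⁺(η)η`;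
a class is determined by its dyadic blocks. Here `μp = μ⁺`, `μm = μ⁻`, `ρp = ρ⁺`, `ρm = ρ⁻`. -/
def TwoPhaseMap (ψ : Rd d → ℝ) (μp μm ρp ρm : ℝ) (η g h : TempModPoly d) : Prop :=
  ∃ Rp Rm Rη : Rd d → ℂ,
    IsRemainder ψ 1 η g Rp ∧ IsRemainder ψ (-1) η g Rm ∧ IsRemainder ψ 1 η η Rη ∧
    ∀ (j : ℤ) (x : Rd d), blockC ψ 1 j h x =
      1 / (μp + μm) * (μm * blockF ψ absSym⁻¹ j Rp x - μp * blockF ψ absSym⁻¹ j Rm x) -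
        (ρm - ρp) * μm / (μp + μm) * blockDN ψ absSym⁻¹ j 1 η Rη x

end Muskat

end

open scoped SchwartzMap FourierTransform ENNReal NNReal ContDiff Real
open MeasureTheory Filter Topology
open ENNReal (ofReal ofReal_le_ofReal ofReal_mul ofReal_lt_top mul_lt_top tsum_le_tsum add_lt_top toReal_mono toReal_nonneg)
open Real (norm_of_nonneg)
open Complex (I norm_real)
open Finset (sum_insert sum_congr sum_le_sum sum_nonneg mul_sum sum_mul single_le_sum)
noncomputable section
namespace Muskat
variable {d : ℕ}

/-! ## Symbols and their convolution kernels -/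

/-- The convolution kernel of `m(D)`. -/
def ker (m : Rd d → ℂ) : Rd d → ℂ := 𝓕⁻ (fun ξ : Rd d => m ((2 * π) • ξ))

/-- The `L¹` norm of the convolution kernel of `m(D)`. -/
def symNorm (m : Rd d → ℂ) : ℝ≥0∞ := ∫⁻ x, ‖ker m x‖ₑ

/-- The supremum norm of a function. -/
def supN {X : Type*} (q : X → ℂ) : ℝ≥0∞ := ⨆ x, ‖q x‖ₑ

/-- Continuous integrable symbols whose kernel is integrable. -/
structure L1Sym (m : Rd d → ℂ) : Prop where
  cont : Continuous m
  int : Integrable m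
  kint : Integrable (ker m)

/-- Bounded measurable functions. -/
structure BM (q : Rd d → ℂ) : Prop where
  meas : Measurable q
  fin : supN q < ⊤

lemma multF_eq (m q : Rd d → ℂ) (x : Rd d) : multF m q x = ∫ y, ker m (x - y) * q y := rfl

lemma le_supN {X : Type*} (q : X → ℂ) (x : X) : ‖q x‖ₑ ≤ supN q := le_iSup (fun x => ‖q x‖ₑ) x

lemma supN_add_le {X : Type*} (f g : X → ℂ) : supN (f + g) ≤ supN f + supN g :=
  iSup_le fun x => (enorm_add_le _ _).trans (add_le_add (le_supN f x) (le_supN g x))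

lemma supN_mul_le {X : Type*} (f g : X → ℂ) : supN (f * g) ≤ supN f * supN g :=
  iSup_le fun x => by
    rw [Pi.mul_apply, enorm_mul]; exact mul_le_mul' (le_supN f x) (le_supN g x)

lemma supN_const_mul {X : Type*} (c : ℂ) (f : X → ℂ) :
    supN (fun x => c * f x) = ‖c‖ₑ * supN f := by
  simp only [supN, enorm_mul, ENNReal.mul_iSup]

lemma norm_le_supN {X : Type*} {q : X → ℂ} (h : supN q < ⊤) (x : X) : ‖q x‖ ≤ (supN q).toReal := by
  rw [← toReal_enorm]; exact toReal_mono h.ne (le_supN q x)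

lemma supN_le_ofReal {X : Type*} {q : X → ℂ} {M : ℝ} (h : ∀ x, ‖q x‖ ≤ M) :
    supN q ≤ ofReal M :=
  iSup_le fun x => by rw [← ofReal_norm]; exact ofReal_le_ofReal (h x)

lemma supN_lt_top {X : Type*} {q : X → ℂ} {M : ℝ} (h : ∀ x, ‖q x‖ ≤ M) : supN q < ⊤ :=
  (supN_le_ofReal h).trans_lt ofReal_lt_top

lemma eq_zero_of_supN {X : Type*} {q : X → ℂ} (h : supN q = 0) (x : X) : q x = 0 := by
  have := le_supN q x
  rw [h] at this
  simpa using this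

lemma BM.add {f g : Rd d → ℂ} (hf : BM f) (hg : BM g) : BM (f + g) :=
  ⟨hf.meas.add hg.meas, (supN_add_le f g).trans_lt (ENNReal.add_lt_top.2 ⟨hf.fin, hg.fin⟩)⟩

lemma BM.mul {f g : Rd d → ℂ} (hf : BM f) (hg : BM g) : BM (f * g) :=
  ⟨hf.meas.mul hg.meas, (supN_mul_le f g).trans_lt (mul_lt_top hf.fin hg.fin)⟩

lemma BM.const_mul {f : Rd d → ℂ} (c : ℂ) (hf : BM f) : BM (fun x => c * f x) :=
  ⟨hf.meas.const_mul c, by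
    rw [supN_const_mul]; exact mul_lt_top enorm_lt_top hf.fin⟩

lemma BM.of_bound {f : Rd d → ℂ} (hf : Measurable f) {M : ℝ} (h : ∀ x, ‖f x‖ ≤ M) : BM f :=
  ⟨hf, supN_lt_top h⟩

namespace L1Sym

variable {m m₁ m₂ : Rd d → ℂ}

lemma int_scaled (h : L1Sym m) : Integrable (fun ξ : Rd d => m ((2 * π) • ξ)) :=
  h.int.comp_smul Real.two_pi_pos.ne'

lemma cont_scaled (h : L1Sym m) : Continuous (fun ξ : Rd d => m ((2 * π) • ξ)) :=
  h.cont.comp (continuous_const_smul _)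

end L1Sym

lemma continuous_ker {m : Rd d → ℂ} (h : Integrable m) : Continuous (ker m) := by
  have h' : Integrable (fun ξ : Rd d => m ((2 * π) • ξ)) := h.comp_smul Real.two_pi_pos.ne'
  have : Continuous (𝓕 (fun ξ : Rd d => m ((2 * π) • ξ))) :=
    VectorFourier.fourierIntegral_continuous Real.continuous_fourierChar
      (by exact continuous_inner) h'
  have h2 : ker m = fun x => 𝓕 (fun ξ : Rd d => m ((2 * π) • ξ)) (-x) := by
    ext x; exact Real.fourierInv_eq_fourier_neg _ _
  rw [h2]
  exact this.comp continuous_neg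

lemma L1Sym.fourier_ker {m : Rd d → ℂ} (h : L1Sym m) :
    𝓕 (ker m) = fun ξ => m ((2 * π) • ξ) := by
  refine h.cont_scaled.fourier_fourierInv_eq h.int_scaled ?_
  have : 𝓕 (fun ξ : Rd d => m ((2 * π) • ξ)) = fun x => ker m (-x) := by
    ext x; rw [ker, Real.fourierInv_eq_fourier_neg, neg_neg]
  rw [this]
  exact h.kint.comp_neg

lemma L1Sym.integral_ker {m : Rd d → ℂ} (h : L1Sym m) : ∫ x, ker m x = m 0 := by
  have := congrFun h.fourier_ker 0
  rw [Real.fourier_eq] at this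
  simpa using this

lemma L1Sym.integral_ker_exp {m : Rd d → ℂ} (h : L1Sym m) (x ξ : Rd d) :
    ∫ y, ker m (x - y) * Complex.exp ((2 * π * inner ℝ y ξ : ℝ) * I) =
      Complex.exp ((2 * π * inner ℝ x ξ : ℝ) * I) * m ((2 * π) • ξ) := by
  have h1 : 𝓕 (ker m) ξ = m ((2 * π) • ξ) := congrFun h.fourier_ker ξ
  rw [← h1, Real.fourier_eq', ← integral_sub_left_eq_self _ _ x, ← integral_const_mul]
  congr 1 with y
  simp only [smul_eq_mul]
  rw [sub_sub_cancel, ← mul_assoc, ← Complex.exp_add, mul_comm]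
  congr 2
  rw [inner_sub_left]
  push_cast
  ring

lemma continuous_neg_innerₗ : Continuous fun p : Rd d × Rd d => (-innerₗ (Rd d)) p.1 p.2 :=
  (continuous_inner (𝕜 := ℝ) (E := Rd d)).neg

lemma L1Sym.ker_mul {m₁ m₂ : Rd d → ℂ} (h₁ : L1Sym m₁) (h₂ : L1Sym m₂) (x : Rd d) :
    ker (m₁ * m₂) x = ∫ y, ker m₁ (x - y) * ker m₂ y := by
  have hflip := VectorFourier.integral_fourierIntegral_smul_eq_flip (e := Real.fourierChar)
    (μ := volume) (ν := volume) (L := -innerₗ (Rd d))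
    (f := fun ξ : Rd d => m₂ ((2 * π) • ξ)) (g := fun y => ker m₁ (x - y))
    Real.continuous_fourierChar continuous_neg_innerₗ h₂.int_scaled (h₁.kint.comp_sub_left x)
  calc ker (m₁ * m₂) x = ∫ ξ : Rd d, m₂ ((2 * π) • ξ) *
        (Complex.exp ((2 * π * inner ℝ x ξ : ℝ) * I) * m₁ ((2 * π) • ξ)) := by
        rw [ker, Real.fourierInv_eq']
        congr 1 with ξ
        simp only [Pi.mul_apply, smul_eq_mul, real_inner_comm]
        ring
    _ = ∫ ξ : Rd d, m₂ ((2 * π) • ξ) • (VectorFourier.fourierIntegral Real.fourierChar volume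
          (-innerₗ (Rd d)).flip (fun y => ker m₁ (x - y)) ξ) := by
        congr 1 with ξ
        rw [← h₁.integral_ker_exp, smul_eq_mul]
        congr 1
        rw [VectorFourier.fourierIntegral]
        congr 1 with y
        rw [Circle.smul_def, Real.fourierChar_apply, smul_eq_mul, mul_comm]
        simp [real_inner_comm]
    _ = ∫ y, ker m₁ (x - y) * ker m₂ y := by
        rw [← hflip]
        congr 1 with y
        rw [smul_eq_mul, mul_comm]
        rfl

lemma L1Sym.integrable_prod {m₁ m₂ : Rd d → ℂ} (h₁ : L1Sym m₁) (h₂ : L1Sym m₂) :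
    Integrable (fun p : Rd d × Rd d => ker m₁ (p.1 - p.2) * ker m₂ p.2) := by
  have := h₂.kint.convolution_integrand (ContinuousLinearMap.mul ℂ ℂ) h₁.kint
  refine this.congr (.of_forall fun p => ?_)
  simp [mul_comm]

lemma L1Sym.bounded {m : Rd d → ℂ} (h : L1Sym m) : ∃ C : ℝ, ∀ ζ, ‖m ζ‖ ≤ C := by
  refine ⟨∫ x, ‖ker m x‖, fun ζ => ?_⟩
  have := congrFun h.fourier_ker ((2 * π)⁻¹ • ζ)
  simp only [smul_smul, mul_inv_cancel₀ Real.two_pi_pos.ne', one_smul] at this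
  rw [← this]
  exact VectorFourier.norm_fourierIntegral_le_integral_norm _ _ _ _ _

lemma L1Sym.mul {m₁ m₂ : Rd d → ℂ} (h₁ : L1Sym m₁) (h₂ : L1Sym m₂) : L1Sym (m₁ * m₂) where
  cont := h₁.cont.mul h₂.cont
  int := by
    obtain ⟨C, hC⟩ := h₁.bounded
    exact h₂.int.bdd_mul h₁.cont.aestronglyMeasurable (.of_forall hC)
  kint := by
    have : ker (m₁ * m₂) = fun x => ∫ y, ker m₁ (x - y) * ker m₂ y := by
      ext x; exact h₁.ker_mul h₂ x
    rw [this]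
    exact (h₁.integrable_prod h₂).integral_prod_left

lemma L1Sym.symNorm_lt_top {m : Rd d → ℂ} (h : L1Sym m) : symNorm m < ⊤ := h.kint.2

lemma L1Sym.symNorm_mul_le {m₁ m₂ : Rd d → ℂ} (h₁ : L1Sym m₁) (h₂ : L1Sym m₂) :
    symNorm (m₁ * m₂) ≤ symNorm m₁ * symNorm m₂ := by
  have hm1 : Measurable (ker m₁) := (continuous_ker h₁.int).measurable
  have hm2 : Measurable (ker m₂) := (continuous_ker h₂.int).measurable
  calc symNorm (m₁ * m₂) ≤ ∫⁻ x, ∫⁻ y, ‖ker m₁ (x - y)‖ₑ * ‖ker m₂ y‖ₑ := by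
        refine lintegral_mono fun x => ?_
        rw [h₁.ker_mul h₂]
        refine (enorm_integral_le_lintegral_enorm _).trans_eq ?_
        simp only [enorm_mul]
    _ = ∫⁻ y, ∫⁻ x, ‖ker m₁ (x - y)‖ₑ * ‖ker m₂ y‖ₑ := by
        apply lintegral_lintegral_swap
        apply Measurable.aemeasurable
        exact ((hm1.comp (measurable_fst.sub measurable_snd)).enorm).mul
          ((hm2.comp measurable_snd).enorm)
    _ = ∫⁻ y, symNorm m₁ * ‖ker m₂ y‖ₑ := by
        refine lintegral_congr fun y => ?_
        rw [lintegral_mul_const' _ _ enorm_ne_top,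
          lintegral_sub_right_eq_self (fun x => ‖ker m₁ x‖ₑ) y]
        rfl
    _ = symNorm m₁ * symNorm m₂ := by
        rw [lintegral_const_mul _ hm2.enorm]; rfl

lemma ker_add {m₁ m₂ : Rd d → ℂ} (h₁ : Integrable m₁) (h₂ : Integrable m₂) :
    ker (m₁ + m₂) = ker m₁ + ker m₂ := by
  have e1 : Integrable (fun ξ : Rd d => m₁ ((2 * π) • ξ)) := h₁.comp_smul Real.two_pi_pos.ne'
  have e2 : Integrable (fun ξ : Rd d => m₂ ((2 * π) • ξ)) := h₂.comp_smul Real.two_pi_pos.ne'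
  have := VectorFourier.fourierIntegral_add Real.continuous_fourierChar
    (continuous_neg_innerₗ (d := d)) e1 e2
  funext x
  exact congrFun this x

lemma ker_const_mul (c : ℂ) (m : Rd d → ℂ) : ker (fun ζ => c * m ζ) = fun x => c * ker m x :=
  VectorFourier.fourierIntegral_const_smul (E := ℂ) Real.fourierChar volume (-innerₗ (Rd d))
    (fun ξ => m ((2 * π) • ξ)) c

lemma L1Sym.add {m₁ m₂ : Rd d → ℂ} (h₁ : L1Sym m₁) (h₂ : L1Sym m₂) : L1Sym (m₁ + m₂) where
  cont := h₁.cont.add h₂.cont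
  int := h₁.int.add h₂.int
  kint := by rw [ker_add h₁.int h₂.int]; exact h₁.kint.add h₂.kint

lemma L1Sym.const_mul {m : Rd d → ℂ} (c : ℂ) (h : L1Sym m) : L1Sym (fun ζ => c * m ζ) where
  cont := continuous_const.mul h.cont
  int := h.int.const_mul c
  kint := by rw [ker_const_mul]; exact h.kint.const_mul c

lemma ker_scale (m : Rd d → ℂ) {l : ℝ} (hl : 0 < l) (x : Rd d) :
    ker (fun ζ => m (l • ζ)) x = ((l⁻¹ ^ d : ℝ) : ℂ) * ker m (l⁻¹ • x) := by
  simp only [ker, Real.fourierInv_eq']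
  have := Measure.integral_comp_smul (volume : Measure (Rd d)) (fun ξ : Rd d =>
    Complex.exp ((2 * π * inner ℝ ξ (l⁻¹ • x) : ℝ) * I) • m ((2 * π) • ξ)) l
  rw [finrank_euclideanSpace_fin, abs_of_pos (by positivity), Complex.real_smul] at this
  rw [inv_pow, ← this]
  congr 1 with ξ
  rw [real_inner_smul_left, real_inner_smul_right, smul_comm]
  congr 4
  field_simp

lemma symNorm_scale (m : Rd d → ℂ) {l : ℝ} (hl : 0 < l) :
    symNorm (fun ζ => m (l • ζ)) = symNorm m := by
  simp only [symNorm, ker_scale m hl, enorm_mul]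
  have h2 : ∫⁻ x, ‖ker m (l⁻¹ • x)‖ₑ = ofReal |((l⁻¹) ^ d)⁻¹| * ∫⁻ x, ‖ker m x‖ₑ := by
    let e := ((Homeomorph.smul (isUnit_iff_ne_zero.2 (inv_pos.2 hl).ne').unit).toMeasurableEquiv :
      Rd d ≃ᵐ Rd d)
    have h3 := lintegral_map_equiv (μ := volume) (fun x => ‖ker m x‖ₑ) e
    have h4 := Measure.map_addHaar_smul (volume : Measure (Rd d)) (inv_pos.2 hl).ne'
    rw [show (⇑e : Rd d → Rd d) = fun x => l⁻¹ • x from rfl, h4, lintegral_smul_measure,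
      finrank_euclideanSpace_fin] at h3
    exact h3.symm
  rw [lintegral_const_mul' _ _ enorm_ne_top, h2, ← mul_assoc]
  rw [show ‖((l⁻¹ ^ d : ℝ) : ℂ)‖ₑ * ofReal |((l⁻¹) ^ d)⁻¹| = 1 from ?_, one_mul]
  rw [← ofReal_norm, ← ofReal_mul (norm_nonneg _), norm_real,
    Real.norm_eq_abs, ← abs_mul, mul_inv_cancel₀ (by positivity)]
  simp

/-! ## Convolution operators -/

lemma supN_multF_le {m : Rd d → ℂ} (h : Integrable m) (q : Rd d → ℂ) :
    supN (multF m q) ≤ symNorm m * supN q := by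
  refine iSup_le fun x => ?_
  have hm : Measurable (ker m) := (continuous_ker h).measurable
  calc ‖multF m q x‖ₑ ≤ ∫⁻ y, ‖ker m (x - y) * q y‖ₑ := enorm_integral_le_lintegral_enorm _
    _ ≤ ∫⁻ y, ‖ker m (x - y)‖ₑ * supN q := by
        refine lintegral_mono fun y => ?_
        rw [enorm_mul]
        exact mul_le_mul_right (le_supN q y) _
    _ = symNorm m * supN q := by
        rw [lintegral_mul_const _ (by fun_prop),
          lintegral_sub_left_eq_self (fun y => ‖ker m y‖ₑ) x]
        rfl

lemma integrable_multF {m : Rd d → ℂ} (h : L1Sym m) {q : Rd d → ℂ} (hq : BM q) (x : Rd d) :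
    Integrable (fun y => ker m (x - y) * q y) :=
  (h.kint.comp_sub_left x).mul_bdd hq.meas.aestronglyMeasurable
    (.of_forall (norm_le_supN hq.fin))

lemma multF_add_sym {m₁ m₂ : Rd d → ℂ} (h₁ : L1Sym m₁) (h₂ : L1Sym m₂) {q : Rd d → ℂ} (hq : BM q) :
    multF (m₁ + m₂) q = multF m₁ q + multF m₂ q := by
  ext x
  simp only [Pi.add_apply, multF_eq, ker_add h₁.int h₂.int, add_mul]
  exact integral_add (integrable_multF h₁ hq x) (integrable_multF h₂ hq x)

lemma multF_const_mul_sym (c : ℂ) (m q : Rd d → ℂ) (x : Rd d) :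
    multF (fun ζ => c * m ζ) q x = c * multF m q x := by
  simp only [multF_eq, ker_const_mul, mul_assoc, integral_const_mul]

lemma multF_add {m : Rd d → ℂ} (h : L1Sym m) {f g : Rd d → ℂ} (hf : BM f) (hg : BM g) :
    multF m (f + g) = multF m f + multF m g := by
  ext x
  simp only [Pi.add_apply, multF_eq, mul_add]
  exact integral_add (integrable_multF h hf x) (integrable_multF h hg x)

lemma multF_const_mul (c : ℂ) (m q : Rd d → ℂ) (x : Rd d) :
    multF m (fun y => c * q y) x = c * multF m q x := by
  simp only [multF_eq, ← integral_const_mul]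
  congr 1 with y
  ring

lemma multF_congr_ae (m : Rd d → ℂ) {f g : Rd d → ℂ} (h : f =ᵐ[volume] g) :
    multF m f = multF m g := by
  ext x
  refine integral_congr_ae ?_
  filter_upwards [h] with y hy
  rw [hy]

lemma continuous_multF {m : Rd d → ℂ} (h : L1Sym m) {q : Rd d → ℂ} (hq : BM q) :
    Continuous (multF m q) := by
  have hK : MemLp (ker m) 1 := memLp_one_iff_integrable.2 h.kint
  let T : C(Rd d, C(Rd d, Rd d)) :=
    (ContinuousMap.mk (fun p : Rd d × Rd d => p.1 - p.2) (by fun_prop)).curry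
  have hT : ∀ x : Rd d, MeasurePreserving (T x) := fun x =>
    Measure.measurePreserving_sub_left volume x
  have hc : Continuous fun x => Lp.compMeasurePreserving (T x) (hT x) hK.toLp := by
    exact continuous_const.compMeasurePreservingLp (g := fun x => T x) T.continuous hT (by simp)
  have key : ∀ x, multF m q x = ∫ y, (Lp.compMeasurePreserving (T x) (hT x) hK.toLp) y * q y := by
    intro x
    refine integral_congr_ae ?_
    filter_upwards [Lp.coeFn_compMeasurePreserving hK.toLp (hT x),
      (hT x).quasiMeasurePreserving.ae_eq_comp hK.coeFn_toLp] with y h1 h2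
    rw [h1, h2]
    rfl
  rw [show multF m q = _ from funext key]
  have hI : ∀ F : Lp ℂ 1 (volume : Measure (Rd d)), Integrable (fun y => F y * q y) := fun F =>
    (L1.integrable_coeFn F).mul_bdd hq.meas.aestronglyMeasurable
      (.of_forall (norm_le_supN hq.fin))
  let L : Lp ℂ 1 (volume : Measure (Rd d)) →L[ℂ] ℂ := LinearMap.mkContinuous
    { toFun := fun F => ∫ y, F y * q y
      map_add' := fun F G => by
        rw [← integral_add (hI F) (hI G)]
        refine integral_congr_ae ?_
        filter_upwards [Lp.coeFn_add F G] with y hy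
        rw [hy, Pi.add_apply, add_mul]
      map_smul' := fun c F => by
        rw [RingHom.id_apply, smul_eq_mul, ← integral_const_mul]
        refine integral_congr_ae ?_
        filter_upwards [Lp.coeFn_smul c F] with y hy
        rw [hy, Pi.smul_apply, smul_eq_mul, mul_assoc] }
    (supN q).toReal (fun F => by
      change ‖∫ y, F y * q y‖ ≤ _
      rw [L1.norm_eq_integral_norm, ← integral_const_mul]
      refine norm_integral_le_of_norm_le ((L1.integrable_coeFn F).norm.const_mul _) ?_
      refine .of_forall fun y => ?_
      rw [norm_mul, mul_comm]
      gcongr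
      exact norm_le_supN hq.fin y)
  exact L.continuous.comp hc

lemma BM.multF {m : Rd d → ℂ} (h : L1Sym m) {q : Rd d → ℂ} (hq : BM q) : BM (multF m q) :=
  ⟨(continuous_multF h hq).measurable, (supN_multF_le h.int q).trans_lt
    (mul_lt_top h.symNorm_lt_top hq.fin)⟩

lemma multF_comp_of_integrable {m₁ m₂ : Rd d → ℂ} (h₁ : L1Sym m₁) (h₂ : L1Sym m₂) {q : Rd d → ℂ}
    (x : Rd d) (hI : Integrable (fun p : Rd d × Rd d =>
      ker m₁ (x - p.1) * (ker m₂ (p.1 - p.2) * q p.2))) :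
    multF m₁ (multF m₂ q) x = multF (m₁ * m₂) q x := by
  simp only [multF_eq, ← integral_const_mul]
  rw [integral_integral_swap hI]
  congr 1 with w
  simp only [← mul_assoc]
  rw [integral_mul_const, h₁.ker_mul h₂]
  congr 1
  rw [← integral_add_right_eq_self (fun y => ker m₁ (x - y) * ker m₂ (y - w)) w]
  congr 1 with y
  rw [add_sub_cancel_right, sub_add_eq_sub_sub, sub_right_comm]

lemma integrable_ker_comp {m₁ m₂ : Rd d → ℂ} (h₁ : L1Sym m₁) (h₂ : L1Sym m₂) (x : Rd d) :
    Integrable (fun p : Rd d × Rd d => ker m₁ (x - p.1) * ker m₂ (p.1 - p.2)) := by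
  have hT : MeasurePreserving (fun p : Rd d × Rd d => (p.1, p.1 - p.2))
      (volume.prod volume) (volume.prod volume) :=
    (MeasurePreserving.id volume).skew_product (g := fun a b : Rd d => a - b) (by fun_prop)
      (.of_forall fun a => (Measure.measurePreserving_sub_left volume a).map_eq)
  exact hT.integrable_comp_of_integrable ((h₁.kint.comp_sub_left x).mul_prod h₂.kint)

lemma multF_comp {m₁ m₂ : Rd d → ℂ} (h₁ : L1Sym m₁) (h₂ : L1Sym m₂) {q : Rd d → ℂ} (hq : BM q) :
    multF m₁ (multF m₂ q) = multF (m₁ * m₂) q := by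
  ext x
  refine multF_comp_of_integrable h₁ h₂ x ?_
  have := (integrable_ker_comp h₁ h₂ x).mul_bdd (g := fun p : Rd d × Rd d => q p.2)
    (hq.meas.comp measurable_snd).aestronglyMeasurable
    (.of_forall fun p => norm_le_supN hq.fin p.2)
  simpa only [mul_assoc] using this

/-! ## Smooth compactly supported symbols -/

/-- Smooth compactly supported symbols. -/
structure SmoothSym (m : Rd d → ℂ) : Prop where
  smooth : ContDiff ℝ ∞ m
  cpt : HasCompactSupport m

lemma contDiff_scaled {m : Rd d → ℂ} (h : ContDiff ℝ ∞ m) :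
    ContDiff ℝ ∞ (fun ξ : Rd d => m ((2 * π) • ξ)) :=
  h.comp (contDiff_const_smul _)

lemma hasCompactSupport_scaled {m : Rd d → ℂ} (h : HasCompactSupport m) :
    HasCompactSupport (fun ξ : Rd d => m ((2 * π) • ξ)) :=
  h.comp_homeomorph (Homeomorph.smulOfNeZero (2 * π) Real.two_pi_pos.ne')

namespace SmoothSym

variable {m m₁ m₂ : Rd d → ℂ}

/-- The symbol in the frequency variable of the Fourier transform, as a Schwartz function. -/
def scaled (h : SmoothSym m) : 𝓢(Rd d, ℂ) :=
  (hasCompactSupport_scaled h.cpt).toSchwartzMap (contDiff_scaled h.smooth)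

@[simp] lemma scaled_apply (h : SmoothSym m) (ξ : Rd d) : h.scaled ξ = m ((2 * π) • ξ) := rfl

lemma ker_eq (h : SmoothSym m) : ker m = ⇑(𝓕⁻ h.scaled : 𝓢(Rd d, ℂ)) := by
  rw [SchwartzMap.fourierInv_coe]; rfl

lemma l1 (h : SmoothSym m) : L1Sym m where
  cont := h.smooth.continuous
  int := h.smooth.continuous.integrable_of_hasCompactSupport h.cpt
  kint := by rw [h.ker_eq]; exact (𝓕⁻ h.scaled : 𝓢(Rd d, ℂ)).integrable

lemma mul_left {a : Rd d → ℂ} (ha : ContDiff ℝ ∞ a) (h : SmoothSym m) : SmoothSym (a * m) :=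
  ⟨ha.mul h.smooth, h.cpt.mul_left⟩

lemma mul (h₁ : SmoothSym m₁) (h₂ : SmoothSym m₂) : SmoothSym (m₁ * m₂) := mul_left h₁.smooth h₂

/-- Multiplication by a function which is smooth away from the origin. -/
lemma mul_of_ne_zero {a : Rd d → ℂ} (ha : ∀ ζ ≠ 0, ContDiffAt ℝ ∞ a ζ) (h : SmoothSym m)
    (h0 : ∀ᶠ ζ in 𝓝 0, m ζ = 0) : SmoothSym (fun ζ => a ζ * m ζ) := by
  refine ⟨contDiff_iff_contDiffAt.2 fun ζ => ?_, h.cpt.mul_left⟩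
  rcases eq_or_ne ζ 0 with rfl | hζ
  · have : (fun ζ => a ζ * m ζ) =ᶠ[𝓝 0] fun _ => 0 := by
      filter_upwards [h0] with x hx
      rw [hx, mul_zero]
    exact contDiffAt_const.congr_of_eventuallyEq this
  · exact (ha ζ hζ).mul h.smooth.contDiffAt

end SmoothSym

/-! ## Kernel bounds for families of symbols -/

lemma norm_iteratedFDeriv_section_le {G : ℝ × Rd d → ℂ} (hG : ContDiff ℝ ∞ G) (n : ℕ) (s : ℝ)
    (x : Rd d) :
    ‖iteratedFDeriv ℝ n (fun y => G (s, y)) x‖ ≤ ‖iteratedFDeriv ℝ n G (s, x)‖ := by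
  have h1 : (fun y => G (s, y)) =
      (fun p => G (p + (s, 0))) ∘ (ContinuousLinearMap.inr ℝ ℝ (Rd d)) := by
    ext y; simp
  have hG' : ContDiff ℝ ∞ (fun p => G (p + (s, 0))) := hG.comp (contDiff_id.add contDiff_const)
  rw [h1, ContinuousLinearMap.iteratedFDeriv_comp_right _ hG' x (mod_cast le_top)]
  refine (ContinuousMultilinearMap.norm_compContinuousLinearMap_le _ _).trans ?_
  rw [iteratedFDeriv_comp_add_right]
  simp only [ContinuousLinearMap.inr_apply, Prod.mk_add_mk, zero_add, add_zero]
  refine mul_le_of_le_one_right (norm_nonneg _) (Finset.prod_le_one (fun _ _ => norm_nonneg _)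
    fun _ _ => ContinuousLinearMap.norm_inr_le_one ℝ ℝ (Rd d))

/-- The kernels of a smooth compact family of symbols are bounded in `L¹`. -/
lemma exists_symNorm_le_of_family {F : ℝ × Rd d → ℂ} (hF : ContDiff ℝ ∞ F) {ρ : ℝ}
    (hρ : ∀ s, ∀ ζ : Rd d, ρ ≤ ‖ζ‖ → F (s, ζ) = 0) :
    ∃ C : ℝ, 0 ≤ C ∧ ∀ s ∈ Set.Icc (0 : ℝ) 1,
      symNorm (fun ζ => F (s, ζ)) ≤ ofReal C := by
  have hsm : ∀ s, SmoothSym (fun ζ => F (s, ζ)) := fun s => by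
    refine ⟨hF.comp (contDiff_const.prodMk contDiff_id),
      HasCompactSupport.of_support_subset_isCompact (isCompact_closedBall 0 ρ) fun ζ hζ => ?_⟩
    rw [mem_closedBall_zero_iff]
    by_contra! h
    exact hζ (hρ s ζ h.le)
  let L : 𝓢(Rd d, ℂ) →L[ℂ] Lp ℂ 1 (volume : Measure (Rd d)) :=
    (SchwartzMap.toLpCLM ℂ ℂ 1 volume).comp (FourierTransform.fourierInvCLM ℂ 𝓢(Rd d, ℂ))
  obtain ⟨S, C, -, hC⟩ := Seminorm.bound_of_continuous (schwartz_withSeminorms ℂ (Rd d) ℂ)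
    ((normSeminorm ℂ (Lp ℂ 1 (volume : Measure (Rd d)))).comp L.toLinearMap)
    (by exact continuous_norm.comp L.continuous)
  let G : ℝ × Rd d → ℂ := fun p => F (p.1, (2 * π) • p.2)
  have hG : ContDiff ℝ ∞ G := hF.comp (contDiff_fst.prodMk (contDiff_snd.const_smul _))
  have hB : ∀ kn : ℕ × ℕ, ∃ B : ℝ, 0 ≤ B ∧ ∀ s ∈ Set.Icc (0 : ℝ) 1,
      schwartzSeminormFamily ℂ (Rd d) ℂ kn (hsm s).scaled ≤ B := by
    intro ⟨k, n⟩
    have hK : IsCompact (Set.Icc (0 : ℝ) 1 ×ˢ Metric.closedBall (0 : Rd d) |ρ|) :=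
      isCompact_Icc.prod (isCompact_closedBall 0 _)
    obtain ⟨B, hB⟩ := hK.exists_bound_of_continuousOn (f := fun p => iteratedFDeriv ℝ n G p)
      ((hG.continuous_iteratedFDeriv (m := n) (mod_cast le_top)).continuousOn)
    have hB0 : 0 ≤ B := (norm_nonneg _).trans (hB (0, 0) ⟨by simp, by simp⟩)
    refine ⟨|ρ| ^ k * B, by positivity, fun s hs => ?_⟩
    refine SchwartzMap.seminorm_le_bound ℂ k n _ (by positivity) fun x => ?_
    by_cases hx : ‖x‖ ≤ |ρ|
    · gcongr
      exact (norm_iteratedFDeriv_section_le hG n s x).trans (hB (s, x) ⟨hs, by simpa using hx⟩)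
    · push Not at hx
      have : iteratedFDeriv ℝ n ((hsm s).scaled) x = 0 := by
        have hev : ((hsm s).scaled : Rd d → ℂ) =ᶠ[𝓝 x] fun _ => 0 := by
          filter_upwards [(isOpen_lt continuous_const continuous_norm).mem_nhds hx] with y hy
          refine hρ s _ ?_
          rw [norm_smul, norm_of_nonneg Real.two_pi_pos.le]
          have h1 : |ρ| < ‖y‖ := hy
          have h2 := le_abs_self ρ
          nlinarith [Real.pi_gt_three, norm_nonneg y]
        rw [hev.iteratedFDeriv ℝ n |>.eq_of_nhds]
        simp
      rw [this]
      simp only [norm_zero, mul_zero]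
      positivity
  choose B hB0 hB using hB
  refine ⟨C * ∑ kn ∈ S, B kn, mul_nonneg C.2 (sum_nonneg fun _ _ => hB0 _), fun s hs => ?_⟩
  have h1 := hC (hsm s).scaled
  have h2 : (S.sup (schwartzSeminormFamily ℂ (Rd d) ℂ)) (hsm s).scaled ≤ ∑ kn ∈ S, B kn := by
    refine Seminorm.finset_sup_apply_le (sum_nonneg fun _ _ => hB0 _) fun i hi => ?_
    exact (hB i s hs).trans (single_le_sum (f := B) (fun _ _ => hB0 _) hi)
  have h3 : symNorm (fun ζ => F (s, ζ)) = ofReal ‖L (hsm s).scaled‖ := by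
    change _ = ofReal ‖(𝓕⁻ (hsm s).scaled : 𝓢(Rd d, ℂ)).toLp 1 volume‖
    rw [SchwartzMap.norm_toLp_one, ofReal_integral_norm_eq_lintegral_enorm
      (SchwartzMap.integrable _), symNorm, (hsm s).ker_eq]
  rw [h3]
  refine ofReal_le_ofReal (h1.trans ?_)
  exact mul_le_mul_of_nonneg_left h2 C.2

/-! ## Littlewood-Paley symbols -/

/-- A dyadic symbol equal to `1` on the support of `dyadicSym ψ j`. -/
def fatSym (ψ : Rd d → ℝ) (j : ℤ) (ζ : Rd d) : ℂ :=
  (ψ ((4 : ℝ)⁻¹ • ((2 : ℝ) ^ (-j)) • ζ) - ψ ((4 : ℝ) • ((2 : ℝ) ^ (-j)) • ζ) : ℝ)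

/-- The symbol of the low-frequency cut-off `S_j`. -/
def lowSym (ψ : Rd d → ℝ) (j : ℤ) (ζ : Rd d) : ℂ := (ψ (((2 : ℝ) ^ (-j)) • ζ) : ℝ)

lemma norm_zpow_smul (j : ℤ) (ζ : Rd d) : ‖((2 : ℝ) ^ (-j)) • ζ‖ = 2 ^ (-j) * ‖ζ‖ := by
  rw [norm_smul, norm_of_nonneg (by positivity)]

lemma dyadicSym_scale (ψ : Rd d → ℝ) (j : ℤ) (ζ : Rd d) :
    dyadicSym ψ j ζ = dyadicSym ψ 0 (((2 : ℝ) ^ (-j)) • ζ) := by simp [dyadicSym]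

lemma fatSym_scale (ψ : Rd d → ℝ) (j : ℤ) (ζ : Rd d) :
    fatSym ψ j ζ = fatSym ψ 0 (((2 : ℝ) ^ (-j)) • ζ) := by simp [fatSym]

lemma lowSym_scale (ψ : Rd d → ℝ) (j : ℤ) (ζ : Rd d) :
    lowSym ψ j ζ = lowSym ψ 0 (((2 : ℝ) ^ (-j)) • ζ) := by simp [lowSym]

lemma lowSym_succ (ψ : Rd d → ℝ) (j : ℤ) :
    lowSym ψ (j + 1) = lowSym ψ j + dyadicSym ψ j := by
  ext ζ
  simp only [lowSym, dyadicSym, Pi.add_apply, smul_smul]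
  rw [show (2 : ℝ) ^ (-(j + 1)) = 2⁻¹ * 2 ^ (-j) by
    rw [neg_add, zpow_add₀ two_ne_zero, zpow_neg_one, mul_comm]]
  push_cast
  ring

namespace IsCutoff

variable {ψ : Rd d → ℝ}

lemma eq_zero (h : IsCutoff ψ) {ζ : Rd d} (hζ : 4 / 3 ≤ ‖ζ‖) : ψ ζ = 0 := by
  by_contra h0
  have := h.tsupport_subset (subset_tsupport ψ h0)
  rw [mem_ball_zero_iff] at this
  linarith

lemma cpt (h : IsCutoff ψ) : HasCompactSupport ψ :=
  HasCompactSupport.of_support_subset_isCompact (isCompact_closedBall 0 (4 / 3)) fun _ hζ =>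
    Metric.ball_subset_closedBall (h.tsupport_subset (subset_tsupport ψ hζ))

lemma smoothSym_smul (h : IsCutoff ψ) {l : ℝ} (hl : l ≠ 0) :
    SmoothSym (fun ζ => ((ψ (l • ζ) : ℝ) : ℂ)) := by
  refine ⟨Complex.ofRealCLM.contDiff.comp (h.contDiff.comp (contDiff_const_smul _)), ?_⟩
  have : HasCompactSupport (fun ζ => ψ (l • ζ)) := h.cpt.comp_homeomorph
    (Homeomorph.smulOfNeZero l hl)
  exact this.comp_left (g := fun x : ℝ => (x : ℂ)) (by simp)

lemma low_smooth (h : IsCutoff ψ) (j : ℤ) : SmoothSym (lowSym ψ j) :=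
  h.smoothSym_smul (by positivity)

lemma dyadic_smooth (h : IsCutoff ψ) (j : ℤ) : SmoothSym (dyadicSym ψ j) := by
  have h1 := h.smoothSym_smul (l := 2⁻¹ * 2 ^ (-j)) (by positivity)
  have h2 := h.smoothSym_smul (l := 2 ^ (-j)) (by positivity)
  have : dyadicSym ψ j = fun ζ => ((ψ (((2 : ℝ)⁻¹ * 2 ^ (-j)) • ζ) : ℝ) : ℂ) -
      ((ψ ((2 : ℝ) ^ (-j) • ζ) : ℝ) : ℂ) := by
    ext ζ; simp [dyadicSym, smul_smul]
  rw [this]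
  exact ⟨h1.smooth.sub h2.smooth, h1.cpt.sub h2.cpt⟩

lemma fat_smooth (h : IsCutoff ψ) (j : ℤ) : SmoothSym (fatSym ψ j) := by
  have h1 := h.smoothSym_smul (l := 4⁻¹ * 2 ^ (-j)) (by positivity)
  have h2 := h.smoothSym_smul (l := 4 * 2 ^ (-j)) (by positivity)
  have : fatSym ψ j = fun ζ => ((ψ (((4 : ℝ)⁻¹ * 2 ^ (-j)) • ζ) : ℝ) : ℂ) -
      ((ψ (((4 : ℝ) * 2 ^ (-j)) • ζ) : ℝ) : ℂ) := by
    ext ζ; simp [fatSym, smul_smul]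
  rw [this]
  exact ⟨h1.smooth.sub h2.smooth, h1.cpt.sub h2.cpt⟩

lemma low_eq_one (h : IsCutoff ψ) {j : ℤ} {ζ : Rd d} (hζ : ‖ζ‖ ≤ 3 / 4 * 2 ^ j) :
    lowSym ψ j ζ = 1 := by
  rw [lowSym, h.eq_one, Complex.ofReal_one]
  rw [norm_zpow_smul, zpow_neg, inv_mul_le_iff₀ (by positivity)]
  linarith

lemma low_eq_zero (h : IsCutoff ψ) {j : ℤ} {ζ : Rd d} (hζ : 4 / 3 * 2 ^ j ≤ ‖ζ‖) :
    lowSym ψ j ζ = 0 := by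
  rw [lowSym, h.eq_zero, Complex.ofReal_zero]
  rw [norm_zpow_smul, zpow_neg, le_inv_mul_iff₀ (by positivity)]
  linarith

lemma dyadic_eq_sub (_h : IsCutoff ψ) (j : ℤ) (ζ : Rd d) :
    dyadicSym ψ j ζ = lowSym ψ (j + 1) ζ - lowSym ψ j ζ := by
  rw [lowSym_succ]; simp

lemma dyadic_eq_zero_of_le (h : IsCutoff ψ) {j : ℤ} {ζ : Rd d} (hζ : ‖ζ‖ ≤ 3 / 4 * 2 ^ j) :
    dyadicSym ψ j ζ = 0 := by
  rw [h.dyadic_eq_sub, h.low_eq_one hζ, h.low_eq_one, sub_self]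
  rw [zpow_add_one₀ two_ne_zero]
  have : (0 : ℝ) < 2 ^ j := by positivity
  linarith

lemma dyadic_eq_zero_of_ge (h : IsCutoff ψ) {j : ℤ} {ζ : Rd d} (hζ : 8 / 3 * 2 ^ j ≤ ‖ζ‖) :
    dyadicSym ψ j ζ = 0 := by
  have : (0 : ℝ) < 2 ^ j := by positivity
  rw [h.dyadic_eq_sub, h.low_eq_zero, h.low_eq_zero, sub_self]
  · linarith
  · rw [zpow_add_one₀ two_ne_zero]; linarith

lemma fat_eq_zero (h : IsCutoff ψ) {j : ℤ} {ζ : Rd d} (hζ : ‖ζ‖ ≤ 3 / 16 * 2 ^ j) :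
    fatSym ψ j ζ = 0 := by
  have h2 : (0 : ℝ) < 2 ^ j := by positivity
  have h1 : 2 ^ (-j) * ‖ζ‖ ≤ 3 / 16 := by
    rw [zpow_neg, inv_mul_le_iff₀ h2]; linarith
  rw [fatSym, h.eq_one, h.eq_one, sub_self, Complex.ofReal_zero] <;>
    rw [norm_smul, norm_zpow_smul, norm_of_nonneg (by norm_num)] <;> linarith

lemma fat_eq_zero_of_ge (h : IsCutoff ψ) {j : ℤ} {ζ : Rd d} (hζ : 16 / 3 * 2 ^ j ≤ ‖ζ‖) :
    fatSym ψ j ζ = 0 := by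
  have h2 : (0 : ℝ) < 2 ^ j := by positivity
  have h1 : 16 / 3 ≤ 2 ^ (-j) * ‖ζ‖ := by
    rw [zpow_neg, le_inv_mul_iff₀ h2]; linarith
  rw [fatSym, h.eq_zero, h.eq_zero, sub_self, Complex.ofReal_zero] <;>
    rw [norm_smul, norm_zpow_smul, norm_of_nonneg (by norm_num)] <;> linarith

lemma fat_mul_dyadic (h : IsCutoff ψ) (j : ℤ) (ζ : Rd d) :
    fatSym ψ j ζ * dyadicSym ψ j ζ = dyadicSym ψ j ζ := by
  have h2 : (0 : ℝ) < 2 ^ j := by positivity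
  rcases le_total ‖ζ‖ (3 / 4 * 2 ^ j) with h1 | h1
  · rw [h.dyadic_eq_zero_of_le h1, mul_zero]
  rcases le_total (8 / 3 * 2 ^ j) ‖ζ‖ with h3 | h3
  · rw [h.dyadic_eq_zero_of_ge h3, mul_zero]
  have h4 : 3 / 4 ≤ 2 ^ (-j) * ‖ζ‖ := by rw [zpow_neg, le_inv_mul_iff₀ h2]; linarith
  have h5 : 2 ^ (-j) * ‖ζ‖ ≤ 8 / 3 := by rw [zpow_neg, inv_mul_le_iff₀ h2]; linarith
  rw [fatSym, h.eq_one, h.eq_zero, sub_zero, Complex.ofReal_one, one_mul] <;>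
    rw [norm_smul, norm_zpow_smul, norm_of_nonneg (by norm_num)] <;> linarith

lemma dyadic_eventually_zero (h : IsCutoff ψ) (j : ℤ) : ∀ᶠ ζ in 𝓝 0, dyadicSym ψ j ζ = 0 := by
  filter_upwards [Metric.closedBall_mem_nhds (0 : Rd d) (ε := 3 / 4 * 2 ^ j) (by positivity)]
    with ζ hζ
  exact h.dyadic_eq_zero_of_le (by simpa using hζ)

lemma fat_eventually_zero (h : IsCutoff ψ) (j : ℤ) : ∀ᶠ ζ in 𝓝 0, fatSym ψ j ζ = 0 := by
  filter_upwards [Metric.closedBall_mem_nhds (0 : Rd d) (ε := 3 / 16 * 2 ^ j) (by positivity)]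
    with ζ hζ
  exact h.fat_eq_zero (by simpa using hζ)

lemma norm_dyadic_le (h : IsCutoff ψ) (j : ℤ) (ζ : Rd d) : ‖dyadicSym ψ j ζ‖ ≤ 1 := by
  rw [dyadicSym, norm_real, Real.norm_eq_abs, abs_le]
  have h1 := h.mem_Icc ((2 : ℝ)⁻¹ • ((2 : ℝ) ^ (-j)) • ζ)
  have h2 := h.mem_Icc (((2 : ℝ) ^ (-j)) • ζ)
  constructor <;> linarith [h1.1, h1.2, h2.1, h2.2]

/-- For `ζ ≠ 0` only the blocks with index close to `log₂|ζ|` see the frequency `ζ`. -/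
lemma exists_two_blocks (h : IsCutoff ψ) {ζ : Rd d} (hζ : ζ ≠ 0) :
    ∃ k : ℤ, (∀ j, j ≠ k → j ≠ k - 1 → j ≠ k + 1 → dyadicSym ψ j ζ = 0) ∧
      dyadicSym ψ (k - 1) ζ + dyadicSym ψ k ζ + dyadicSym ψ (k + 1) ζ = 1 := by
  obtain ⟨k, hk⟩ := exists_mem_Ico_zpow (norm_pos_iff.2 hζ) (one_lt_two (α := ℝ))
  have hp : (0 : ℝ) < 2 ^ k := by positivity
  refine ⟨k, fun j h0 h1 h2 => ?_, ?_⟩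
  · rcases lt_or_gt_of_ne h0 with h3 | h3
    · apply h.dyadic_eq_zero_of_ge
      have : (2 : ℝ) ^ j ≤ 2 ^ (k - 2) := zpow_le_zpow_right₀ one_le_two (by lia)
      rw [zpow_sub₀ two_ne_zero] at this
      norm_num at this
      linarith [hk.1]
    · apply h.dyadic_eq_zero_of_le
      have : (2 : ℝ) ^ (k + 2) ≤ 2 ^ j := zpow_le_zpow_right₀ one_le_two (by lia)
      have h5 := hk.2
      rw [zpow_add₀ two_ne_zero] at this h5
      norm_num at this h5
      linarith
  · simp only [h.dyadic_eq_sub]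
    rw [h.low_eq_zero (j := k - 1), h.low_eq_one (j := k + 1 + 1)]
    · ring_nf
    · have h5 := hk.2.le
      rw [zpow_add_one₀ two_ne_zero] at h5 ⊢
      rw [zpow_add_one₀ two_ne_zero]
      linarith
    · rw [zpow_sub_one₀ two_ne_zero]
      linarith [hk.1]

lemma hasSum_dyadic (h : IsCutoff ψ) {ζ : Rd d} (hζ : ζ ≠ 0) :
    HasSum (fun j => dyadicSym ψ j ζ) 1 := by
  obtain ⟨k, hk, hs⟩ := h.exists_two_blocks hζ
  have := hasSum_sum_of_ne_finset_zero (f := fun j => dyadicSym ψ j ζ) (s := {k - 1, k, k + 1})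
    (L := .unconditional ℤ) (fun j hj => by
      simp only [Finset.mem_insert, Finset.mem_singleton, not_or] at hj
      exact hk j hj.2.1 hj.1 hj.2.2)
  rw [sum_insert (by simp; lia), sum_insert (by simp), Finset.sum_singleton,
    ← add_assoc, hs] at this
  exact this

lemma tsum_enorm_dyadic_le (h : IsCutoff ψ) (ζ : Rd d) : ∑' j, ‖dyadicSym ψ j ζ‖ₑ ≤ 3 := by
  rcases eq_or_ne ζ 0 with rfl | hζ
  · have : ∀ j, dyadicSym ψ j (0 : Rd d) = 0 := fun j => (h.dyadic_eventually_zero j).self_of_nhds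
    simp [this]
  obtain ⟨k, hk, hs⟩ := h.exists_two_blocks hζ
  rw [tsum_eq_sum (s := {k - 1, k, k + 1})]
  · refine (Finset.sum_le_card_nsmul _ _ 1 fun j _ => ?_).trans ?_
    · rw [← ofReal_norm]
      exact (ofReal_le_ofReal (h.norm_dyadic_le j ζ)).trans (by simp)
    · rw [Finset.card_insert_of_notMem (by simp; lia), Finset.card_insert_of_notMem (by simp)]
      norm_num
  · intro j hj
    simp only [Finset.mem_insert, Finset.mem_singleton, not_or] at hj
    rw [hk j hj.2.1 hj.1 hj.2.2, enorm_zero]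

lemma dyadic_mul_eq_zero (h : IsCutoff ψ) {j k : ℤ} (hjk : j + 2 ≤ k) (ζ : Rd d) :
    dyadicSym ψ j ζ * dyadicSym ψ k ζ = 0 := by
  have h1 : (2 : ℝ) ^ (j + 2) ≤ 2 ^ k := zpow_le_zpow_right₀ one_le_two hjk
  rw [zpow_add₀ two_ne_zero] at h1
  have h2 : (0 : ℝ) < 2 ^ j := by positivity
  norm_num at h1
  rcases le_total ‖ζ‖ (3 / 4 * 2 ^ k) with h3 | h3
  · rw [h.dyadic_eq_zero_of_le h3, mul_zero]
  · rw [h.dyadic_eq_zero_of_ge (by linarith), zero_mul]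

lemma sum_dyadic_mul (h : IsCutoff ψ) (k : ℤ) (ζ : Rd d) :
    (dyadicSym ψ (k - 1) ζ + dyadicSym ψ k ζ + dyadicSym ψ (k + 1) ζ) * dyadicSym ψ k ζ =
      dyadicSym ψ k ζ := by
  have h2 : (0 : ℝ) < 2 ^ k := by positivity
  rcases le_total ‖ζ‖ (3 / 4 * 2 ^ k) with h1 | h1
  · rw [h.dyadic_eq_zero_of_le h1, mul_zero]
  rcases le_total (8 / 3 * 2 ^ k) ‖ζ‖ with h3 | h3
  · rw [h.dyadic_eq_zero_of_ge h3, mul_zero]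
  simp only [h.dyadic_eq_sub]
  rw [h.low_eq_zero (j := k - 1), h.low_eq_one (j := k + 1 + 1)]
  · ring_nf
  · rw [zpow_add_one₀ two_ne_zero, zpow_add_one₀ two_ne_zero]
    linarith
  · rw [zpow_sub_one₀ two_ne_zero]
    linarith

end IsCutoff

/-! ## Homogeneous symbols -/

/-- Symbols which are smooth away from the origin and positively homogeneous of degree `s`. -/
structure Homog (s : ℤ) (a : Rd d → ℂ) : Prop where
  smooth : ∀ ζ ≠ 0, ContDiffAt ℝ ∞ a ζ
  scale : ∀ l : ℝ, 0 < l → ∀ ζ, a (l • ζ) = ((l ^ s : ℝ) : ℂ) * a ζ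

lemma homog_one : Homog 0 (1 : Rd d → ℂ) := ⟨fun _ _ => contDiffAt_const, fun l _ ζ => by simp⟩

lemma homog_absSym : Homog 1 (absSym : Rd d → ℂ) := by
  refine ⟨fun ζ hζ => ?_, fun l hl ζ => ?_⟩
  · exact Complex.ofRealCLM.contDiff.contDiffAt.comp ζ (contDiffAt_norm ℝ hζ)
  · simp [absSym, norm_smul, abs_of_pos hl]

lemma homog_gradSym (k : Fin d) : Homog 1 (gradSym k : Rd d → ℂ) := by
  refine ⟨fun ζ _ => ContDiff.contDiffAt ?_, fun l hl ζ => ?_⟩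
  · refine contDiff_const.mul (Complex.ofRealCLM.contDiff.comp ?_)
    exact (EuclideanSpace.proj (𝕜 := ℝ) k).contDiff
  · simp [gradSym]; ring

lemma absSym_ne_zero {ζ : Rd d} (h : ζ ≠ 0) : absSym ζ ≠ 0 := by
  simpa [absSym] using h

lemma Homog.inv_abs : Homog (-1) (absSym⁻¹ : Rd d → ℂ) := by
  refine ⟨fun ζ hζ => ?_, fun l hl ζ => ?_⟩
  · exact (homog_absSym.smooth ζ hζ).inv (absSym_ne_zero hζ)
  · simp [absSym, norm_smul, abs_of_pos hl, mul_comm]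

lemma Homog.mul {s t : ℤ} {a b : Rd d → ℂ} (ha : Homog s a) (hb : Homog t b) :
    Homog (s + t) (a * b) := by
  refine ⟨fun ζ hζ => (ha.smooth ζ hζ).mul (hb.smooth ζ hζ), fun l hl ζ => ?_⟩
  simp only [Pi.mul_apply, ha.scale l hl, hb.scale l hl, zpow_add₀ hl.ne']
  push_cast
  ring

lemma contDiffAt_poissonSym (t : ℝ) {ζ : Rd d} (h : ζ ≠ 0) : ContDiffAt ℝ ∞ (poissonSym t) ζ := by
  refine Complex.ofRealCLM.contDiff.contDiffAt.comp ζ ?_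
  exact (contDiffAt_const.mul (contDiffAt_norm ℝ h)).neg.exp

lemma continuous_poissonSym (t : ℝ) : Continuous (poissonSym t : Rd d → ℂ) := by
  unfold poissonSym; fun_prop

lemma norm_poissonSym_le {t : ℝ} (ht : 0 ≤ t) (ζ : Rd d) : ‖poissonSym t ζ‖ ≤ 1 := by
  rw [poissonSym, norm_real, norm_of_nonneg (Real.exp_pos _).le, Real.exp_le_one_iff]
  have := mul_nonneg ht (norm_nonneg ζ)
  linarith

lemma poissonSym_zero : (poissonSym 0 : Rd d → ℂ) = 1 := by ext ζ; simp [poissonSym]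

lemma poissonSym_scale (t : ℝ) {l : ℝ} (hl : 0 < l) (ζ : Rd d) :
    poissonSym t (l • ζ) = poissonSym (t * l) ζ := by
  simp [poissonSym, norm_smul, abs_of_pos hl, mul_assoc]

lemma Homog.smoothSym_fat {ψ : Rd d → ℝ} (hψ : IsCutoff ψ) {s : ℤ} {a : Rd d → ℂ} (ha : Homog s a)
    (t : ℝ) (j : ℤ) : SmoothSym (fun ζ => a ζ * poissonSym t ζ * fatSym ψ j ζ) :=
  (hψ.fat_smooth j).mul_of_ne_zero (a := fun ζ => a ζ * poissonSym t ζ)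
    (fun ζ hζ => (ha.smooth ζ hζ).mul (contDiffAt_poissonSym t hζ)) (hψ.fat_eventually_zero j)

lemma Homog.smoothSym_dyadic {ψ : Rd d → ℝ} (hψ : IsCutoff ψ) {s : ℤ} {a : Rd d → ℂ}
    (ha : Homog s a) (t : ℝ) (j : ℤ) :
    SmoothSym (fun ζ => a ζ * poissonSym t ζ * dyadicSym ψ j ζ) :=
  (hψ.dyadic_smooth j).mul_of_ne_zero (a := fun ζ => a ζ * poissonSym t ζ)
    (fun ζ hζ => (ha.smooth ζ hζ).mul (contDiffAt_poissonSym t hζ)) (hψ.dyadic_eventually_zero j)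

lemma Homog.exists_symNorm_le_zero {ψ : Rd d → ℝ} (hψ : IsCutoff ψ) {s : ℤ} {a : Rd d → ℂ}
    (ha : Homog s a) : ∃ C : ℝ, 0 ≤ C ∧ ∀ t : ℝ, 0 ≤ t →
      symNorm (fun ζ => a ζ * poissonSym t ζ * fatSym ψ 0 ζ) ≤
        ofReal (C * Real.exp (-(t / 8))) := by
  have hfat : ∀ ζ : Rd d, ‖ζ‖ ≤ 3 / 16 → fatSym ψ 0 ζ = 0 := fun ζ h =>
    hψ.fat_eq_zero (by simpa using h)
  have hfat' : ∀ ζ : Rd d, 16 / 3 ≤ ‖ζ‖ → fatSym ψ 0 ζ = 0 := fun ζ h =>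
    hψ.fat_eq_zero_of_ge (by simpa using h)
  have hsm : ∀ b : ℝ × Rd d → ℂ, (∀ s ζ, 1 / 8 < ‖ζ‖ → ContDiffAt ℝ ∞ b (s, ζ)) →
      ContDiff ℝ ∞ (fun p => b p * fatSym ψ 0 p.2) := by
    intro b hb
    rw [contDiff_iff_contDiffAt]
    intro ⟨s, ζ⟩
    rcases lt_or_ge (1 / 8) ‖ζ‖ with h | h
    · exact (hb s ζ h).mul ((hψ.fat_smooth 0).smooth.comp contDiff_snd).contDiffAt
    · have : (fun p : ℝ × Rd d => b p * fatSym ψ 0 p.2) =ᶠ[𝓝 (s, ζ)] fun _ => 0 := by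
        have h2 : {p : ℝ × Rd d | ‖p.2‖ < 3 / 16} ∈ 𝓝 (s, ζ) :=
          (isOpen_lt (by fun_prop) continuous_const).mem_nhds (show ‖ζ‖ < 3 / 16 by linarith)
        filter_upwards [h2] with p hp
        rw [hfat p.2 (le_of_lt hp), mul_zero]
      exact contDiffAt_const.congr_of_eventuallyEq this
  have hne : ∀ ζ : Rd d, 1 / 8 < ‖ζ‖ → ζ ≠ 0 := fun ζ h h0 => by
    rw [h0, norm_zero] at h; linarith
  have hnorm : ∀ (s : ℝ) (ζ : Rd d), 1 / 8 < ‖ζ‖ →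
      ContDiffAt ℝ ∞ (fun p : ℝ × Rd d => ‖p.2‖) (s, ζ) := fun s ζ h =>
    ContDiffAt.comp (g := fun ζ : Rd d => ‖ζ‖) (s, ζ) (contDiffAt_norm ℝ (hne ζ h)) contDiffAt_snd
  have ha2 : ∀ (s : ℝ) (ζ : Rd d), 1 / 8 < ‖ζ‖ →
      ContDiffAt ℝ ∞ (fun p : ℝ × Rd d => a p.2) (s, ζ) := fun s ζ h =>
    ContDiffAt.comp (g := a) (s, ζ) (ha.smooth ζ (hne ζ h)) contDiffAt_snd
  obtain ⟨C₁, h₁, H₁⟩ := exists_symNorm_le_of_family (ρ := 16 / 3)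
    (hsm (fun p => a p.2 * ((Real.exp (-(p.1 * ‖p.2‖)) : ℝ) : ℂ)) (fun s ζ h => by
      refine (ha2 s ζ h).mul (Complex.ofRealCLM.contDiff.contDiffAt.comp (s, ζ) ?_)
      exact (contDiffAt_fst.mul (hnorm s ζ h)).neg.exp))
    (fun s ζ h => by rw [hfat' ζ h, mul_zero])
  obtain ⟨C₂, h₂, H₂⟩ := exists_symNorm_le_of_family (ρ := 16 / 3)
    (hsm (fun p => a p.2 * ((expNegInvGlue (p.1 * (‖p.2‖ - 1 / 8)⁻¹) : ℝ) : ℂ)) (fun s ζ h => by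
      refine (ha2 s ζ h).mul (Complex.ofRealCLM.contDiff.contDiffAt.comp (s, ζ) ?_)
      refine expNegInvGlue.contDiff.contDiffAt.comp (s, ζ) ?_
      exact contDiffAt_fst.mul (((hnorm s ζ h).sub contDiffAt_const).inv
        (by simpa [sub_ne_zero] using h.ne'))))
    (fun s ζ h => by rw [hfat' ζ h, mul_zero])
  refine ⟨C₁ * Real.exp (1 / 8) + C₂, by positivity, fun t ht => ?_⟩
  rcases le_total t 1 with ht1 | ht1
  · refine (H₁ t ⟨ht, ht1⟩).trans (ofReal_le_ofReal ?_)
    have : Real.exp (1 / 8) * Real.exp (-(t / 8)) ≥ 1 := by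
      rw [← Real.exp_add]; exact Real.one_le_exp (by linarith)
    have h3 := mul_nonneg h₂ (Real.exp_pos (-(t / 8))).le
    nlinarith
  · have ht0 : 0 < t := by linarith
    have key : (fun ζ => a ζ * poissonSym t ζ * fatSym ψ 0 ζ) = fun ζ =>
        ((Real.exp (-(t / 8)) : ℝ) : ℂ) * (a ζ *
          ((expNegInvGlue (t⁻¹ * (‖ζ‖ - 1 / 8)⁻¹) : ℝ) : ℂ) * fatSym ψ 0 ζ) := by
      ext ζ
      rcases le_total ‖ζ‖ (3 / 16) with h | h
      · rw [hfat ζ h]; simp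
      · have h4 : 0 < ‖ζ‖ - 1 / 8 := by linarith
        rw [expNegInvGlue, if_neg (by rw [not_le]; positivity), mul_inv, inv_inv, inv_inv,
          poissonSym]
        have : Real.exp (-(t * ‖ζ‖)) = Real.exp (-(t / 8)) * Real.exp (-(t * (‖ζ‖ - 1 / 8))) := by
          rw [← Real.exp_add]; congr 1; ring
        rw [this]
        push_cast
        ring
    have hmul : ∀ (c : ℝ) (m : Rd d → ℂ), 0 ≤ c →
        symNorm (fun ζ => (c : ℂ) * m ζ) = ofReal c * symNorm m := by
      intro c m hc
      simp only [symNorm, ker_const_mul, enorm_mul]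
      rw [lintegral_const_mul' _ _ enorm_ne_top, ← ofReal_norm, norm_real,
        norm_of_nonneg hc]
    rw [key, hmul _ _ (Real.exp_pos _).le, mul_comm _ (Real.exp _),
      ofReal_mul (Real.exp_pos _).le]
    refine mul_le_mul_right ((H₂ t⁻¹ ⟨by positivity, inv_le_one_of_one_le₀ ht1⟩).trans ?_) _
    exact ofReal_le_ofReal (le_add_of_nonneg_left (by positivity))

/-- The decay factor of a degree `s` multiplier composed with `exp(-t|D|)` on the `j`-th block. -/
def decay (s j : ℤ) (t : ℝ) : ℝ := (2 : ℝ) ^ (s * j) * Real.exp (-(t * 2 ^ j / 8))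

lemma decay_nonneg (s j : ℤ) (t : ℝ) : 0 ≤ decay s j t := by unfold decay; positivity

lemma Homog.exists_symNorm_le {ψ : Rd d → ℝ} (hψ : IsCutoff ψ) {s : ℤ} {a : Rd d → ℂ}
    (ha : Homog s a) : ∃ C : ℝ, 0 ≤ C ∧ ∀ (j : ℤ) (t : ℝ), 0 ≤ t →
      symNorm (fun ζ => a ζ * poissonSym t ζ * fatSym ψ j ζ) ≤
        ofReal (C * decay s j t) := by
  obtain ⟨C, hC, H⟩ := ha.exists_symNorm_le_zero hψ
  refine ⟨C, hC, fun j t ht => ?_⟩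
  have hp : (0 : ℝ) < 2 ^ j := by positivity
  have key : (fun ζ => a ζ * poissonSym t ζ * fatSym ψ j ζ) = fun ζ =>
      (fun ζ => (((2 : ℝ) ^ (s * j) : ℝ) : ℂ) * (a ζ * poissonSym (t * 2 ^ j) ζ * fatSym ψ 0 ζ))
        (((2 : ℝ) ^ (-j)) • ζ) := by
    ext ζ
    simp only
    rw [fatSym_scale, ha.scale _ (by positivity), poissonSym_scale _ (by positivity), mul_assoc t,
      ← zpow_add₀ two_ne_zero, add_neg_cancel, zpow_zero, mul_one, ← zpow_mul, neg_mul,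
      mul_comm j s]
    have h1 : (((2 : ℝ) ^ (s * j) : ℝ) : ℂ) * (((2 : ℝ) ^ (-(s * j)) : ℝ) : ℂ) = 1 := by
      rw [← Complex.ofReal_mul, ← zpow_add₀ two_ne_zero, add_neg_cancel, zpow_zero,
        Complex.ofReal_one]
    linear_combination (-(a ζ * poissonSym t ζ * fatSym ψ 0 ((2 : ℝ) ^ (-j) • ζ))) * h1
  have h2 := symNorm_scale (l := (2 : ℝ) ^ (-j)) (fun ζ : Rd d => (((2 : ℝ) ^ (s * j) : ℝ) : ℂ) *
    (a ζ * poissonSym (t * 2 ^ j) ζ * fatSym ψ 0 ζ)) (by positivity)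
  rw [key]
  refine h2.trans_le ?_
  simp only [symNorm, ker_const_mul, enorm_mul]
  rw [lintegral_const_mul' _ _ enorm_ne_top, ← ofReal_norm, norm_real,
    norm_of_nonneg (by positivity)]
  refine (mul_le_mul_right (H (t * 2 ^ j) (by positivity)) _).trans_eq ?_
  rw [← ofReal_mul (by positivity)]
  congr 1
  unfold decay
  ring

lemma mul_fat_mul_dyadic {ψ : Rd d → ℝ} (hψ : IsCutoff ψ) (a : Rd d → ℂ) (j : ℤ) :
    (fun ζ => a ζ * fatSym ψ j ζ) * dyadicSym ψ j = fun ζ => a ζ * dyadicSym ψ j ζ := by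
  ext ζ
  simp only [Pi.mul_apply, mul_assoc, hψ.fat_mul_dyadic]

lemma symNorm_dyadic (ψ : Rd d → ℝ) (j : ℤ) : symNorm (dyadicSym ψ j) = symNorm (dyadicSym ψ 0) := by
  rw [← symNorm_scale (dyadicSym ψ 0) (l := 2 ^ (-j)) (by positivity)]
  congr 1
  ext ζ
  exact dyadicSym_scale ψ j ζ

lemma symNorm_low (ψ : Rd d → ℝ) (j : ℤ) : symNorm (lowSym ψ j) = symNorm (lowSym ψ 0) := by
  rw [← symNorm_scale (lowSym ψ 0) (l := 2 ^ (-j)) (by positivity)]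
  congr 1
  ext ζ
  exact lowSym_scale ψ j ζ

/-! ## Sums and integrals of symbols -/

lemma ker_tsum {ι : Type*} [Countable ι] {m : ι → Rd d → ℂ} {M : Rd d → ℂ}
    (hm : ∀ i, L1Sym (m i)) (hsum : ∀ᵐ ζ : Rd d, HasSum (fun i => m i ζ) (M ζ))
    (hdom : ∑' i, ∫⁻ ζ, ‖m i ζ‖ₑ ≠ ⊤) (x : Rd d) : ker M x = ∑' i, ker (m i) x := by
  simp only [ker, Real.fourierInv_eq']
  rw [← integral_tsum]
  · have h2 : ∀ᵐ ξ : Rd d, HasSum (fun i => m i ((2 * π) • ξ)) (M ((2 * π) • ξ)) := by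
      have hq : Measure.QuasiMeasurePreserving (fun ξ : Rd d => (2 * π) • ξ) := by
        refine ⟨measurable_const_smul _, ?_⟩
        rw [Measure.map_addHaar_smul _ Real.two_pi_pos.ne']
        exact Measure.smul_absolutelyContinuous
      exact hq.ae hsum
    refine integral_congr_ae ?_
    filter_upwards [h2] with ξ hξ
    simp only [smul_eq_mul]
    rw [tsum_mul_left, hξ.tsum_eq]
  · intro i
    have hc : Continuous fun ξ : Rd d =>
      Complex.exp ((2 * π * inner ℝ ξ x : ℝ) * I) := by fun_prop
    exact (hc.smul (hm i).cont_scaled).aestronglyMeasurable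
  · have h3 : ∀ i, ∫⁻ ξ : Rd d, ‖Complex.exp ((2 * π * inner ℝ ξ x : ℝ) * I) •
        m i ((2 * π) • ξ)‖ₑ = ofReal |((2 * π) ^ d)⁻¹| * ∫⁻ ζ, ‖m i ζ‖ₑ := by
      intro i
      have h4 : ∫⁻ ξ : Rd d, ‖m i ((2 * π) • ξ)‖ₑ =
          ofReal |((2 * π) ^ d)⁻¹| * ∫⁻ ζ, ‖m i ζ‖ₑ := by
        have h5 := lintegral_map (μ := volume) (f := fun ζ : Rd d => ‖m i ζ‖ₑ)
          (hm i).cont.measurable.enorm (measurable_const_smul (2 * π))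
        rw [Measure.map_addHaar_smul _ Real.two_pi_pos.ne', lintegral_smul_measure,
          finrank_euclideanSpace_fin] at h5
        exact h5.symm
      rw [← h4]
      refine lintegral_congr fun ξ => ?_
      rw [smul_eq_mul, enorm_mul, ← ofReal_norm (Complex.exp _), Complex.norm_exp_ofReal_mul_I]
      simp
    simp only [h3]
    rw [ENNReal.tsum_mul_left]
    exact ENNReal.mul_ne_top ENNReal.ofReal_ne_top hdom

lemma L1Sym.of_tsum {ι : Type*} [Countable ι] {m : ι → Rd d → ℂ} {M : Rd d → ℂ}
    (hm : ∀ i, L1Sym (m i)) (hM : Continuous M) (hMint : Integrable M)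
    (hsum : ∀ᵐ ζ : Rd d, HasSum (fun i => m i ζ) (M ζ))
    (hdom : ∑' i, ∫⁻ ζ, ‖m i ζ‖ₑ ≠ ⊤) (hker : ∑' i, symNorm (m i) < ⊤) : L1Sym M where
  cont := hM
  int := hMint
  kint := by
    refine ⟨(continuous_ker hMint).aestronglyMeasurable, ?_⟩
    refine lt_of_le_of_lt ?_ hker
    simp only [symNorm]
    rw [← lintegral_tsum (fun i => (hm i).kint.aestronglyMeasurable.enorm)]
    refine lintegral_mono fun x => ?_
    rw [ker_tsum hm hsum hdom]
    exact enorm_tsum_le_tsum_enorm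

lemma multF_tsum {ι : Type*} [Countable ι] {m : ι → Rd d → ℂ} {M : Rd d → ℂ}
    (hm : ∀ i, L1Sym (m i))
    (hsum : ∀ᵐ ζ : Rd d, HasSum (fun i => m i ζ) (M ζ))
    (hdom : ∑' i, ∫⁻ ζ, ‖m i ζ‖ₑ ≠ ⊤) (hker : ∑' i, symNorm (m i) < ⊤) {q : Rd d → ℂ} (hq : BM q)
    (x : Rd d) : multF M q x = ∑' i, multF (m i) q x := by
  simp only [multF_eq]
  have hb : ∀ i, ∫⁻ y, ‖ker (m i) (x - y) * q y‖ₑ ≤ symNorm (m i) * supN q := by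
    intro i
    calc _ ≤ ∫⁻ y, ‖ker (m i) (x - y)‖ₑ * supN q := by
          refine lintegral_mono fun y => ?_
          rw [enorm_mul]
          exact mul_le_mul_right (le_supN q y) _
      _ = symNorm (m i) * supN q := by
          rw [lintegral_mul_const' _ _ hq.fin.ne,
            lintegral_sub_left_eq_self (fun y => ‖ker (m i) y‖ₑ) x]
          rfl
  have hfin : ∑' i, ∫⁻ y, ‖ker (m i) (x - y) * q y‖ₑ < ⊤ := by
    refine (tsum_le_tsum hb).trans_lt ?_
    rw [ENNReal.tsum_mul_right]
    exact mul_lt_top hker hq.fin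
  have hmeas : ∀ i, AEStronglyMeasurable (fun y => ker (m i) (x - y) * q y) := fun i =>
    (integrable_multF (hm i) hq x).aestronglyMeasurable
  rw [← integral_tsum hmeas hfin.ne]
  refine integral_congr_ae (.of_forall fun y => ?_)
  simp only
  rw [ker_tsum hm hsum hdom, tsum_mul_right]

lemma supN_multF_tsum_le {ι : Type*} [Countable ι] {m : ι → Rd d → ℂ} {M : Rd d → ℂ}
    (hm : ∀ i, L1Sym (m i))
    (hsum : ∀ᵐ ζ : Rd d, HasSum (fun i => m i ζ) (M ζ))
    (hdom : ∑' i, ∫⁻ ζ, ‖m i ζ‖ₑ ≠ ⊤) (hker : ∑' i, symNorm (m i) < ⊤) {q : Rd d → ℂ} (hq : BM q) :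
    supN (multF M q) ≤ ∑' i, supN (multF (m i) q) := by
  refine iSup_le fun x => ?_
  rw [multF_tsum hm hsum hdom hker hq]
  exact enorm_tsum_le_tsum_enorm.trans (tsum_le_tsum fun i => le_supN _ x)

section path

variable {ν : Measure ℝ} [SFinite ν] {n : ℝ → Rd d → ℂ} {M : Rd d → ℂ}

lemma measurable_ker_family (hn : Measurable (Function.uncurry n)) :
    Measurable (fun p : ℝ × Rd d => ker (n p.1) p.2) := by
  simp only [ker, Real.fourierInv_eq']
  refine StronglyMeasurable.measurable ?_
  refine StronglyMeasurable.integral_prod_right (f := fun (p : ℝ × Rd d) (ξ : Rd d) =>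
    Complex.exp ((2 * π * inner ℝ ξ p.2 : ℝ) * I) • n p.1 ((2 * π) • ξ)) ?_
  have hc : Measurable fun p : (ℝ × Rd d) × Rd d =>
    Complex.exp ((2 * π * inner ℝ p.2 p.1.2 : ℝ) * I) :=
    Continuous.measurable (by fun_prop)
  have h2 : Measurable fun p : (ℝ × Rd d) × Rd d => (p.1.1, (2 * π) • p.2) := by fun_prop
  exact (hc.smul (hn.comp h2)).stronglyMeasurable

lemma ker_integral (hn : Measurable (Function.uncurry n))
    (hint : Integrable (Function.uncurry n) (ν.prod volume))
    (hM : ∀ ζ, M ζ = ∫ s, n s ζ ∂ν) (x : Rd d) : ker M x = ∫ s, ker (n s) x ∂ν := by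
  simp only [ker, Real.fourierInv_eq', hM, ← integral_smul]
  rw [integral_integral_swap]
  have h1 : Integrable (fun p : ℝ × Rd d => n p.1 ((2 * π) • p.2)) (ν.prod volume) := by
    have hI := (integrable_prod_iff hint.aestronglyMeasurable).1 hint
    have h2 : Measurable fun p : ℝ × Rd d => (p.1, (2 * π) • p.2) := by fun_prop
    have hmeas : Measurable (fun p : ℝ × Rd d => n p.1 ((2 * π) • p.2)) := hn.comp h2
    refine (integrable_prod_iff hmeas.aestronglyMeasurable).2 ⟨?_, ?_⟩
    · filter_upwards [hI.1] with s hs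
      exact hs.comp_smul Real.two_pi_pos.ne'
    · refine (hI.2.const_mul |((2 * π) ^ d)⁻¹|).congr (.of_forall fun s => ?_)
      have := Measure.integral_comp_smul (volume : Measure (Rd d)) (fun ζ => ‖n s ζ‖) (2 * π)
      rw [finrank_euclideanSpace_fin] at this
      exact this.symm
  have h2 := h1.swap.bdd_mul (c := 1) (f := fun p : Rd d × ℝ =>
    Complex.exp ((2 * π * inner ℝ p.1 x : ℝ) * I))
    (Continuous.aestronglyMeasurable (by fun_prop))
    (.of_forall fun p => by rw [Complex.norm_exp_ofReal_mul_I])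
  exact h2

lemma symNorm_integral_le (hn : Measurable (Function.uncurry n))
    (hint : Integrable (Function.uncurry n) (ν.prod volume))
    (hM : ∀ ζ, M ζ = ∫ s, n s ζ ∂ν) : symNorm M ≤ ∫⁻ s, symNorm (n s) ∂ν := by
  simp only [symNorm]
  rw [lintegral_lintegral_swap (measurable_ker_family hn).enorm.aemeasurable]
  refine lintegral_mono fun x => ?_
  rw [ker_integral hn hint hM]
  exact enorm_integral_le_lintegral_enorm _

lemma multF_integral (hn : Measurable (Function.uncurry n))
    (hint : Integrable (Function.uncurry n) (ν.prod volume))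
    (hM : ∀ ζ, M ζ = ∫ s, n s ζ ∂ν) (hfin : (∫⁻ s, symNorm (n s) ∂ν) < ⊤) {q : Rd d → ℂ} (hq : BM q)
    (x : Rd d) : multF M q x = ∫ s, multF (n s) q x ∂ν := by
  have hk := measurable_ker_family hn
  have hs : Measurable (fun p : ℝ × Rd d => (p.1, x - p.2)) := by fun_prop
  have hme : Measurable (fun p : ℝ × Rd d => ker (n p.1) (x - p.2)) := by
    simpa only [Function.comp_def] using hk.comp hs
  have h1 : Integrable (fun p : ℝ × Rd d => ker (n p.1) (x - p.2)) (ν.prod volume) := by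
    refine ⟨hme.aestronglyMeasurable, ?_⟩
    rw [HasFiniteIntegral, lintegral_prod _ hme.enorm.aemeasurable]
    refine lt_of_eq_of_lt (lintegral_congr fun s => ?_) hfin
    exact lintegral_sub_left_eq_self (fun y => ‖ker (n s) y‖ₑ) x
  have h2 : Integrable (fun p : ℝ × Rd d => ker (n p.1) (x - p.2) * q p.2) (ν.prod volume) :=
    h1.mul_bdd (hq.meas.comp measurable_snd).aestronglyMeasurable
      (.of_forall fun p => norm_le_supN hq.fin p.2)
  calc multF M q x = ∫ y, ∫ s, ker (n s) (x - y) * q y ∂ν := by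
        rw [multF_eq]
        congr 1 with y
        rw [ker_integral hn hint hM, integral_mul_const]
    _ = ∫ s, multF (n s) q x ∂ν :=
        (integral_integral_swap (f := fun s y => ker (n s) (x - y) * q y) h2).symm

end path

/-! ## Time decay -/

lemma summable_half_natAbs : Summable fun j : ℤ => (1 / 2 : ℝ) ^ j.natAbs := by
  have h : Summable fun n : ℕ => (1 / 2 : ℝ) ^ n :=
    summable_geometric_of_lt_one (by norm_num) (by norm_num)
  refine Summable.of_nat_of_neg ?_ ?_ <;> simpa using h

lemma two_zpow_le_of_nonneg (n : ℕ) : (2 : ℝ) ^ (-(n : ℤ)) = (1 / 2) ^ n := by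
  rw [zpow_neg, zpow_natCast, one_div, inv_pow]

lemma decay_zero_le {t : ℝ} (ht : 0 < t) (n : ℕ) : decay 0 n t ≤ 8 / t * (1 / 2) ^ n := by
  have hp : (0 : ℝ) < 2 ^ (n : ℤ) := by positivity
  have h1 := Real.add_one_le_exp (t * 2 ^ (n : ℤ) / 8)
  rw [decay, zero_mul, zpow_zero, one_mul, Real.exp_neg, ← two_zpow_le_of_nonneg, zpow_neg,
    ← div_eq_mul_inv, div_div]
  rw [← one_div, div_le_div_iff₀ (Real.exp_pos _) (by positivity)]
  linarith

lemma decay_one_le {t : ℝ} (ht : 0 < t) (j : ℤ) :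
    decay 1 j t ≤ (1 + 128 / t ^ 2) * (1 / 2) ^ j.natAbs := by
  have hp : (0 : ℝ) < 2 ^ j := by positivity
  rw [decay, one_mul]
  rcases le_total 0 j with hj | hj
  · obtain ⟨n, rfl⟩ := Int.eq_ofNat_of_zero_le hj
    have h1 := Real.quadratic_le_exp_of_nonneg (x := t * 2 ^ (n : ℤ) / 8) (by positivity)
    rw [Real.exp_neg, Int.natAbs_natCast, ← two_zpow_le_of_nonneg, zpow_neg]
    have h2 : t ^ 2 * ((2 : ℝ) ^ (n : ℤ)) ^ 2 / 128 ≤ Real.exp (t * 2 ^ (n : ℤ) / 8) := by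
      have : 0 ≤ t * 2 ^ (n : ℤ) / 8 := by positivity
      nlinarith
    calc (2 : ℝ) ^ (n : ℤ) * (Real.exp (t * 2 ^ (n : ℤ) / 8))⁻¹
        ≤ (2 : ℝ) ^ (n : ℤ) * (t ^ 2 * ((2 : ℝ) ^ (n : ℤ)) ^ 2 / 128)⁻¹ := by gcongr
      _ = 128 / t ^ 2 * ((2 : ℝ) ^ (n : ℤ))⁻¹ := by field_simp
      _ ≤ _ := by gcongr; linarith
  · obtain ⟨n, rfl⟩ := Int.exists_eq_neg_ofNat hj
    rw [Int.natAbs_neg, Int.natAbs_natCast, two_zpow_le_of_nonneg]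
    have h1 : Real.exp (-(t * (1 / 2) ^ n / 8)) ≤ 1 := by
      rw [Real.exp_le_one_iff]
      have : 0 ≤ t * (1 / 2) ^ n / 8 := by positivity
      linarith
    have h2 : (0 : ℝ) < (1 / 2) ^ n := by positivity
    have h3 : 0 ≤ 128 / t ^ 2 := by positivity
    nlinarith

lemma summable_decay {t : ℝ} (ht : 0 < t) : Summable fun j : ℤ => decay 1 j t :=
  (summable_half_natAbs.mul_left (1 + 128 / t ^ 2)).of_nonneg_of_le
    (fun j => decay_nonneg 1 j t) (decay_one_le ht)

lemma decay_anti (s j : ℤ) {t t' : ℝ} (h : t ≤ t') : decay s j t' ≤ decay s j t := by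
  unfold decay
  gcongr

lemma decay_zero_right (s j : ℤ) : decay s j 0 = 2 ^ (s * j) := by simp [decay]

lemma decay_le (s j : ℤ) {t : ℝ} (h : 0 ≤ t) : decay s j t ≤ 2 ^ (s * j) :=
  (decay_anti s j h).trans_eq (decay_zero_right s j)

lemma continuous_decay (s j : ℤ) : Continuous (decay s j) := by unfold decay; fun_prop

lemma lintegral_decay_le (j : ℤ) (z : ℝ) :
    ∫⁻ τ : ℝ, ofReal (decay 1 j |z - τ|) ≤ 16 := by
  have hp : (0 : ℝ) < 2 ^ j := by positivity
  have hneg : -(2 ^ j / 8 : ℝ) < 0 := by linarith [div_pos hp (by norm_num : (0 : ℝ) < 8)]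
  have h1 : ∫⁻ τ in Set.Ioi (0 : ℝ), ofReal (decay 1 j |τ|) = 8 := by
    have : ∫⁻ τ in Set.Ioi (0 : ℝ), ofReal (decay 1 j |τ|) =
        ∫⁻ τ in Set.Ioi (0 : ℝ), ofReal (2 ^ j * Real.exp (-(2 ^ j / 8) * τ)) := by
      refine setLIntegral_congr_fun measurableSet_Ioi fun τ hτ => ?_
      rw [abs_of_pos hτ, decay, one_mul]
      ring_nf
    rw [this, ← ofReal_integral_eq_lintegral_ofReal
      ((integrableOn_exp_mul_Ioi hneg 0).const_mul _) (.of_forall fun τ => by positivity),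
      integral_const_mul, integral_exp_mul_Ioi hneg, mul_zero, Real.exp_zero,
      show (2 : ℝ) ^ j * (-1 / -(2 ^ j / 8)) = 8 by field_simp]
    simp
  have h2 := (Measure.measurePreserving_neg (volume : Measure ℝ)).setLIntegral_comp_preimage_emb
    (MeasurableEquiv.neg ℝ).measurableEmbedding (fun τ => ofReal (decay 1 j |τ|)) (Set.Ioi 0)
  simp only [abs_neg, Set.neg_preimage, Set.neg_Ioi, neg_zero, h1] at h2
  rw [lintegral_sub_left_eq_self (fun τ => ofReal (decay 1 j |τ|)) z,
    ← lintegral_add_compl _ (measurableSet_Ioi (a := (0 : ℝ))), Set.compl_Ioi,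
    setLIntegral_congr Iio_ae_eq_Iic.symm, h1, h2]
  norm_num

/-! ## Multipliers acting on dyadic blocks -/

lemma blockF_one (ψ : Rd d → ℝ) (j : ℤ) (q : Rd d → ℂ) :
    blockF ψ 1 j q = multF (dyadicSym ψ j) q := by
  simp only [blockF, Pi.one_apply, one_mul]

lemma multF_block {ψ : Rd d → ℝ} (hψ : IsCutoff ψ) {s : ℤ} {a : Rd d → ℂ} (ha : Homog s a)
    (t : ℝ) (j : ℤ) {q : Rd d → ℂ} (hq : BM q) :
    multF (fun ζ => a ζ * poissonSym t ζ * dyadicSym ψ j ζ) q =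
      multF (fun ζ => a ζ * poissonSym t ζ * fatSym ψ j ζ) (multF (dyadicSym ψ j) q) := by
  rw [multF_comp (ha.smoothSym_fat hψ t j).l1 (hψ.dyadic_smooth j).l1 hq,
    mul_fat_mul_dyadic hψ (fun ζ => a ζ * poissonSym t ζ)]

/-- `C` bounds the multiplier `a` together with its composition with the Poisson semigroup on
all dyadic blocks. -/
def BlockBound (ψ : Rd d → ℝ) (s : ℤ) (a : Rd d → ℂ) (C : ℝ) : Prop :=
  0 ≤ C ∧ ∀ (j : ℤ) (t : ℝ), 0 ≤ t →
    symNorm (fun ζ => a ζ * poissonSym t ζ * fatSym ψ j ζ) ≤ ofReal (C * decay s j t)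

lemma supN_multF_block_le {ψ : Rd d → ℝ} (hψ : IsCutoff ψ) {s : ℤ} {a : Rd d → ℂ}
    (ha : Homog s a) {C : ℝ} (hC : BlockBound ψ s a C) {t : ℝ} (ht : 0 ≤ t) (j : ℤ)
    {q : Rd d → ℂ} (hq : BM q) :
    supN (multF (fun ζ => a ζ * poissonSym t ζ * dyadicSym ψ j ζ) q) ≤
      ofReal (C * decay s j t) * supN (multF (dyadicSym ψ j) q) := by
  rw [multF_block hψ ha t j hq]
  exact (supN_multF_le (ha.smoothSym_fat hψ t j).l1.int _).trans
    (mul_le_mul_left (hC.2 j t ht) _)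

lemma symNorm_block_le {ψ : Rd d → ℝ} (hψ : IsCutoff ψ) {s : ℤ} {a : Rd d → ℂ}
    (ha : Homog s a) {C : ℝ} (hC : BlockBound ψ s a C) {t : ℝ} (ht : 0 ≤ t) (j : ℤ) :
    symNorm (fun ζ => a ζ * poissonSym t ζ * dyadicSym ψ j ζ) ≤
      ofReal (C * decay s j t) * symNorm (dyadicSym ψ 0) := by
  rw [← mul_fat_mul_dyadic hψ (fun ζ => a ζ * poissonSym t ζ)]
  refine ((ha.smoothSym_fat hψ t j).l1.symNorm_mul_le (hψ.dyadic_smooth j).l1).trans ?_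
  rw [symNorm_dyadic]
  exact mul_le_mul_left (hC.2 j t ht) _

/-- Continuous symbols, homogeneous of degree one and bounded by `|ζ|`. -/
structure Deg1 (a : Rd d → ℂ) : Prop where
  hom : Homog 1 a
  cont : Continuous a
  bound : ∀ ζ, ‖a ζ‖ ≤ ‖ζ‖

lemma deg1_absSym : Deg1 (absSym : Rd d → ℂ) :=
  ⟨homog_absSym, by unfold absSym; fun_prop, fun ζ => by simp [absSym]⟩

lemma deg1_gradSym (k : Fin d) : Deg1 (gradSym k : Rd d → ℂ) :=
  ⟨homog_gradSym k, by unfold gradSym; fun_prop, fun ζ => by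
    simpa [gradSym] using PiLp.norm_apply_le ζ k⟩

lemma integrable_norm_mul_poisson {t : ℝ} (ht : 0 < t) :
    Integrable (fun ζ : Rd d => (1 + ‖ζ‖) * Real.exp (-(t * ‖ζ‖))) := by
  have h0 : Integrable (fun ζ : Rd d => (1 + ‖ζ‖) ^ (-((d : ℝ) + 1))) :=
    integrable_one_add_norm (by rw [finrank_euclideanSpace_fin]; linarith)
  refine (h0.const_mul (Real.exp t * ((d + 2).factorial / t ^ (d + 2)))).mono'
    (Continuous.aestronglyMeasurable (by fun_prop)) (.of_forall fun ζ => ?_)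
  have h1 : 0 < 1 + ‖ζ‖ := by positivity
  have h2 := Real.pow_div_factorial_le_exp (x := t * (1 + ‖ζ‖)) (by positivity) (d + 2)
  rw [norm_of_nonneg (by positivity), Real.rpow_neg h1.le,
    show ((d : ℝ) + 1) = ((d + 1 : ℕ) : ℝ) by push_cast; ring, Real.rpow_natCast]
  have h3 : Real.exp (-(t * ‖ζ‖)) = Real.exp t * (Real.exp (t * (1 + ‖ζ‖)))⁻¹ := by
    rw [← Real.exp_neg, ← Real.exp_add]; congr 1; ring
  rw [h3]
  have h4 : (Real.exp (t * (1 + ‖ζ‖)))⁻¹ ≤ ((t * (1 + ‖ζ‖)) ^ (d + 2) / (d + 2).factorial)⁻¹ :=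
    inv_anti₀ (by positivity) h2
  calc (1 + ‖ζ‖) * (Real.exp t * (Real.exp (t * (1 + ‖ζ‖)))⁻¹)
      ≤ (1 + ‖ζ‖) * (Real.exp t * ((t * (1 + ‖ζ‖)) ^ (d + 2) / (d + 2).factorial)⁻¹) := by gcongr
    _ = _ := by
        rw [mul_pow]
        field_simp
        ring

lemma integrable_poissonSym {t : ℝ} (ht : 0 < t) : Integrable (poissonSym t : Rd d → ℂ) := by
  refine (integrable_norm_mul_poisson ht).mono' (continuous_poissonSym t).aestronglyMeasurable
    (.of_forall fun ζ => ?_)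
  rw [poissonSym, norm_real, norm_of_nonneg (Real.exp_pos _).le]
  exact le_mul_of_one_le_left (Real.exp_pos _).le (by linarith [norm_nonneg ζ])

namespace Deg1

variable {a : Rd d → ℂ} {ψ : Rd d → ℝ}

lemma norm_mul_poisson_le (ha : Deg1 a) (t : ℝ) (ζ : Rd d) :
    ‖a ζ * poissonSym t ζ‖ ≤ (1 + ‖ζ‖) * Real.exp (-(t * ‖ζ‖)) := by
  rw [norm_mul, poissonSym, norm_real, norm_of_nonneg (Real.exp_pos _).le]
  exact mul_le_mul_of_nonneg_right ((ha.bound ζ).trans (by linarith)) (Real.exp_pos _).le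

lemma cont_poisson (ha : Deg1 a) (t : ℝ) : Continuous (fun ζ => a ζ * poissonSym t ζ) :=
  ha.cont.mul (continuous_poissonSym t)

lemma integrable (ha : Deg1 a) {t : ℝ} (ht : 0 < t) :
    Integrable (fun ζ => a ζ * poissonSym t ζ) :=
  (integrable_norm_mul_poisson ht).mono' (ha.cont_poisson t).aestronglyMeasurable
    (.of_forall (ha.norm_mul_poisson_le t))

lemma hasSum_blocks (hψ : IsCutoff ψ) (ha : Deg1 a) (t : ℝ) (ζ : Rd d) :
    HasSum (fun j => a ζ * poissonSym t ζ * dyadicSym ψ j ζ) (a ζ * poissonSym t ζ) := by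
  rcases eq_or_ne ζ 0 with rfl | hζ
  · have : a 0 = 0 := by simpa using ha.bound 0
    simp [this, hasSum_zero]
  · simpa using (hψ.hasSum_dyadic hζ).mul_left (a ζ * poissonSym t ζ)

lemma tsum_lintegral_blocks (hψ : IsCutoff ψ) (ha : Deg1 a) {t : ℝ} (ht : 0 < t) :
    ∑' j, ∫⁻ ζ, ‖a ζ * poissonSym t ζ * dyadicSym ψ j ζ‖ₑ ≠ ⊤ := by
  rw [← lintegral_tsum fun j =>
    (ha.hom.smoothSym_dyadic hψ t j).smooth.continuous.measurable.enorm.aemeasurable]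
  refine ne_top_of_le_ne_top (b := ∫⁻ ζ, ‖a ζ * poissonSym t ζ‖ₑ * 3) ?_
    (lintegral_mono fun ζ => ?_)
  · rw [lintegral_mul_const' _ _ (by norm_num)]
    exact ENNReal.mul_ne_top (ha.integrable ht).2.ne (by norm_num)
  · simp only [enorm_mul (a ζ * poissonSym t ζ)]
    rw [ENNReal.tsum_mul_left]
    exact mul_le_mul_right (hψ.tsum_enorm_dyadic_le ζ) _

lemma tsum_symNorm_le (hψ : IsCutoff ψ) (ha : Deg1 a) {C : ℝ} (hC : BlockBound ψ 1 a C) {t : ℝ}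
    (ht : 0 ≤ t) : ∑' j, symNorm (fun ζ => a ζ * poissonSym t ζ * dyadicSym ψ j ζ) ≤
      (∑' j, ofReal (C * decay 1 j t)) * symNorm (dyadicSym ψ 0) := by
  rw [← ENNReal.tsum_mul_right]
  exact tsum_le_tsum fun j => symNorm_block_le hψ ha.hom hC ht j

lemma tsum_symNorm_lt_top (hψ : IsCutoff ψ) (ha : Deg1 a) {t : ℝ} (ht : 0 < t) :
    ∑' j, symNorm (fun ζ => a ζ * poissonSym t ζ * dyadicSym ψ j ζ) < ⊤ := by
  obtain ⟨C, hC⟩ := ha.hom.exists_symNorm_le hψ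
  refine (ha.tsum_symNorm_le hψ hC ht.le).trans_lt (mul_lt_top ?_
    (hψ.dyadic_smooth 0).l1.symNorm_lt_top)
  exact ((summable_decay ht).mul_left C).tsum_ofReal_lt_top

lemma l1 (hψ : IsCutoff ψ) (ha : Deg1 a) {t : ℝ} (ht : 0 < t) :
    L1Sym (fun ζ => a ζ * poissonSym t ζ) :=
  L1Sym.of_tsum (fun j => (ha.hom.smoothSym_dyadic hψ t j).l1) (ha.cont_poisson t)
    (ha.integrable ht) (.of_forall (ha.hasSum_blocks hψ t))
    (ha.tsum_lintegral_blocks hψ ht) (ha.tsum_symNorm_lt_top hψ ht)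

lemma supN_multF_le (hψ : IsCutoff ψ) (ha : Deg1 a) {C : ℝ} (hC : BlockBound ψ 1 a C) {t : ℝ}
    (ht : 0 < t) {q : Rd d → ℂ} (hq : BM q) :
    supN (multF (fun ζ => a ζ * poissonSym t ζ) q) ≤
      ∑' j, ofReal (C * decay 1 j t) * supN (multF (dyadicSym ψ j) q) :=
  (supN_multF_tsum_le (fun j => (ha.hom.smoothSym_dyadic hψ t j).l1)
    (.of_forall (ha.hasSum_blocks hψ t)) (ha.tsum_lintegral_blocks hψ ht)
    (ha.tsum_symNorm_lt_top hψ ht) hq).trans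
    (tsum_le_tsum fun j => supN_multF_block_le hψ ha.hom hC ht.le j hq)

lemma symNorm_le (hψ : IsCutoff ψ) (ha : Deg1 a) {C : ℝ} (hC : BlockBound ψ 1 a C) {t : ℝ}
    (ht : 0 < t) : symNorm (fun ζ => a ζ * poissonSym t ζ) ≤
      (∑' j, ofReal (C * decay 1 j t)) * symNorm (dyadicSym ψ 0) := by
  refine le_trans ?_ (ha.tsum_symNorm_le hψ hC ht.le)
  simp only [symNorm]
  rw [← lintegral_tsum fun i =>
    (ha.hom.smoothSym_dyadic hψ t i).l1.kint.aestronglyMeasurable.enorm]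
  refine lintegral_mono fun x => ?_
  rw [ker_tsum (fun j => (ha.hom.smoothSym_dyadic hψ t j).l1)
    (.of_forall (ha.hasSum_blocks hψ t)) (ha.tsum_lintegral_blocks hψ ht)]
  exact enorm_tsum_le_tsum_enorm

end Deg1

/-! ## The Poisson kernel -/

lemma measurable_poissonSym : Measurable (Function.uncurry (poissonSym : ℝ → Rd d → ℂ)) := by
  unfold Function.uncurry poissonSym
  exact Continuous.measurable (by fun_prop)

lemma measurable_mul_poissonSym {a : Rd d → ℂ} (ha : Continuous a) :
    Measurable (Function.uncurry fun (s : ℝ) (ζ : Rd d) => a ζ * poissonSym s ζ) :=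
  (ha.measurable.comp measurable_snd).mul measurable_poissonSym

lemma integral_abs_mul_poissonSym {t₀ t : ℝ} (h : t₀ ≤ t) (ζ : Rd d) :
    ∫ s in Set.Ioc t₀ t, absSym ζ * poissonSym s ζ = poissonSym t₀ ζ - poissonSym t ζ := by
  rw [← intervalIntegral.integral_of_le h]
  have : ∀ s ∈ Set.uIcc t₀ t, HasDerivAt (fun s : ℝ => -poissonSym s ζ)
      (absSym ζ * poissonSym s ζ) s := by
    intro s _
    have h1 : HasDerivAt (fun s : ℝ => Real.exp (-(s * ‖ζ‖))) (Real.exp (-(s * ‖ζ‖)) * -‖ζ‖) s := by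
      have := ((hasDerivAt_id s).mul_const ‖ζ‖).neg.exp
      simpa using this
    have h2 := h1.ofReal_comp.neg
    convert! h2 using 1
    simp [absSym, poissonSym, mul_comm]
  rw [intervalIntegral.integral_eq_sub_of_hasDerivAt this]
  · ring
  · refine Continuous.intervalIntegrable ?_ _ _
    unfold poissonSym
    fun_prop

lemma symNorm_one_sub_poisson_le {ψ : Rd d → ℝ} (hψ : IsCutoff ψ) {C : ℝ}
    (hC : BlockBound ψ 1 (absSym : Rd d → ℂ) C) {t : ℝ} (ht : 0 ≤ t) (j : ℤ) :
    symNorm (fun ζ => (1 - poissonSym t ζ) * dyadicSym ψ j ζ) ≤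
      ofReal (C * 2 ^ j * t) * symNorm (dyadicSym ψ 0) := by
  have hsm := hψ.dyadic_smooth j
  have hm : Measurable (Function.uncurry fun (s : ℝ) (ζ : Rd d) =>
      absSym ζ * poissonSym s ζ * dyadicSym ψ j ζ) :=
    (measurable_mul_poissonSym deg1_absSym.cont).mul
      (hsm.smooth.continuous.measurable.comp measurable_snd)
  refine (symNorm_integral_le (ν := volume.restrict (Set.Ioc 0 t))
    (n := fun s ζ => absSym ζ * poissonSym s ζ * dyadicSym ψ j ζ) hm ?_ fun ζ => ?_).trans ?_
  · have hI : Integrable (fun p : ℝ × Rd d => (1 : ℝ) * ((8 / 3 * 2 ^ j) * ‖dyadicSym ψ j p.2‖))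
        ((volume.restrict (Set.Ioc 0 t)).prod volume) :=
      (integrable_const (1 : ℝ)).mul_prod (hsm.l1.int.norm.const_mul _)
    have hae : ∀ᵐ p : ℝ × Rd d ∂((volume.restrict (Set.Ioc 0 t)).prod volume), 0 ≤ p.1 := by
      have h1 : ∀ᵐ s : ℝ ∂(volume.restrict (Set.Ioc 0 t)), 0 ≤ s := by
        filter_upwards [ae_restrict_mem measurableSet_Ioc] with s hs using hs.1.le
      exact Measure.quasiMeasurePreserving_fst.ae h1
    refine hI.mono' hm.aestronglyMeasurable ?_
    filter_upwards [hae] with p hp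
    simp only [Function.uncurry, norm_mul]
    rw [one_mul]
    rcases le_total (8 / 3 * 2 ^ j) ‖p.2‖ with h | h
    · rw [hψ.dyadic_eq_zero_of_ge h]; simp
    · refine mul_le_mul_of_nonneg_right ?_ (norm_nonneg _)
      calc ‖absSym p.2‖ * ‖poissonSym p.1 p.2‖ ≤ ‖p.2‖ * 1 := by
            gcongr
            · exact deg1_absSym.bound p.2
            · exact norm_poissonSym_le hp p.2
        _ ≤ _ := by linarith
  · rw [integral_mul_const, integral_abs_mul_poissonSym ht, poissonSym_zero]
    rfl
  · calc ∫⁻ s in Set.Ioc 0 t, symNorm (fun ζ => absSym ζ * poissonSym s ζ * dyadicSym ψ j ζ)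
        ≤ ∫⁻ s in Set.Ioc 0 t, ofReal (C * 2 ^ j) * symNorm (dyadicSym ψ 0) := by
          refine setLIntegral_mono measurable_const fun s hs => ?_
          refine (symNorm_block_le hψ homog_absSym hC hs.1.le j).trans ?_
          refine mul_le_mul_left (ofReal_le_ofReal ?_) _
          refine mul_le_mul_of_nonneg_left ?_ hC.1
          simpa using decay_le 1 j hs.1.le
      _ = _ := by
          rw [setLIntegral_const, Real.volume_Ioc, sub_zero, mul_right_comm,
            ← ofReal_mul (mul_nonneg hC.1 (by positivity))]

lemma l1_poissonSym [Nonempty (Fin d)] {t : ℝ} (ht : 0 < t) : L1Sym (poissonSym t : Rd d → ℂ) := by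
  obtain ⟨ψ, hψ⟩ := exists_isCutoff d
  obtain ⟨C₀, hC₀⟩ := homog_one.exists_symNorm_le hψ (d := d)
  obtain ⟨C₁, hC₁⟩ := homog_absSym.exists_symNorm_le hψ (d := d)
  set m : ℤ → Rd d → ℂ := fun j ζ => (poissonSym t ζ - lowSym ψ 0 ζ) * dyadicSym ψ j ζ with hm
  have hms : ∀ j, SmoothSym (m j) := fun j =>
    (hψ.dyadic_smooth j).mul_of_ne_zero (a := fun ζ => poissonSym t ζ - lowSym ψ 0 ζ)
      (fun ζ hζ => (contDiffAt_poissonSym t hζ).sub (hψ.low_smooth 0).smooth.contDiffAt)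
      (hψ.dyadic_eventually_zero j)
  set S := (symNorm (dyadicSym ψ 0)).toReal with hS
  have hS' : symNorm (dyadicSym ψ 0) = ofReal S :=
    (ENNReal.ofReal_toReal (hψ.dyadic_smooth 0).l1.symNorm_lt_top.ne).symm
  have hS0 : 0 ≤ S := toReal_nonneg
  set A : ℝ := C₀ * (8 / t) * S + C₁ * t * S + (symNorm (m 0)).toReal +
    2 * (symNorm (m (-1))).toReal with hA
  have hA1 : 0 ≤ C₀ * (8 / t) * S := by have := hC₀.1; positivity
  have hA2 : 0 ≤ C₁ * t * S := by have := hC₁.1; positivity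
  have hA3 : 0 ≤ (symNorm (m 0)).toReal := toReal_nonneg
  have hA4 : 0 ≤ (symNorm (m (-1))).toReal := toReal_nonneg
  have hb : ∀ j, symNorm (m j) ≤ ofReal (A * (1 / 2) ^ j.natAbs) := by
    intro j
    have hp : (0 : ℝ) < (1 / 2) ^ j.natAbs := by positivity
    rcases lt_trichotomy j 0 with hj | rfl | hj
    · rcases eq_or_lt_of_le (Int.le_sub_one_of_lt hj) with h1 | h1
      · have h1 : j = -1 := by simpa using h1
        subst h1
        rw [← ENNReal.ofReal_toReal (hms (-1)).l1.symNorm_lt_top.ne]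
        refine ofReal_le_ofReal ?_
        norm_num
        linarith
      · obtain ⟨n, rfl⟩ := Int.exists_eq_neg_ofNat hj.le
        have h2 : m (-n) = fun ζ => ((-1 : ℂ)) * ((1 - poissonSym t ζ) * dyadicSym ψ (-n) ζ) := by
          ext ζ
          rw [hm]
          simp only
          rcases le_total (8 / 3 * 2 ^ (-n : ℤ)) ‖ζ‖ with h | h
          · rw [hψ.dyadic_eq_zero_of_ge h]; simp
          · rw [hψ.low_eq_one]
            · ring
            · have : (2 : ℝ) ^ (-n : ℤ) ≤ 2 ^ (-2 : ℤ) :=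
                zpow_le_zpow_right₀ one_le_two (by lia)
              have h14 : (2 : ℝ) ^ (-2 : ℤ) = 1 / 4 := by norm_num
              rw [h14] at this
              simp only [zpow_zero]
              linarith
        have h3 : symNorm (m (-n)) = symNorm (fun ζ => (1 - poissonSym t ζ) *
            dyadicSym ψ (-n) ζ) := by
          rw [h2]
          simp only [symNorm, ker_const_mul]
          simp
        rw [h3]
        refine (symNorm_one_sub_poisson_le hψ hC₁ ht.le _).trans ?_
        rw [hS', ← ofReal_mul (by have := hC₁.1; positivity)]
        refine ofReal_le_ofReal ?_
        rw [Int.natAbs_neg, Int.natAbs_natCast, two_zpow_le_of_nonneg]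
        have h4 : (0 : ℝ) < (1 / 2) ^ n := by positivity
        calc C₁ * (1 / 2) ^ n * t * S = C₁ * t * S * (1 / 2) ^ n := by ring
          _ ≤ A * (1 / 2) ^ n := by gcongr; linarith
    · rw [← ENNReal.ofReal_toReal (hms 0).l1.symNorm_lt_top.ne]
      refine ofReal_le_ofReal ?_
      simp only [Int.natAbs_zero, pow_zero, mul_one]
      linarith
    · obtain ⟨n, rfl⟩ := Int.eq_ofNat_of_zero_le hj.le
      have h2 : m n = fun ζ => (1 : Rd d → ℂ) ζ * poissonSym t ζ * dyadicSym ψ n ζ := by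
        ext ζ
        rw [hm]
        simp only [Pi.one_apply, one_mul]
        rcases le_total ‖ζ‖ (3 / 4 * 2 ^ (n : ℤ)) with h | h
        · rw [hψ.dyadic_eq_zero_of_le h]; simp
        · rw [hψ.low_eq_zero]
          · ring
          · have : (2 : ℝ) ^ (1 : ℤ) ≤ 2 ^ (n : ℤ) :=
              zpow_le_zpow_right₀ one_le_two (by lia)
            norm_num at this h ⊢
            linarith
      rw [h2]
      refine (symNorm_block_le hψ homog_one hC₀ ht.le _).trans ?_
      rw [hS', ← ofReal_mul (mul_nonneg hC₀.1 (decay_nonneg _ _ _))]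
      refine ofReal_le_ofReal ?_
      rw [Int.natAbs_natCast]
      have h4 : (0 : ℝ) < (1 / 2) ^ n := by positivity
      have := hC₀.1
      calc C₀ * decay 0 n t * S ≤ C₀ * (8 / t * (1 / 2) ^ n) * S := by
            gcongr; exact decay_zero_le ht n
        _ = C₀ * (8 / t) * S * (1 / 2) ^ n := by ring
        _ ≤ A * (1 / 2) ^ n := by gcongr; linarith
  have hker : ∑' j, symNorm (m j) < ⊤ := (tsum_le_tsum hb).trans_lt
    (summable_half_natAbs.mul_left A).tsum_ofReal_lt_top
  have hint : Integrable (fun ζ : Rd d => poissonSym t ζ - lowSym ψ 0 ζ) :=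
    (integrable_poissonSym ht).sub (hψ.low_smooth 0).l1.int
  have hcont : Continuous (fun ζ : Rd d => poissonSym t ζ - lowSym ψ 0 ζ) :=
    (continuous_poissonSym t).sub (hψ.low_smooth 0).l1.cont
  have hL : L1Sym (fun ζ : Rd d => poissonSym t ζ - lowSym ψ 0 ζ) := by
    refine L1Sym.of_tsum (fun j => (hms j).l1) hcont hint ?_ ?_ hker
    · have h0 : ∀ᵐ ζ : Rd d, ζ ≠ 0 := by simp [ae_iff]
      filter_upwards [h0] with ζ hζ
      simpa using (hψ.hasSum_dyadic hζ).mul_left (poissonSym t ζ - lowSym ψ 0 ζ)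
    · rw [← lintegral_tsum fun j => (hms j).l1.cont.measurable.enorm.aemeasurable]
      refine ne_top_of_le_ne_top (b := ∫⁻ ζ : Rd d, ‖poissonSym t ζ - lowSym ψ 0 ζ‖ₑ * 3) ?_
        (lintegral_mono fun ζ => ?_)
      · rw [lintegral_mul_const' _ _ (by norm_num)]
        exact ENNReal.mul_ne_top hint.2.ne (by norm_num)
      · simp only [hm, enorm_mul]
        rw [ENNReal.tsum_mul_left]
        exact mul_le_mul_right (hψ.tsum_enorm_dyadic_le ζ) _
  have := hL.add (hψ.low_smooth 0).l1
  convert! this using 1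
  ext ζ
  simp

lemma symNorm_poissonSym {t : ℝ} (ht : 0 < t) :
    symNorm (poissonSym t : Rd d → ℂ) = symNorm (poissonSym 1 : Rd d → ℂ) := by
  rw [← symNorm_scale (poissonSym 1 : Rd d → ℂ) ht]
  congr 1
  ext ζ
  rw [poissonSym_scale 1 ht, one_mul]

/-! ## Almost everywhere bounds -/

lemma supN_multF_le_ae {m : Rd d → ℂ} (h : Integrable m) {q : Rd d → ℂ} {M : ℝ≥0∞}
    (hq : ∀ᵐ x, ‖q x‖ₑ ≤ M) : supN (multF m q) ≤ symNorm m * M := by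
  refine iSup_le fun x => ?_
  calc ‖multF m q x‖ₑ ≤ ∫⁻ y, ‖ker m (x - y) * q y‖ₑ := enorm_integral_le_lintegral_enorm _
    _ ≤ ∫⁻ y, ‖ker m (x - y)‖ₑ * M := by
        refine lintegral_mono_ae ?_
        filter_upwards [hq] with y hy
        rw [enorm_mul]
        gcongr
    _ = symNorm m * M := by
        rw [lintegral_mul_const _ (by
          exact ((continuous_ker h).measurable.comp (measurable_const.sub measurable_id)).enorm),
          lintegral_sub_left_eq_self (fun y => ‖ker m y‖ₑ) x]
        rfl

/-! ## Approximation by low frequencies -/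

lemma multF_scale (m : Rd d → ℂ) {l : ℝ} (hl : 0 < l) (q : Rd d → ℂ) (x : Rd d) :
    multF (fun ζ => m (l • ζ)) q x = ∫ y, ker m y * q (x - l • y) := by
  rw [multF_eq, ← integral_sub_left_eq_self _ _ x]
  simp only [sub_sub_cancel, ker_scale m hl]
  have := Measure.integral_comp_smul (volume : Measure (Rd d))
    (fun y => ker m y * q (x - l • y)) l⁻¹
  simp only [finrank_euclideanSpace, Fintype.card_fin, inv_pow, inv_inv] at this
  rw [abs_of_pos (by positivity)] at this
  simp only [smul_smul, mul_inv_cancel₀ hl.ne', one_smul] at this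
  have h2 : ∫ y, ker m (l⁻¹ • y) * q (x - y) = ((l ^ d : ℝ) : ℂ) * ∫ y, ker m y * q (x - l • y) := by
    rw [this]; exact Complex.real_smul
  simp only [mul_assoc]
  rw [integral_const_mul, h2, ← mul_assoc, ← Complex.ofReal_mul, ← mul_pow,
    inv_mul_cancel₀ hl.ne']
  simp

lemma continuous_correlation {χ : Rd d → ℝ} (hχ : Continuous χ) (hc : HasCompactSupport χ)
    {q : Rd d → ℂ} (hq : BM q) : Continuous fun s => ∫ x, (χ x : ℂ) * q (x - s) := by
  have hloc : LocallyIntegrable (fun x => q (-x)) := by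
    refine MeasureTheory.LocallyIntegrable.mono (g := fun x => q (-x))
      (f := fun _ : Rd d => (supN q).toReal) (locallyIntegrable_const _)
      (hq.meas.comp measurable_neg).aestronglyMeasurable (.of_forall fun x => ?_)
    simpa using norm_le_supN hq.fin (-x)
  have := hc.continuous_convolution_right (ContinuousLinearMap.lsmul ℝ ℝ).flip hloc hχ
  convert this using 1
  ext s
  rw [convolution_def, ← integral_sub_left_eq_self _ _ s]
  congr 1 with x
  simp

lemma tendsto_integral_mul_multF {m : Rd d → ℂ} (hm : L1Sym m) {χ : Rd d → ℝ} (hχ : Continuous χ)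
    (hc : HasCompactSupport χ) {q : Rd d → ℂ} (hq : BM q) {l : ℕ → ℝ} (hl : ∀ n, 0 < l n)
    (hl0 : Tendsto l atTop (𝓝 0)) :
    Tendsto (fun n => ∫ x, (χ x : ℂ) * multF (fun ζ => m (l n • ζ)) q x) atTop
      (𝓝 (m 0 * ∫ x, (χ x : ℂ) * q x)) := by
  set Θ : Rd d → ℂ := fun s => ∫ x, (χ x : ℂ) * q (x - s) with hΘ
  have hΘc : Continuous Θ := continuous_correlation hχ hc hq
  have hχi : Integrable (fun x => (χ x : ℂ)) := (hχ.integrable_of_hasCompactSupport hc).ofReal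
  have hΘb : ∀ s, ‖Θ s‖ ≤ (∫ x, ‖(χ x : ℂ)‖) * (supN q).toReal := by
    intro s
    rw [← integral_mul_const]
    refine norm_integral_le_of_norm_le (hχi.norm.mul_const _) (.of_forall fun x => ?_)
    rw [norm_mul]
    gcongr
    exact norm_le_supN hq.fin _
  have h1 : ∀ n, ∫ x, (χ x : ℂ) * multF (fun ζ => m (l n • ζ)) q x =
      ∫ y, ker m y * Θ (l n • y) := by
    intro n
    simp only [multF_scale m (hl n), hΘ, ← integral_const_mul]
    rw [integral_integral_swap]
    · congr 1 with y
      congr 1 with x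
      ring
    · have h3 : Measurable fun p : Rd d × Rd d => q (p.1 - l n • p.2) := hq.meas.comp (by fun_prop)
      have := (hχi.mul_prod hm.kint).mul_bdd
        (g := fun p : Rd d × Rd d => q (p.1 - l n • p.2)) (c := (supN q).toReal)
        h3.aestronglyMeasurable (.of_forall fun p => norm_le_supN hq.fin _)
      refine this.congr (.of_forall fun p => ?_)
      simp only [Function.uncurry]
      ring
  simp only [h1]
  have h2 : m 0 * ∫ x, (χ x : ℂ) * q x = ∫ y, ker m y * Θ 0 := by
    rw [integral_mul_const, hm.integral_ker]
    simp [hΘ]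
  rw [h2]
  refine tendsto_integral_of_dominated_convergence
    (fun y => ‖ker m y‖ * ((∫ x, ‖(χ x : ℂ)‖) * (supN q).toReal)) (fun n => ?_)
    (hm.kint.norm.mul_const _) (fun n => .of_forall fun y => ?_)
    (.of_forall fun y => ?_)
  · exact ((continuous_ker hm.int).mul (hΘc.comp (continuous_const_smul _))).aestronglyMeasurable
  · rw [norm_mul]
    gcongr
    exact hΘb _
  · refine Tendsto.const_mul _ ((hΘc.tendsto 0).comp ?_)
    have := hl0.smul_const y
    rwa [zero_smul] at this

/-- The sum of the norms of the blocks of frequency at least `2^J`. -/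
def tail (ψ : Rd d → ℝ) (J : ℤ) (q : Rd d → ℂ) : ℝ≥0∞ :=
  ∑' n : ℕ, supN (multF (dyadicSym ψ (J + n)) q)

lemma ae_approx {ψ : Rd d → ℝ} (hψ : IsCutoff ψ) {q : Rd d → ℂ} (hq : BM q) (J : ℤ) :
    ∀ᵐ x, ‖q x - multF (lowSym ψ J) q x‖ₑ ≤ tail ψ J q := by
  by_cases hfin : tail ψ J q = ⊤
  · simp [hfin]
  set b : ℕ → ℝ := fun n => (supN (multF (dyadicSym ψ (J + n)) q)).toReal with hb
  have hbs : Summable b := ENNReal.summable_toReal hfin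
  have hbn : ∀ (n : ℕ) x, ‖multF (dyadicSym ψ (J + n)) q x‖ ≤ b n := fun n x =>
    norm_le_supN (BM.multF (hψ.dyadic_smooth _).l1 hq).fin x
  have hlowBM : BM (multF (lowSym ψ J) q) := BM.multF (hψ.low_smooth _).l1 hq
  set F : Rd d → ℂ := fun x => multF (lowSym ψ J) q x +
    ∑' n : ℕ, multF (dyadicSym ψ (J + n)) q x with hF
  have hFc : Continuous F := by
    refine (continuous_multF (hψ.low_smooth _).l1 hq).add ?_
    exact continuous_tsum (fun n => continuous_multF (hψ.dyadic_smooth _).l1 hq) hbs hbn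
  have hpart : ∀ n : ℕ, ∀ x, multF (lowSym ψ (J + n)) q x = multF (lowSym ψ J) q x +
      ∑ i ∈ Finset.range n, multF (dyadicSym ψ (J + i)) q x := by
    intro n x
    induction n with
    | zero => simp
    | succ n ih =>
      rw [Finset.sum_range_succ, ← add_assoc, ← ih]
      have : (J + (n + 1 : ℕ) : ℤ) = (J + n) + 1 := by push_cast; ring
      rw [this, lowSym_succ, multF_add_sym (hψ.low_smooth _).l1 (hψ.dyadic_smooth _).l1 hq]
      rfl
  have hFae : ∀ᵐ x, q x = F x := by
    refine ae_eq_of_integral_contDiff_smul_eq ?_ hFc.locallyIntegrable fun χ hχ hχc => ?_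
    · refine LocallyIntegrable.mono (f := fun _ : Rd d => (supN q).toReal)
        (locallyIntegrable_const _) hq.meas.aestronglyMeasurable (.of_forall fun x => ?_)
      simpa using norm_le_supN hq.fin x
    simp only [Complex.real_smul]
    have hl0 : Tendsto (fun n : ℕ => (2 : ℝ) ^ (-(J + n : ℤ))) atTop (𝓝 0) := by
      have : (fun n : ℕ => (2 : ℝ) ^ (-(J + n : ℤ))) = fun n : ℕ => (2 : ℝ) ^ (-J) * (1 / 2) ^ n := by
        ext n
        rw [neg_add, zpow_add₀ two_ne_zero, two_zpow_le_of_nonneg]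
      rw [this]
      simpa using (tendsto_pow_atTop_nhds_zero_of_lt_one (r := (1 / 2 : ℝ)) (by norm_num)
        (by norm_num)).const_mul ((2 : ℝ) ^ (-J))
    have hlim := tendsto_integral_mul_multF (hψ.low_smooth 0).l1 hχ.continuous hχc hq
      (l := fun n : ℕ => (2 : ℝ) ^ (-(J + n : ℤ))) (fun n => by positivity) hl0
    simp only [← lowSym_scale] at hlim
    rw [hψ.low_eq_one (by simp; norm_num), one_mul] at hlim
    refine tendsto_nhds_unique hlim ?_
    have hχi : Integrable (fun x => (χ x : ℂ)) :=
      (hχ.continuous.integrable_of_hasCompactSupport hχc).ofReal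
    refine tendsto_integral_of_dominated_convergence
      (fun x => ‖(χ x : ℂ)‖ * ((supN (multF (lowSym ψ J) q)).toReal + ∑' n, b n)) (fun n => ?_)
      (hχi.norm.mul_const _) (fun n => .of_forall fun x => ?_)
      (.of_forall fun x => ?_)
    · exact ((Complex.continuous_ofReal.comp hχ.continuous).mul
        (continuous_multF (hψ.low_smooth _).l1 hq)).aestronglyMeasurable
    · rw [norm_mul, hpart]
      gcongr
      refine (norm_add_le _ _).trans (add_le_add (norm_le_supN hlowBM.fin x) ?_)
      refine (norm_sum_le _ _).trans ((sum_le_sum fun i _ => hbn i x).trans ?_)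
      exact hbs.sum_le_tsum _ fun i _ => toReal_nonneg
    · refine Tendsto.const_mul _ ?_
      simp only [hpart, hF]
      refine Tendsto.const_add _ ?_
      exact (Summable.of_norm_bounded hbs (fun n => hbn n x)).hasSum.tendsto_sum_nat
  filter_upwards [hFae] with x hx
  rw [hx, hF]
  simp only [add_sub_cancel_left]
  refine (enorm_tsum_le_tsum_enorm).trans (tsum_le_tsum fun n => le_supN _ x)

/-! ## Products -/

/-- The character `x ↦ exp(2πi x·ξ)`. -/
def chr (ξ x : Rd d) : ℂ := Complex.exp ((2 * π * inner ℝ x ξ : ℝ) * I)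

lemma norm_chr (ξ x : Rd d) : ‖chr ξ x‖ = 1 := Complex.norm_exp_ofReal_mul_I _

lemma continuous_chr (ξ : Rd d) : Continuous (chr ξ) := by unfold chr; fun_prop

lemma chr_add (ξ x y : Rd d) : chr ξ (x + y) = chr ξ x * chr ξ y := by
  rw [chr, chr, chr, ← Complex.exp_add, inner_add_left]
  congr 1
  push_cast
  ring

lemma ker_shift (m : Rd d → ℂ) (ξ x : Rd d) :
    ker (fun ζ => m (ζ + (2 * π) • ξ)) x = chr ξ (-x) * ker m x := by
  simp only [ker]
  rw [Real.fourierInv_eq', Real.fourierInv_eq', ← integral_const_mul,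
    ← integral_sub_right_eq_self _ ξ]
  congr 1 with v
  rw [← smul_add, sub_add_cancel, smul_eq_mul, smul_eq_mul, ← mul_assoc, chr, ← Complex.exp_add,
    inner_sub_left, inner_neg_left, real_inner_comm ξ x]
  congr 2
  push_cast
  ring

lemma L1Sym.shift {m : Rd d → ℂ} (h : L1Sym m) (ξ : Rd d) :
    L1Sym (fun ζ => m (ζ + (2 * π) • ξ)) where
  cont := h.cont.comp (by fun_prop)
  int := h.int.comp_add_right _
  kint := by
    have : ker (fun ζ => m (ζ + (2 * π) • ξ)) = fun x => chr ξ (-x) * ker m x := by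
      ext x; exact ker_shift m ξ x
    rw [this]
    exact h.kint.bdd_mul ((continuous_chr ξ).comp continuous_neg).aestronglyMeasurable
      (.of_forall fun x => (norm_chr _ _).le)

lemma multF_chr_mul (m : Rd d → ℂ) (ξ : Rd d) (q : Rd d → ℂ) (x : Rd d) :
    multF m (fun y => chr ξ y * q y) x =
      chr ξ x * multF (fun ζ => m (ζ + (2 * π) • ξ)) q x := by
  simp only [multF_eq, ker_shift, ← integral_const_mul]
  congr 1 with y
  have : chr ξ y = chr ξ x * chr ξ (-(x - y)) := by rw [← chr_add]; congr 1; abel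
  rw [this]
  ring

lemma multF_ker_mul {m₁ m₂ : Rd d → ℂ} (h₁ : L1Sym m₁) (h₂ : L1Sym m₂) {G : Rd d → ℂ} (hG : BM G)
    (x y : Rd d) : ∫ u, ker m₁ (x - u) * ker m₂ (u - y) * G u =
      ∫ ξ, m₂ ((2 * π) • ξ) * (chr ξ (-y) * multF m₁ (fun u => chr ξ u * G u) x) := by
  have hint : Integrable (fun u => ker m₁ (x - (u + y)) * G (u + y)) := by
    exact (((h₁.kint.comp_sub_left x).mul_bdd hG.meas.aestronglyMeasurable
      (.of_forall fun u => norm_le_supN hG.fin u))).comp_add_right y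
  have hflip := VectorFourier.integral_fourierIntegral_smul_eq_flip (e := Real.fourierChar)
    (μ := volume) (ν := volume) (L := -innerₗ (Rd d))
    (f := fun ξ : Rd d => m₂ ((2 * π) • ξ))
    (g := fun u => ker m₁ (x - (u + y)) * G (u + y))
    Real.continuous_fourierChar continuous_neg_innerₗ h₂.int_scaled hint
  rw [← integral_add_right_eq_self _ y]
  calc ∫ u, ker m₁ (x - (u + y)) * ker m₂ (u + y - y) * G (u + y)
      = ∫ u, ker m₂ u • (ker m₁ (x - (u + y)) * G (u + y)) := by
        congr 1 with u
        rw [add_sub_cancel_right, smul_eq_mul]; ring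
    _ = _ := hflip
    _ = _ := by
        congr 1 with ξ
        rw [smul_eq_mul]
        congr 1
        rw [multF_eq, ← integral_add_right_eq_self _ y, ← integral_const_mul,
          VectorFourier.fourierIntegral]
        congr 1 with u
        have : chr ξ u = chr ξ (-y) * chr ξ (u + y) := by rw [← chr_add]; congr 1; abel
        rw [Circle.smul_def, Real.fourierChar_apply, smul_eq_mul]
        have h3 : Complex.exp (((2 * π * -(-innerₗ (Rd d)).flip u ξ : ℝ) : ℂ) * I)
          = chr ξ u := by
          rw [chr]
          simp [real_inner_comm]
        rw [h3, this]
        ring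

/-- Frequencies add under multiplication. -/
lemma multF_mul_eq_zero {m₁ m₂ m₃ : Rd d → ℂ} (h₁ : L1Sym m₁) (h₂ : L1Sym m₂) (h₃ : L1Sym m₃)
    (hsupp : ∀ α β, m₂ α ≠ 0 → m₃ β ≠ 0 → m₁ (β + α) = 0) {f g : Rd d → ℂ} (hf : BM f)
    (hg : BM g) : multF m₁ (multF m₂ f * multF m₃ g) = 0 := by
  have hG := BM.multF h₃ hg
  set G := multF m₃ g with hGdef
  have hzero : ∀ x y, ∫ u, ker m₁ (x - u) * ker m₂ (u - y) * G u = 0 := by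
    intro x y
    rw [multF_ker_mul h₁ h₂ hG]
    refine integral_eq_zero_of_ae (.of_forall fun ξ => ?_)
    simp only [Pi.zero_apply]
    rw [multF_chr_mul, hGdef, multF_comp (h₁.shift ξ) h₃ hg]
    by_cases hξ : m₂ ((2 * π) • ξ) = 0
    · rw [hξ, zero_mul]
    · have : (fun ζ => m₁ (ζ + (2 * π) • ξ)) * m₃ = fun ζ => 0 * m₃ ζ := by
        ext β
        by_cases hβ : m₃ β = 0
        · simp [hβ]
        · simp [hsupp _ _ hξ hβ]
      rw [this, multF_const_mul_sym]
      simp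
  ext x
  have hI : Integrable (fun p : Rd d × Rd d =>
      ker m₁ (x - p.1) * ker m₂ (p.1 - p.2) * (G p.1 * f p.2)) := by
    refine (integrable_ker_comp h₁ h₂ x).mul_bdd (c := (supN G).toReal * (supN f).toReal)
      (((hG.meas.comp measurable_fst).mul
        (hf.meas.comp measurable_snd)).aestronglyMeasurable) (.of_forall fun p => ?_)
    rw [norm_mul]
    gcongr
    · exact norm_le_supN hG.fin _
    · exact norm_le_supN hf.fin _
  calc multF m₁ (multF m₂ f * G) x
      = ∫ u, ∫ y, ker m₁ (x - u) * ker m₂ (u - y) * (G u * f y) := by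
        rw [multF_eq]
        congr 1 with u
        rw [Pi.mul_apply, multF_eq, mul_comm _ (G u), ← mul_assoc, ← integral_const_mul]
        congr 1 with y
        ring
    _ = ∫ y, ∫ u, ker m₁ (x - u) * ker m₂ (u - y) * (G u * f y) := integral_integral_swap hI
    _ = ∫ y, 0 := by
        congr 1 with y
        have := hzero x y
        calc _ = ∫ u, ker m₁ (x - u) * ker m₂ (u - y) * G u * f y := by
              congr 1 with u; ring
          _ = 0 := by rw [integral_mul_const, this, zero_mul]
    _ = 0 := by simp

/-- The constant in the product estimate. -/
def mulC (ψ : Rd d → ℝ) : ℝ≥0∞ := symNorm (dyadicSym ψ 0) * (1 + symNorm (lowSym ψ 0))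

lemma mulC_lt_top {ψ : Rd d → ℝ} (hψ : IsCutoff ψ) : mulC ψ < ⊤ :=
  mul_lt_top (hψ.dyadic_smooth 0).l1.symNorm_lt_top
    (ENNReal.add_lt_top.2 ⟨ENNReal.one_lt_top, (hψ.low_smooth 0).l1.symNorm_lt_top⟩)

lemma supN_block_mul_le {ψ : Rd d → ℝ} (hψ : IsCutoff ψ) {f g : Rd d → ℂ} (hf : BM f) (hg : BM g)
    (j : ℤ) : supN (multF (dyadicSym ψ j) (f * g)) ≤
      mulC ψ * (tail ψ (j - 2) f * supN g + supN f * tail ψ (j - 2) g) := by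
  set J := j - 2 with hJ
  have hF := BM.multF (hψ.low_smooth J).l1 hf
  have hG := BM.multF (hψ.low_smooth J).l1 hg
  have hz : multF (dyadicSym ψ j) (multF (lowSym ψ J) f * multF (lowSym ψ J) g) = 0 := by
    refine multF_mul_eq_zero (hψ.dyadic_smooth j).l1 (hψ.low_smooth J).l1 (hψ.low_smooth J).l1
      (fun α β hα hβ => ?_) hf hg
    refine hψ.dyadic_eq_zero_of_le ?_
    have h1 : ‖α‖ < 4 / 3 * 2 ^ J := by
      by_contra! h; exact hα (hψ.low_eq_zero h)
    have h2 : ‖β‖ < 4 / 3 * 2 ^ J := by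
      by_contra! h; exact hβ (hψ.low_eq_zero h)
    have h3 : (2 : ℝ) ^ j = 4 * 2 ^ J := by
      rw [hJ, zpow_sub₀ two_ne_zero]; norm_num; ring
    rw [h3]
    have h4 : (0 : ℝ) < 2 ^ J := by positivity
    have := norm_add_le β α
    linarith
  have hfg : f * g = (f * g - multF (lowSym ψ J) f * multF (lowSym ψ J) g) +
    multF (lowSym ψ J) f * multF (lowSym ψ J) g := by abel
  have hsub : BM (f * g - multF (lowSym ψ J) f * multF (lowSym ψ J) g) := by
    have := (hf.mul hg).add ((hF.mul hG).const_mul (-1))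
    convert this using 1
    ext x
    simp
    ring
  rw [hfg, multF_add (hψ.dyadic_smooth j).l1 hsub (hF.mul hG), hz, add_zero]
  have hlow : supN (multF (lowSym ψ J) f) ≤ symNorm (lowSym ψ 0) * supN f := by
    rw [← symNorm_low ψ J]
    exact supN_multF_le (hψ.low_smooth J).l1.int f
  have hae : ∀ᵐ x, ‖(f * g - multF (lowSym ψ J) f * multF (lowSym ψ J) g) x‖ₑ ≤
      (1 + symNorm (lowSym ψ 0)) * (tail ψ J f * supN g + supN f * tail ψ J g) := by
    filter_upwards [ae_approx hψ hf J, ae_approx hψ hg J] with x h1 h2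
    have : (f * g - multF (lowSym ψ J) f * multF (lowSym ψ J) g) x =
        (f x - multF (lowSym ψ J) f x) * g x +
          multF (lowSym ψ J) f x * (g x - multF (lowSym ψ J) g x) := by
      simp only [Pi.sub_apply, Pi.mul_apply]; ring
    rw [this]
    calc _ ≤ ‖f x - multF (lowSym ψ J) f x‖ₑ * ‖g x‖ₑ +
          ‖multF (lowSym ψ J) f x‖ₑ * ‖g x - multF (lowSym ψ J) g x‖ₑ := by
          refine (enorm_add_le _ _).trans_eq ?_
          rw [enorm_mul, enorm_mul]
      _ ≤ tail ψ J f * supN g + (symNorm (lowSym ψ 0) * supN f) * tail ψ J g := by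
          gcongr
          · exact le_supN g x
          · exact (le_supN _ x).trans hlow
      _ ≤ _ := by
          rw [mul_add, ← mul_assoc _ (supN f)]
          refine add_le_add (le_mul_of_one_le_left zero_le le_self_add) ?_
          gcongr
          exact le_add_self
  refine (supN_multF_le_ae (hψ.dyadic_smooth j).l1.int hae).trans_eq ?_
  rw [symNorm_dyadic, mulC, mul_assoc]

/-! ## Functionals on Schwartz space -/

lemma norm_iteratedFDeriv_le_of_fourier (χ : 𝓢(Rd d, ℂ)) (n : ℕ) {M : ℝ}
    (hM : ∀ x, (1 + ‖x‖) ^ (n + (d + 1)) * ‖(𝓕 χ) x‖ ≤ M) (ξ : Rd d) :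
    ‖iteratedFDeriv ℝ n χ ξ‖ ≤
      (2 * π) ^ n * (∫ x : Rd d, (1 + ‖x‖) ^ (-((d : ℝ) + 1))) * M := by
  set X : 𝓢(Rd d, ℂ) := 𝓕 χ with hX
  have hχ : (χ : Rd d → ℂ) = 𝓕 (X : Rd d → ℂ) ∘ (LinearIsometryEquiv.neg ℝ : Rd d ≃ₗᵢ[ℝ] Rd d) := by
    ext y
    have : χ = 𝓕⁻ X := by simp [hX]
    conv_lhs => rw [this, SchwartzMap.fourierInv_coe, Real.fourierInv_eq_fourier_neg]
    rfl
  rw [hχ, LinearIsometryEquiv.norm_iteratedFDeriv_comp_right,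
    Real.iteratedFDeriv_fourier (N := ⊤) (fun k _ => X.integrable_pow_mul volume k)
      X.continuous.aestronglyMeasurable le_top]
  have hint : Integrable (fun x : Rd d => (1 + ‖x‖) ^ (-((d : ℝ) + 1))) :=
    integrable_one_add_norm (by simp)
  refine (VectorFourier.norm_fourierIntegral_le_integral_norm _ _ _ _ _).trans ?_
  rw [mul_assoc, ← integral_mul_const, ← integral_const_mul]
  refine integral_mono_of_nonneg (.of_forall fun _ => norm_nonneg _)
    ((hint.mul_const _).const_mul _) (.of_forall fun x => ?_)
  refine (VectorFourier.norm_fourierPowSMulRight_le _ _ _ _).trans ?_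
  have h1 : (2 * π * ‖innerSL ℝ (E := Rd d)‖) ^ n ≤ (2 * π) ^ n := by
    refine pow_le_pow_left₀ (by positivity) ?_ n
    exact mul_le_of_le_one_right (by positivity) (norm_innerSL_le ℝ)
  have h0 : (0 : ℝ) < 1 + ‖x‖ := by positivity
  have h2 : ‖x‖ ^ n * ‖X x‖ ≤ (1 + ‖x‖) ^ (-((d : ℝ) + 1)) * M := by
    have h3 : (1 + ‖x‖) ^ (-((d : ℝ) + 1)) = ((1 + ‖x‖) ^ (d + 1))⁻¹ := by
      rw [Real.rpow_neg h0.le]; norm_cast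
    rw [h3, ← div_eq_inv_mul, le_div_iff₀ (by positivity)]
    refine le_trans ?_ (hM x)
    rw [pow_add _ n]
    have : ‖x‖ ^ n ≤ (1 + ‖x‖) ^ n := by gcongr; linarith
    calc ‖x‖ ^ n * ‖X x‖ * (1 + ‖x‖) ^ (d + 1) ≤ (1 + ‖x‖) ^ n * ‖X x‖ * (1 + ‖x‖) ^ (d + 1) := by
          gcongr
      _ = _ := by ring
  rw [mul_assoc]
  exact mul_le_mul h1 h2 (by positivity) (by positivity)

/-- Pointwise product of Schwartz functions. -/
def smul𝓢 (ρ χ : 𝓢(Rd d, ℂ)) : 𝓢(Rd d, ℂ) := SchwartzMap.smulLeftCLM ℂ ρ χ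

lemma smul𝓢_apply (ρ χ : 𝓢(Rd d, ℂ)) (x : Rd d) : smul𝓢 ρ χ x = ρ x * χ x := by
  simp [smul𝓢, SchwartzMap.smulLeftCLM_apply_apply ρ.hasTemperateGrowth]

lemma exists_bound_of_continuous (L : 𝓢(Rd d, ℂ) →L[ℂ] ℂ) :
    ∃ (s : Finset (ℕ × ℕ)) (C : ℝ), 0 ≤ C ∧ ∀ χ : 𝓢(Rd d, ℂ), ∀ A : ℝ, 0 ≤ A →
      (∀ i ∈ s, SchwartzMap.seminorm ℝ i.1 i.2 χ ≤ A) → ‖L χ‖ ≤ C * A := by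
  obtain ⟨s, C, -, h⟩ := Seminorm.bound_of_continuous (schwartz_withSeminorms ℂ (Rd d) ℂ)
    ((normSeminorm ℂ ℂ).comp L.toLinearMap) (by
      change Continuous fun χ => ‖L χ‖
      exact L.continuous.norm)
  refine ⟨s, C, C.2, fun χ A hA hs => (h χ).trans ?_⟩
  rw [smul_apply, NNReal.smul_def, smul_eq_mul]
  refine mul_le_mul_of_nonneg_left (Seminorm.finset_sup_apply_le hA fun i hi => ?_) C.2
  exact hs i hi

lemma seminorm_smul𝓢_le (ρ χ : 𝓢(Rd d, ℂ)) (k n : ℕ) {A : ℝ} (hA : 0 ≤ A)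
    (h : ∀ i ≤ n, ∀ ξ, ‖iteratedFDeriv ℝ i χ ξ‖ ≤ A) :
    SchwartzMap.seminorm ℝ k n (smul𝓢 ρ χ) ≤
      (∑ i ∈ Finset.range (n + 1), (n.choose i) * SchwartzMap.seminorm ℝ k i ρ) * A := by
  refine SchwartzMap.seminorm_le_bound ℝ k n _ (by positivity) fun ξ => ?_
  have h1 : ((smul𝓢 ρ χ : 𝓢(Rd d, ℂ)) : Rd d → ℂ) = fun x => ρ x * χ x := by
    ext x; exact smul𝓢_apply ρ χ x
  rw [h1]
  refine (mul_le_mul_of_nonneg_left (norm_iteratedFDeriv_mul_le (N := ∞) (ρ.smooth ⊤)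
    (χ.smooth ⊤) ξ (by exact_mod_cast le_top)) (by positivity)).trans ?_
  rw [mul_sum, sum_mul]
  refine sum_le_sum fun i hi => ?_
  have h2 := SchwartzMap.le_seminorm ℝ k i ρ ξ
  have h3 := h (n - i) (Nat.sub_le _ _) ξ
  calc ‖ξ‖ ^ k * (n.choose i * ‖iteratedFDeriv ℝ i ρ ξ‖ * ‖iteratedFDeriv ℝ (n - i) χ ξ‖)
      = n.choose i * (‖ξ‖ ^ k * ‖iteratedFDeriv ℝ i ρ ξ‖) * ‖iteratedFDeriv ℝ (n - i) χ ξ‖ := by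
        ring
    _ ≤ n.choose i * SchwartzMap.seminorm ℝ k i ρ * A := by gcongr

/-- A localized functional is controlled by a weighted sup norm of the Fourier transform. -/
lemma exists_weighted_bound (L : 𝓢(Rd d, ℂ) →L[ℂ] ℂ) (ρ : 𝓢(Rd d, ℂ)) :
    ∃ (N : ℕ) (C : ℝ), 0 ≤ C ∧ ∀ χ : 𝓢(Rd d, ℂ), ∀ M : ℝ,
      (∀ x, (1 + ‖x‖) ^ N * ‖(𝓕 χ) x‖ ≤ M) → ‖L (smul𝓢 ρ χ)‖ ≤ C * M := by
  obtain ⟨s, C, hC, h⟩ := exists_bound_of_continuous L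
  set n₀ := s.sup Prod.snd with hn₀
  set I := ∫ x : Rd d, (1 + ‖x‖) ^ (-((d : ℝ) + 1)) with hI
  have hI0 : 0 ≤ I := integral_nonneg fun x => by positivity
  set B := ∑ j ∈ s, ∑ i ∈ Finset.range (j.2 + 1), ((j.2).choose i : ℝ) *
    SchwartzMap.seminorm ℝ j.1 i ρ with hB
  have hB0 : 0 ≤ B := sum_nonneg fun j _ => sum_nonneg fun i _ => by positivity
  refine ⟨n₀ + (d + 1), C * (B * ((2 * π) ^ n₀ * I)), by positivity, fun χ M hM => ?_⟩
  have hM0 : 0 ≤ M := le_trans (by positivity) (hM 0)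
  have hder : ∀ i ≤ n₀, ∀ ξ, ‖iteratedFDeriv ℝ i χ ξ‖ ≤ (2 * π) ^ n₀ * I * M := by
    intro i hi ξ
    refine (norm_iteratedFDeriv_le_of_fourier χ i (M := M) (fun x => le_trans ?_ (hM x)) ξ).trans ?_
    · gcongr
      linarith [norm_nonneg x]
    · gcongr
      have := Real.pi_gt_three
      linarith
  rw [mul_assoc, mul_assoc]
  refine h _ _ (by positivity) fun j hj => ?_
  refine (seminorm_smul𝓢_le ρ χ j.1 j.2 (A := (2 * π) ^ n₀ * I * M) (by positivity)
    fun i hi ξ => hder i (hi.trans (Finset.le_sup (f := Prod.snd) hj)) ξ).trans ?_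
  gcongr
  exact single_le_sum (f := fun j : ℕ × ℕ => ∑ i ∈ Finset.range (j.2 + 1),
    ((j.2).choose i : ℝ) * SchwartzMap.seminorm ℝ j.1 i ρ)
    (fun j _ => sum_nonneg fun i _ => by positivity) hj

/-- `ξ ↦ exp(2πi y·ξ) m(ξ)`, constructed by translating the Fourier transform of `m`. -/
def osc (m : 𝓢(Rd d, ℂ)) (y : Rd d) : 𝓢(Rd d, ℂ) := 𝓕⁻ (SchwartzMap.compSubConstCLM ℂ y (𝓕 m))

lemma fourier_osc (m : 𝓢(Rd d, ℂ)) (y x : Rd d) : (𝓕 (osc m y)) x = (𝓕 m) (x - y) := by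
  simp [osc]

lemma osc_apply (m : 𝓢(Rd d, ℂ)) (y ξ : Rd d) : osc m y ξ = chr y ξ * m ξ := by
  have h1 : m = 𝓕⁻ (𝓕 m) := by simp
  conv_rhs => rw [h1]
  rw [osc, SchwartzMap.fourierInv_coe, SchwartzMap.fourierInv_coe, Real.fourierInv_eq',
    Real.fourierInv_eq', ← integral_add_right_eq_self _ y, ← integral_const_mul]
  congr 1 with v
  simp only [SchwartzMap.compSubConstCLM_apply, add_sub_cancel_right, smul_eq_mul]
  rw [← mul_assoc, chr, ← Complex.exp_add, inner_add_left, real_inner_comm y ξ]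
  congr 2
  push_cast
  ring

lemma fourier_smul_fourierInv (m k : 𝓢(Rd d, ℂ)) (x : Rd d) :
    (𝓕 (smul𝓢 m (𝓕⁻ k))) x = ∫ y, k y * (𝓕 m) (x - y) := by
  have hflip := VectorFourier.integral_fourierIntegral_smul_eq_flip (e := Real.fourierChar)
    (μ := volume) (ν := volume) (L := -innerₗ (Rd d))
    (f := fun y => k y) (g := fun ξ => osc m (-x) ξ)
    Real.continuous_fourierChar continuous_neg_innerₗ k.integrable (osc m (-x)).integrable
  have h1 : ∀ y, VectorFourier.fourierIntegral Real.fourierChar volume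
      (-innerₗ (Rd d)).flip (fun ξ => osc m (-x) ξ) y = (𝓕 m) (x - y) := by
    intro y
    rw [SchwartzMap.fourier_coe, Real.fourier_eq', VectorFourier.fourierIntegral]
    congr 1 with ξ
    rw [Circle.smul_def, Real.fourierChar_apply, osc_apply, smul_eq_mul, smul_eq_mul, ← mul_assoc,
      chr, ← Complex.exp_add]
    congr 2
    simp [inner_sub_right, real_inner_comm]
    ring
  simp only [h1, smul_eq_mul] at hflip
  rw [← hflip, SchwartzMap.fourier_coe, Real.fourier_eq']
  congr 1 with ξ
  rw [smul𝓢_apply, osc_apply, chr, smul_eq_mul]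
  have h2 : VectorFourier.fourierIntegral Real.fourierChar volume (-innerₗ (Rd d))
      (fun y => k y) ξ = (𝓕⁻ k) ξ := by
    rw [SchwartzMap.fourierInv_coe]; rfl
  rw [h2, inner_neg_right]
  have h3 : (((2 * π * -inner ℝ ξ x : ℝ) : ℂ) * I) =
      ((-2 * π * inner ℝ ξ x : ℝ) : ℂ) * I := by
    push_cast
    ring
  rw [h3]
  ring

/-! ## The exchange of a functional and an integral over oscillations -/

/-- A polynomial weight. -/
def wt (N : ℕ) (x : Rd d) : ℝ := (1 + ‖x‖ ^ 2) ^ N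

lemma one_le_wt (N : ℕ) (x : Rd d) : 1 ≤ wt N x := one_le_pow₀ (by linarith [sq_nonneg ‖x‖])

lemma wt_pos (N : ℕ) (x : Rd d) : 0 < wt N x := zero_lt_one.trans_le (one_le_wt N x)

lemma wt_add_le (N : ℕ) (x y : Rd d) : wt N (x + y) ≤ 2 ^ N * wt N x * wt N y := by
  simp only [wt, ← mul_pow]
  gcongr
  have := norm_add_le x y
  nlinarith [norm_nonneg (x + y), norm_nonneg x, norm_nonneg y, sq_nonneg (‖x‖ - ‖y‖),
    mul_nonneg (sq_nonneg ‖x‖) (sq_nonneg ‖y‖), sq_nonneg ‖x‖]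

lemma pow_le_wt (N : ℕ) (x : Rd d) : (1 + ‖x‖) ^ N ≤ 2 ^ N * wt N x := by
  rw [wt, ← mul_pow]
  gcongr
  nlinarith [sq_nonneg (‖x‖ - 1 / 2)]

lemma wt_le_pow (N : ℕ) (x : Rd d) : wt N x ≤ (1 + ‖x‖) ^ (2 * N) := by
  rw [wt, pow_mul]
  gcongr
  nlinarith [norm_nonneg x]

lemma wt_temperate (N : ℕ) : (fun x : Rd d => (wt N x : ℂ)).HasTemperateGrowth := by
  have h : (fun x : Rd d => wt N x).HasTemperateGrowth :=
    ((Function.HasTemperateGrowth.const (1 : ℝ)).add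
      (Function.hasTemperateGrowth_norm_sq (Rd d))).pow N
  exact Function.Complex.hasTemperateGrowth_ofReal.comp h

/-- `χ ↦ (1+|x|²)^N 𝓕χ`, with values in the bounded continuous functions. -/
def wtFourier (N : ℕ) : 𝓢(Rd d, ℂ) →L[ℂ] BoundedContinuousFunction (Rd d) ℂ :=
  (SchwartzMap.toBoundedContinuousFunctionCLM ℂ (Rd d) ℂ).comp
    ((SchwartzMap.smulLeftCLM ℂ (fun x : Rd d => (wt N x : ℂ))).comp
      (FourierTransform.fourierCLM ℂ 𝓢(Rd d, ℂ)))

lemma wtFourier_apply (N : ℕ) (χ : 𝓢(Rd d, ℂ)) (x : Rd d) :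
    wtFourier N χ x = wt N x * (𝓕 χ) x := by
  simp [wtFourier, SchwartzMap.smulLeftCLM_apply_apply (wt_temperate N)]

lemma wtFourier_injective (N : ℕ) : Function.Injective (wtFourier N : 𝓢(Rd d, ℂ) → _) := by
  intro χ χ' h
  have : (𝓕 χ : 𝓢(Rd d, ℂ)) = 𝓕 χ' := by
    ext x
    have := DFunLike.congr_fun h x
    rw [wtFourier_apply, wtFourier_apply] at this
    exact mul_left_cancel₀ (by exact_mod_cast (wt_pos N x).ne') this
  simpa using congrArg (fun X : 𝓢(Rd d, ℂ) => (𝓕⁻ X : 𝓢(Rd d, ℂ))) this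

lemma exists_extension_wtFourier (L : 𝓢(Rd d, ℂ) →L[ℂ] ℂ) (ρ : 𝓢(Rd d, ℂ)) :
    ∃ (N : ℕ) (Λ : BoundedContinuousFunction (Rd d) ℂ →L[ℂ] ℂ),
      ∀ χ, L (smul𝓢 ρ χ) = Λ (wtFourier N χ) := by
  obtain ⟨N, C, hC, h⟩ := exists_weighted_bound L ρ
  have hinj : Function.Injective (wtFourier N : 𝓢(Rd d, ℂ) →L[ℂ] _).toLinearMap :=
    wtFourier_injective N
  let e := LinearEquiv.ofInjective _ hinj
  let f₀ : LinearMap.range (wtFourier N : 𝓢(Rd d, ℂ) →L[ℂ] _).toLinearMap →ₗ[ℂ] ℂ :=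
    (L.comp (SchwartzMap.smulLeftCLM ℂ ρ)).toLinearMap.comp e.symm.toLinearMap
  have hf₀ : ∀ χ, f₀ (e χ) = L (smul𝓢 ρ χ) := by
    intro χ
    simp [f₀, smul𝓢]
  have hbound : ∀ v, ‖f₀ v‖ ≤ (C * 2 ^ N) * ‖v‖ := by
    intro v
    obtain ⟨χ, rfl⟩ := e.surjective v
    rw [hf₀, mul_assoc]
    refine h χ _ fun x => ?_
    have h1 : ‖wtFourier N χ x‖ ≤ ‖wtFourier N χ‖ := BoundedContinuousFunction.norm_coe_le_norm _ x
    have h2 : ‖e χ‖ = ‖wtFourier N χ‖ := rfl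
    rw [h2]
    rw [wtFourier_apply, norm_mul, norm_real, norm_of_nonneg (wt_pos N x).le] at h1
    calc (1 + ‖x‖) ^ N * ‖(𝓕 χ) x‖ ≤ 2 ^ N * wt N x * ‖(𝓕 χ) x‖ := by
          gcongr; exact pow_le_wt N x
      _ ≤ _ := by rw [mul_assoc]; gcongr
  obtain ⟨Λ, hΛ, -⟩ := exists_extension_norm_eq _ (f₀.mkContinuous _ hbound)
  refine ⟨N, Λ, fun χ => ?_⟩
  rw [← hf₀]
  exact (hΛ (e χ)).symm

lemma exists_wt_bound (K : 𝓢(Rd d, ℂ)) (N n : ℕ) :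
    ∃ A : ℝ, 0 ≤ A ∧ ∀ x, wt N x * ‖iteratedFDeriv ℝ n K x‖ ≤ A := by
  refine ⟨2 ^ (2 * N) * ((Finset.Iic (2 * N, n)).sup fun m => SchwartzMap.seminorm ℝ m.1 m.2) K,
    by positivity, fun x => ?_⟩
  refine le_trans ?_ (SchwartzMap.one_add_le_sup_seminorm_apply (𝕜 := ℝ) (m := (2 * N, n)) le_rfl
    le_rfl K x)
  gcongr
  exact wt_le_pow N x

lemma continuous_wtFourier_osc (N : ℕ) (m : 𝓢(Rd d, ℂ)) :
    Continuous fun y => wtFourier N (osc m y) := by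
  set K : 𝓢(Rd d, ℂ) := 𝓕 m with hK
  obtain ⟨A, hA, hA'⟩ := exists_wt_bound K N 1
  rw [continuous_iff_continuousAt]
  intro y₀
  set R := ‖y₀‖ + 1 with hR
  set B := 2 ^ N * A * (1 + R ^ 2) ^ N with hB
  have hB0 : 0 ≤ B := by positivity
  have hlip : ∀ y ∈ Metric.closedBall (0 : Rd d) R, ∀ y' ∈ Metric.closedBall (0 : Rd d) R,
      ‖wtFourier N (osc m y) - wtFourier N (osc m y')‖ ≤ B * ‖y - y'‖ := by
    intro y hy y' hy'
    rw [BoundedContinuousFunction.norm_le (by positivity)]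
    intro x
    rw [BoundedContinuousFunction.sub_apply, wtFourier_apply, wtFourier_apply, fourier_osc,
      fourier_osc, ← mul_sub, norm_mul, norm_real, norm_of_nonneg (wt_pos N x).le]
    have hmv := (convex_closedBall x R).norm_image_sub_le_of_norm_fderiv_le (f := K) (𝕜 := ℝ)
      (C := B / wt N x) (fun v _ => K.differentiableAt) (fun v hv => ?_)
      (x := x - y') (y := x - y) (by simpa using hy') (by simpa using hy)
    · calc wt N x * ‖K (x - y) - K (x - y')‖ ≤ wt N x * (B / wt N x * ‖x - y - (x - y')‖) := by
            gcongr; exact (wt_pos N x).le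
        _ = B * ‖y - y'‖ := by
            rw [← mul_assoc, mul_div_cancel₀ _ (wt_pos N x).ne', sub_sub_sub_cancel_left,
              norm_sub_rev]
    · rw [le_div_iff₀ (wt_pos N x)]
      have h1 := hA' v
      rw [norm_iteratedFDeriv_one] at h1
      have h2 := wt_add_le N v (x - v)
      rw [add_sub_cancel] at h2
      have h3 : wt N (x - v) ≤ (1 + R ^ 2) ^ N := by
        unfold wt
        rw [mem_closedBall_iff_norm, norm_sub_rev] at hv
        gcongr
      calc ‖fderiv ℝ K v‖ * wt N x ≤ ‖fderiv ℝ K v‖ * (2 ^ N * wt N v * wt N (x - v)) := by gcongr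
        _ = 2 ^ N * (wt N v * ‖fderiv ℝ K v‖) * wt N (x - v) := by ring
        _ ≤ B := by
            rw [hB]
            gcongr
            exact (wt_pos N _).le
  have h1 : ∀ᶠ y in 𝓝 y₀, ‖wtFourier N (osc m y) - wtFourier N (osc m y₀)‖ ≤ B * ‖y - y₀‖ := by
    filter_upwards [Metric.closedBall_mem_nhds y₀ one_pos] with y hy
    refine hlip y ?_ y₀ ?_
    · rw [mem_closedBall_iff_norm] at hy
      rw [mem_closedBall_zero_iff]
      have := norm_le_norm_add_norm_sub' y y₀
      linarith
    · rw [mem_closedBall_zero_iff]; linarith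
  rw [ContinuousAt, tendsto_iff_norm_sub_tendsto_zero]
  refine squeeze_zero' (.of_forall fun _ => norm_nonneg _) h1 ?_
  have : Tendsto (fun y => B * ‖y - y₀‖) (𝓝 y₀) (𝓝 (B * ‖y₀ - y₀‖)) :=
    Continuous.tendsto (by fun_prop) _
  simpa using this

lemma exists_norm_wtFourier_osc_le (N : ℕ) (m : 𝓢(Rd d, ℂ)) :
    ∃ A : ℝ, 0 ≤ A ∧ ∀ y, ‖wtFourier N (osc m y)‖ ≤ A * wt N y := by
  obtain ⟨A, hA, hA'⟩ := exists_wt_bound (𝓕 m) N 0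
  refine ⟨2 ^ N * A, by positivity, fun y => ?_⟩
  have := wt_pos N y
  rw [BoundedContinuousFunction.norm_le (by positivity)]
  intro x
  rw [wtFourier_apply, fourier_osc, norm_mul, norm_real,
    norm_of_nonneg (wt_pos N x).le]
  have h1 := hA' (x - y)
  rw [norm_iteratedFDeriv_zero] at h1
  have h2 := wt_add_le N (x - y) y
  rw [sub_add_cancel] at h2
  calc wt N x * ‖(𝓕 m) (x - y)‖ ≤ 2 ^ N * wt N (x - y) * wt N y * ‖(𝓕 m) (x - y)‖ := by gcongr
    _ = 2 ^ N * (wt N (x - y) * ‖(𝓕 m) (x - y)‖) * wt N y := by ring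
    _ ≤ _ := by gcongr

lemma integrable_wt_mul (N : ℕ) (k : 𝓢(Rd d, ℂ)) : Integrable fun y => wt N y * ‖k y‖ := by
  have := (SchwartzMap.smulLeftCLM ℂ (fun x : Rd d => (wt N x : ℂ)) k).integrable (μ := volume)
  refine this.norm.congr (.of_forall fun y => ?_)
  simp only
  rw [SchwartzMap.smulLeftCLM_apply_apply (wt_temperate N), smul_eq_mul, norm_mul,
    norm_real, norm_of_nonneg (wt_pos N y).le]

/-- `⟨L, m·𝓕⁻k⟩ = ∫ k(y) ⟨L, exp(2πi y·ξ) m⟩ dy` for localized `m`. -/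
lemma exchange (L : 𝓢(Rd d, ℂ) →L[ℂ] ℂ) {ρ m : 𝓢(Rd d, ℂ)} (hρ : ∀ ξ, ρ ξ * m ξ = m ξ)
    (k : 𝓢(Rd d, ℂ)) : L (smul𝓢 m (𝓕⁻ k)) = ∫ y, k y * L (osc m y) := by
  obtain ⟨N, Λ, hΛ⟩ := exists_extension_wtFourier L ρ
  have h1 : ∀ χ : 𝓢(Rd d, ℂ), smul𝓢 ρ (smul𝓢 m χ) = smul𝓢 m χ := by
    intro χ; ext ξ; rw [smul𝓢_apply, smul𝓢_apply, ← mul_assoc, hρ]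
  have h2 : ∀ y, smul𝓢 ρ (osc m y) = osc m y := by
    intro y; ext ξ; rw [smul𝓢_apply, osc_apply, mul_left_comm, hρ]
  obtain ⟨A, hA, hA'⟩ := exists_norm_wtFourier_osc_le N m
  have hint : Integrable fun y => k y • wtFourier N (osc m y) := by
    refine Integrable.mono' ((integrable_wt_mul N k).const_mul A)
      (k.continuous.smul (continuous_wtFourier_osc N m)).aestronglyMeasurable
      (.of_forall fun y => ?_)
    rw [norm_smul]
    calc ‖k y‖ * ‖wtFourier N (osc m y)‖ ≤ ‖k y‖ * (A * wt N y) := by gcongr; exact hA' y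
      _ = _ := by ring
  have key : wtFourier N (smul𝓢 m (𝓕⁻ k)) = ∫ y, k y • wtFourier N (osc m y) := by
    ext x
    have := (BoundedContinuousFunction.evalCLM ℂ x).integral_comp_comm hint
    simp only [BoundedContinuousFunction.evalCLM_apply] at this
    rw [← this, wtFourier_apply, fourier_smul_fourierInv, ← integral_const_mul]
    congr 1 with y
    rw [BoundedContinuousFunction.smul_apply, wtFourier_apply, fourier_osc, smul_eq_mul]
    ring
  rw [← h1, hΛ, key, ← Λ.integral_comp_comm hint]
  congr 1 with y
  rw [map_smul, ← hΛ, h2, smul_eq_mul]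

/-! ## Blocks of a class modulo polynomials -/

/-- The functional `χ ↦ ⟨T, 𝓕χ⟩`. -/
def hatF (T : 𝓢'(Rd d, ℂ)) : 𝓢(Rd d, ℂ) →L[ℂ] ℂ where
  toFun χ := T (𝓕 χ)
  map_add' a b := by rw [FourierTransform.fourier_add, map_add]
  map_smul' a b := by rw [FourierTransform.fourier_smul, map_smul]; rfl
  cont := T.continuous.comp (FourierTransform.fourierCLM ℂ 𝓢(Rd d, ℂ)).continuous

lemma hatF_apply (T : 𝓢'(Rd d, ℂ)) (χ : 𝓢(Rd d, ℂ)) : hatF T χ = T (𝓕 χ) := rfl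

lemma SmoothSym.ker_eq_fourier {m : Rd d → ℂ} (h : SmoothSym m) (x y : Rd d) :
    ker m (x - y) = (𝓕 (osc h.scaled x)) y := by
  rw [fourier_osc, h.ker_eq, SchwartzMap.fourierInv_coe, Real.fourierInv_eq_fourier_neg, neg_sub,
    SchwartzMap.fourier_coe]

lemma multC_mk (T : 𝓢'(Rd d, ℂ)) {m : Rd d → ℂ} (h : SmoothSym m)
    (h0 : ∀ᶠ ζ in 𝓝 0, m ζ = 0) (x : Rd d) :
    multC m (Submodule.Quotient.mk T) x = hatF T (osc h.scaled x) := by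
  have hfun : (fun ξ : Rd d => Complex.exp (2 * π * I * (inner ℝ x ξ : ℝ)) *
      m ((2 * π) • ξ)) = ⇑(osc h.scaled x) := by
    ext ξ
    rw [osc_apply, chr, h.scaled_apply, real_inner_comm x ξ]
    congr 2
    push_cast
    ring
  have hc : HasCompactSupport (fun ξ : Rd d => Complex.exp (2 * π * I *
      (inner ℝ x ξ : ℝ)) * m ((2 * π) • ξ)) :=
    (hasCompactSupport_scaled h.cpt).mul_left
  have hs : ContDiff ℝ ∞ (fun ξ : Rd d => Complex.exp (2 * π * I *
      (inner ℝ x ξ : ℝ)) * m ((2 * π) • ξ)) := by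
    rw [hfun]; exact (osc h.scaled x).smooth ⊤
  have h0' : (0 : Rd d) ∉ tsupport (fun ξ : Rd d => Complex.exp (2 * π * I *
      (inner ℝ x ξ : ℝ)) * m ((2 * π) • ξ)) := by
    rw [notMem_tsupport_iff_eventuallyEq]
    have ht : Tendsto (fun ξ : Rd d => (2 * π) • ξ) (𝓝 0) (𝓝 0) := by
      have : Continuous (fun ξ : Rd d => (2 * π) • ξ) := by fun_prop
      simpa using this.tendsto 0
    filter_upwards [ht.eventually h0] with ξ hξ
    simp [hξ]
  rw [multC, pairHat, dif_pos ⟨⟨hc, hs⟩, h0'⟩]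
  change evalAt _ T = _
  change T _ = T _
  congr 2
  ext ξ
  exact congrFun hfun ξ

lemma SmoothSym.exists_one {m : Rd d → ℂ} (h : SmoothSym m) :
    ∃ ρ : 𝓢(Rd d, ℂ), ∀ ξ, ρ ξ * h.scaled ξ = h.scaled ξ := by
  obtain ⟨ψ, hψ⟩ := exists_isCutoff d
  obtain ⟨R, hR⟩ := h.cpt.isCompact.isBounded.exists_norm_le
  obtain ⟨n, hn⟩ := pow_unbounded_of_one_lt (4 / 3 * R) (one_lt_two (α := ℝ))
  refine ⟨(hψ.low_smooth n).scaled, fun ξ => ?_⟩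
  rw [SmoothSym.scaled_apply, SmoothSym.scaled_apply]
  by_cases hm : m ((2 * π) • ξ) = 0
  · rw [hm, mul_zero]
  · rw [hψ.low_eq_one, one_mul]
    have := hR _ (subset_tsupport _ hm)
    rw [zpow_natCast]
    linarith

lemma multC_mul {m₁ m₂ : Rd d → ℂ} (h₁ : SmoothSym m₁) (h₂ : SmoothSym m₂)
    (h0 : ∀ᶠ ζ in 𝓝 0, m₂ ζ = 0) (u : TempModPoly d) :
    multC (m₁ * m₂) u = multF m₁ (multC m₂ u) := by
  obtain ⟨T, rfl⟩ := Submodule.Quotient.mk_surjective _ u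
  ext x
  have h0' : ∀ᶠ ζ in 𝓝 0, (m₁ * m₂) ζ = 0 := by
    filter_upwards [h0] with ζ hζ
    simp [hζ]
  obtain ⟨ρ, hρ⟩ := h₂.exists_one
  rw [multC_mk T (h₁.mul h₂) h0', multF_eq]
  have := exchange (hatF T) hρ (𝓕 (osc h₁.scaled x))
  simp only [FourierTransform.fourierInv_fourier_eq] at this
  have he : osc (h₁.mul h₂).scaled x = smul𝓢 h₂.scaled (osc h₁.scaled x) := by
    ext ξ
    simp only [smul𝓢_apply, osc_apply, SmoothSym.scaled_apply, Pi.mul_apply]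
    ring
  rw [he, this]
  congr 1 with y
  rw [multC_mk T h₂ h0, h₁.ker_eq_fourier]

lemma continuous_multC {m : Rd d → ℂ} (h : SmoothSym m) (h0 : ∀ᶠ ζ in 𝓝 0, m ζ = 0)
    (u : TempModPoly d) : Continuous (multC m u) := by
  obtain ⟨T, rfl⟩ := Submodule.Quotient.mk_surjective _ u
  obtain ⟨ρ, hρ⟩ := h.exists_one
  obtain ⟨N, Λ, hΛ⟩ := exists_extension_wtFourier (hatF T) ρ
  have : multC m (Submodule.Quotient.mk T) = fun x => Λ (wtFourier N (osc h.scaled x)) := by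
    ext x
    rw [multC_mk T h h0, ← hΛ]
    congr 1
    ext ξ
    rw [smul𝓢_apply, osc_apply, mul_left_comm, hρ]
  rw [this]
  exact Λ.continuous.comp (continuous_wtFourier_osc N _)

/-! ### A class with vanishing blocks vanishes -/

lemma norm_iteratedFDeriv_comp_smul_le {f : Rd d → ℂ} (hf : ContDiff ℝ ∞ f) (i : ℕ) {l : ℝ}
    (hl : 0 ≤ l) (ξ : Rd d) :
    ‖iteratedFDeriv ℝ i (fun x => f (l • x)) ξ‖ ≤ ‖iteratedFDeriv ℝ i f (l • ξ)‖ * l ^ i := by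
  have := (l • ContinuousLinearMap.id ℝ (Rd d)).iteratedFDeriv_comp_right hf ξ (i := i)
    (by exact_mod_cast le_top)
  have h2 : f ∘ (l • ContinuousLinearMap.id ℝ (Rd d)) = fun x => f (l • x) := by
    ext x; simp
  rw [h2] at this
  rw [this]
  refine (ContinuousMultilinearMap.norm_compContinuousLinearMap_le _ _).trans ?_
  rw [Finset.prod_const, Finset.card_univ, Fintype.card_fin]
  have h3 : ‖l • ContinuousLinearMap.id ℝ (Rd d)‖ ≤ l := by
    rw [norm_smul, norm_of_nonneg hl]
    exact mul_le_of_le_one_right hl ContinuousLinearMap.norm_id_le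
  have h4 : (l • ContinuousLinearMap.id ℝ (Rd d)) ξ = l • ξ := by simp
  rw [h4]
  gcongr

section vanishing

variable {ψ : Rd d → ℝ} (hψ : IsCutoff ψ)

/-- The low-frequency cut-off as a Schwartz function. -/
def lowS (J : ℤ) : 𝓢(Rd d, ℂ) := (hψ.low_smooth J).scaled

lemma lowS_apply (J : ℤ) (ξ : Rd d) : lowS hψ J ξ = lowSym ψ J ((2 * π) • ξ) := rfl

lemma lowS_scale (J : ℤ) (ξ : Rd d) : lowS hψ J ξ = lowS hψ 0 ((2 : ℝ) ^ (-J) • ξ) := by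
  rw [lowS_apply, lowS_apply, lowSym_scale, smul_comm]

lemma exists_bound_iteratedFDeriv (χ : 𝓢(Rd d, ℂ)) (n : ℕ) :
    ∃ B : ℝ, 0 ≤ B ∧ ∀ ξ, ‖iteratedFDeriv ℝ n χ ξ‖ ≤ B :=
  ⟨_, by positivity, χ.norm_iteratedFDeriv_le_seminorm ℝ n⟩

/-- `χ - ψ(2^{-n}·)χ` tends to zero in the Schwartz space. -/
lemma seminorm_sub_lowS_le (χ : 𝓢(Rd d, ℂ)) (k n : ℕ) : ∃ C : ℝ, 0 ≤ C ∧ ∀ N : ℕ,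
    SchwartzMap.seminorm ℝ k n (χ - smul𝓢 (lowS hψ N) χ) ≤ C * (1 / 2) ^ N := by
  choose B hB0 hB using exists_bound_iteratedFDeriv (lowS hψ 0)
  set C := ∑ i ∈ Finset.range (n + 1), (n.choose i : ℝ) * (1 + B i) *
    (16 * SchwartzMap.seminorm ℝ (k + 1) (n - i) χ) with hC
  have hC0 : 0 ≤ C := sum_nonneg fun i _ => by have := hB0 i; positivity
  refine ⟨C, hC0, fun N => ?_⟩
  set s : ℝ := (1 / 2) ^ N with hs
  have hs0 : 0 < s := by positivity
  have hs1 : s ≤ 1 := pow_le_one₀ (by norm_num) (by norm_num)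
  have hs' : (2 : ℝ) ^ (-(N : ℤ)) = s := two_zpow_le_of_nonneg N
  have hfun : ((χ - smul𝓢 (lowS hψ N) χ : 𝓢(Rd d, ℂ)) : Rd d → ℂ) =
      fun ξ => (1 - lowS hψ 0 (s • ξ)) * χ ξ := by
    ext ξ
    rw [sub_apply, smul𝓢_apply, lowS_scale hψ N, hs']
    ring
  refine SchwartzMap.seminorm_le_bound ℝ k n _ (by positivity) fun ξ => ?_
  rw [hfun]
  have hcd : ContDiff ℝ ∞ (fun ξ : Rd d => lowS hψ 0 (s • ξ)) :=
    ((lowS hψ 0).smooth ⊤).comp (by fun_prop)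
  rcases lt_or_ge (s * ‖ξ‖) (1 / 16) with hlt | hge
  · have hev : (fun ξ => (1 - lowS hψ 0 (s • ξ)) * χ ξ) =ᶠ[𝓝 ξ] fun _ => 0 := by
      have : ∀ᶠ y in 𝓝 ξ, s * ‖y‖ < 1 / 16 :=
        (by fun_prop : Continuous fun y : Rd d => s * ‖y‖).continuousAt.eventually_lt_const hlt
      filter_upwards [this] with y hy
      rw [lowS_apply, hψ.low_eq_one, sub_self, zero_mul]
      rw [norm_smul, norm_smul, norm_of_nonneg (by positivity : (0 : ℝ) ≤ 2 * π),
        norm_of_nonneg hs0.le, zpow_zero]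
      nlinarith [Real.pi_lt_four, Real.pi_pos]
    rw [(hev.iteratedFDeriv ℝ n).eq_of_nhds]
    have : iteratedFDeriv ℝ n (fun _ : Rd d => (0 : ℂ)) ξ = 0 := by
      simp
    rw [this, norm_zero, mul_zero]
    positivity
  · refine (mul_le_mul_of_nonneg_left (norm_iteratedFDeriv_mul_le (N := ∞)
      (contDiff_const.sub hcd) (χ.smooth ⊤) ξ (by exact_mod_cast le_top)) (by positivity)).trans ?_
    rw [mul_sum, hC, sum_mul]
    refine sum_le_sum fun i hi => ?_
    have h1 : ‖iteratedFDeriv ℝ i (fun ξ : Rd d => 1 - lowS hψ 0 (s • ξ)) ξ‖ ≤ 1 + B i := by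
      have h2 : ‖iteratedFDeriv ℝ i (fun ξ : Rd d => lowS hψ 0 (s • ξ)) ξ‖ ≤ B i := by
        refine (norm_iteratedFDeriv_comp_smul_le ((lowS hψ 0).smooth ⊤) i hs0.le ξ).trans ?_
        calc _ ≤ B i * 1 := by
              exact mul_le_mul (hB i _) (pow_le_one₀ hs0.le hs1) (by positivity) (hB0 i)
          _ = B i := mul_one _
      have h3 : (fun ξ : Rd d => 1 - lowS hψ 0 (s • ξ)) =
        (fun _ => (1 : ℂ)) - fun ξ : Rd d => lowS hψ 0 (s • ξ) := rfl
      rw [h3, iteratedFDeriv_sub_apply contDiff_const.contDiffAt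
        (hcd.of_le (by exact_mod_cast le_top)).contDiffAt]
      refine (norm_sub_le _ _).trans (add_le_add ?_ h2)
      rcases Nat.eq_zero_or_pos i with rfl | hi
      · simp
      · rw [iteratedFDeriv_const_of_ne hi.ne']; simp
    have h4 := SchwartzMap.le_seminorm ℝ (k + 1) (n - i) χ ξ
    have h5 : ‖ξ‖ ^ k * ‖iteratedFDeriv ℝ (n - i) χ ξ‖ ≤
        16 * SchwartzMap.seminorm ℝ (k + 1) (n - i) χ * s := by
      calc ‖ξ‖ ^ k * ‖iteratedFDeriv ℝ (n - i) χ ξ‖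
          ≤ (16 * (s * ‖ξ‖)) * (‖ξ‖ ^ k * ‖iteratedFDeriv ℝ (n - i) χ ξ‖) :=
            le_mul_of_one_le_left (by positivity) (by linarith)
        _ = 16 * (‖ξ‖ ^ (k + 1) * ‖iteratedFDeriv ℝ (n - i) χ ξ‖) * s := by ring
        _ ≤ _ := by gcongr
    have hBi := hB0 i
    calc ‖ξ‖ ^ k * (n.choose i * ‖iteratedFDeriv ℝ i (fun ξ : Rd d => 1 - lowS hψ 0 (s • ξ)) ξ‖ *
          ‖iteratedFDeriv ℝ (n - i) χ ξ‖)
        = n.choose i * ‖iteratedFDeriv ℝ i (fun ξ : Rd d => 1 - lowS hψ 0 (s • ξ)) ξ‖ *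
          (‖ξ‖ ^ k * ‖iteratedFDeriv ℝ (n - i) χ ξ‖) := by ring
      _ ≤ n.choose i * (1 + B i) * (16 * SchwartzMap.seminorm ℝ (k + 1) (n - i) χ * s) := by
          gcongr
      _ = _ := by ring

lemma tendsto_apply_lowS (L : 𝓢(Rd d, ℂ) →L[ℂ] ℂ) (χ : 𝓢(Rd d, ℂ)) :
    Tendsto (fun N : ℕ => L (smul𝓢 (lowS hψ N) χ)) atTop (𝓝 (L χ)) := by
  obtain ⟨s, C, hC, h⟩ := exists_bound_of_continuous L
  choose B hB0 hB using fun i : ℕ × ℕ => seminorm_sub_lowS_le hψ χ i.1 i.2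
  have hb : ∀ N : ℕ, ‖L (smul𝓢 (lowS hψ N) χ) - L χ‖ ≤ C * ((∑ i ∈ s, B i) * (1 / 2) ^ N) := by
    intro N
    rw [norm_sub_rev, ← map_sub]
    have hsum : 0 ≤ ∑ i ∈ s, B i := sum_nonneg fun i _ => hB0 i
    refine h _ _ (by positivity) fun i hi => (hB i N).trans ?_
    gcongr
    exact single_le_sum (fun i _ => hB0 i) hi
  rw [tendsto_iff_norm_sub_tendsto_zero]
  refine squeeze_zero (fun _ => norm_nonneg _) hb ?_
  simpa using ((tendsto_pow_atTop_nhds_zero_of_lt_one (r := (1 / 2 : ℝ)) (by norm_num)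
    (by norm_num)).const_mul (∑ i ∈ s, B i)).const_mul C

/-- Multiplication of `χ` by `(y·ξ)^N` and the low-frequency cut-off. -/
def monoLow (y : Rd d) (N : ℕ) (χ : 𝓢(Rd d, ℂ)) : 𝓢(Rd d, ℂ) :=
  SchwartzMap.smulLeftCLM ℂ (fun ξ : Rd d => ((inner ℝ y ξ ^ N : ℝ) : ℂ)) χ

lemma monoLow_apply (y : Rd d) (N : ℕ) (χ : 𝓢(Rd d, ℂ)) (ξ : Rd d) :
    monoLow y N χ ξ = (inner ℝ y ξ : ℂ) ^ N * χ ξ := by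
  rw [monoLow, SchwartzMap.smulLeftCLM_apply_apply, smul_eq_mul]
  · push_cast; rfl
  · refine Function.Complex.hasTemperateGrowth_ofReal.comp ?_
    exact (Function.hasTemperateGrowth_inner_right y).pow N

lemma exists_bound_section {F : ℝ × Rd d → ℂ} (hF : ContDiff ℝ ∞ F) (i : ℕ) (ρ : ℝ) :
    ∃ B : ℝ, 0 ≤ B ∧ ∀ s ∈ Set.Icc (0 : ℝ) 1, ∀ ζ : Rd d, ‖ζ‖ ≤ ρ →
      ‖iteratedFDeriv ℝ i (fun y => F (s, y)) ζ‖ ≤ B := by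
  have hc : IsCompact (Set.Icc (0 : ℝ) 1 ×ˢ Metric.closedBall (0 : Rd d) ρ) :=
    isCompact_Icc.prod (isCompact_closedBall _ _)
  obtain ⟨B, hB⟩ := hc.exists_bound_of_continuousOn
    (hF.continuous_iteratedFDeriv (m := i) (by exact_mod_cast le_top)).continuousOn
  refine ⟨max B 0, le_max_right _ _, fun s hs ζ hζ => ?_⟩
  refine (norm_iteratedFDeriv_section_le hF i s ζ).trans ((hB (s, ζ) ⟨hs, ?_⟩).trans
    (le_max_left _ _))
  simpa using hζ

lemma seminorm_lowS_monoLow_le (χ : 𝓢(Rd d, ℂ)) (y : Rd d) (k i : ℕ) {N : ℕ} (hN : i < N) :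
    ∃ C : ℝ, 0 ≤ C ∧ ∀ n : ℕ,
      SchwartzMap.seminorm ℝ k i (smul𝓢 (lowS hψ (-n)) (monoLow y N χ)) ≤ C * (1 / 2) ^ n := by
  set F : ℝ × Rd d → ℂ := fun p => lowS hψ 0 p.2 * ((inner ℝ y p.2 : ℝ) : ℂ) ^ N * χ (p.1 • p.2)
    with hF
  have hFs : ContDiff ℝ ∞ F := by
    refine ContDiff.mul (ContDiff.mul (((lowS hψ 0).smooth ⊤).comp contDiff_snd)
      (ContDiff.pow ?_ N)) ((χ.smooth ⊤).comp (by fun_prop))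
    exact Complex.ofRealCLM.contDiff.comp (contDiff_const.inner ℝ contDiff_snd)
  obtain ⟨B, hB0, hB⟩ := exists_bound_section hFs i 1
  refine ⟨B, hB0, fun n => ?_⟩
  set s : ℝ := (1 / 2) ^ n with hs
  have hs0 : 0 < s := by positivity
  have hs1 : s ≤ 1 := pow_le_one₀ (by norm_num) (by norm_num)
  set l : ℝ := 2 ^ n with hl
  have hl0 : 0 < l := by positivity
  have hsl : s * l = 1 := by rw [hs, hl, ← mul_pow]; norm_num
  have hfun : ((smul𝓢 (lowS hψ (-n)) (monoLow y N χ) : 𝓢(Rd d, ℂ)) : Rd d → ℂ) =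
      fun ξ => (s ^ N : ℂ) • (fun ζ => F (s, ζ)) (l • ξ) := by
    ext ξ
    have h1 : (2 : ℝ) ^ (-(-(n : ℤ))) = l := by rw [neg_neg, zpow_natCast]
    rw [smul𝓢_apply, monoLow_apply, lowS_scale, h1, hF]
    simp only [smul_smul, hsl, one_smul, inner_smul_right, smul_eq_mul]
    have h2 : ((s : ℂ) ^ N) * (l : ℂ) ^ N = 1 := by
      rw [← mul_pow, ← Complex.ofReal_mul, hsl]; simp
    push_cast
    rw [mul_pow]
    linear_combination (- lowS hψ 0 (l • ξ) * ((inner ℝ y ξ : ℝ) : ℂ) ^ N * χ ξ) * h2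
  refine SchwartzMap.seminorm_le_bound ℝ k i _ (by positivity) fun ξ => ?_
  rw [hfun]
  have hFsec : ContDiff ℝ ∞ fun ζ => F (s, ζ) := hFs.comp (by fun_prop)
  have hcomp : ContDiff ℝ ∞ (fun ξ : Rd d => (fun ζ => F (s, ζ)) (l • ξ)) :=
    hFsec.comp (by fun_prop)
  rcases lt_or_ge 1 (l * ‖ξ‖) with hgt | hle
  · have hev : (fun ξ => (s ^ N : ℂ) • (fun ζ => F (s, ζ)) (l • ξ)) =ᶠ[𝓝 ξ] fun _ => 0 := by
      have : ∀ᶠ y in 𝓝 ξ, 1 < l * ‖y‖ :=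
        (by fun_prop : Continuous fun y : Rd d => l * ‖y‖).continuousAt.eventually_const_lt hgt
      filter_upwards [this] with v hv
      have h0 : lowS hψ 0 (l • v) = 0 := by
        rw [lowS_apply, hψ.low_eq_zero]
        rw [norm_smul, norm_smul, norm_of_nonneg (by positivity : (0 : ℝ) ≤ 2 * π),
          norm_of_nonneg hl0.le, zpow_zero]
        nlinarith [Real.pi_gt_three]
      simp [hF, h0]
    rw [(hev.iteratedFDeriv ℝ i).eq_of_nhds]
    have : iteratedFDeriv ℝ i (fun _ : Rd d => (0 : ℂ)) ξ = 0 := by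
      simp
    rw [this, norm_zero, mul_zero]
    positivity
  · have h1 : iteratedFDeriv ℝ i (fun ξ => (s ^ N : ℂ) • (fun ζ => F (s, ζ)) (l • ξ)) ξ =
        (s ^ N : ℂ) • iteratedFDeriv ℝ i (fun ξ : Rd d => (fun ζ => F (s, ζ)) (l • ξ)) ξ :=
      iteratedFDeriv_const_smul_apply (a := (s ^ N : ℂ)) (x := ξ)
        (f := fun ξ : Rd d => (fun ζ => F (s, ζ)) (l • ξ))
        (hcomp.of_le (by exact_mod_cast le_top)).contDiffAt
    have h2 := norm_iteratedFDeriv_comp_smul_le hFsec i hl0.le ξ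
    have h3 := hB s ⟨hs0.le, hs1⟩ (l • ξ) (by rwa [norm_smul, norm_of_nonneg hl0.le])
    have h4 : ‖ξ‖ ≤ 1 := by
      have : ‖ξ‖ ≤ l * ‖ξ‖ := le_mul_of_one_le_left (norm_nonneg _) (one_le_pow₀ one_le_two)
      linarith
    rw [h1, norm_smul, norm_pow, norm_real, norm_of_nonneg hs0.le]
    calc ‖ξ‖ ^ k * (s ^ N * _) ≤ 1 * (s ^ N * (B * l ^ i)) := by
          gcongr
          · exact pow_le_one₀ (norm_nonneg _) h4
          · exact h2.trans (by gcongr)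
      _ = B * s ^ (N - i) * (s * l) ^ i := by
          have : s ^ N = s ^ (N - i) * s ^ i := by rw [← pow_add]; congr 1; omega
          rw [this, mul_pow]; ring
      _ ≤ B * s := by
          rw [hsl, one_pow, mul_one]
          gcongr
          exact pow_le_of_le_one hs0.le hs1 (by omega)

lemma exists_tendsto_monoLow (L : 𝓢(Rd d, ℂ) →L[ℂ] ℂ) : ∃ N : ℕ, ∀ (y : Rd d) (χ : 𝓢(Rd d, ℂ)),
    Tendsto (fun n : ℕ => L (smul𝓢 (lowS hψ (-n)) (monoLow y N χ))) atTop (𝓝 0) := by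
  obtain ⟨s, C, hC, h⟩ := exists_bound_of_continuous L
  set N := s.sup Prod.snd + 1 with hN
  refine ⟨N, fun y χ => ?_⟩
  have hlt : ∀ i ∈ s, i.2 < N := fun i hi =>
    Nat.lt_succ_of_le (Finset.le_sup (f := Prod.snd) hi)
  have : ∀ i : ℕ × ℕ, ∃ B : ℝ, 0 ≤ B ∧ (i ∈ s → ∀ n : ℕ,
      SchwartzMap.seminorm ℝ i.1 i.2 (smul𝓢 (lowS hψ (-n)) (monoLow y N χ)) ≤ B * (1 / 2) ^ n) := by
    intro i
    by_cases hi : i ∈ s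
    · obtain ⟨B, h0, hB⟩ := seminorm_lowS_monoLow_le hψ χ y i.1 i.2 (hlt i hi)
      exact ⟨B, h0, fun _ => hB⟩
    · exact ⟨0, le_rfl, fun h => absurd h hi⟩
  choose B hB0 hB using this
  have hb : ∀ n : ℕ, ‖L (smul𝓢 (lowS hψ (-n)) (monoLow y N χ))‖ ≤
      C * ((∑ i ∈ s, B i) * (1 / 2) ^ n) := by
    intro n
    have hsum : 0 ≤ ∑ i ∈ s, B i := sum_nonneg fun i _ => hB0 i
    refine h _ _ (by positivity) fun i hi => (hB i hi n).trans ?_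
    gcongr
    exact single_le_sum (fun i _ => hB0 i) hi
  refine squeeze_zero_norm hb ?_
  simpa using ((tendsto_pow_atTop_nhds_zero_of_lt_one (r := (1 / 2 : ℝ)) (by norm_num)
    (by norm_num)).const_mul (∑ i ∈ s, B i)).const_mul C

lemma exists_exp_taylor (N : ℕ) : ∃ (c : ℕ → ℂ) (g : ℂ → ℂ), Differentiable ℂ g ∧
    ∀ w, Complex.exp w = ∑ n ∈ Finset.range N, c n * w ^ n + w ^ N * g w := by
  induction N with
  | zero => exact ⟨0, Complex.exp, Complex.differentiable_exp, fun w => by simp⟩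
  | succ N ih =>
    obtain ⟨c, g, hg, h⟩ := ih
    refine ⟨Function.update c N (g 0), dslope g 0, ?_, fun w => ?_⟩
    · rw [← differentiableOn_univ, Complex.differentiableOn_dslope univ_mem, differentiableOn_univ]
      exact hg
    · rw [Finset.sum_range_succ, Function.update_self, h]
      have h1 : ∑ n ∈ Finset.range N, Function.update c N (g 0) n * w ^ n =
          ∑ n ∈ Finset.range N, c n * w ^ n := by
        refine sum_congr rfl fun n hn => ?_
        rw [Function.update_of_ne (Finset.mem_range.1 hn).ne]
      rw [h1]
      have h2 := sub_smul_dslope g 0 w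
      rw [sub_zero, smul_eq_mul] at h2
      rw [pow_succ]
      linear_combination - w ^ N * h2

end vanishing

section vanishing

variable {ψ : Rd d → ℝ} (hψ : IsCutoff ψ)

/-- `a·ψ` as a Schwartz function. -/
def locS {a : Rd d → ℂ} (ha : ContDiff ℝ ∞ a) : 𝓢(Rd d, ℂ) :=
  HasCompactSupport.toSchwartzMap (f := fun ξ => a ξ * lowS hψ 0 ξ)
    ((hasCompactSupport_scaled (hψ.low_smooth 0).cpt).mul_left) (ha.mul ((lowS hψ 0).smooth ⊤))

lemma locS_apply {a : Rd d → ℂ} (ha : ContDiff ℝ ∞ a) (ξ : Rd d) :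
    locS hψ ha ξ = a ξ * lowS hψ 0 ξ := rfl

lemma contDiff_inner_ofReal (y : Rd d) : ContDiff ℝ ∞ fun ξ : Rd d => ((inner ℝ y ξ : ℝ) : ℂ) :=
  Complex.ofRealCLM.contDiff.comp (contDiff_const.inner ℝ contDiff_id)

lemma contDiff_coord (k : Fin d) : ContDiff ℝ ∞ fun ξ : Rd d => ((ξ k : ℝ) : ℂ) :=
  Complex.ofRealCLM.contDiff.comp (EuclideanSpace.proj (𝕜 := ℝ) k).contDiff

lemma contDiff_monomial {n : ℕ} (p : Fin n → Fin d) :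
    ContDiff ℝ ∞ fun ξ : Rd d => ∏ i, ((ξ (p i) : ℝ) : ℂ) :=
  contDiff_prod fun i _ => contDiff_coord (p i)

include hψ in
/-- A class whose dyadic blocks vanish is zero. -/
theorem eq_zero_of_blocks {u : TempModPoly d} (hu : ∀ j x, multC (dyadicSym ψ j) u x = 0) :
    u = 0 := by
  obtain ⟨T, rfl⟩ := Submodule.Quotient.mk_surjective _ u
  set L := hatF T with hL
  have hdy : ∀ (j : ℤ) (χ : 𝓢(Rd d, ℂ)), L (smul𝓢 (hψ.dyadic_smooth j).scaled χ) = 0 := by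
    intro j χ
    obtain ⟨ρ, hρ⟩ := (hψ.dyadic_smooth j).exists_one
    have := exchange L hρ (𝓕 χ)
    rw [FourierTransform.fourierInv_fourier_eq] at this
    rw [this]
    refine integral_eq_zero_of_ae (.of_forall fun y => ?_)
    simp only [hL, ← multC_mk T (hψ.dyadic_smooth j) (hψ.dyadic_eventually_zero j), hu, mul_zero,
      Pi.zero_apply]
  have hstep : ∀ (J : ℤ) (χ : 𝓢(Rd d, ℂ)),
      L (smul𝓢 (lowS hψ (J + 1)) χ) = L (smul𝓢 (lowS hψ J) χ) := by
    intro J χ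
    have : smul𝓢 (lowS hψ (J + 1)) χ =
        smul𝓢 (lowS hψ J) χ + smul𝓢 (hψ.dyadic_smooth J).scaled χ := by
      ext ξ
      rw [add_apply, smul𝓢_apply, smul𝓢_apply, smul𝓢_apply, lowS_apply, lowS_apply,
        SmoothSym.scaled_apply, lowSym_succ, Pi.add_apply]
      ring
    rw [this, map_add, hdy, add_zero]
  have hconst : ∀ (J : ℤ) (χ : 𝓢(Rd d, ℂ)), L (smul𝓢 (lowS hψ J) χ) = L (smul𝓢 (lowS hψ 0) χ) := by
    intro J χ
    induction J using Int.induction_on with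
    | zero => rfl
    | succ n ih => rw [hstep, ih]
    | pred n ih => rw [← ih, ← hstep (-(n : ℤ) - 1) χ, sub_add_cancel]
  have hall : ∀ χ : 𝓢(Rd d, ℂ), L (smul𝓢 (lowS hψ 0) χ) = L χ := by
    intro χ
    refine tendsto_nhds_unique ?_ (tendsto_apply_lowS hψ L χ)
    simp only [hconst]
    exact tendsto_const_nhds
  obtain ⟨N, hN⟩ := exists_tendsto_monoLow hψ L
  have hmono : ∀ (y : Rd d) (χ : 𝓢(Rd d, ℂ)), L (monoLow y N χ) = 0 := by
    intro y χ
    refine tendsto_nhds_unique ?_ (hN y χ)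
    simp only [hconst, hall]
    exact tendsto_const_nhds
  obtain ⟨c, g, hg, hexp⟩ := exists_exp_taylor N
  have hgs : ∀ y : Rd d, ContDiff ℝ ∞ fun ξ : Rd d =>
      (2 * π * I) ^ N * g (2 * π * I * (inner ℝ y ξ : ℝ)) := by
    intro y
    have h1 : ContDiff ℝ ∞ g := (hg.contDiff (n := ∞)).restrict_scalars ℝ
    exact contDiff_const.mul (h1.comp (contDiff_const.mul (contDiff_inner_ofReal y)))
  set cc : ∀ n : ℕ, (Fin n → Fin d) → ℂ := fun n p =>
    c n * (2 * π * I) ^ n * L (locS hψ (contDiff_monomial p)) with hcc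
  have hosc : ∀ y : Rd d, L (osc (lowS hψ 0) y) =
      ∑ n ∈ Finset.range N, ∑ p : Fin n → Fin d, cc n p * ∏ i, ((y (p i) : ℝ) : ℂ) := by
    intro y
    have hdec : osc (lowS hψ 0) y = (∑ n ∈ Finset.range N, ∑ p : Fin n → Fin d,
        (c n * (2 * π * I) ^ n * ∏ i, ((y (p i) : ℝ) : ℂ)) •
          locS hψ (contDiff_monomial p)) + monoLow y N (locS hψ (hgs y)) := by
      ext ξ
      rw [add_apply, osc_apply, monoLow_apply, locS_apply, chr]
      have h1 : (((2 * π * inner ℝ ξ y : ℝ) : ℂ) * I) =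
          2 * π * I * (inner ℝ y ξ : ℝ) := by
        rw [real_inner_comm]; push_cast; ring
      rw [h1, hexp, sum_apply, add_mul, sum_mul]
      congr 1
      · refine sum_congr rfl fun n _ => ?_
        rw [sum_apply]
        have h2 : ((inner ℝ y ξ : ℝ) : ℂ) = ∑ k, ((y k : ℝ) : ℂ) * ((ξ k : ℝ) : ℂ) := by
          rw [PiLp.inner_apply]
          push_cast
          refine sum_congr rfl fun k _ => ?_
          simp [mul_comm]
        rw [mul_pow, h2, Fintype.sum_pow, mul_sum, mul_sum, sum_mul]
        refine sum_congr rfl fun p _ => ?_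
        rw [smul_apply, locS_apply, smul_eq_mul, Finset.prod_mul_distrib]
        ring
      · ring
    rw [hdec, map_add, hmono, add_zero, map_sum]
    refine sum_congr rfl fun n _ => ?_
    rw [map_sum]
    refine sum_congr rfl fun p _ => ?_
    rw [map_smul, smul_eq_mul, hcc]
    ring
  rw [Submodule.Quotient.mk_eq_zero]
  refine Submodule.subset_span ⟨∑ n ∈ Finset.range N, ∑ p : Fin n → Fin d,
    MvPolynomial.C (cc n p) * ∏ i, MvPolynomial.X (p i), fun χ => ?_⟩
  obtain ⟨ρ, hρ⟩ := (hψ.low_smooth 0).exists_one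
  have h1 : T χ = L (smul𝓢 (lowS hψ 0) (𝓕⁻ χ)) := by
    rw [hall, hL, hatF_apply, FourierTransform.fourier_fourierInv_eq]
  rw [h1, lowS, exchange L hρ χ]
  congr 1 with y
  have := hosc y
  rw [lowS] at this
  rw [this, mul_comm, map_sum]
  congr 1
  refine sum_congr rfl fun n _ => ?_
  rw [map_sum]
  refine sum_congr rfl fun p _ => ?_
  simp

end vanishing

/-! ## Directional derivatives -/

/-- The symbol of the derivative in the direction `h`. -/
def dirSym (h ζ : Rd d) : ℂ := I * (inner ℝ h ζ : ℝ)

lemma gradSym_eq_dirSym (k : Fin d) : gradSym k = dirSym (EuclideanSpace.single k (1 : ℝ)) := by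
  ext ζ
  simp [gradSym, dirSym, EuclideanSpace.inner_single_left]

lemma dirSym_smul (s : ℝ) (h ζ : Rd d) : dirSym (s • h) ζ = s * dirSym h ζ := by
  simp [dirSym, inner_smul_left]; ring

lemma dirSym_eq_sum (h ζ : Rd d) : dirSym h ζ = ∑ k, ((h k : ℝ) : ℂ) * gradSym k ζ := by
  rw [dirSym, PiLp.inner_apply]
  push_cast
  rw [mul_sum]
  refine sum_congr rfl fun k _ => ?_
  simp [gradSym]
  ring

lemma continuous_dirSym (h : Rd d) : Continuous (dirSym h) := by unfold dirSym; fun_prop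

lemma ker_modulate (m : Rd d → ℂ) (h x : Rd d) :
    ker (fun ζ => Complex.exp (dirSym h ζ) * m ζ) x = ker m (x + h) := by
  simp only [ker]
  rw [Real.fourierInv_eq', Real.fourierInv_eq']
  congr 1 with v
  rw [smul_eq_mul, smul_eq_mul, ← mul_assoc, ← Complex.exp_add, dirSym, inner_add_right,
    inner_smul_right, real_inner_comm v h]
  congr 2
  push_cast
  ring

lemma symNorm_modulate (m : Rd d → ℂ) (h : Rd d) :
    symNorm (fun ζ => Complex.exp (dirSym h ζ) * m ζ) = symNorm m := by
  simp only [symNorm, ker_modulate]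
  exact lintegral_add_right_eq_self (fun x => ‖ker m x‖ₑ) h

lemma multF_modulate (m : Rd d → ℂ) (h : Rd d) (q : Rd d → ℂ) (x : Rd d) :
    multF (fun ζ => Complex.exp (dirSym h ζ) * m ζ) q x = multF m q (x + h) := by
  simp only [multF_eq, ker_modulate]
  congr 1 with y
  rw [sub_add_eq_add_sub]

lemma norm_exp_dirSym (h ζ : Rd d) : ‖Complex.exp (dirSym h ζ)‖ = 1 := by
  rw [dirSym, mul_comm]; exact Complex.norm_exp_ofReal_mul_I _

lemma multF_add_sub {m : Rd d → ℂ} (hm : L1Sym m) {h : Rd d}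
    (hm' : L1Sym (fun ζ => dirSym h ζ * m ζ)) {q : Rd d → ℂ} (hq : BM q) (x : Rd d) :
    multF m q (x + h) - multF m q x =
      ∫ s in Set.Ioc (0 : ℝ) 1, multF (fun ζ => dirSym h ζ * m ζ) q (x + s • h) := by
  set n : ℝ → Rd d → ℂ := fun s ζ => Complex.exp (dirSym (s • h) ζ) * (dirSym h ζ * m ζ) with hn
  have hcont : Continuous (Function.uncurry n) := by
    have h1 : Continuous fun p : ℝ × Rd d => dirSym (p.1 • h) p.2 := by
      unfold dirSym; fun_prop
    exact (Complex.continuous_exp.comp h1).mul (hm'.cont.comp continuous_snd)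
  have hsym : ∀ s, symNorm (n s) = symNorm (fun ζ => dirSym h ζ * m ζ) := fun s =>
    symNorm_modulate _ _
  have hint : Integrable (Function.uncurry n)
      ((volume.restrict (Set.Ioc (0 : ℝ) 1)).prod volume) := by
    have := (integrable_const (1 : ℂ) (μ := volume.restrict (Set.Ioc (0 : ℝ) 1))).mul_prod hm'.int
    refine this.mono hcont.aestronglyMeasurable (.of_forall fun p => ?_)
    simp only [Function.uncurry, hn]
    rw [norm_mul, norm_exp_dirSym]
    simp
  have hM : ∀ ζ, (fun ζ => Complex.exp (dirSym h ζ) * m ζ + (-1) * m ζ) ζ =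
      ∫ s in Set.Ioc (0 : ℝ) 1, n s ζ := by
    intro ζ
    rw [← intervalIntegral.integral_of_le zero_le_one]
    have hd : ∀ s ∈ Set.uIcc (0 : ℝ) 1, HasDerivAt (fun s : ℝ =>
        Complex.exp (s * dirSym h ζ) * m ζ) (n s ζ) s := by
      intro s _
      have h1 : HasDerivAt (fun s : ℝ => (s : ℂ) * dirSym h ζ) (dirSym h ζ) s := by
        simpa using (Complex.ofRealCLM.hasDerivAt (x := s)).mul_const (dirSym h ζ)
      refine HasDerivAt.congr_deriv (h1.cexp.mul_const (m ζ)) ?_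
      simp only [hn]
      simp only [dirSym_smul]
      ring
    rw [intervalIntegral.integral_eq_sub_of_hasDerivAt hd]
    · simp; ring
    · exact (hcont.comp (by fun_prop : Continuous fun s : ℝ => (s, ζ))).intervalIntegrable _ _
  have hfin : (∫⁻ s in Set.Ioc (0 : ℝ) 1, symNorm (n s)) < ⊤ := by
    simp only [hsym]
    rw [lintegral_const]
    exact mul_lt_top hm'.symNorm_lt_top (by simp)
  have key := multF_integral hcont.measurable hint hM hfin hq x
  have h1 : L1Sym (fun ζ => Complex.exp (dirSym h ζ) * m ζ) := by
    refine ⟨(Complex.continuous_exp.comp (continuous_dirSym h)).mul hm.cont, ?_, ?_⟩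
    · exact hm.int.bdd_mul (Complex.continuous_exp.comp (continuous_dirSym h)).aestronglyMeasurable
        (.of_forall fun ζ => (norm_exp_dirSym h ζ).le)
    · have : ker (fun ζ => Complex.exp (dirSym h ζ) * m ζ) = fun x => ker m (x + h) := by
        ext x; exact ker_modulate m h x
      rw [this]
      exact hm.kint.comp_add_right h
  have h2 := congrFun (multF_add_sym h1 (hm.const_mul (-1)) hq) x
  have h3 : (fun ζ => Complex.exp (dirSym h ζ) * m ζ) + (fun ζ => (-1) * m ζ) =
    fun ζ => Complex.exp (dirSym h ζ) * m ζ + (-1) * m ζ := rfl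
  rw [h3, Pi.add_apply, multF_modulate, multF_const_mul_sym, key] at h2
  rw [sub_eq_add_neg, ← neg_one_mul, ← h2]
  congr 1 with s
  exact multF_modulate _ _ _ _

lemma enorm_multF_add_sub_le {m : Rd d → ℂ} (hm : L1Sym m) {h : Rd d}
    (hm' : L1Sym (fun ζ => dirSym h ζ * m ζ)) {q : Rd d → ℂ} (hq : BM q) (x : Rd d) :
    ‖multF m q (x + h) - multF m q x‖ₑ ≤ supN (multF (fun ζ => dirSym h ζ * m ζ) q) := by
  rw [multF_add_sub hm hm' hq]
  refine (enorm_integral_le_lintegral_enorm _).trans ?_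
  refine (lintegral_mono fun s => le_supN _ _).trans_eq ?_
  simp

lemma hasLineDerivAt_multF {m : Rd d → ℂ} (hm : L1Sym m) {h : Rd d}
    (hm' : L1Sym (fun ζ => dirSym h ζ * m ζ)) {q : Rd d → ℂ} (hq : BM q) (x : Rd d) :
    HasLineDerivAt ℝ (multF m q) (multF (fun ζ => dirSym h ζ * m ζ) q x) x h := by
  set g := multF (fun ζ => dirSym h ζ * m ζ) q with hg
  have hgc : Continuous g := continuous_multF hm' hq
  have hs : ∀ s : ℝ, multF m q (x + s • h) - multF m q x =
      s * ∫ s' in Set.Ioc (0 : ℝ) 1, g (x + s' • s • h) := by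
    intro s
    have he : (fun ζ => dirSym (s • h) ζ * m ζ) = fun ζ => (s : ℂ) * (dirSym h ζ * m ζ) := by
      ext ζ; rw [dirSym_smul, mul_assoc]
    have hm'' : L1Sym (fun ζ => dirSym (s • h) ζ * m ζ) := by rw [he]; exact hm'.const_mul _
    rw [multF_add_sub hm hm'' hq, ← integral_const_mul]
    congr 1 with s'
    rw [he, multF_const_mul_sym]
  rw [HasLineDerivAt, hasDerivAt_iff_tendsto_slope]
  have hlim : Tendsto (fun s : ℝ => ∫ s' in Set.Ioc (0 : ℝ) 1, g (x + s' • s • h)) (𝓝[≠] 0)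
      (𝓝 (∫ s' in Set.Ioc (0 : ℝ) 1, g x)) := by
    refine tendsto_integral_filter_of_dominated_convergence (fun _ => (supN g).toReal)
      (.of_forall fun s => ?_) (.of_forall fun s =>
        .of_forall fun s' => norm_le_supN (BM.multF hm' hq).fin _)
      (integrable_const _) (.of_forall fun s' => ?_)
    · exact (hgc.comp (by fun_prop)).aestronglyMeasurable
    · have : Continuous fun s : ℝ => g (x + s' • s • h) := hgc.comp (by fun_prop)
      have := this.tendsto 0
      simp only [zero_smul, smul_zero, add_zero] at this
      exact this.mono_left nhdsWithin_le_nhds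
  simp only [integral_const, MeasurableSet.univ, measureReal_restrict_apply, Set.univ_inter,
    Real.volume_real_Ioc, sub_zero] at hlim
  norm_num at hlim
  refine hlim.congr' ?_
  filter_upwards [self_mem_nhdsWithin] with s hs0
  have hs0' : (s : ℂ) ≠ 0 := by exact_mod_cast hs0
  have := hs s
  rw [slope_def_module]
  simp only [sub_zero, zero_smul, add_zero]
  rw [this, Complex.real_smul, ← mul_assoc]
  push_cast
  rw [inv_mul_cancel₀ hs0', one_mul]

/-! ## Hermitian symbols and conjugation -/

/-- Symbols of real operators. -/
def Herm (m : Rd d → ℂ) : Prop := ∀ ζ, m (-ζ) = star (m ζ)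

lemma Herm.mul {m₁ m₂ : Rd d → ℂ} (h₁ : Herm m₁) (h₂ : Herm m₂) :
    Herm (fun ζ => m₁ ζ * m₂ ζ) := fun ζ => by
  simp only [h₁ ζ, h₂ ζ, star_mul']

lemma herm_absSym : Herm (absSym : Rd d → ℂ) := fun ζ => by simp [absSym]

lemma herm_inv_absSym : Herm (absSym⁻¹ : Rd d → ℂ) := fun ζ => by simp [absSym]

lemma herm_gradSym (k : Fin d) : Herm (gradSym k : Rd d → ℂ) := fun ζ => by simp [gradSym]

lemma herm_poissonSym (t : ℝ) : Herm (poissonSym t : Rd d → ℂ) := fun ζ => by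
  simp only [poissonSym, norm_neg]
  exact (Complex.conj_ofReal _).symm

lemma herm_dyadicSym {ψ : Rd d → ℝ} (hψ : IsCutoff ψ) (j : ℤ) : Herm (dyadicSym ψ j) := fun ζ => by
  simp only [dyadicSym, smul_neg]
  rw [hψ.radial (-((2 : ℝ)⁻¹ • (2 : ℝ) ^ (-j) • ζ)) ((2 : ℝ)⁻¹ • (2 : ℝ) ^ (-j) • ζ) (norm_neg _),
    hψ.radial (-((2 : ℝ) ^ (-j) • ζ)) ((2 : ℝ) ^ (-j) • ζ) (norm_neg _)]
  exact (Complex.conj_ofReal _).symm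

lemma Herm.star_ker {m : Rd d → ℂ} (h : Herm m) (x : Rd d) : star (ker m x) = ker m x := by
  simp only [ker]
  rw [Real.fourierInv_eq', Complex.star_def, ← integral_conj, ← integral_neg_eq_self]
  congr 1 with v
  rw [smul_eq_mul, smul_eq_mul, map_mul, ← Complex.exp_conj, smul_neg, h, inner_neg_left]
  have h2 : (starRingEnd ℂ) (((2 * π * -inner ℝ v x : ℝ) : ℂ) * I) =
      ((2 * π * inner ℝ v x : ℝ) : ℂ) * I := by
    rw [map_mul, Complex.conj_ofReal, Complex.conj_I]
    push_cast
    ring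
  rw [h2]
  simp

lemma Herm.star_multF {m : Rd d → ℂ} (h : Herm m) (q : Rd d → ℂ) (x : Rd d) :
    star (multF m q x) = multF m (fun y => star (q y)) x := by
  rw [multF_eq, multF_eq, Complex.star_def, ← integral_conj]
  congr 1 with y
  rw [map_mul]
  congr 1
  exact h.star_ker _

lemma multC_star_of_isReal {m : Rd d → ℂ} (h : SmoothSym m) (h0 : ∀ᶠ ζ in 𝓝 0, m ζ = 0)
    (hm : Herm m) {u : TempModPoly d} (hu : IsReal u) (x : Rd d) :
    star (multC m u x) = multC m u x := by
  obtain ⟨T, rfl, hT⟩ := hu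
  rw [multC_mk T h h0, hatF_apply]
  refine Complex.conj_eq_iff_im.2 (hT _ fun y => ?_)
  rw [← h.ker_eq_fourier]
  exact Complex.conj_eq_iff_im.1 (hm.star_ker _)

/-! ## Construction of classes from their blocks -/

lemma Homog.l1_dyadic {ψ : Rd d → ℝ} (hψ : IsCutoff ψ) {s : ℤ} {a : Rd d → ℂ} (ha : Homog s a)
    (j : ℤ) : SmoothSym (fun ζ => a ζ * dyadicSym ψ j ζ) := by
  have := ha.smoothSym_dyadic hψ 0 j
  simpa [poissonSym_zero] using this

lemma Homog.eventually_zero {ψ : Rd d → ℝ} (hψ : IsCutoff ψ) (a : Rd d → ℂ) (j : ℤ) :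
    ∀ᶠ ζ in 𝓝 0, a ζ * dyadicSym ψ j ζ = 0 := by
  filter_upwards [hψ.dyadic_eventually_zero j] with ζ h
  rw [h, mul_zero]

lemma smooth_dir_dyadic {ψ : Rd d → ℝ} (hψ : IsCutoff ψ) (h : Rd d) (j : ℤ) :
    SmoothSym (fun ζ => dirSym h ζ * dyadicSym ψ j ζ) := by
  refine SmoothSym.mul_left (a := dirSym h) ?_ (hψ.dyadic_smooth j)
  exact contDiff_const.mul (contDiff_inner_ofReal h)

/-- The symbol norm of a derivative of a dyadic block. -/
lemma exists_symNorm_dir_le {ψ : Rd d → ℝ} (hψ : IsCutoff ψ) : ∃ C : ℝ, 0 ≤ C ∧ ∀ (h : Rd d) (j : ℤ),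
    symNorm (fun ζ => dirSym h ζ * dyadicSym ψ j ζ) ≤ ofReal (C * ‖h‖ * 2 ^ j) := by
  choose C hC0 hC using fun k : Fin d => (homog_gradSym k).exists_symNorm_le hψ
  set S := (symNorm (dyadicSym ψ 0)).toReal with hS
  refine ⟨∑ k, C k * S, sum_nonneg fun k _ => mul_nonneg (hC0 k) toReal_nonneg,
    fun h j => ?_⟩
  have hk : ∀ k, symNorm (fun ζ => gradSym k ζ * dyadicSym ψ j ζ) ≤
      ofReal (C k * 2 ^ j * S) := by
    intro k
    have := symNorm_block_le hψ (homog_gradSym k) (C := C k) ⟨hC0 k, hC k⟩ le_rfl j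
    rw [decay_zero_right, one_mul] at this
    simp only [poissonSym_zero, Pi.one_apply, mul_one] at this
    refine this.trans_eq ?_
    rw [ofReal_mul (p := C k * 2 ^ j) (by have := hC0 k; positivity), hS,
      ENNReal.ofReal_toReal (hψ.dyadic_smooth 0).l1.symNorm_lt_top.ne]
  have hsum : ∀ x, ker (fun ζ => dirSym h ζ * dyadicSym ψ j ζ) x =
      ∑ k, ((h k : ℝ) : ℂ) * ker (fun ζ => gradSym k ζ * dyadicSym ψ j ζ) x := by
    intro x
    have : (fun ζ => dirSym h ζ * dyadicSym ψ j ζ) =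
        ∑ k, fun ζ => ((h k : ℝ) : ℂ) * (gradSym k ζ * dyadicSym ψ j ζ) := by
      ext ζ
      rw [dirSym_eq_sum, sum_mul, Finset.sum_apply]
      simp only [mul_assoc]
    rw [this]
    have hind : ∀ s : Finset (Fin d), L1Sym (∑ k ∈ s, fun ζ => ((h k : ℝ) : ℂ) *
        (gradSym k ζ * dyadicSym ψ j ζ)) ∧
        ker (∑ k ∈ s, fun ζ => ((h k : ℝ) : ℂ) * (gradSym k ζ * dyadicSym ψ j ζ)) x =
        ∑ k ∈ s, ((h k : ℝ) : ℂ) * ker (fun ζ => gradSym k ζ * dyadicSym ψ j ζ) x := by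
      intro s
      have hl : ∀ k, L1Sym (fun ζ => ((h k : ℝ) : ℂ) * (gradSym k ζ * dyadicSym ψ j ζ)) :=
        fun k => ((homog_gradSym k).l1_dyadic hψ j).l1.const_mul _
      induction s using Finset.induction_on with
      | empty =>
        have h0 : SmoothSym (0 : Rd d → ℂ) := ⟨contDiff_const, HasCompactSupport.zero⟩
        refine ⟨by simpa using h0.l1, ?_⟩
        have := ker_const_mul 0 (0 : Rd d → ℂ)
        simp only [zero_mul] at this
        simp only [Finset.sum_empty]
        exact congrFun this x
      | insert a s ha ih =>
        rw [sum_insert ha, sum_insert ha]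
        refine ⟨(hl a).add ih.1, ?_⟩
        rw [ker_add (hl a).int ih.1.int, Pi.add_apply, ih.2, ker_const_mul]
    exact (hind Finset.univ).2
  calc symNorm (fun ζ => dirSym h ζ * dyadicSym ψ j ζ)
      ≤ ∫⁻ x, ∑ k, ‖((h k : ℝ) : ℂ)‖ₑ * ‖ker (fun ζ => gradSym k ζ * dyadicSym ψ j ζ) x‖ₑ := by
        refine lintegral_mono fun x => ?_
        simp only [hsum]
        refine (enorm_sum_le _ _).trans_eq ?_
        simp only [enorm_mul]
    _ = ∑ k, ‖((h k : ℝ) : ℂ)‖ₑ * symNorm (fun ζ => gradSym k ζ * dyadicSym ψ j ζ) := by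
        rw [lintegral_finsetSum _ fun k _ => ((continuous_ker
          ((homog_gradSym k).l1_dyadic hψ j).l1.int).measurable.enorm.const_mul _)]
        refine sum_congr rfl fun k _ => ?_
        rw [lintegral_const_mul _ (continuous_ker
          ((homog_gradSym k).l1_dyadic hψ j).l1.int).measurable.enorm]
        rfl
    _ ≤ ∑ k, ofReal ‖h‖ * ofReal (C k * 2 ^ j * S) := by
        refine sum_le_sum fun k _ => ?_
        gcongr
        · rw [← ofReal_norm]
          refine ofReal_le_ofReal ?_
          rw [norm_real]
          exact PiLp.norm_apply_le h k
        · exact hk k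
    _ = ofReal ((∑ k, C k * S) * ‖h‖ * 2 ^ j) := by
        have hp : ∀ k ∈ Finset.univ, 0 ≤ ‖h‖ * (C k * 2 ^ j * S) := fun k _ => by
          have := hC0 k
          have : 0 ≤ S := toReal_nonneg
          positivity
        simp only [← ofReal_mul (norm_nonneg h)]
        rw [← ENNReal.ofReal_sum_of_nonneg hp]
        congr 1
        rw [sum_mul, sum_mul]
        refine sum_congr rfl fun k _ => ?_
        ring

/-- The weight `2^j`. -/
def pw (j : ℤ) : ℝ≥0∞ := ofReal (2 ^ j)

lemma pw_eq (j : ℤ) : pw j = (2 : ℝ≥0∞) ^ (j : ℝ) := by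
  rw [pw, ← Real.rpow_intCast, ← ENNReal.ofReal_rpow_of_pos two_pos]
  norm_num

lemma pw_add (i j : ℤ) : pw (i + j) = pw i * pw j := by
  rw [pw, zpow_add₀ two_ne_zero, ofReal_mul (by positivity)]; rfl

lemma pw_ne_top (j : ℤ) : pw j ≠ ⊤ := ENNReal.ofReal_ne_top

lemma pw_ne_zero (j : ℤ) : pw j ≠ 0 := by
  rw [pw, Ne, ENNReal.ofReal_eq_zero, not_le]; positivity

lemma pw_zero : pw 0 = 1 := by simp [pw]

lemma pw_one : pw 1 = 2 := by simp [pw]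

/-- Compatible families of blocks. -/
structure Blocks (ψ : Rd d → ℝ) (h : ℤ → Rd d → ℂ) : Prop where
  bm : ∀ j, BM (h j)
  near : ∀ k x, h k x = multF (dyadicSym ψ k) (h (k - 1)) x + multF (dyadicSym ψ k) (h k) x +
    multF (dyadicSym ψ k) (h (k + 1)) x
  far : ∀ j k x, j ≠ k - 1 → j ≠ k → j ≠ k + 1 → multF (dyadicSym ψ k) (h j) x = 0

lemma exists_blocks_lip {ψ : Rd d → ℝ} (hψ : IsCutoff ψ) : ∃ C : ℝ, 0 ≤ C ∧
    ∀ h : ℤ → Rd d → ℂ, Blocks ψ h → ∀ j x,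
    ‖h j x - h j 0‖ₑ ≤ ofReal (C * ‖x‖) *
      (pw j * (supN (h (j - 1)) + supN (h j) + supN (h (j + 1)))) := by
  obtain ⟨C, hC0, hC⟩ := exists_symNorm_dir_le hψ
  refine ⟨C, hC0, fun h hh j x => ?_⟩
  set H := h (j - 1) + h j + h (j + 1) with hH
  have hHB : BM H := ((hh.bm _).add (hh.bm _)).add (hh.bm _)
  have hl := (hψ.dyadic_smooth j).l1
  have hj : h j = multF (dyadicSym ψ j) H := by
    ext y
    rw [hH, multF_add hl ((hh.bm _).add (hh.bm _)) (hh.bm _), multF_add hl (hh.bm _) (hh.bm _)]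
    exact hh.near j y
  have h1 := enorm_multF_add_sub_le hl (smooth_dir_dyadic hψ x j).l1 hHB 0
  rw [zero_add, ← hj] at h1
  refine h1.trans ((supN_multF_le (smooth_dir_dyadic hψ x j).l1.int H).trans ?_)
  rw [← mul_assoc, pw, ← ofReal_mul (by positivity)]
  gcongr
  · exact hC x j
  · exact (supN_add_le _ _).trans (by gcongr; exact supN_add_le _ _)

lemma tsum_shift (f : ℤ → ℝ≥0∞) (k : ℤ) : ∑' j, f (j + k) = ∑' j, f j :=
  (Equiv.addRight k).tsum_eq f

lemma tsum_pw_neighbours_lt_top {a : ℤ → ℝ≥0∞} (ha : ∑' j, pw j * a j < ⊤) :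
    ∑' j, pw j * (a (j - 1) + a j + a (j + 1)) < ⊤ := by
  have h1 : ∑' j, pw j * a (j - 1) = 2 * ∑' j, pw j * a j := by
    rw [← tsum_shift _ 1, ← ENNReal.tsum_mul_left]
    congr 1 with j
    rw [add_sub_cancel_right, pw_add, pw_one]; ring
  have h2 : ∑' j, pw j * a (j + 1) ≤ ∑' j, pw j * a j := by
    rw [← tsum_shift (fun j => pw j * a j) 1]
    refine tsum_le_tsum fun j => ?_
    rw [pw_add, pw_one]
    gcongr
    exact le_mul_of_one_le_right zero_le (by norm_num)
  simp only [mul_add]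
  rw [ENNReal.tsum_add, ENNReal.tsum_add, h1]
  refine ENNReal.add_lt_top.2 ⟨ENNReal.add_lt_top.2 ⟨mul_lt_top (by simp) ha, ha⟩,
    h2.trans_lt ha⟩

/-- A measurable function of at most linear growth is a tempered distribution. -/
lemma exists_distribution {H : Rd d → ℂ} (hm : Measurable H) {A : ℝ} (hA : 0 ≤ A)
    (hH : ∀ x, ‖H x‖ ≤ A * ‖x‖) :
    ∃ T : 𝓢'(Rd d, ℂ), ∀ χ : 𝓢(Rd d, ℂ), T χ = ∫ x, H x * χ x := by
  have hint : ∀ χ : 𝓢(Rd d, ℂ), Integrable fun x => H x * χ x := by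
    intro χ
    refine Integrable.mono' ((χ.integrable_pow_mul volume 1).const_mul A)
      (hm.aestronglyMeasurable.mul χ.continuous.aestronglyMeasurable)
      (.of_forall fun x => ?_)
    rw [norm_mul, pow_one, ← mul_assoc]
    gcongr
    exact hH x
  set p := (volume : Measure (Rd d)).integrablePower with hp
  obtain ⟨I, hI⟩ : ∃ I : ℝ, I = 2 ^ p * ∫ x : Rd d, (1 + ‖x‖) ^ (-(p : ℝ)) := ⟨_, rfl⟩
  have hI0 : 0 ≤ I := hI ▸ mul_nonneg (by positivity) (integral_nonneg fun x => by positivity)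
  let L : 𝓢(Rd d, ℂ) →L[ℂ] ℂ := SchwartzMap.mkCLMtoNormedSpace (𝕜 := ℂ) (σ := RingHom.id ℂ)
    (fun χ => ∫ x, H x * χ x)
    (fun f g => by
      rw [← integral_add (hint f) (hint g)]
      congr 1 with x
      rw [add_apply, mul_add])
    (fun a f => by
      rw [RingHom.id_apply, smul_eq_mul, ← integral_const_mul]
      congr 1 with x
      rw [smul_apply, smul_eq_mul]
      ring)
    ⟨{(0, 0), (1 + p, 0)}, A * (I * 2), by positivity, fun χ => by
      have h1 := χ.integral_pow_mul_iteratedFDeriv_le (𝕜 := ℂ) (μ := volume) 1 0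
      rw [← hI] at h1
      simp only [norm_iteratedFDeriv_zero] at h1
      have h2 : ∀ i ∈ ({(0, 0), (1 + p, 0)} : Finset (ℕ × ℕ)), SchwartzMap.seminorm ℂ i.1 i.2 χ ≤
          (({(0, 0), (1 + p, 0)} : Finset (ℕ × ℕ)).sup (schwartzSeminormFamily ℂ (Rd d) ℂ)) χ :=
        fun i hi => Seminorm.le_def.1 (Finset.le_sup (f := schwartzSeminormFamily ℂ (Rd d) ℂ) hi) χ
      obtain ⟨Y, hY⟩ : ∃ Y, Y = (({(0, 0), (1 + p, 0)} : Finset (ℕ × ℕ)).sup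
        (schwartzSeminormFamily ℂ (Rd d) ℂ)) χ := ⟨_, rfl⟩
      rw [← hY] at h2 ⊢
      have h3 := h2 (0, 0) (by simp)
      have h4 := h2 (1 + p, 0) (by simp)
      calc ‖∫ x, H x * χ x‖ ≤ ∫ x, A * (‖x‖ ^ 1 * ‖χ x‖) := by
            refine norm_integral_le_of_norm_le ((χ.integrable_pow_mul volume 1).const_mul A)
              (.of_forall fun x => ?_)
            rw [norm_mul, pow_one, ← mul_assoc]
            gcongr
            exact hH x
        _ = A * ∫ x, ‖x‖ ^ 1 * ‖χ x‖ := integral_const_mul _ _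
        _ ≤ A * (I * (SchwartzMap.seminorm ℂ 0 0 χ + SchwartzMap.seminorm ℂ (1 + p) 0 χ)) := by
            gcongr
        _ ≤ A * (I * (Y + Y)) := by gcongr
        _ = _ := by ring⟩
  exact ⟨ContinuousLinearMap.toPointwiseConvergenceCLM ℂ (RingHom.id ℂ) _ _ L, fun χ => rfl⟩

theorem exists_class {ψ : Rd d → ℝ} (hψ : IsCutoff ψ) {h : ℤ → Rd d → ℂ} (hh : Blocks ψ h)
    (hfin : ∑' j, pw j * supN (h j) < ⊤) :
    ∃ u : TempModPoly d, (∀ k, multC (dyadicSym ψ k) u = h k) ∧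
      ((∀ j x, star (h j x) = h j x) → IsReal u) := by
  obtain ⟨C, hC0, hC⟩ := exists_blocks_lip hψ
  have hS := tsum_pw_neighbours_lt_top hfin
  set b : ℤ → ℝ≥0∞ := fun j => pw j * (supN (h (j - 1)) + supN (h j) + supN (h (j + 1))) with hb
  set S := ∑' j, b j with hSdef
  have hdiff : ∀ x, ∑' j, ‖h j x - h j 0‖ₑ ≤ ofReal (C * ‖x‖) * S := by
    intro x
    rw [hSdef, ← ENNReal.tsum_mul_left]
    exact tsum_le_tsum fun j => hC h hh j x
  have hsummable : ∀ x, Summable fun j => h j x - h j 0 := by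
    intro x
    refine Summable.of_enorm ((hdiff x).trans_lt (mul_lt_top ofReal_lt_top hS)).ne
  set H : Rd d → ℂ := fun x => ∑' j, (h j x - h j 0) with hHdef
  have hHm : Measurable H := by
    have : ∀ x, HasSum (fun j => h j x - h j 0) (H x) := fun x => (hsummable x).hasSum
    refine measurable_of_tendsto_metrizable' (atTop : Filter (Finset ℤ))
      (f := fun s x => ∑ j ∈ s, (h j x - h j 0)) (fun s => ?_) (tendsto_pi_nhds.2 this)
    exact Finset.measurable_sum _ fun j _ => (hh.bm j).meas.sub_const _
  have hHb : ∀ x, ‖H x‖ ≤ (C * S.toReal) * ‖x‖ := by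
    intro x
    have h1 : ‖H x‖ₑ ≤ ofReal (C * ‖x‖) * S := enorm_tsum_le_tsum_enorm.trans (hdiff x)
    have h2 := toReal_mono (mul_lt_top ofReal_lt_top hS).ne h1
    rw [toReal_enorm, ENNReal.toReal_mul, ENNReal.toReal_ofReal (by positivity)] at h2
    linarith
  obtain ⟨T, hT⟩ := exists_distribution hHm (by positivity) hHb
  refine ⟨Submodule.Quotient.mk T, fun k => ?_, fun hreal => ⟨T, rfl, fun χ hχ => ?_⟩⟩
  · ext x
    have hsm := hψ.dyadic_smooth k
    have hl := hsm.l1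
    rw [multC_mk T hsm (hψ.dyadic_eventually_zero k), hatF_apply, hT]
    have hterm : ∀ j, ∫ y, (h j y - h j 0) * ker (dyadicSym ψ k) (x - y) =
        multF (dyadicSym ψ k) (h j) x := by
      intro j
      have h0 : ∫ y, h j 0 * ker (dyadicSym ψ k) (x - y) = 0 := by
        rw [integral_const_mul, integral_sub_left_eq_self (fun y => ker (dyadicSym ψ k) y),
          hl.integral_ker, (hψ.dyadic_eventually_zero k).self_of_nhds, mul_zero]
      have h1 : ∫ y, h j y * ker (dyadicSym ψ k) (x - y) = multF (dyadicSym ψ k) (h j) x := by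
        rw [multF_eq]
        congr 1 with y
        ring
      simp only [sub_mul]
      rw [integral_sub, h0, h1, sub_zero]
      · refine (integrable_multF hl (hh.bm j) x).congr (.of_forall fun y => ?_)
        simp only; ring
      · exact (hl.kint.comp_sub_left x).const_mul _
    have hswap : ∫ y, H y * (𝓕 (osc hsm.scaled x)) y =
        ∑' j, ∫ y, (h j y - h j 0) * ker (dyadicSym ψ k) (x - y) := by
      simp only [hHdef, ← hsm.ker_eq_fourier, ← tsum_mul_right]
      refine integral_tsum (fun j => ?_) ?_
      · exact (((hh.bm j).meas.sub_const _).mul ((continuous_ker hl.int).measurable.comp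
          (measurable_const.sub measurable_id))).aestronglyMeasurable
      · have h1 : ∀ j, ∫⁻ y, ‖(h j y - h j 0) * ker (dyadicSym ψ k) (x - y)‖ₑ ≤
            b j * ∫⁻ y, ofReal (C * ‖y‖) * ‖ker (dyadicSym ψ k) (x - y)‖ₑ := by
          intro j
          rw [← lintegral_const_mul']
          · refine lintegral_mono fun y => ?_
            rw [enorm_mul, ← mul_assoc]
            gcongr
            rw [mul_comm]
            exact hC h hh j y
          · exact ((ENNReal.le_tsum j).trans_lt hS).ne
        refine ((tsum_le_tsum h1).trans_lt ?_).ne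
        rw [ENNReal.tsum_mul_right]
        refine mul_lt_top hS ?_
        have h2 := ((𝓕 (osc hsm.scaled x) : 𝓢(Rd d, ℂ)).integrable_pow_mul volume 1).const_mul C
        refine lt_of_le_of_lt (lintegral_mono fun y => ?_) h2.2
        simp only [pow_one]
        rw [hsm.ker_eq_fourier, enorm_mul, enorm_mul, enorm_norm,
          ofReal_mul hC0, ofReal_norm, enorm_norm, mul_assoc,
          ← Real.enorm_of_nonneg hC0]
    rw [hswap]
    simp only [hterm]
    rw [tsum_eq_sum (s := {k - 1, k, k + 1}), hh.near k x, sum_insert, sum_insert,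
      Finset.sum_singleton, add_assoc]
    · simp
    · simp only [Finset.mem_insert, Finset.mem_singleton]; omega
    · intro j hj
      simp only [Finset.mem_insert, Finset.mem_singleton, not_or] at hj
      exact hh.far j k x hj.1 hj.2.1 hj.2.2
  · rw [hT, ← Complex.conj_eq_iff_im, ← integral_conj]
    congr 1 with x
    rw [map_mul]
    have h1 : (starRingEnd ℂ) (χ x) = χ x := Complex.conj_eq_iff_im.2 (hχ x)
    have h2 : (starRingEnd ℂ) (H x) = H x := by
      simp only [hHdef]
      rw [Complex.conj_tsum]
      congr 1 with j
      rw [map_sub]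
      congr 1
      · exact hreal j x
      · exact hreal j 0
    rw [h1, h2]

/-! ## Weights -/

/-- Admissible weights for Besov norms: at least `2^j`, and of finite growth. -/
structure Weight (wg : ℤ → ℝ≥0∞) (K : ℝ≥0∞) : Prop where
  pw_le : ∀ j, pw j ≤ wg j
  low : ∀ j (n : ℕ), wg (j - n) ≤ pw (-n) * wg j
  succ : ∀ j, wg (j + 1) ≤ K * wg j
  lt_top : K < ⊤

lemma pw_mono {i j : ℤ} (h : i ≤ j) : pw i ≤ pw j :=
  ofReal_le_ofReal (zpow_le_zpow_right₀ one_le_two h)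

lemma weight_pw : Weight pw 2 where
  pw_le _ := le_rfl
  low j n := by rw [← pw_add, add_comm, ← sub_eq_add_neg]
  succ j := by rw [pw_add, pw_one, mul_comm]
  lt_top := by norm_num

lemma tsum_pw_neg : ∑' n : ℕ, pw (-(n : ℤ)) = 2 := by
  have : ∀ n : ℕ, pw (-(n : ℤ)) = 2⁻¹ ^ n := by
    intro n
    rw [pw, two_zpow_le_of_nonneg, one_div, ENNReal.ofReal_pow (by norm_num),
      ENNReal.ofReal_inv_of_pos two_pos]
    norm_num
  simp only [this, ENNReal.tsum_geometric]
  norm_num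

/-! ## Norms of functions of `(x, z)` -/

/-- The restriction to the height `z`. -/
def at' (f : Rd d → ℝ → ℂ) (z : ℝ) : Rd d → ℂ := fun x => f x z

/-- The sup norm over all `(x, z)`. -/
def sN (f : Rd d → ℝ → ℂ) : ℝ≥0∞ := ⨆ z, supN (at' f z)

/-- The block norm `‖Δ_j f(·, z)‖_∞`. -/
def bl (ψ : Rd d → ℝ) (f : Rd d → ℝ → ℂ) (j : ℤ) (z : ℝ) : ℝ≥0∞ :=
  supN (multF (dyadicSym ψ j) (at' f z))

/-- The Chemin-Lerner norm with weight `wg`. -/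
def cl (ψ : Rd d → ℝ) (wg : ℤ → ℝ≥0∞) (f : Rd d → ℝ → ℂ) : ℝ≥0∞ :=
  ∑' j, wg j * ∫⁻ z, bl ψ f j z

/-- The norm of `L^∞ ∩ L̃^1(Ḃ_wg)`. -/
def nN (ψ : Rd d → ℝ) (wg : ℤ → ℝ≥0∞) (f : Rd d → ℝ → ℂ) : ℝ≥0∞ := sN f + cl ψ wg f

/-- Jointly measurable bounded functions. -/
structure JM (f : Rd d → ℝ → ℂ) : Prop where
  meas : Measurable (Function.uncurry f)
  fin : sN f < ⊤

lemma le_sN (f : Rd d → ℝ → ℂ) (x : Rd d) (z : ℝ) : ‖f x z‖ₑ ≤ sN f :=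
  (le_supN (at' f z) x).trans (le_iSup (fun z => supN (at' f z)) z)

lemma supN_at_le (f : Rd d → ℝ → ℂ) (z : ℝ) : supN (at' f z) ≤ sN f :=
  le_iSup (fun z => supN (at' f z)) z

lemma sN_le {f : Rd d → ℝ → ℂ} {M : ℝ≥0∞} (h : ∀ x z, ‖f x z‖ₑ ≤ M) : sN f ≤ M :=
  iSup_le fun z => iSup_le fun x => h x z

lemma JM.bm {f : Rd d → ℝ → ℂ} (hf : JM f) (z : ℝ) : BM (at' f z) :=
  ⟨hf.meas.comp (measurable_id.prodMk measurable_const), (supN_at_le f z).trans_lt hf.fin⟩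

lemma sN_add_le (f g : Rd d → ℝ → ℂ) : sN (f + g) ≤ sN f + sN g :=
  sN_le fun x z => (enorm_add_le _ _).trans (add_le_add (le_sN f x z) (le_sN g x z))

lemma sN_mul_le (f g : Rd d → ℝ → ℂ) : sN (f * g) ≤ sN f * sN g :=
  sN_le fun x z => (enorm_mul _ _).trans_le (mul_le_mul' (le_sN f x z) (le_sN g x z))

lemma sN_smul_le (c : ℂ) (f : Rd d → ℝ → ℂ) : sN (c • f) ≤ ‖c‖ₑ * sN f :=
  sN_le fun x z => (enorm_mul _ _).trans_le (mul_le_mul' le_rfl (le_sN f x z))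

lemma JM.add {f g : Rd d → ℝ → ℂ} (hf : JM f) (hg : JM g) : JM (f + g) :=
  ⟨hf.meas.add hg.meas, (sN_add_le f g).trans_lt (ENNReal.add_lt_top.2 ⟨hf.fin, hg.fin⟩)⟩

lemma JM.mul {f g : Rd d → ℝ → ℂ} (hf : JM f) (hg : JM g) : JM (f * g) :=
  ⟨hf.meas.mul hg.meas, (sN_mul_le f g).trans_lt (mul_lt_top hf.fin hg.fin)⟩

lemma JM.smul {f : Rd d → ℝ → ℂ} (c : ℂ) (hf : JM f) : JM (c • f) :=
  ⟨hf.meas.const_smul c, (sN_smul_le c f).trans_lt (mul_lt_top enorm_lt_top hf.fin)⟩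

lemma JM.zero : JM (0 : Rd d → ℝ → ℂ) :=
  ⟨measurable_const, (sN_le (M := 0) fun x z => by simp).trans_lt (by simp)⟩

lemma JM.neg {f : Rd d → ℝ → ℂ} (hf : JM f) : JM (-f) := by
  have := hf.smul (-1); rwa [neg_one_smul] at this

lemma JM.sub {f g : Rd d → ℝ → ℂ} (hf : JM f) (hg : JM g) : JM (f - g) := by
  rw [sub_eq_add_neg]; exact hf.add hg.neg

lemma JM.sum {ι : Type*} {s : Finset ι} {f : ι → Rd d → ℝ → ℂ} (hf : ∀ i ∈ s, JM (f i)) :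
    JM (∑ i ∈ s, f i) := by
  classical
  induction s using Finset.induction_on with
  | empty => exact JM.zero
  | insert a s ha ih =>
    rw [sum_insert ha]
    exact (hf a (Finset.mem_insert_self _ _)).add
      (ih fun i hi => hf i (Finset.mem_insert_of_mem hi))

/-! ### Measurability -/

lemma measurable_multF_slice {m : Rd d → ℂ} (hm : L1Sym m) {f : Rd d → ℝ → ℂ}
    (hf : Measurable (Function.uncurry f)) :
    Measurable fun p : Rd d × ℝ => multF m (at' f p.2) p.1 := by
  have h1 : StronglyMeasurable fun q : (Rd d × ℝ) × Rd d => ker m (q.1.1 - q.2) * f q.2 q.1.2 := by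
    refine Measurable.stronglyMeasurable (Measurable.mul ?_ ?_)
    · have h3 : Measurable fun q : (Rd d × ℝ) × Rd d => q.1.1 - q.2 := by fun_prop
      simpa only [Function.comp_def] using (continuous_ker hm.int).measurable.comp h3
    · exact hf.comp (measurable_snd.prodMk (measurable_snd.comp measurable_fst))
  exact h1.integral_prod_right'.measurable

lemma measurable_supN_of_continuous {F : Rd d → ℝ → ℂ} (hm : Measurable (Function.uncurry F))
    (hc : ∀ z, Continuous (at' F z)) : Measurable fun z => supN (at' F z) := by
  obtain ⟨s, hs, hd⟩ := TopologicalSpace.exists_countable_dense (Rd d)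
  have : (fun z => supN (at' F z)) = fun z => ⨆ x ∈ s, ‖F x z‖ₑ := by
    ext z
    apply le_antisymm
    · refine iSup_le fun x => ?_
      have hcl : IsClosed {x | ‖F x z‖ₑ ≤ ⨆ x ∈ s, ‖F x z‖ₑ} :=
        isClosed_le (hc z).enorm continuous_const
      have hsub : s ⊆ {x | ‖F x z‖ₑ ≤ ⨆ x ∈ s, ‖F x z‖ₑ} := fun x hx =>
        le_iSup₂ (f := fun x (_ : x ∈ s) => ‖F x z‖ₑ) x hx
      exact hcl.closure_subset_iff.2 hsub (hd x)
    · exact iSup₂_le fun x _ => le_supN (at' F z) x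
  rw [this]
  exact Measurable.biSup s hs fun x _ => (hm.comp (measurable_const.prodMk measurable_id)).enorm

lemma measurable_bl {ψ : Rd d → ℝ} (hψ : IsCutoff ψ) {f : Rd d → ℝ → ℂ} (hf : JM f) (j : ℤ) :
    Measurable (bl ψ f j) :=
  measurable_supN_of_continuous (F := fun x z => multF (dyadicSym ψ j) (at' f z) x)
    (measurable_multF_slice (hψ.dyadic_smooth j).l1 hf.meas)
    (fun z => continuous_multF (hψ.dyadic_smooth j).l1 (hf.bm z))

/-! ### Algebra of the norms -/

section algebra

variable {ψ : Rd d → ℝ} (hψ : IsCutoff ψ) {wg : ℤ → ℝ≥0∞} {K : ℝ≥0∞}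

include hψ

omit hψ in
lemma cl_le_of_le {f g : Rd d → ℝ → ℂ} {c : ℝ≥0∞}
    (h : ∀ j, ∫⁻ z, bl ψ f j z ≤ c * ∫⁻ z, bl ψ g j z) : cl ψ wg f ≤ c * cl ψ wg g := by
  rw [cl, cl, ← ENNReal.tsum_mul_left]
  refine tsum_le_tsum fun j => ?_
  rw [mul_left_comm]
  gcongr
  exact h j

lemma cl_add_le {f g : Rd d → ℝ → ℂ} (hf : JM f) (hg : JM g) :
    cl ψ wg (f + g) ≤ cl ψ wg f + cl ψ wg g := by
  rw [cl, cl, cl, ← ENNReal.tsum_add]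
  refine tsum_le_tsum fun j => ?_
  rw [← mul_add, ← lintegral_add_left (measurable_bl hψ hf j)]
  gcongr with z
  have h : at' (f + g) z = at' f z + at' g z := rfl
  rw [bl, h, multF_add (hψ.dyadic_smooth j).l1 (hf.bm z) (hg.bm z)]
  exact supN_add_le _ _

omit hψ in
lemma cl_smul_le (c : ℂ) (f : Rd d → ℝ → ℂ) : cl ψ wg (c • f) ≤ ‖c‖ₑ * cl ψ wg f := by
  refine cl_le_of_le fun j => ?_
  rw [← lintegral_const_mul' _ _ enorm_ne_top]
  refine lintegral_mono fun z => ?_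
  have : multF (dyadicSym ψ j) (at' (c • f) z) =
      fun x => c * multF (dyadicSym ψ j) (at' f z) x := by
    ext x; exact multF_const_mul c _ (at' f z) x
  rw [bl, this, supN_const_mul]
  rfl

lemma nN_add_le {f g : Rd d → ℝ → ℂ} (hf : JM f) (hg : JM g) :
    nN ψ wg (f + g) ≤ nN ψ wg f + nN ψ wg g := by
  refine (add_le_add (sN_add_le f g) (cl_add_le hψ hf hg)).trans_eq ?_
  rw [nN, nN]; ring

omit hψ in
lemma nN_smul_le (c : ℂ) (f : Rd d → ℝ → ℂ) : nN ψ wg (c • f) ≤ ‖c‖ₑ * nN ψ wg f := by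
  rw [nN, nN, mul_add]
  exact add_le_add (sN_smul_le c f) (cl_smul_le c f)

omit hψ in
lemma nN_neg_le (f : Rd d → ℝ → ℂ) : nN ψ wg (-f) ≤ nN ψ wg f := by
  have := nN_smul_le (ψ := ψ) (wg := wg) (-1) f
  simpa using this

lemma nN_sub_le {f g : Rd d → ℝ → ℂ} (hf : JM f) (hg : JM g) :
    nN ψ wg (f - g) ≤ nN ψ wg f + nN ψ wg g := by
  rw [sub_eq_add_neg]
  exact (nN_add_le hψ hf hg.neg).trans (add_le_add le_rfl (nN_neg_le g))

omit hψ in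
lemma nN_zero : nN ψ wg (0 : Rd d → ℝ → ℂ) = 0 := by
  have := nN_smul_le (ψ := ψ) (wg := wg) 0 (0 : Rd d → ℝ → ℂ)
  simpa using this

lemma nN_sum_le {ι : Type*} {s : Finset ι} {f : ι → Rd d → ℝ → ℂ} (hf : ∀ i ∈ s, JM (f i)) :
    nN ψ wg (∑ i ∈ s, f i) ≤ ∑ i ∈ s, nN ψ wg (f i) := by
  classical
  induction s using Finset.induction_on with
  | empty => simp [nN_zero]
  | insert a s ha ih =>
    rw [sum_insert ha, sum_insert ha]
    have h1 := fun i hi => hf i (Finset.mem_insert_of_mem hi)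
    exact (nN_add_le hψ (hf a (Finset.mem_insert_self _ _)) (JM.sum h1)).trans
      (add_le_add le_rfl (ih h1))

lemma sum_tail_le (hwg : Weight wg K) {f : Rd d → ℝ → ℂ} (hf : JM f) :
    ∑' j, wg j * ∫⁻ z, tail ψ (j - 2) (at' f z) ≤ 2 * K ^ 2 * cl ψ wg f := by
  have h1 : ∀ j, ∫⁻ z, tail ψ (j - 2) (at' f z) = ∑' n : ℕ, ∫⁻ z, bl ψ f (j - 2 + n) z := fun j =>
    lintegral_tsum fun n => (measurable_bl hψ hf _).aemeasurable
  simp only [h1, ← ENNReal.tsum_mul_left]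
  rw [ENNReal.tsum_comm]
  have h2 : ∀ n : ℕ, ∑' j, wg j * ∫⁻ z, bl ψ f (j - 2 + n) z ≤
      pw (-(n : ℤ)) * (K ^ 2 * cl ψ wg f) := by
    intro n
    rw [← tsum_shift _ (2 - n : ℤ), cl, ← ENNReal.tsum_mul_left, ← ENNReal.tsum_mul_left]
    refine tsum_le_tsum fun j => ?_
    have e1 : j + (2 - n : ℤ) - 2 + n = j := by ring
    have e2 : j + (2 - n : ℤ) = (j + 1 + 1) - n := by ring
    rw [e1, e2, ← mul_assoc, ← mul_assoc]
    gcongr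
    calc wg (j + 1 + 1 - n) ≤ pw (-n) * wg (j + 1 + 1) := hwg.low _ n
      _ ≤ pw (-n) * (K * (K * wg j)) := by
          gcongr
          exact (hwg.succ _).trans (by gcongr; exact hwg.succ j)
      _ = _ := by ring
  refine (tsum_le_tsum h2).trans_eq ?_
  rw [ENNReal.tsum_mul_right, tsum_pw_neg, mul_assoc]

omit hψ in
/-- The constant in the algebra property. -/
def algC (ψ : Rd d → ℝ) (K : ℝ≥0∞) : ℝ≥0∞ := 1 + 2 * K ^ 2 * mulC ψ

lemma algC_lt_top (hwg : Weight wg K) : algC ψ K < ⊤ :=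
  ENNReal.add_lt_top.2 ⟨ENNReal.one_lt_top, mul_lt_top
    (mul_lt_top (by simp) (ENNReal.pow_lt_top hwg.lt_top)) (mulC_lt_top hψ)⟩

lemma measurable_tail {f : Rd d → ℝ → ℂ} (hf : JM f) (J : ℤ) :
    Measurable fun z => tail ψ J (at' f z) :=
  Measurable.tsum fun n => measurable_bl hψ hf (J + n)

lemma cl_mul_le (hwg : Weight wg K) {f g : Rd d → ℝ → ℂ} (hf : JM f) (hg : JM g) :
    cl ψ wg (f * g) ≤ 2 * K ^ 2 * mulC ψ * (cl ψ wg f * sN g + sN f * cl ψ wg g) := by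
  have h1 : ∀ j, ∫⁻ z, bl ψ (f * g) j z ≤ mulC ψ * ((∫⁻ z, tail ψ (j - 2) (at' f z)) * sN g +
      sN f * ∫⁻ z, tail ψ (j - 2) (at' g z)) := by
    intro j
    rw [← lintegral_mul_const _ (measurable_tail hψ hf _),
      ← lintegral_const_mul _ (measurable_tail hψ hg _),
      ← lintegral_add_left ((measurable_tail hψ hf _).mul_const _),
      ← lintegral_const_mul' _ _ (mulC_lt_top hψ).ne]
    refine lintegral_mono fun z => ?_
    refine (supN_block_mul_le hψ (hf.bm z) (hg.bm z) j).trans ?_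
    gcongr
    · exact supN_at_le g z
    · exact supN_at_le f z
  calc cl ψ wg (f * g) ≤ ∑' j, mulC ψ * (wg j * (∫⁻ z, tail ψ (j - 2) (at' f z)) * sN g +
        sN f * (wg j * ∫⁻ z, tail ψ (j - 2) (at' g z))) := by
        refine tsum_le_tsum fun j => ?_
        refine (mul_le_mul' le_rfl (h1 j)).trans_eq ?_
        ring
    _ = mulC ψ * ((∑' j, wg j * ∫⁻ z, tail ψ (j - 2) (at' f z)) * sN g +
        sN f * ∑' j, wg j * ∫⁻ z, tail ψ (j - 2) (at' g z)) := by
        rw [ENNReal.tsum_mul_left, ENNReal.tsum_add, ENNReal.tsum_mul_right, ENNReal.tsum_mul_left]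
    _ ≤ mulC ψ * ((2 * K ^ 2 * cl ψ wg f) * sN g + sN f * (2 * K ^ 2 * cl ψ wg g)) := by
        gcongr
        · exact sum_tail_le hψ hwg hf
        · exact sum_tail_le hψ hwg hg
    _ = _ := by ring

lemma nN_mul_le (hwg : Weight wg K) {f g : Rd d → ℝ → ℂ} (hf : JM f) (hg : JM g) :
    nN ψ wg (f * g) ≤ algC ψ K * nN ψ wg f * nN ψ wg g := by
  set c := 2 * K ^ 2 * mulC ψ with hc
  calc nN ψ wg (f * g) ≤ sN f * sN g + c * (cl ψ wg f * sN g + sN f * cl ψ wg g) :=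
        add_le_add (sN_mul_le f g) (cl_mul_le hψ hwg hf hg)
    _ ≤ sN f * sN g + c * (cl ψ wg f * sN g + sN f * cl ψ wg g) +
        (cl ψ wg f * sN g + sN f * cl ψ wg g + cl ψ wg f * cl ψ wg g + c * (sN f * sN g) +
        c * (cl ψ wg f * cl ψ wg g)) := le_self_add
    _ = algC ψ K * nN ψ wg f * nN ψ wg g := by
        rw [algC, nN, nN, ← hc]
        ring

omit hψ in
lemma multF_tsum_fun {m : Rd d → ℂ} (hm : L1Sym m) {ι : Type*} [Countable ι] {q : ι → Rd d → ℂ}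
    (hq : ∀ n, BM (q n)) (hs : ∑' n, supN (q n) < ⊤) (x : Rd d) :
    multF m (fun y => ∑' n, q n y) x = ∑' n, multF m (q n) x := by
  simp only [multF_eq, ← tsum_mul_left]
  refine integral_tsum (fun n => (integrable_multF hm (hq n) x).aestronglyMeasurable) ?_
  have h1 : ∀ n, ∫⁻ y, ‖ker m (x - y) * q n y‖ₑ ≤ symNorm m * supN (q n) := by
    intro n
    calc _ ≤ ∫⁻ y, ‖ker m (x - y)‖ₑ * supN (q n) := by
          refine lintegral_mono fun y => ?_
          rw [enorm_mul]
          gcongr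
          exact le_supN _ _
      _ = _ := by
          rw [lintegral_mul_const' _ _ (hq n).fin.ne,
            lintegral_sub_left_eq_self (fun y => ‖ker m y‖ₑ) x]
          rfl
  refine ((tsum_le_tsum h1).trans_lt ?_).ne
  rw [ENNReal.tsum_mul_left]
  exact mul_lt_top hm.symNorm_lt_top hs

/-- Countable subadditivity. -/
lemma bl_tsum_le {ι : Type*} [Countable ι] {f : ι → Rd d → ℝ → ℂ} (hf : ∀ n, JM (f n))
    (hs : ∑' n, sN (f n) < ⊤) (j : ℤ) (z : ℝ) :
    bl ψ (fun x z => ∑' n, f n x z) j z ≤ ∑' n, bl ψ (f n) j z := by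
  refine iSup_le fun x => ?_
  have h := multF_tsum_fun (hψ.dyadic_smooth j).l1 (fun n => (hf n).bm z)
    ((tsum_le_tsum fun n => supN_at_le (f n) z).trans_lt hs) x
  change ‖multF (dyadicSym ψ j) (fun y => ∑' n, at' (f n) z y) x‖ₑ ≤ _
  rw [h]
  exact enorm_tsum_le_tsum_enorm.trans (tsum_le_tsum fun n => le_supN _ x)

lemma nN_tsum_le {ι : Type*} [Countable ι] {f : ι → Rd d → ℝ → ℂ} (hf : ∀ n, JM (f n)) (hs : ∑' n, sN (f n) < ⊤) :
    JM (fun x z => ∑' n, f n x z) ∧ nN ψ wg (fun x z => ∑' n, f n x z) ≤ ∑' n, nN ψ wg (f n) := by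
  have hsum : ∀ x z, ∑' n, ‖f n x z‖ₑ ≤ ∑' n, sN (f n) := fun x z =>
    tsum_le_tsum fun n => le_sN (f n) x z
  have hsummable : ∀ x z, Summable fun n => f n x z := fun x z =>
    Summable.of_enorm ((hsum x z).trans_lt hs).ne
  have hsN : sN (fun x z => ∑' n, f n x z) ≤ ∑' n, sN (f n) :=
    sN_le fun x z => enorm_tsum_le_tsum_enorm.trans (hsum x z)
  have hmeas : Measurable (Function.uncurry fun x z => ∑' n, f n x z) := by
    refine measurable_of_tendsto_metrizable' atTop
      (f := fun (N : Finset ι) (p : Rd d × ℝ) => ∑ n ∈ N, f n p.1 p.2)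
      (fun N => ?_) (tendsto_pi_nhds.2 fun p => (hsummable p.1 p.2).hasSum)
    exact Finset.measurable_sum _ fun n _ => (hf n).meas
  have hJ : JM (fun x z => ∑' n, f n x z) := ⟨hmeas, hsN.trans_lt hs⟩
  refine ⟨hJ, ?_⟩
  simp only [nN]
  rw [ENNReal.tsum_add]
  refine add_le_add hsN ?_
  simp only [cl]
  rw [ENNReal.tsum_comm]
  refine tsum_le_tsum fun j => ?_
  rw [ENNReal.tsum_mul_left, ← lintegral_tsum fun n => (measurable_bl hψ (hf n) j).aemeasurable]
  gcongr with z
  exact bl_tsum_le hψ hf hs j z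

end algebra

/-! ## Layer potentials -/

/-- The potential `∫ a(D) exp(-|z-τ||D|) q(τ) dτ` over the `τ` with `(z, τ) ∈ S`. -/
def layer (S : Set (ℝ × ℝ)) (a : Rd d → ℂ) (q : Rd d → ℝ → ℂ) (x : Rd d) (z : ℝ) : ℂ :=
  ∫ τ in {τ | (z, τ) ∈ S}, multF (fun ζ => a ζ * poissonSym |z - τ| ζ) (at' q τ) x

lemma measurable_multF_poisson {a : Rd d → ℂ} (ha : Continuous a) {q : Rd d → ℝ → ℂ}
    (hq : Measurable (Function.uncurry q)) :
    Measurable fun p : (Rd d × ℝ) × ℝ =>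
      multF (fun ζ => a ζ * poissonSym |p.1.2 - p.2| ζ) (at' q p.2) p.1.1 := by
  have hk := measurable_ker_family (measurable_mul_poissonSym ha)
  have h1 : StronglyMeasurable fun r : ((Rd d × ℝ) × ℝ) × Rd d =>
      ker (fun ζ => a ζ * poissonSym |r.1.1.2 - r.1.2| ζ) (r.1.1.1 - r.2) * q r.2 r.1.2 := by
    refine Measurable.stronglyMeasurable (Measurable.mul ?_ ?_)
    · have h3 : Measurable fun r : ((Rd d × ℝ) × ℝ) × Rd d =>
        (|r.1.1.2 - r.1.2|, r.1.1.1 - r.2) := by fun_prop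
      simpa only [Function.comp_def] using hk.comp h3
    · exact hq.comp (measurable_snd.prodMk (measurable_snd.comp measurable_fst))
  exact h1.integral_prod_right'.measurable

lemma measurable_layer {S : Set (ℝ × ℝ)} (hS : MeasurableSet S) {a : Rd d → ℂ} (ha : Continuous a)
    {q : Rd d → ℝ → ℂ} (hq : Measurable (Function.uncurry q)) :
    Measurable (Function.uncurry (layer S a q)) := by
  have h1 : Function.uncurry (layer S a q) = fun p : Rd d × ℝ =>
      ∫ τ, Set.indicator {r : (Rd d × ℝ) × ℝ | (r.1.2, r.2) ∈ S} (fun r =>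
        multF (fun ζ => a ζ * poissonSym |r.1.2 - r.2| ζ) (at' q r.2) r.1.1) (p, τ) := by
    ext p
    have hSz : MeasurableSet {τ | (p.2, τ) ∈ S} := measurable_prodMk_left hS
    rw [Function.uncurry, layer, ← integral_indicator hSz]
    rfl
  rw [h1]
  have hS' : MeasurableSet {r : (Rd d × ℝ) × ℝ | (r.1.2, r.2) ∈ S} :=
    hS.preimage (by fun_prop : Measurable fun r : (Rd d × ℝ) × ℝ => (r.1.2, r.2))
  exact ((measurable_multF_poisson ha hq).indicator hS').stronglyMeasurable.integral_prod_right'.measurable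

section layer

variable {ψ : Rd d → ℝ} (hψ : IsCutoff ψ) {a : Rd d → ℂ} (ha : Deg1 a) {C : ℝ}
  {q : Rd d → ℝ → ℂ} {S : Set (ℝ × ℝ)}

lemma ae_pos_abs_sub (z : ℝ) : ∀ᵐ τ : ℝ, 0 < |z - τ| := by
  filter_upwards [compl_mem_ae_iff.2 (measure_singleton (z : ℝ))] with τ hτ
  exact abs_pos.2 (sub_ne_zero.2 fun h => hτ h.symm)

include hψ ha in
lemma lintegral_supN_poisson_le (hC : BlockBound ψ 1 a C) (hq : JM q) (z : ℝ) :
    ∫⁻ τ, supN (multF (fun ζ => a ζ * poissonSym |z - τ| ζ) (at' q τ)) ≤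
      ofReal C * cl ψ pw q := by
  calc _ ≤ ∫⁻ τ, ∑' j, ofReal C * pw j * bl ψ q j τ := by
        refine lintegral_mono_ae ?_
        filter_upwards [ae_pos_abs_sub z] with τ hτ
        refine (ha.supN_multF_le hψ hC hτ (hq.bm τ)).trans (tsum_le_tsum fun j => ?_)
        rw [pw, ← ofReal_mul hC.1]
        refine mul_le_mul' (ofReal_le_ofReal ?_) le_rfl
        have := decay_le 1 j (abs_nonneg (z - τ))
        rw [one_mul] at this
        exact mul_le_mul_of_nonneg_left this hC.1
    _ = _ := by
        rw [lintegral_tsum fun j => ((measurable_bl hψ hq j).const_mul _).aemeasurable, cl,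
          ← ENNReal.tsum_mul_left]
        refine tsum_congr fun j => ?_
        rw [lintegral_const_mul _ (measurable_bl hψ hq j), mul_assoc]

lemma measurable_slice_multF_poisson (hq : JM q) (ha : Continuous a) (x : Rd d) (z : ℝ) :
    Measurable fun τ => multF (fun ζ => a ζ * poissonSym |z - τ| ζ) (at' q τ) x := by
  have h := measurable_multF_poisson ha hq.meas
  have h2 : Measurable fun τ : ℝ => ((x, z), τ) := by fun_prop
  simpa only [Function.comp_def] using h.comp h2

include hψ ha in
lemma integrable_multF_poisson (hq : JM q) (hc : cl ψ pw q < ⊤) (x : Rd d) (z : ℝ) :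
    Integrable fun τ => multF (fun ζ => a ζ * poissonSym |z - τ| ζ) (at' q τ) x := by
  obtain ⟨C, hC⟩ := ha.hom.exists_symNorm_le hψ
  refine ⟨(measurable_slice_multF_poisson hq ha.cont x z).aestronglyMeasurable, ?_⟩
  exact (lintegral_mono fun _ => le_supN _ x).trans_lt
    ((lintegral_supN_poisson_le hψ ha hC hq z).trans_lt
      (mul_lt_top ofReal_lt_top hc))

include hψ ha in
lemma sN_layer_le (hC : BlockBound ψ 1 a C) (hq : JM q) :
    sN (layer S a q) ≤ ofReal C * cl ψ pw q :=
  sN_le fun x z => (enorm_integral_le_lintegral_enorm _).trans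
    ((setLIntegral_le_lintegral _ _).trans ((lintegral_mono fun _ => le_supN _ x).trans
      (lintegral_supN_poisson_le hψ ha hC hq z)))

include hψ ha in
lemma jm_layer (hS : MeasurableSet S) (hq : JM q) (hc : cl ψ pw q < ⊤) : JM (layer S a q) := by
  obtain ⟨C, hC⟩ := ha.hom.exists_symNorm_le hψ
  exact ⟨measurable_layer hS ha.cont hq.meas, (sN_layer_le hψ ha hC hq).trans_lt
      (mul_lt_top ofReal_lt_top hc)⟩

include hψ ha in
lemma multF_layer {m : Rd d → ℂ} (hm : L1Sym m) (hq : JM q) (hc : cl ψ pw q < ⊤)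
    (x : Rd d) (z : ℝ) : multF m (at' (layer S a q) z) x =
      ∫ τ in {τ | (z, τ) ∈ S}, multF (fun ζ => m ζ * (a ζ * poissonSym |z - τ| ζ)) (at' q τ) x := by
  obtain ⟨C, hC⟩ := ha.hom.exists_symNorm_le hψ
  simp only [multF_eq m, at', layer, ← integral_const_mul]
  rw [integral_integral_swap]
  · refine integral_congr_ae (ae_restrict_of_ae ?_)
    filter_upwards [ae_pos_abs_sub z] with τ hτ
    have := congrFun (multF_comp hm (ha.l1 hψ hτ) (hq.bm τ)) x
    exact this
  · have hmeas : Measurable fun p : Rd d × ℝ => ker m (x - p.1) *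
        multF (fun ζ => a ζ * poissonSym |z - p.2| ζ) (at' q p.2) p.1 := by
      refine Measurable.mul ?_ ?_
      · have h3 : Measurable fun p : Rd d × ℝ => x - p.1 := by fun_prop
        simpa only [Function.comp_def] using (continuous_ker hm.int).measurable.comp h3
      · have h3 : Measurable fun p : Rd d × ℝ => ((p.1, z), p.2) := by fun_prop
        simpa only [Function.comp_def] using (measurable_multF_poisson ha.cont hq.meas).comp h3
    refine ⟨hmeas.aestronglyMeasurable, ?_⟩
    change ∫⁻ p : Rd d × ℝ, ‖ker m (x - p.1) *
        multF (fun ζ => a ζ * poissonSym |z - p.2| ζ) (at' q p.2) p.1‖ₑ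
          ∂(volume.prod (volume.restrict _)) < ⊤
    rw [lintegral_prod_symm _ hmeas.enorm.aemeasurable]
    refine (setLIntegral_le_lintegral _ _).trans_lt ?_
    have h1 : ∀ τ, ∫⁻ y, ‖ker m (x - y) * multF (fun ζ => a ζ * poissonSym |z - τ| ζ) (at' q τ) y‖ₑ ≤
        symNorm m * supN (multF (fun ζ => a ζ * poissonSym |z - τ| ζ) (at' q τ)) := by
      intro τ
      rw [symNorm, ← lintegral_sub_left_eq_self (fun y => ‖ker m y‖ₑ) x,
        ← lintegral_mul_const _ (by
          have h3 : Measurable fun y : Rd d => x - y := by fun_prop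
          simpa only [Function.comp_def] using ((continuous_ker hm.int).measurable.comp h3).enorm)]
      refine lintegral_mono fun y => ?_
      rw [enorm_mul]
      gcongr
      exact le_supN _ y
    refine (lintegral_mono h1).trans_lt ?_
    rw [lintegral_const_mul' _ _ hm.symNorm_lt_top.ne]
    exact mul_lt_top hm.symNorm_lt_top ((lintegral_supN_poisson_le hψ ha hC hq z).trans_lt
      (mul_lt_top ofReal_lt_top hc))

include hψ ha in
lemma bl_layer_le (hC : BlockBound ψ 1 a C) (hq : JM q) (hc : cl ψ pw q < ⊤) (k : ℤ) (z : ℝ) :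
    bl ψ (layer S a q) k z ≤ ∫⁻ τ, ofReal (C * decay 1 k |z - τ|) * bl ψ q k τ := by
  refine iSup_le fun x => ?_
  rw [multF_layer hψ ha (hψ.dyadic_smooth k).l1 hq hc]
  refine (enorm_integral_le_lintegral_enorm _).trans ((setLIntegral_le_lintegral _ _).trans ?_)
  refine lintegral_mono fun τ => (le_supN _ x).trans ?_
  have : (fun ζ => dyadicSym ψ k ζ * (a ζ * poissonSym |z - τ| ζ)) =
      fun ζ => a ζ * poissonSym |z - τ| ζ * dyadicSym ψ k ζ := by ext; ring
  rw [this]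
  exact supN_multF_block_le hψ ha.hom hC (abs_nonneg _) k (hq.bm τ)

include hψ ha in
lemma cl_layer_le {wg : ℤ → ℝ≥0∞} (hC : BlockBound ψ 1 a C) (hq : JM q) (hc : cl ψ pw q < ⊤) :
    cl ψ wg (layer S a q) ≤ 16 * ofReal C * cl ψ wg q := by
  refine cl_le_of_le fun k => ?_
  refine (lintegral_mono fun z => bl_layer_le hψ ha hC hq hc k z).trans ?_
  have hm : Measurable fun p : ℝ × ℝ => ofReal (C * decay 1 k |p.1 - p.2|) * bl ψ q k p.2 := by
    refine Measurable.mul ?_ ((measurable_bl hψ hq k).comp measurable_snd)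
    have := continuous_decay 1 k
    exact Measurable.ennreal_ofReal (Continuous.measurable (by fun_prop))
  rw [lintegral_lintegral_swap hm.aemeasurable, ← lintegral_const_mul' _ _ (by finiteness)]
  refine lintegral_mono fun τ => ?_
  have hm' : Measurable fun z => ofReal (C * decay 1 k |z - τ|) := by
    have := continuous_decay 1 k
    exact Measurable.ennreal_ofReal (Continuous.measurable (by fun_prop))
  rw [lintegral_mul_const _ hm']
  gcongr
  simp only [ofReal_mul hC.1, abs_sub_comm _ τ]
  rw [lintegral_const_mul' _ _ ENNReal.ofReal_ne_top, mul_comm]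
  gcongr
  exact lintegral_decay_le k τ

include hψ ha in
lemma nN_layer_le {wg : ℤ → ℝ≥0∞} {K : ℝ≥0∞} (hwg : Weight wg K) (hC : BlockBound ψ 1 a C)
    (hq : JM q) (hc : cl ψ pw q < ⊤) :
    nN ψ wg (layer S a q) ≤ 17 * ofReal C * nN ψ wg q := by
  have h1 : cl ψ pw q ≤ cl ψ wg q :=
    tsum_le_tsum fun j => mul_le_mul' (hwg.pw_le j) le_rfl
  calc _ ≤ ofReal C * cl ψ wg q + 16 * ofReal C * cl ψ wg q :=
        add_le_add ((sN_layer_le hψ ha hC hq).trans (by gcongr)) (cl_layer_le hψ ha hC hq hc)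
    _ = 17 * ofReal C * cl ψ wg q := by ring
    _ ≤ _ := by gcongr; exact le_add_self

include hψ ha in
lemma layer_add {q' : Rd d → ℝ → ℂ} (hq : JM q) (hc : cl ψ pw q < ⊤) (hq' : JM q')
    (hc' : cl ψ pw q' < ⊤) : layer S a (q + q') = layer S a q + layer S a q' := by
  ext x z
  simp only [layer, Pi.add_apply]
  rw [← integral_add (integrable_multF_poisson hψ ha hq hc x z).restrict
    (integrable_multF_poisson hψ ha hq' hc' x z).restrict]
  refine integral_congr_ae (ae_restrict_of_ae ?_)
  filter_upwards [ae_pos_abs_sub z] with τ hτ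
  have : at' (q + q') τ = at' q τ + at' q' τ := rfl
  rw [this, multF_add (ha.l1 hψ hτ) (hq.bm τ) (hq'.bm τ)]
  rfl

end layer

lemma layer_congr {S : Set (ℝ × ℝ)} (hS : MeasurableSet S) (a : Rd d → ℂ) {q q' : Rd d → ℝ → ℂ}
    (z : ℝ) (h : ∀ᵐ τ, (z, τ) ∈ S → at' q τ =ᵐ[volume] at' q' τ) (x : Rd d) :
    layer S a q x z = layer S a q' x z := by
  refine setIntegral_congr_ae (measurable_prodMk_left hS) ?_
  filter_upwards [h] with τ hτ hS
  rw [multF_congr_ae _ (hτ hS)]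

/-! ## Harmonic extensions of Besov classes -/

/-- The Besov norm `∑ wg_j ‖Δ_j u‖_∞`. -/
def bes (ψ : Rd d → ℝ) (wg : ℤ → ℝ≥0∞) (u : TempModPoly d) : ℝ≥0∞ :=
  ∑' j, wg j * supN (multC (dyadicSym ψ j) u)

/-- `a(D) exp(-|z||D|) u`. -/
def harmF (ψ : Rd d → ℝ) (a : Rd d → ℂ) (u : TempModPoly d) (x : Rd d) (z : ℝ) : ℂ :=
  realize ψ (fun ζ => a ζ * poissonSym |z| ζ) u x

section classes

variable {ψ : Rd d → ℝ} (hψ : IsCutoff ψ)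

lemma multF_zero_sym (q : Rd d → ℂ) : multF (0 : Rd d → ℂ) q = 0 := by
  ext x
  have h := multF_const_mul_sym 0 (0 : Rd d → ℂ) q x
  have e : (fun ζ : Rd d => (0 : ℂ) * (0 : Rd d → ℂ) ζ) = 0 := by ext; simp
  rwa [e, zero_mul] at h

lemma smoothSym_zero : SmoothSym (0 : Rd d → ℂ) :=
  ⟨contDiff_const, HasCompactSupport.zero⟩

include hψ

lemma multC_zero_sym (u : TempModPoly d) : multC (0 : Rd d → ℂ) u = 0 := by
  have := multC_mul smoothSym_zero (hψ.dyadic_smooth 0) (hψ.dyadic_eventually_zero 0) u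
  rwa [zero_mul, multF_zero_sym] at this

lemma multC_poisson_block {s : ℤ} {a : Rd d → ℂ} (ha : Homog s a) (t : ℝ) (j : ℤ)
    (u : TempModPoly d) : multC (fun ζ => a ζ * poissonSym t ζ * dyadicSym ψ j ζ) u =
      multF (fun ζ => a ζ * poissonSym t ζ * fatSym ψ j ζ) (multC (dyadicSym ψ j) u) := by
  rw [← multC_mul (ha.smoothSym_fat hψ t j) (hψ.dyadic_smooth j) (hψ.dyadic_eventually_zero j),
    mul_fat_mul_dyadic hψ (fun ζ => a ζ * poissonSym t ζ)]

lemma multF_multC_dyadic (j k : ℤ) (u : TempModPoly d) :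
    multF (dyadicSym ψ k) (multC (dyadicSym ψ j) u) =
      multF (dyadicSym ψ j) (multC (dyadicSym ψ k) u) := by
  rw [← multC_mul (hψ.dyadic_smooth k) (hψ.dyadic_smooth j) (hψ.dyadic_eventually_zero j),
    ← multC_mul (hψ.dyadic_smooth j) (hψ.dyadic_smooth k) (hψ.dyadic_eventually_zero k), mul_comm]

lemma dyadic_mul_far {j k : ℤ} (h1 : j ≠ k - 1) (h2 : j ≠ k) (h3 : j ≠ k + 1) :
    dyadicSym ψ k * dyadicSym ψ j = 0 := by
  ext ζ
  rcases lt_or_ge j k with h | h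
  · rw [mul_comm]; exact hψ.dyadic_mul_eq_zero (by lia) ζ
  · exact hψ.dyadic_mul_eq_zero (by lia) ζ

lemma multF_multC_far {j k : ℤ} (h1 : j ≠ k - 1) (h2 : j ≠ k) (h3 : j ≠ k + 1)
    (u : TempModPoly d) : multF (dyadicSym ψ k) (multC (dyadicSym ψ j) u) = 0 := by
  rw [← multC_mul (hψ.dyadic_smooth k) (hψ.dyadic_smooth j) (hψ.dyadic_eventually_zero j),
    dyadic_mul_far hψ h1 h2 h3, multC_zero_sym hψ]

lemma bm_multC {wg : ℤ → ℝ≥0∞} {K : ℝ≥0∞} (hwg : Weight wg K) {u : TempModPoly d}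
    (hu : bes ψ wg u < ⊤) (j : ℤ) : BM (multC (dyadicSym ψ j) u) := by
  refine ⟨(continuous_multC (hψ.dyadic_smooth j) (hψ.dyadic_eventually_zero j) u).measurable, ?_⟩
  have h1 : wg j * supN (multC (dyadicSym ψ j) u) < ⊤ := (ENNReal.le_tsum j).trans_lt hu
  have h2 : wg j ≠ 0 := fun h => pw_ne_zero j (le_zero_iff.1 ((hwg.pw_le j).trans_eq h))
  by_contra h
  rw [not_lt, top_le_iff] at h
  rw [h, ENNReal.mul_top h2] at h1
  exact lt_irrefl _ h1

lemma blocks_multC {wg : ℤ → ℝ≥0∞} {K : ℝ≥0∞} (hwg : Weight wg K) {u : TempModPoly d}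
    (hu : bes ψ wg u < ⊤) : Blocks ψ fun j => multC (dyadicSym ψ j) u where
  bm := bm_multC hψ hwg hu
  near k x := by
    have hb := bm_multC hψ hwg hu k
    have h1 := (hψ.dyadic_smooth (k - 1)).l1
    have h2 := (hψ.dyadic_smooth k).l1
    have h3 := (hψ.dyadic_smooth (k + 1)).l1
    rw [multF_multC_dyadic hψ (k - 1) k, multF_multC_dyadic hψ (k + 1) k]
    have h4 := congrFun (multF_add_sym (h1.add h2) h3 hb) x
    rw [multF_add_sym h1 h2 hb] at h4
    refine Eq.trans ?_ h4
    rw [← multC_mul _ (hψ.dyadic_smooth k) (hψ.dyadic_eventually_zero k)]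
    · congr 1
      ext ζ
      exact (hψ.sum_dyadic_mul k ζ).symm
    · exact ⟨((hψ.dyadic_smooth (k - 1)).smooth.add (hψ.dyadic_smooth k).smooth).add
        (hψ.dyadic_smooth (k + 1)).smooth, ((hψ.dyadic_smooth (k - 1)).cpt.add
          (hψ.dyadic_smooth k).cpt).add (hψ.dyadic_smooth (k + 1)).cpt⟩
  far j k x h1 h2 h3 := congrFun (multF_multC_far hψ h1 h2 h3 u) x

end classes

section harmonic

variable {ψ : Rd d → ℝ} (hψ : IsCutoff ψ) {a : Rd d → ℂ} (ha : Deg1 a) {C : ℝ}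
  {wg : ℤ → ℝ≥0∞} {K : ℝ≥0∞} {u : TempModPoly d}

/-- One block of `a(D) exp(-|z||D|) u`. -/
def harmB (ψ : Rd d → ℝ) (a : Rd d → ℂ) (u : TempModPoly d) (j : ℤ) (x : Rd d) (z : ℝ) : ℂ :=
  multC (fun ζ => a ζ * poissonSym |z| ζ * dyadicSym ψ j ζ) u x

lemma harmF_eq (ψ : Rd d → ℝ) (a : Rd d → ℂ) (u : TempModPoly d) :
    harmF ψ a u = fun x z => ∑' j, harmB ψ a u j x z := rfl

include hψ ha

lemma sN_harmB_le (hC : BlockBound ψ 1 a C) (j : ℤ) :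
    sN (harmB ψ a u j) ≤ ofReal C * (pw j * supN (multC (dyadicSym ψ j) u)) := by
  refine sN_le fun x z => ?_
  rw [harmB, multC_poisson_block hψ ha.hom]
  refine (le_supN _ x).trans ((supN_multF_le (ha.hom.smoothSym_fat hψ _ j).l1.int _).trans ?_)
  rw [← mul_assoc, pw, ← ofReal_mul hC.1]
  gcongr
  refine (hC.2 j _ (abs_nonneg z)).trans (ofReal_le_ofReal ?_)
  have := decay_le 1 j (abs_nonneg z)
  rw [one_mul] at this
  exact mul_le_mul_of_nonneg_left this hC.1

lemma jm_harmB (hwg : Weight wg K) (hu : bes ψ wg u < ⊤) (j : ℤ) : JM (harmB ψ a u j) := by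
  obtain ⟨C, hC⟩ := ha.hom.exists_symNorm_le hψ
  have hb := bm_multC hψ hwg hu j
  refine ⟨?_, (sN_harmB_le hψ ha hC j).trans_lt
    (mul_lt_top ofReal_lt_top (mul_lt_top (pw_ne_top j).lt_top hb.fin))⟩
  have hk := measurable_ker_family (n := fun t ζ => a ζ * poissonSym t ζ * fatSym ψ j ζ)
    ((measurable_mul_poissonSym ha.cont).mul
      ((hψ.fat_smooth j).smooth.continuous.measurable.comp measurable_snd))
  have h1 : StronglyMeasurable fun r : (Rd d × ℝ) × Rd d =>
      ker (fun ζ => a ζ * poissonSym |r.1.2| ζ * fatSym ψ j ζ) (r.1.1 - r.2) *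
        multC (dyadicSym ψ j) u r.2 := by
    refine Measurable.stronglyMeasurable (Measurable.mul ?_ (hb.meas.comp measurable_snd))
    have h3 : Measurable fun r : (Rd d × ℝ) × Rd d => (|r.1.2|, r.1.1 - r.2) := by fun_prop
    simpa only [Function.comp_def] using hk.comp h3
  have h2 : Function.uncurry (harmB ψ a u j) = fun p : Rd d × ℝ => ∫ y,
      ker (fun ζ => a ζ * poissonSym |p.2| ζ * fatSym ψ j ζ) (p.1 - y) *
        multC (dyadicSym ψ j) u y := by
    ext p
    rw [Function.uncurry, harmB, multC_poisson_block hψ ha.hom]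
    rfl
  rw [h2]
  exact h1.integral_prod_right'.measurable

lemma bl_harmB_far (hwg : Weight wg K) (hu : bes ψ wg u < ⊤) {j k : ℤ} (h1 : j ≠ k - 1)
    (h2 : j ≠ k) (h3 : j ≠ k + 1) (z : ℝ) : bl ψ (harmB ψ a u j) k z = 0 := by
  have hb := bm_multC hψ hwg hu j
  have e : at' (harmB ψ a u j) z =
      multF (fun ζ => a ζ * poissonSym |z| ζ * fatSym ψ j ζ) (multC (dyadicSym ψ j) u) :=
    multC_poisson_block hψ ha.hom |z| j u
  have hf := (ha.hom.smoothSym_fat hψ |z| j).l1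
  have hk := (hψ.dyadic_smooth k).l1
  rw [bl, e, multF_comp hk hf hb, mul_comm, ← multF_comp hf hk hb,
    multF_multC_far hψ h1 h2 h3]
  refine le_zero_iff.1 ((supN_multF_le hf.int _).trans_eq ?_)
  simp [supN]

lemma lintegral_bl_harmB_le (hC : BlockBound ψ 1 a C) (j k : ℤ) :
    ∫⁻ z, bl ψ (harmB ψ a u j) k z ≤
      16 * ofReal C * symNorm (dyadicSym ψ 0) * supN (multC (dyadicSym ψ j) u) := by
  have h1 : ∀ z, bl ψ (harmB ψ a u j) k z ≤ ofReal (decay 1 j |0 - z|) *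
      (ofReal C * symNorm (dyadicSym ψ 0) * supN (multC (dyadicSym ψ j) u)) := by
    intro z
    have e : at' (harmB ψ a u j) z =
        multF (fun ζ => a ζ * poissonSym |z| ζ * fatSym ψ j ζ) (multC (dyadicSym ψ j) u) :=
      multC_poisson_block hψ ha.hom |z| j u
    rw [bl, e, zero_sub, abs_neg]
    calc _ ≤ symNorm (dyadicSym ψ k) * (ofReal (C * decay 1 j |z|) *
          supN (multC (dyadicSym ψ j) u)) :=
          (supN_multF_le (hψ.dyadic_smooth k).l1.int _).trans (by
            gcongr
            exact (supN_multF_le (ha.hom.smoothSym_fat hψ _ j).l1.int _).trans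
              (by gcongr; exact hC.2 j _ (abs_nonneg z)))
      _ = _ := by
          rw [symNorm_dyadic, ofReal_mul hC.1]
          ring
  refine (lintegral_mono h1).trans ?_
  have hm : Measurable fun z : ℝ => ofReal (decay 1 j |0 - z|) := by
    have := continuous_decay 1 j
    exact Measurable.ennreal_ofReal (Continuous.measurable (by fun_prop))
  rw [lintegral_mul_const _ hm]
  calc _ ≤ 16 * (ofReal C * symNorm (dyadicSym ψ 0) *
        supN (multC (dyadicSym ψ j) u)) := by
        gcongr
        exact lintegral_decay_le j 0
    _ = _ := by ring

lemma cl_harmB_le (hwg : Weight wg K) (hu : bes ψ wg u < ⊤) (hC : BlockBound ψ 1 a C) (j : ℤ) :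
    cl ψ wg (harmB ψ a u j) ≤ (K + 2) * (16 * ofReal C * symNorm (dyadicSym ψ 0)) *
      (wg j * supN (multC (dyadicSym ψ j) u)) := by
  set B := 16 * ofReal C * symNorm (dyadicSym ψ 0) * supN (multC (dyadicSym ψ j) u)
    with hB
  rw [cl, tsum_eq_sum (s := {j - 1, j, j + 1})]
  · rw [sum_insert (by simp; lia), sum_insert (by simp), Finset.sum_singleton]
    have hlow : wg (j - 1) ≤ wg j := by
      have h1 := hwg.low j 1
      push_cast at h1
      refine h1.trans (mul_le_of_le_one_left' ?_)
      rw [← pw_zero]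
      exact pw_mono (by norm_num)
    calc _ ≤ wg j * B + (wg j * B + K * wg j * B) := by
          refine add_le_add (mul_le_mul' hlow ?_) (add_le_add (mul_le_mul' le_rfl ?_)
            (mul_le_mul' (hwg.succ j) ?_)) <;> exact lintegral_bl_harmB_le hψ ha hC _ _
      _ = _ := by rw [hB]; ring
  · intro k hk
    simp only [Finset.mem_insert, Finset.mem_singleton, not_or] at hk
    have : ∀ z, bl ψ (harmB ψ a u j) k z = 0 := fun z =>
      bl_harmB_far hψ ha hwg hu (by lia) (by lia) (by lia) z
    simp [this]

omit hψ ha in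
/-- The constant in the bound of a harmonic extension. -/
def harmC (ψ : Rd d → ℝ) (K : ℝ≥0∞) (C : ℝ) : ℝ≥0∞ :=
  ofReal C + (K + 2) * (16 * ofReal C * symNorm (dyadicSym ψ 0))

omit ha in
lemma harmC_lt_top (hwg : Weight wg K) : harmC ψ K C < ⊤ := by
  have := hwg.lt_top
  have := (hψ.dyadic_smooth 0).l1.symNorm_lt_top
  unfold harmC
  finiteness

lemma tsum_sN_harmB_le (hwg : Weight wg K) (hC : BlockBound ψ 1 a C) :
    ∑' j, sN (harmB ψ a u j) ≤ ofReal C * bes ψ wg u := by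
  rw [bes, ← ENNReal.tsum_mul_left]
  refine tsum_le_tsum fun j => (sN_harmB_le hψ ha hC j).trans ?_
  gcongr
  exact hwg.pw_le j

lemma nN_harmF_le (hwg : Weight wg K) (hu : bes ψ wg u < ⊤) (hC : BlockBound ψ 1 a C) :
    JM (harmF ψ a u) ∧ nN ψ wg (harmF ψ a u) ≤ harmC ψ K C * bes ψ wg u := by
  have h1 := nN_tsum_le hψ (wg := wg) (jm_harmB hψ ha hwg hu)
    ((tsum_sN_harmB_le hψ ha hwg hC).trans_lt (by finiteness))
  refine ⟨h1.1, h1.2.trans ?_⟩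
  simp only [nN, harmC]
  rw [ENNReal.tsum_add, add_mul]
  refine add_le_add (tsum_sN_harmB_le hψ ha hwg hC) ?_
  rw [bes, ← ENNReal.tsum_mul_left]
  exact tsum_le_tsum fun j => cl_harmB_le hψ ha hwg hu hC j

end harmonic

/-! ## Quotients -/

lemma nN_div_le {ψ : Rd d → ℝ} (hψ : IsCutoff ψ) {wg : ℤ → ℝ≥0∞} {K : ℝ≥0∞} (hwg : Weight wg K)
    {c h : Rd d → ℝ → ℂ} (hc : JM c) (hh : JM h) (hs : algC ψ K * nN ψ wg h ≤ 2⁻¹) :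
    JM (fun x z => c x z / (1 + h x z)) ∧
      nN ψ wg (fun x z => c x z / (1 + h x z)) ≤ 2 * nN ψ wg c := by
  set g : ℕ → Rd d → ℝ → ℂ := fun n => c * (-h) ^ n with hg
  have hjm : ∀ n, JM (g n) := by
    intro n
    induction n with
    | zero => simpa [hg] using hc
    | succ n ih =>
      have : g (n + 1) = g n * (-h) := by simp only [hg]; rw [pow_succ, mul_assoc]
      rw [this]
      exact ih.mul hh.neg
  have h1 : sN h ≤ 2⁻¹ := by
    refine le_trans ?_ hs
    calc sN h ≤ nN ψ wg h := le_self_add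
      _ ≤ algC ψ K * nN ψ wg h := le_mul_of_one_le_left' le_self_add
  have hsN : ∀ n, sN (g n) ≤ 2⁻¹ ^ n * sN c := by
    intro n
    induction n with
    | zero => simp [hg]
    | succ n ih =>
      have : g (n + 1) = g n * (-h) := by simp only [hg]; rw [pow_succ, mul_assoc]
      rw [this]
      refine (sN_mul_le _ _).trans ?_
      have h2 : sN (-h) ≤ 2⁻¹ := by
        have := sN_smul_le (-1) h
        rw [neg_one_smul] at this
        exact this.trans (by simpa using h1)
      calc _ ≤ 2⁻¹ ^ n * sN c * 2⁻¹ := mul_le_mul' ih h2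
        _ = _ := by ring
  have hnN : ∀ n, nN ψ wg (g n) ≤ 2⁻¹ ^ n * nN ψ wg c := by
    intro n
    induction n with
    | zero => simp [hg]
    | succ n ih =>
      have : g (n + 1) = g n * (-h) := by simp only [hg]; rw [pow_succ, mul_assoc]
      rw [this]
      refine (nN_mul_le hψ hwg (hjm n) hh.neg).trans ?_
      calc _ ≤ algC ψ K * (2⁻¹ ^ n * nN ψ wg c) * nN ψ wg h :=
            mul_le_mul' (mul_le_mul' le_rfl ih) (nN_neg_le h)
        _ = (algC ψ K * nN ψ wg h) * (2⁻¹ ^ n * nN ψ wg c) := by ring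
        _ ≤ 2⁻¹ * (2⁻¹ ^ n * nN ψ wg c) := by gcongr
        _ = _ := by ring
  have hgeo : ∑' n : ℕ, (2⁻¹ : ℝ≥0∞) ^ n = 2 := by
    rw [ENNReal.tsum_geometric, ENNReal.one_sub_inv_two, inv_inv]
  have heq : (fun x z => c x z / (1 + h x z)) = fun x z => ∑' n, g n x z := by
    ext x z
    have hn : ‖-h x z‖ < 1 := by
      rw [norm_neg]
      have h2 : ‖h x z‖ₑ ≤ ofReal 2⁻¹ := by
        rw [ENNReal.ofReal_inv_of_pos two_pos, ENNReal.ofReal_ofNat]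
        exact (le_sN h x z).trans h1
      rw [← ofReal_norm, ENNReal.ofReal_le_ofReal_iff (by norm_num)] at h2
      exact h2.trans_lt (by norm_num)
    have h3 : ∀ n, g n x z = c x z * (-h x z) ^ n := fun n => rfl
    simp only [h3]
    rw [tsum_mul_left, tsum_geometric_of_norm_lt_one hn, sub_neg_eq_add, div_eq_mul_inv]
  rw [heq]
  have hfin : ∑' n, sN (g n) < ⊤ := by
    refine (tsum_le_tsum hsN).trans_lt ?_
    rw [ENNReal.tsum_mul_right, hgeo]
    have := hc.fin
    finiteness
  refine ⟨(nN_tsum_le hψ (wg := wg) hjm hfin).1, (nN_tsum_le hψ hjm hfin).2.trans ?_⟩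
  refine (tsum_le_tsum hnN).trans_eq ?_
  rw [ENNReal.tsum_mul_right, hgeo]

/-! ## A fixed point lemma -/

lemma exists_fixedPoint {V : Type*} [AddCommGroup V] (P : V → Prop) (N : V → ℝ≥0∞) (A : V → V)
    (hfin : ∀ x, P x → N x < ⊤) (h0 : P 0) (hPadd : ∀ x y, P x → P y → P (x + y))
    (hPneg : ∀ x, P x → P (-x))
    (hNadd : ∀ x y, P x → P y → N (x + y) ≤ N x + N y) (hNneg : ∀ x, P x → N (-x) ≤ N x)
    (hzero : ∀ x, P x → N x = 0 → x = 0)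
    (hcomplete : ∀ x : ℕ → V, (∀ n, P (x n)) → ∑' n, N (x n) < ⊤ → ∃ s, P s ∧
      ∀ M, N (s - ∑ n ∈ Finset.range M, x n) ≤ ∑' n, N (x (n + M)))
    (hAP : ∀ x, P x → P (A x)) (hAadd : ∀ x y, P x → P y → A (x + y) = A x + A y)
    (hA : ∀ x, P x → N (A x) ≤ 2⁻¹ * N x) {b : V} (hb : P b) :
    ∃ x, P x ∧ x = b + A x ∧ N x ≤ 2 * N b ∧ ∀ y, P y → y = b + A y → y = x := by
  have hA0 : A 0 = 0 := by
    have := hAadd 0 0 h0 h0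
    simpa using this
  have hAneg : ∀ x, P x → A (-x) = -A x := by
    intro x hx
    have := hAadd x (-x) hx (hPneg x hx)
    rw [add_neg_cancel, hA0] at this
    exact (neg_eq_of_add_eq_zero_right this.symm).symm
  have hPsub : ∀ x y, P x → P y → P (x - y) := fun x y hx hy => by
    rw [sub_eq_add_neg]; exact hPadd _ _ hx (hPneg y hy)
  have hAsub : ∀ x y, P x → P y → A (x - y) = A x - A y := fun x y hx hy => by
    rw [sub_eq_add_neg, hAadd _ _ hx (hPneg y hy), hAneg y hy, ← sub_eq_add_neg]
  have hgeo : ∑' n : ℕ, (2⁻¹ : ℝ≥0∞) ^ n = 2 := by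
    rw [ENNReal.tsum_geometric, ENNReal.one_sub_inv_two, inv_inv]
  set t : ℕ → V := fun n => A^[n] b with ht
  have htP : ∀ n, P (t n) := by
    intro n
    induction n with
    | zero => exact hb
    | succ n ih => simp only [ht, Function.iterate_succ_apply'] at ih ⊢; exact hAP _ ih
  have htN : ∀ n, N (t n) ≤ 2⁻¹ ^ n * N b := by
    intro n
    induction n with
    | zero => simp [ht]
    | succ n ih =>
      have e : t (n + 1) = A (t n) := Function.iterate_succ_apply' A n b
      rw [e]
      calc N (A (t n)) ≤ 2⁻¹ * N (t n) := hA _ (htP n)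
        _ ≤ 2⁻¹ * (2⁻¹ ^ n * N b) := by gcongr
        _ = _ := by ring
  have hsum : ∑' n, N (t n) ≤ 2 * N b := by
    refine (tsum_le_tsum htN).trans_eq ?_
    rw [ENNReal.tsum_mul_right, hgeo]
  have hsumt : ∑' n, N (t n) < ⊤ := hsum.trans_lt (mul_lt_top (by simp) (hfin b hb))
  obtain ⟨x, hxP, hx⟩ := hcomplete t htP hsumt
  set S : ℕ → V := fun M => ∑ n ∈ Finset.range M, t n with hS
  have hSP : ∀ M, P (S M) := by
    intro M
    induction M with
    | zero => simpa [hS] using h0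
    | succ M ih => simp only [hS, Finset.sum_range_succ] at ih ⊢; exact hPadd _ _ ih (htP M)
  have hSA : ∀ M, S (M + 1) = b + A (S M) := by
    intro M
    induction M with
    | zero => simp [hS, ht, hA0]
    | succ M ih =>
      have e1 : S (M + 1 + 1) = S (M + 1) + t (M + 1) := Finset.sum_range_succ _ _
      have e2 : S (M + 1) = S M + t M := Finset.sum_range_succ _ _
      have e3 : t (M + 1) = A (t M) := Function.iterate_succ_apply' A M b
      rw [e1, e3]
      nth_rewrite 2 [e2]
      rw [hAadd _ _ (hSP M) (htP M), ih]
      abel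
  have htail : Tendsto (fun M => ∑' n, N (t (n + M))) atTop (𝓝 0) :=
    ENNReal.tendsto_sum_nat_add (fun n => N (t n)) hsumt.ne
  have hxe : x = b + A x := by
    have hP' : P (x - (b + A x)) := hPsub _ _ hxP (hPadd _ _ hb (hAP _ hxP))
    have : N (x - (b + A x)) = 0 := by
      refine le_zero_iff.1 (ge_of_tendsto' (x := atTop)
        (f := fun M => (∑' n, N (t (n + (M + 1)))) + 2⁻¹ * ∑' n, N (t (n + M))) ?_ fun M => ?_)
      · have h1 := htail.comp (tendsto_add_atTop_nat 1)
        have h2 := ENNReal.Tendsto.const_mul (a := 2⁻¹) htail (Or.inr (by simp))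
        simpa using h1.add h2
      · have e : x - (b + A x) = (x - S (M + 1)) + -A (x - S M) := by
          rw [hSA, hAsub _ _ hxP (hSP M)]; abel
        rw [e]
        have hP1 := hPsub _ _ hxP (hSP M)
        have hP2 := hPsub _ _ hxP (hSP (M + 1))
        refine (hNadd _ _ hP2 (hPneg _ (hAP _ hP1))).trans (add_le_add (hx _) ?_)
        exact (hNneg _ (hAP _ hP1)).trans ((hA _ hP1).trans (mul_le_mul' le_rfl (hx M)))
    exact sub_eq_zero.1 (hzero _ hP' this)
  refine ⟨x, hxP, hxe, ?_, fun y hyP hy => ?_⟩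
  · have := hx 0
    simp only [Finset.range_zero, Finset.sum_empty, sub_zero, add_zero] at this
    exact this.trans hsum
  · have hD := hPsub _ _ hyP hxP
    have e : y - x = A (y - x) := by
      rw [hAsub _ _ hyP hxP]
      nth_rewrite 1 [hy, hxe]
      abel
    have h1 : N (y - x) ≤ 2⁻¹ * N (y - x) := by
      nth_rewrite 1 [e]; exact hA _ hD
    have h2 : N (y - x) = 0 := by
      by_contra hne
      have h3 : 2⁻¹ * N (y - x) < 1 * N (y - x) :=
        ENNReal.mul_lt_mul_left hne (hfin _ hD).ne ENNReal.one_half_lt_one |> (by simpa using ·)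
      rw [one_mul] at h3
      exact absurd h1 (not_le.2 h3)
    exact sub_eq_zero.1 (hzero _ hD h2)

/-! ## The elliptic system -/

/-- Fields `(∂_k v, ∂_z v)` on `ℝ^d × ℝ`. -/
abbrev Fld (d : ℕ) : Type := Option (Fin d) → Rd d → ℝ → ℂ

/-- `∂_k` for `some k` and `|D|` for `none`. -/
def symb : Option (Fin d) → Rd d → ℂ
  | some k => gradSym k
  | none => absSym

lemma deg1_symb (i : Option (Fin d)) : Deg1 (symb i) := by
  cases i with
  | none => exact deg1_absSym
  | some k => exact deg1_gradSym k

lemma exists_blockBound_of_homog {ψ : Rd d → ℝ} (hψ : IsCutoff ψ) {ι : Type*} [Fintype ι] {s : ℤ}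
    {a : ι → Rd d → ℂ} (ha : ∀ i, Homog s (a i)) : ∃ C : ℝ, ∀ i, BlockBound ψ s (a i) C := by
  choose C h0 hC using fun i => (ha i).exists_symNorm_le hψ
  refine ⟨∑ i, C i, fun i => ⟨sum_nonneg fun i _ => h0 i, fun j t ht =>
    (hC i j t ht).trans (ofReal_le_ofReal ?_)⟩⟩
  exact mul_le_mul_of_nonneg_right
    (single_le_sum (f := C) (fun i _ => h0 i) (Finset.mem_univ i)) (decay_nonneg s j t)

lemma exists_blockBound {ψ : Rd d → ℝ} (hψ : IsCutoff ψ) :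
    ∃ C : ℝ, ∀ i : Option (Fin d), BlockBound ψ 1 (symb i) C :=
  exists_blockBound_of_homog hψ fun i => (deg1_symb i).hom

/-- The first factor of `Q_a`. -/
def coef (h : Fld d) (x : Rd d) (z : ℝ) : ℂ :=
  (∑ k, h (some k) x z ^ 2 - h none x z) / (1 + h none x z)

/-- `Q_a` as a function of `∇H = h` and of the gradient `U`. -/
def qa (h U : Fld d) : Rd d → ℝ → ℂ := ∑ k, h (some k) * U (some k) - coef h * U none

/-- The field `∇H ∂_z v - ∂_z H ∇v`. -/
def qv (h U : Fld d) (k : Fin d) : Rd d → ℝ → ℂ :=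
  h (some k) * U none - h none * U (some k)

/-- Pairs `(z, τ)` with `τ` between `0` and `z`. -/
def below (σ : ℝ) : Set (ℝ × ℝ) := {p | 0 < σ * p.2 ∧ σ * p.2 < σ * p.1}

/-- Pairs `(z, τ)` with `τ` beyond `z`. -/
def beyond (σ : ℝ) : Set (ℝ × ℝ) := {p | 0 < σ * (p.2 - p.1)}

lemma measurableSet_below (σ : ℝ) : MeasurableSet (below σ) :=
  (measurableSet_lt measurable_const (by fun_prop : Measurable fun p : ℝ × ℝ => σ * p.2)).inter
    (measurableSet_lt (by fun_prop : Measurable fun p : ℝ × ℝ => σ * p.2)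
      (by fun_prop : Measurable fun p : ℝ × ℝ => σ * p.1))

lemma measurableSet_beyond (σ : ℝ) : MeasurableSet (beyond σ) :=
  measurableSet_lt measurable_const (by fun_prop)

open Classical in
/-- Restriction to the half-line `side σ`. -/
def ind (σ : ℝ) (f : Rd d → ℝ → ℂ) (x : Rd d) (z : ℝ) : ℂ := if z ∈ side σ then f x z else 0

/-- `w`, as a function of the gradient of `v`. -/
def wOp (σ : ℝ) (h U : Fld d) : Rd d → ℝ → ℂ :=
  (-σ : ℂ) • (∑ k, layer (beyond σ) (gradSym k) (qv h U k) +
    (σ : ℂ) • layer (beyond σ) absSym (qa h U))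

/-- `w + Q_a`. -/
def qt (σ : ℝ) (h U : Fld d) : Rd d → ℝ → ℂ := wOp σ h U + qa h U

/-- The gradient of `∫_0^z exp(-|z-z'||D|) (w + Q_a) dz'`. -/
def gradOp (σ : ℝ) (h U : Fld d) : Fld d
  | some k => ind σ ((σ : ℂ) • layer (below σ) (gradSym k) (qt σ h U))
  | none => ind σ (qt σ h U - layer (below σ) absSym (qt σ h U))

/-- Bounded measurable functions with finite Chemin-Lerner norm. -/
structure Good (ψ : Rd d → ℝ) (wg : ℤ → ℝ≥0∞) (f : Rd d → ℝ → ℂ) : Prop where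
  jm : JM f
  fin : nN ψ wg f < ⊤

/-- The norm of a field. -/
def nF (ψ : Rd d → ℝ) (wg : ℤ → ℝ≥0∞) (U : Fld d) : ℝ≥0∞ := ∑ i, nN ψ wg (U i)

section ind

variable {σ : ℝ} {f : Rd d → ℝ → ℂ}

lemma measurableSet_side (σ : ℝ) : MeasurableSet (side σ) :=
  measurableSet_lt measurable_const (by fun_prop)

lemma ind_of_mem {z : ℝ} (hz : z ∈ side σ) (x : Rd d) : ind σ f x z = f x z := if_pos hz

lemma ind_of_notMem {z : ℝ} (hz : z ∉ side σ) (x : Rd d) : ind σ f x z = 0 := if_neg hz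

lemma sN_ind_le : sN (ind σ f) ≤ sN f := by
  refine sN_le fun x z => ?_
  by_cases hz : z ∈ side σ
  · rw [ind_of_mem hz]; exact le_sN f x z
  · rw [ind_of_notMem hz]; simp

lemma bl_ind_le {ψ : Rd d → ℝ} (j : ℤ) (z : ℝ) : bl ψ (ind σ f) j z ≤ bl ψ f j z := by
  by_cases hz : z ∈ side σ
  · have : at' (ind σ f) z = at' f z := by ext x; exact ind_of_mem hz x
    rw [bl, this, bl]
  · have : at' (ind σ f) z = fun x => 0 * at' f z x := by
      ext x; rw [zero_mul]; exact ind_of_notMem hz x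
    have h2 : multF (dyadicSym ψ j) (fun x => 0 * at' f z x) = fun x => 0 := by
      ext x; rw [multF_const_mul, zero_mul]
    rw [bl, this, h2]
    simp [supN]

lemma nN_ind_le {ψ : Rd d → ℝ} {wg : ℤ → ℝ≥0∞} : nN ψ wg (ind σ f) ≤ nN ψ wg f :=
  add_le_add sN_ind_le (tsum_le_tsum fun j =>
    mul_le_mul' le_rfl (lintegral_mono fun z => bl_ind_le j z))

lemma JM.ind (hf : JM f) : JM (ind σ f) := by
  classical
  refine ⟨?_, sN_ind_le.trans_lt hf.fin⟩
  exact Measurable.ite ((measurableSet_side σ).preimage measurable_snd) hf.meas measurable_const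

lemma Good.ind {ψ : Rd d → ℝ} {wg : ℤ → ℝ≥0∞} (hf : Good ψ wg f) : Good ψ wg (ind σ f) :=
  ⟨hf.jm.ind, nN_ind_le.trans_lt hf.fin⟩

lemma ind_add (σ : ℝ) (f g : Rd d → ℝ → ℂ) : ind σ (f + g) = ind σ f + ind σ g := by
  ext x z
  by_cases hz : z ∈ side σ
  · simp [ind_of_mem hz]
  · simp [ind_of_notMem hz]

end ind

section elliptic

variable {ψ : Rd d → ℝ} (hψ : IsCutoff ψ) {wg : ℤ → ℝ≥0∞} {K : ℝ≥0∞} (hwg : Weight wg K)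
  {f g : Rd d → ℝ → ℂ} {h U V : Fld d} {σ : ℝ}

include hψ

lemma Good.add (hf : Good ψ wg f) (hg : Good ψ wg g) : Good ψ wg (f + g) :=
  ⟨hf.jm.add hg.jm, (nN_add_le hψ hf.jm hg.jm).trans_lt (ENNReal.add_lt_top.2 ⟨hf.fin, hg.fin⟩)⟩

omit hψ in
lemma Good.smul (c : ℂ) (hf : Good ψ wg f) : Good ψ wg (c • f) :=
  ⟨hf.jm.smul c, (nN_smul_le c f).trans_lt (mul_lt_top enorm_lt_top hf.fin)⟩

lemma Good.sub (hf : Good ψ wg f) (hg : Good ψ wg g) : Good ψ wg (f - g) := by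
  have := hf.add hψ (hg.smul (-1))
  rwa [neg_one_smul, ← sub_eq_add_neg] at this

omit hψ in
lemma Good.zero : Good ψ wg (0 : Rd d → ℝ → ℂ) := ⟨JM.zero, by rw [nN_zero]; simp⟩

lemma Good.sum {ι : Type*} {s : Finset ι} {f : ι → Rd d → ℝ → ℂ} (hf : ∀ i ∈ s, Good ψ wg (f i)) :
    Good ψ wg (∑ i ∈ s, f i) := by
  classical
  induction s using Finset.induction_on with
  | empty => exact Good.zero
  | insert a s ha ih =>
    rw [sum_insert ha]
    exact (hf a (Finset.mem_insert_self _ _)).add hψ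
      (ih fun i hi => hf i (Finset.mem_insert_of_mem hi))

include hwg

omit hψ in
lemma Good.cl_lt_top (hf : Good ψ wg f) : cl ψ pw f < ⊤ :=
  (tsum_le_tsum fun j => mul_le_mul' (hwg.pw_le j) le_rfl).trans_lt
    (le_add_self.trans_lt hf.fin)

lemma Good.mul (hf : Good ψ wg f) (hg : Good ψ wg g) : Good ψ wg (f * g) :=
  ⟨hf.jm.mul hg.jm, (nN_mul_le hψ hwg hf.jm hg.jm).trans_lt
    (mul_lt_top (mul_lt_top (algC_lt_top hψ hwg) hf.fin) hg.fin)⟩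

lemma Good.layer {S : Set (ℝ × ℝ)} (hS : MeasurableSet S) (i : Option (Fin d))
    (hf : Good ψ wg f) : Good ψ wg (layer S (symb i) f) := by
  obtain ⟨C, hC⟩ := exists_blockBound hψ
  have h1 := hf.cl_lt_top hwg
  exact ⟨jm_layer hψ (deg1_symb i) hS hf.jm h1,
    (nN_layer_le hψ (deg1_symb i) hwg (hC i) hf.jm h1).trans_lt (by have := hf.fin; finiteness)⟩

lemma good_coef (hh : ∀ i, Good ψ wg (h i)) (hs : algC ψ K * nN ψ wg (h none) ≤ 2⁻¹) :
    Good ψ wg (coef h) := by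
  have h1 : Good ψ wg (∑ k, h (some k) * h (some k) - h none) :=
    (Good.sum hψ fun k _ => (hh (some k)).mul hψ hwg (hh (some k))).sub hψ (hh none)
  have h2 := nN_div_le hψ hwg h1.jm (hh none).jm hs
  have h3 : coef h = fun x z => (∑ k, h (some k) * h (some k) - h none) x z / (1 + h none x z) := by
    ext x z
    simp [coef, pow_two, Finset.sum_apply]
  rw [h3]
  exact ⟨h2.1, h2.2.trans_lt (mul_lt_top (by simp) h1.fin)⟩

end elliptic

/-! ## Estimates for the elliptic system -/

/-- Smallness of the field `∇H`. -/
structure Small (ψ : Rd d → ℝ) (wg : ℤ → ℝ≥0∞) (K : ℝ≥0∞) (h : Fld d) (ε : ℝ≥0∞) : Prop where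
  jm : ∀ i, JM (h i)
  le : ∀ i, nN ψ wg (h i) ≤ ε
  small : algC ψ K * ε ≤ 2⁻¹

section linear

variable {h U V : Fld d} {σ : ℝ}

lemma qa_add : qa h (U + V) = qa h U + qa h V := by
  simp only [qa, Pi.add_apply, mul_add, Finset.sum_add_distrib]
  abel

lemma qv_add (k : Fin d) : qv h (U + V) k = qv h U k + qv h V k := by
  simp only [qv, Pi.add_apply, mul_add]
  abel

end linear

lemma nN_add_le_nF {ψ : Rd d → ℝ} {wg : ℤ → ℝ≥0∞} (U : Fld d) (k : Fin d) :
    nN ψ wg (U none) + nN ψ wg (U (some k)) ≤ nF ψ wg U := by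
  rw [nF, Fintype.sum_option]
  gcongr
  exact single_le_sum (f := fun k => nN ψ wg (U (some k))) (fun _ _ => zero_le)
    (Finset.mem_univ k)

lemma nN_le_nF {ψ : Rd d → ℝ} {wg : ℤ → ℝ≥0∞} (U : Fld d) (i : Option (Fin d)) :
    nN ψ wg (U i) ≤ nF ψ wg U :=
  single_le_sum (f := fun i => nN ψ wg (U i)) (fun _ _ => zero_le) (Finset.mem_univ i)

section estimates

variable {ψ : Rd d → ℝ} (hψ : IsCutoff ψ) {wg : ℤ → ℝ≥0∞} {K ε : ℝ≥0∞} (hwg : Weight wg K)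
  {h U V : Fld d} {σ : ℝ} {C : ℝ}

lemma Small.eps_lt_top (hs : Small ψ wg K h ε) : ε < ⊤ := by
  refine lt_of_le_of_lt ?_ (ENNReal.inv_lt_top.2 two_pos)
  exact (le_mul_of_one_le_left' le_self_add).trans hs.small

lemma Small.good (hs : Small ψ wg K h ε) (i : Option (Fin d)) : Good ψ wg (h i) :=
  ⟨hs.jm i, (hs.le i).trans_lt hs.eps_lt_top⟩

include hψ hwg

lemma Small.good_coef (hs : Small ψ wg K h ε) : Good ψ wg (coef h) :=
  Muskat.good_coef hψ hwg hs.good ((mul_le_mul' le_rfl (hs.le none)).trans hs.small)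

lemma Small.coef_le (hs : Small ψ wg K h ε) : nN ψ wg (coef h) ≤ 2 * (d + 1) * ε := by
  have hg := hs.good
  have h0 : ∀ k ∈ Finset.univ, Good ψ wg (h (some k) * h (some k)) := fun k _ =>
    (hg (some k)).mul hψ hwg (hg (some k))
  have h1 : Good ψ wg (∑ k, h (some k) * h (some k)) := Good.sum hψ h0
  have h2 := (nN_div_le hψ hwg (h1.sub hψ (hg none)).jm (hg none).jm
    ((mul_le_mul' le_rfl (hs.le none)).trans hs.small)).2
  have h3 : coef h = fun x z => (∑ k, h (some k) * h (some k) - h none) x z / (1 + h none x z) := by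
    ext x z
    simp [coef, pow_two, Finset.sum_apply]
  rw [← h3] at h2
  refine h2.trans ?_
  rw [mul_assoc]
  gcongr
  refine (nN_sub_le hψ h1.jm (hg none).jm).trans ?_
  rw [add_mul, one_mul]
  refine add_le_add ((nN_sum_le hψ fun k hk => (h0 k hk).jm).trans ?_) (hs.le none)
  refine (Finset.sum_le_card_nsmul _ _ ε fun k _ => ?_).trans_eq (by simp)
  refine (nN_mul_le hψ hwg (hg (some k)).jm (hg (some k)).jm).trans ?_
  calc _ ≤ algC ψ K * ε * ε := by gcongr <;> exact hs.le _
    _ ≤ 1 * ε := by gcongr; exact hs.small.trans (by norm_num)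
    _ = ε := one_mul ε

lemma Small.good_qa (hs : Small ψ wg K h ε) (hU : ∀ i, Good ψ wg (U i)) : Good ψ wg (qa h U) :=
  (Good.sum hψ fun k _ => (hs.good (some k)).mul hψ hwg (hU (some k))).sub hψ
    ((hs.good_coef hψ hwg).mul hψ hwg (hU none))

lemma Small.good_qv (hs : Small ψ wg K h ε) (hU : ∀ i, Good ψ wg (U i)) (k : Fin d) :
    Good ψ wg (qv h U k) :=
  ((hs.good (some k)).mul hψ hwg (hU none)).sub hψ ((hs.good none).mul hψ hwg (hU (some k)))

omit hψ hwg in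
/-- The constant in the bounds of `Q_a` and `Q_b`. -/
def qC (ψ : Rd d → ℝ) (K : ℝ≥0∞) : ℝ≥0∞ := algC ψ K * (2 * (d + 1))

lemma Small.qa_le (hs : Small ψ wg K h ε) (hU : ∀ i, Good ψ wg (U i)) :
    nN ψ wg (qa h U) ≤ qC ψ K * ε * nF ψ wg U := by
  have h0 : ∀ k ∈ Finset.univ, Good ψ wg (h (some k) * U (some k)) := fun k _ =>
    (hs.good (some k)).mul hψ hwg (hU (some k))
  have hc := hs.good_coef hψ hwg
  have h2 : (1 : ℝ≥0∞) ≤ 2 * (d + 1) := by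
    rw [two_mul]
    exact le_add_self.trans le_self_add
  calc nN ψ wg (qa h U) ≤ nN ψ wg (∑ k, h (some k) * U (some k)) + nN ψ wg (coef h * U none) :=
        nN_sub_le hψ (Good.sum hψ h0).jm (hc.mul hψ hwg (hU none)).jm
    _ ≤ ∑ k, algC ψ K * ε * nN ψ wg (U (some k)) +
        algC ψ K * (2 * (d + 1) * ε) * nN ψ wg (U none) := by
        refine add_le_add ((nN_sum_le hψ fun k hk => (h0 k hk).jm).trans
          (sum_le_sum fun k _ => ?_)) ?_
        · refine (nN_mul_le hψ hwg (hs.jm _) (hU _).jm).trans ?_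
          gcongr
          exact hs.le _
        · refine (nN_mul_le hψ hwg hc.jm (hU _).jm).trans ?_
          gcongr
          exact hs.coef_le hψ hwg
    _ ≤ ∑ k, algC ψ K * (2 * (d + 1)) * ε * nN ψ wg (U (some k)) +
        algC ψ K * (2 * (d + 1)) * ε * nN ψ wg (U none) := by
        refine add_le_add (sum_le_sum fun k _ => ?_) ?_
        · gcongr
          exact le_mul_of_one_le_right' h2
        · rw [mul_assoc (algC ψ K) (2 * _) ε]
    _ = _ := by
        rw [qC, nF, Fintype.sum_option, ← mul_sum]
        ring

lemma Small.qv_le (hs : Small ψ wg K h ε) (hU : ∀ i, Good ψ wg (U i)) (k : Fin d) :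
    nN ψ wg (qv h U k) ≤ qC ψ K * ε * nF ψ wg U := by
  have h2 : (1 : ℝ≥0∞) ≤ 2 * (d + 1) := by
    rw [two_mul]
    exact le_add_self.trans le_self_add
  calc nN ψ wg (qv h U k) ≤ nN ψ wg (h (some k) * U none) + nN ψ wg (h none * U (some k)) :=
        nN_sub_le hψ ((hs.good _).mul hψ hwg (hU none)).jm ((hs.good _).mul hψ hwg (hU _)).jm
    _ ≤ algC ψ K * ε * nN ψ wg (U none) + algC ψ K * ε * nN ψ wg (U (some k)) := by
        refine add_le_add ((nN_mul_le hψ hwg (hs.jm _) (hU _).jm).trans ?_)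
          ((nN_mul_le hψ hwg (hs.jm _) (hU _).jm).trans ?_) <;>
        · gcongr
          exact hs.le _
    _ = algC ψ K * 1 * ε * (nN ψ wg (U none) + nN ψ wg (U (some k))) := by ring
    _ ≤ _ := by
        rw [qC]
        gcongr
        exact nN_add_le_nF U k

lemma Small.good_wOp (hs : Small ψ wg K h ε) (hU : ∀ i, Good ψ wg (U i)) :
    Good ψ wg (wOp σ h U) := by
  have hS := measurableSet_beyond σ
  refine Good.smul _ (Good.add hψ (Good.sum hψ fun k _ => ?_) (Good.smul _ ?_))
  · exact (hs.good_qv hψ hwg hU k).layer hψ hwg hS (some k)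
  · exact (hs.good_qa hψ hwg hU).layer hψ hwg hS none

omit hψ hwg in
/-- The constant in the bound of `w`. -/
def wC (ψ : Rd d → ℝ) (K : ℝ≥0∞) (C : ℝ) : ℝ≥0∞ := 17 * ofReal C * (d + 1) * qC ψ K

lemma Small.wOp_le (hσ : ‖(σ : ℂ)‖ₑ = 1) (hC : ∀ i : Option (Fin d), BlockBound ψ 1 (symb i) C)
    (hs : Small ψ wg K h ε) (hU : ∀ i, Good ψ wg (U i)) :
    nN ψ wg (wOp σ h U) ≤ wC ψ K C * ε * nF ψ wg U := by
  have hS := measurableSet_beyond σ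
  have h1 := fun k => hs.good_qv hψ hwg hU k
  have h2 := hs.good_qa hψ hwg hU
  have h3 : ∀ k ∈ Finset.univ, Good ψ wg (layer (beyond σ) (gradSym k) (qv h U k)) := fun k _ =>
    (h1 k).layer hψ hwg hS (some k)
  have h4 : Good ψ wg (layer (beyond σ) absSym (qa h U)) := h2.layer hψ hwg hS none
  refine (nN_smul_le _ _).trans ?_
  rw [enorm_neg, hσ, one_mul]
  refine (nN_add_le hψ (Good.sum hψ h3).jm (h4.smul _).jm).trans ?_
  set c := 17 * ofReal C with hc
  calc _ ≤ ∑ k : Fin d, c * (qC ψ K * ε * nF ψ wg U) + c * (qC ψ K * ε * nF ψ wg U) := by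
        refine add_le_add ((nN_sum_le hψ fun k hk => (h3 k hk).jm).trans
          (sum_le_sum fun k _ => ?_)) ((nN_smul_le _ _).trans ?_)
        · refine (nN_layer_le hψ (deg1_symb (some k)) hwg (hC _) (h1 k).jm
            ((h1 k).cl_lt_top hwg)).trans ?_
          gcongr
          exact hs.qv_le hψ hwg hU k
        · rw [hσ, one_mul]
          refine (nN_layer_le hψ (deg1_symb none) hwg (hC _) h2.jm (h2.cl_lt_top hwg)).trans ?_
          gcongr
          exact hs.qa_le hψ hwg hU
    _ = _ := by
        rw [Finset.sum_const, Finset.card_univ, Fintype.card_fin, nsmul_eq_mul, wC]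
        ring

lemma Small.good_qt (hs : Small ψ wg K h ε) (hU : ∀ i, Good ψ wg (U i)) :
    Good ψ wg (qt σ h U) :=
  (hs.good_wOp hψ hwg hU).add hψ (hs.good_qa hψ hwg hU)

lemma Small.good_gradOp (hs : Small ψ wg K h ε) (hU : ∀ i, Good ψ wg (U i))
    (i : Option (Fin d)) : Good ψ wg (gradOp σ h U i) := by
  have hS := measurableSet_below σ
  have h1 := hs.good_qt hψ hwg (σ := σ) hU
  cases i with
  | none => exact (h1.sub hψ (h1.layer hψ hwg hS none)).ind
  | some k => exact ((h1.layer hψ hwg hS (some k)).smul _).ind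

omit hψ hwg in
/-- The constant in the contraction estimate. -/
def contrC (ψ : Rd d → ℝ) (K : ℝ≥0∞) (C : ℝ) : ℝ≥0∞ :=
  (d + 1) * (1 + 17 * ofReal C) * (wC ψ K C + qC ψ K)

lemma contrC_lt_top : contrC ψ K C < ⊤ := by
  have := algC_lt_top hψ hwg
  unfold contrC wC qC
  finiteness

lemma Small.gradOp_le (hσ : ‖(σ : ℂ)‖ₑ = 1) (hC : ∀ i : Option (Fin d), BlockBound ψ 1 (symb i) C)
    (hs : Small ψ wg K h ε) (hU : ∀ i, Good ψ wg (U i)) :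
    nF ψ wg (gradOp σ h U) ≤ contrC ψ K C * ε * nF ψ wg U := by
  have hS := measurableSet_below σ
  have h1 := hs.good_qt hψ hwg (σ := σ) hU
  set c := 17 * ofReal C with hc
  have hq : nN ψ wg (qt σ h U) ≤ (wC ψ K C + qC ψ K) * ε * nF ψ wg U := by
    refine (nN_add_le hψ (hs.good_wOp hψ hwg hU).jm (hs.good_qa hψ hwg hU).jm).trans ?_
    refine (add_le_add (hs.wOp_le hψ hwg hσ hC hU) (hs.qa_le hψ hwg hU)).trans_eq ?_
    ring
  have hl : ∀ i, nN ψ wg (layer (below σ) (symb i) (qt σ h U)) ≤ c * nN ψ wg (qt σ h U) := fun i =>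
    nN_layer_le hψ (deg1_symb i) hwg (hC i) h1.jm (h1.cl_lt_top hwg)
  have hi : ∀ i, nN ψ wg (gradOp σ h U i) ≤ (1 + c) * nN ψ wg (qt σ h U) := by
    intro i
    cases i with
    | none =>
      refine nN_ind_le.trans ((nN_sub_le hψ h1.jm (h1.layer hψ hwg hS none).jm).trans ?_)
      rw [add_mul, one_mul]
      exact add_le_add le_rfl (hl none)
    | some k =>
      refine nN_ind_le.trans ((nN_smul_le _ _).trans ?_)
      rw [hσ, one_mul]
      exact (hl (some k)).trans (mul_le_mul' le_add_self le_rfl)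
  calc nF ψ wg (gradOp σ h U) ≤ ∑ i : Option (Fin d), (1 + c) * nN ψ wg (qt σ h U) :=
        sum_le_sum fun i _ => hi i
    _ = (d + 1) * (1 + c) * nN ψ wg (qt σ h U) := by
        rw [Finset.sum_const, Finset.card_univ, Fintype.card_option, Fintype.card_fin,
          nsmul_eq_mul]
        push_cast
        ring
    _ ≤ (d + 1) * (1 + c) * ((wC ψ K C + qC ψ K) * ε * nF ψ wg U) := by gcongr
    _ = _ := by rw [contrC]; ring

/-! ### Linearity -/

lemma Small.wOp_add (hs : Small ψ wg K h ε) (hU : ∀ i, Good ψ wg (U i))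
    (hV : ∀ i, Good ψ wg (V i)) : wOp σ h (U + V) = wOp σ h U + wOp σ h V := by
  have h1 : ∀ k, layer (beyond σ) (gradSym k) (qv h (U + V) k) =
      layer (beyond σ) (gradSym k) (qv h U k) + layer (beyond σ) (gradSym k) (qv h V k) := by
    intro k
    have a := hs.good_qv hψ hwg hU k
    have b := hs.good_qv hψ hwg hV k
    rw [qv_add, layer_add hψ (deg1_gradSym k) a.jm (a.cl_lt_top hwg) b.jm (b.cl_lt_top hwg)]
  have a := hs.good_qa hψ hwg hU
  have b := hs.good_qa hψ hwg hV
  simp only [wOp, h1, qa_add, layer_add hψ deg1_absSym a.jm (a.cl_lt_top hwg) b.jm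
    (b.cl_lt_top hwg), Finset.sum_add_distrib, smul_add]
  abel

lemma Small.qt_add (hs : Small ψ wg K h ε) (hU : ∀ i, Good ψ wg (U i))
    (hV : ∀ i, Good ψ wg (V i)) : qt σ h (U + V) = qt σ h U + qt σ h V := by
  rw [qt, hs.wOp_add hψ hwg hU hV, qa_add, qt, qt]
  abel

lemma Small.gradOp_add (hs : Small ψ wg K h ε) (hU : ∀ i, Good ψ wg (U i))
    (hV : ∀ i, Good ψ wg (V i)) : gradOp σ h (U + V) = gradOp σ h U + gradOp σ h V := by
  have a := hs.good_qt hψ hwg (σ := σ) hU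
  have b := hs.good_qt hψ hwg (σ := σ) hV
  funext i
  cases i with
  | none =>
    simp only [gradOp, hs.qt_add hψ hwg hU hV, Pi.add_apply, layer_add hψ deg1_absSym a.jm
      (a.cl_lt_top hwg) b.jm (b.cl_lt_top hwg), ← ind_add]
    congr 1
    abel
  | some k =>
    simp only [gradOp, hs.qt_add hψ hwg hU hV, Pi.add_apply, layer_add hψ (deg1_gradSym k) a.jm
      (a.cl_lt_top hwg) b.jm (b.cl_lt_top hwg), ← ind_add, smul_add]

end estimates

/-! ## Existence and uniqueness for the elliptic system -/

/-- Almost everywhere equality of fields. -/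
def AEq (U V : Fld d) : Prop := ∀ i, ∀ᵐ z, at' (U i) z =ᵐ[volume] at' (V i) z

section aeq

variable {h U V W : Fld d} {σ : ℝ}

lemma AEq.of_eq (h : U = V) : AEq U V := fun i => by
  subst h; exact .of_forall fun z => EventuallyEq.rfl

lemma AEq.symm (h : AEq U V) : AEq V U := fun i => by
  filter_upwards [h i] with z hz using hz.symm

lemma AEq.trans (h₁ : AEq U V) (h₂ : AEq V W) : AEq U W := fun i => by
  filter_upwards [h₁ i, h₂ i] with z hz hz' using hz.trans hz'

lemma AEq.sub {U' V' : Fld d} (h : AEq U V) (h' : AEq U' V') : AEq (U - U') (V - V') := fun i => by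
  filter_upwards [h i, h' i] with z hz hz' using hz.sub hz'

lemma AEq.add {U' V' : Fld d} (h : AEq U V) (h' : AEq U' V') : AEq (U + U') (V + V') := fun i => by
  filter_upwards [h i, h' i] with z hz hz' using hz.add hz'

lemma AEq.all (hUV : AEq U V) : ∀ᵐ z, ∀ᵐ x, ∀ i, U i x z = V i x z := by
  filter_upwards [ae_all_iff.2 hUV] with z hz
  exact ae_all_iff.2 hz

lemma qa_congr_at {x : Rd d} {z : ℝ} (h' : ∀ i, U i x z = V i x z) :
    qa h U x z = qa h V x z := by
  simp only [qa, Pi.sub_apply, Finset.sum_apply, Pi.mul_apply, h']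

lemma qv_congr_at {x : Rd d} {z : ℝ} (h' : ∀ i, U i x z = V i x z) (k : Fin d) :
    qv h U k x z = qv h V k x z := by
  simp only [qv, Pi.sub_apply, Pi.mul_apply, h']

lemma wOp_congr_at (z : ℝ)
    (hUV : ∀ᵐ τ, (z, τ) ∈ beyond σ → ∀ᵐ x, ∀ i, U i x τ = V i x τ) (x : Rd d) :
    wOp σ h U x z = wOp σ h V x z := by
  have hS := measurableSet_beyond σ
  have h1 : ∀ k, layer (beyond σ) (gradSym k) (qv h U k) x z =
      layer (beyond σ) (gradSym k) (qv h V k) x z := fun k =>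
    layer_congr hS _ z (by
      filter_upwards [hUV] with τ hτ hm
      filter_upwards [hτ hm] with y hy using qv_congr_at hy k) x
  have h2 : layer (beyond σ) absSym (qa h U) x z = layer (beyond σ) absSym (qa h V) x z :=
    layer_congr hS _ z (by
      filter_upwards [hUV] with τ hτ hm
      filter_upwards [hτ hm] with y hy using qa_congr_at hy) x
  simp only [wOp, Pi.smul_apply, Pi.add_apply, Finset.sum_apply, h1, h2]

lemma AEq.wOp (hUV : AEq U V) : wOp σ h U = wOp σ h V := by
  ext x z
  refine wOp_congr_at z ?_ x
  filter_upwards [hUV.all] with τ hτ _ using hτ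

lemma AEq.qt (hUV : AEq U V) : ∀ᵐ z, at' (qt σ h U) z =ᵐ[volume] at' (qt σ h V) z := by
  filter_upwards [hUV.all] with z hz
  filter_upwards [hz] with x hx
  simp only [at', Muskat.qt, Pi.add_apply, hUV.wOp, qa_congr_at hx]

lemma ind_congr_at {f g : Rd d → ℝ → ℂ} {x : Rd d} {z : ℝ} (h : f x z = g x z) :
    ind σ f x z = ind σ g x z := by
  by_cases hz : z ∈ side σ
  · rw [ind_of_mem hz, ind_of_mem hz, h]
  · rw [ind_of_notMem hz, ind_of_notMem hz]

lemma AEq.gradOp (hUV : AEq U V) : AEq (gradOp σ h U) (gradOp σ h V) := by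
  have hq := hUV.qt (σ := σ) (h := h)
  have hl : ∀ (a : Rd d → ℂ) x z, layer (below σ) a (Muskat.qt σ h U) x z =
      layer (below σ) a (Muskat.qt σ h V) x z := fun a x z =>
    layer_congr (measurableSet_below σ) a z (by filter_upwards [hq] with τ hτ _ using hτ) x
  intro i
  filter_upwards [hq] with z hz
  filter_upwards [hz] with x hx
  simp only [at'] at hx ⊢
  cases i with
  | none => exact ind_congr_at (by simp only [Pi.sub_apply, hl, hx])
  | some k => exact ind_congr_at (by simp only [Pi.smul_apply, hl])

end aeq

section solve

variable {ψ : Rd d → ℝ} (hψ : IsCutoff ψ) {wg : ℤ → ℝ≥0∞} {K ε : ℝ≥0∞} (hwg : Weight wg K)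
  {h U V b : Fld d} {σ : ℝ} {C : ℝ}

lemma eq_zero_of_nF {U : Fld d} (h : nF ψ wg U = 0) : U = 0 := by
  ext i x z
  have h1 : sN (U i) = 0 := le_zero_iff.1 ((le_self_add.trans (nN_le_nF U i)).trans_eq h)
  have h2 := le_sN (U i) x z
  rw [h1] at h2
  simpa using h2

include hψ

lemma nF_complete {X : ℕ → Fld d} (hX : ∀ n i, Good ψ wg (X n i)) (hs : ∑' n, nF ψ wg (X n) < ⊤) :
    ∃ S : Fld d, (∀ i, Good ψ wg (S i)) ∧
      ∀ M, nF ψ wg (S - ∑ n ∈ Finset.range M, X n) ≤ ∑' n, nF ψ wg (X (n + M)) := by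
  have hshift : ∀ M, ∑' n, nF ψ wg (X (n + M)) ≤ ∑' n, nF ψ wg (X n) := fun M =>
    ENNReal.tsum_comp_le_tsum_of_injective (add_left_injective M) _
  have hsN : ∀ M i, ∑' n, sN (X (n + M) i) < ⊤ := fun M i =>
    (tsum_le_tsum fun n => le_self_add.trans (nN_le_nF (wg := wg) (ψ := ψ) (X (n + M)) i)).trans_lt
      ((hshift M).trans_lt hs)
  have hsum : ∀ i x z, Summable fun n => X n i x z := fun i x z =>
    Summable.of_enorm ((tsum_le_tsum fun n => le_sN (X n i) x z).trans_lt (hsN 0 i)).ne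
  have key : ∀ M i, JM (fun x z => ∑' n, X (n + M) i x z) ∧
      nN ψ wg (fun x z => ∑' n, X (n + M) i x z) ≤ ∑' n, nN ψ wg (X (n + M) i) := fun M i =>
    nN_tsum_le hψ (fun n => (hX (n + M) i).jm) (hsN M i)
  have hle : ∀ M, ∑ i, ∑' n, nN ψ wg (X (n + M) i) = ∑' n, nF ψ wg (X (n + M)) := fun M => by
    rw [← Summable.tsum_finsetSum fun _ _ => ENNReal.summable]; rfl
  refine ⟨fun i x z => ∑' n, X (n + 0) i x z, fun i => ⟨(key 0 i).1, (key 0 i).2.trans_lt ?_⟩,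
    fun M => ?_⟩
  · exact (tsum_le_tsum fun n => nN_le_nF (X (n + 0)) i).trans_lt hs
  · rw [← hle M]
    refine sum_le_sum fun i _ => ?_
    have : ((fun i x z => ∑' n, X (n + 0) i x z) - ∑ n ∈ Finset.range M, X n : Fld d) i =
        fun x z => ∑' n, X (n + M) i x z := by
      ext x z
      simp only [Pi.sub_apply, Finset.sum_apply, add_zero]
      rw [sub_eq_iff_eq_add', (hsum i x z).sum_add_tsum_nat_add M]
    rw [this]
    exact (key M i).2

include hwg

theorem Small.exists_solution (hσ : ‖(σ : ℂ)‖ₑ = 1)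
    (hC : ∀ i : Option (Fin d), BlockBound ψ 1 (symb i) C) (hs : Small ψ wg K h ε)
    (hc : contrC ψ K C * ε ≤ 2⁻¹) (hb : ∀ i, Good ψ wg (b i)) :
    ∃ U : Fld d, (∀ i, Good ψ wg (U i)) ∧ U = b + gradOp σ h U ∧ nF ψ wg U ≤ 2 * nF ψ wg b := by
  obtain ⟨U, h1, h2, h3, -⟩ := exists_fixedPoint (fun U : Fld d => ∀ i, Good ψ wg (U i)) (nF ψ wg)
    (gradOp σ h) (fun U hU => ENNReal.sum_lt_top.2 fun i _ => (hU i).fin)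
    (fun i => Good.zero) (fun U V hU hV i => (hU i).add hψ (hV i))
    (fun U hU i => by simpa using (hU i).smul (-1))
    (fun U V hU hV => by
      rw [nF, nF, nF, ← Finset.sum_add_distrib]
      exact sum_le_sum fun i _ => nN_add_le hψ (hU i).jm (hV i).jm)
    (fun U hU => sum_le_sum fun i _ => nN_neg_le (U i))
    (fun U _ h => eq_zero_of_nF h) (fun X hX hs => nF_complete hψ hX hs)
    (fun U hU => hs.good_gradOp hψ hwg hU) (fun U V hU hV => hs.gradOp_add hψ hwg hU hV)
    (fun U hU => (hs.gradOp_le hψ hwg hσ hC hU).trans (mul_le_mul' hc le_rfl)) hb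
  exact ⟨U, h1, h2, h3⟩

lemma Small.aeq_zero (hσ : ‖(σ : ℂ)‖ₑ = 1)
    (hC : ∀ i : Option (Fin d), BlockBound ψ 1 (symb i) C) (hs : Small ψ wg K h ε)
    (hc : contrC ψ K C * ε ≤ 2⁻¹) (hU : ∀ i, Good ψ wg (U i)) (hA : AEq U (gradOp σ h U)) :
    AEq U 0 := by
  have hgood : ∀ n i, Good ψ wg ((gradOp σ h)^[n] U i) := by
    intro n
    induction n with
    | zero => exact hU
    | succ n ih => rw [Function.iterate_succ_apply']; exact hs.good_gradOp hψ hwg ih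
  have hN : ∀ n, nF ψ wg ((gradOp σ h)^[n] U) ≤ 2⁻¹ ^ n * nF ψ wg U := by
    intro n
    induction n with
    | zero => simp
    | succ n ih =>
      rw [Function.iterate_succ_apply']
      refine (hs.gradOp_le hψ hwg hσ hC (hgood n)).trans ?_
      calc _ ≤ 2⁻¹ * (2⁻¹ ^ n * nF ψ wg U) := by gcongr
        _ = _ := by ring
  have hAn : ∀ n, AEq U ((gradOp σ h)^[n] U) := by
    intro n
    induction n with
    | zero => exact AEq.of_eq rfl
    | succ n ih => rw [Function.iterate_succ_apply']; exact hA.trans ih.gradOp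
  have hfin : nF ψ wg U ≠ ⊤ := (ENNReal.sum_lt_top.2 fun i _ => (hU i).fin).ne
  intro i
  filter_upwards [ae_all_iff.2 fun n => hAn n i] with z hz
  filter_upwards [ae_all_iff.2 hz] with x hx
  have h1 : ∀ n : ℕ, ‖U i x z‖ₑ ≤ 2⁻¹ ^ n * nF ψ wg U := by
    intro n
    have := hx n
    simp only [at'] at this
    rw [this]
    exact (le_sN _ x z).trans (le_self_add.trans ((nN_le_nF _ i).trans (hN n)))
  have h2 : Tendsto (fun n : ℕ => (2⁻¹ : ℝ≥0∞) ^ n * nF ψ wg U) atTop (𝓝 0) := by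
    have := ENNReal.Tendsto.mul_const (b := nF ψ wg U)
      (ENNReal.tendsto_pow_atTop_nhds_zero_of_lt_one ENNReal.one_half_lt_one) (Or.inr hfin)
    simpa using this
  have h3 := ge_of_tendsto' h2 h1
  simpa [at'] using h3

lemma Small.unique (hσ : ‖(σ : ℂ)‖ₑ = 1)
    (hC : ∀ i : Option (Fin d), BlockBound ψ 1 (symb i) C) (hs : Small ψ wg K h ε)
    (hc : contrC ψ K C * ε ≤ 2⁻¹) (hU : ∀ i, Good ψ wg (U i)) (hV : ∀ i, Good ψ wg (V i))
    (hUe : AEq U (b + gradOp σ h U)) (hVe : AEq V (b + gradOp σ h V)) : AEq U V := by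
  have hg : ∀ i, Good ψ wg ((U - V) i) := fun i => (hU i).sub hψ (hV i)
  have e : gradOp σ h U = gradOp σ h (U - V) + gradOp σ h V := by
    rw [← hs.gradOp_add hψ hwg hg hV, sub_add_cancel]
  have h1 : AEq (U - V) (gradOp σ h (U - V)) := by
    have := hUe.sub hVe
    rw [e] at this
    refine this.trans (AEq.of_eq ?_)
    abel
  have h2 := hs.aeq_zero hψ hwg hσ hC hc hg h1
  intro i
  filter_upwards [h2 i] with z hz
  filter_upwards [hz] with x hx
  simp only [at', Pi.sub_apply, Pi.zero_apply] at hx ⊢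
  exact sub_eq_zero.1 hx

end solve

/-! ## The Poisson semigroup as the height tends to zero -/

/-- The norm `∑ 2^j ‖Δ_j q‖_∞` of a function. -/
def besF (ψ : Rd d → ℝ) (q : Rd d → ℂ) : ℝ≥0∞ := ∑' j, pw j * supN (multF (dyadicSym ψ j) q)

lemma measurable_besF {ψ : Rd d → ℝ} (hψ : IsCutoff ψ) {q : Rd d → ℝ → ℂ} (hq : JM q) :
    Measurable fun z => besF ψ (at' q z) :=
  Measurable.tsum fun j => (measurable_bl hψ hq j).const_mul _

lemma lintegral_besF {ψ : Rd d → ℝ} (hψ : IsCutoff ψ) {q : Rd d → ℝ → ℂ} (hq : JM q) :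
    ∫⁻ z, besF ψ (at' q z) = cl ψ pw q := by
  change ∫⁻ z, ∑' j, pw j * bl ψ q j z = ∑' j, pw j * ∫⁻ z, bl ψ q j z
  rw [lintegral_tsum fun j => ((measurable_bl hψ hq j).const_mul _).aemeasurable]
  exact tsum_congr fun j => lintegral_const_mul _ (measurable_bl hψ hq j)

lemma measurable_multF_time {a : Rd d → ℂ} (ha : Continuous a) {q : Rd d → ℝ → ℂ}
    (hq : Measurable (Function.uncurry q)) :
    Measurable fun p : (Rd d × ℝ) × ℝ =>
      multF (fun ζ => a ζ * poissonSym p.2 ζ) (at' q p.1.2) p.1.1 := by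
  have hk := measurable_ker_family (measurable_mul_poissonSym ha)
  have h1 : StronglyMeasurable fun r : ((Rd d × ℝ) × ℝ) × Rd d =>
      ker (fun ζ => a ζ * poissonSym r.1.2 ζ) (r.1.1.1 - r.2) * q r.2 r.1.1.2 := by
    refine Measurable.stronglyMeasurable (Measurable.mul ?_ ?_)
    · have h3 : Measurable fun r : ((Rd d × ℝ) × ℝ) × Rd d => (r.1.2, r.1.1.1 - r.2) := by fun_prop
      simpa only [Function.comp_def] using hk.comp h3
    · exact hq.comp (measurable_snd.prodMk (measurable_snd.comp (measurable_fst.comp measurable_fst)))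
  exact h1.integral_prod_right'.measurable

section poisson

variable {ψ : Rd d → ℝ} (hψ : IsCutoff ψ) {a : Rd d → ℂ} (ha : Deg1 a) {C : ℝ}
  {q : Rd d → ℂ}

lemma measurable_multF_slice_time (ha : Continuous a) (hq : BM q) (x : Rd d) :
    Measurable fun s => multF (fun ζ => a ζ * poissonSym s ζ) q x := by
  have h1 := measurable_multF_time ha (q := fun x _ => q x) (hq.meas.comp measurable_fst)
  have h2 : Measurable fun s : ℝ => ((x, (0 : ℝ)), s) := by fun_prop
  have h3 := h1.comp h2
  simp only [Function.comp_def] at h3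
  exact h3

include hψ

lemma supN_multF_poisson_le (ha : Deg1 a) (hC : BlockBound ψ 1 a C) {t : ℝ} (ht : 0 < t)
    (hq : BM q) :
    supN (multF (fun ζ => a ζ * poissonSym t ζ) q) ≤ ofReal C * besF ψ q := by
  refine (ha.supN_multF_le hψ hC ht hq).trans ?_
  rw [besF, ← ENNReal.tsum_mul_left]
  refine tsum_le_tsum fun j => ?_
  rw [pw, ← mul_assoc, ← ofReal_mul hC.1]
  refine mul_le_mul' (ofReal_le_ofReal ?_) le_rfl
  have := decay_le 1 j ht.le
  rw [one_mul] at this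
  exact mul_le_mul_of_nonneg_left this hC.1

lemma norm_multF_poisson_le (ha : Deg1 a) (hC : BlockBound ψ 1 a C) {t : ℝ} (ht : 0 < t)
    (hq : BM q) (hb : besF ψ q < ⊤) (x : Rd d) :
    ‖multF (fun ζ => a ζ * poissonSym t ζ) q x‖ ≤ C * (besF ψ q).toReal := by
  have h := (le_supN _ x).trans (supN_multF_poisson_le hψ ha hC ht hq)
  rw [← toReal_enorm, ← ENNReal.toReal_ofReal hC.1, ← ENNReal.toReal_mul]
  exact toReal_mono (by finiteness) h

lemma intervalIntegrable_multF_poisson (ha : Deg1 a) (hq : BM q) (hb : besF ψ q < ⊤) (x : Rd d)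
    {t₀ t : ℝ} (h₀ : 0 ≤ t₀) (h : 0 ≤ t) :
    IntervalIntegrable (fun s => multF (fun ζ => a ζ * poissonSym s ζ) q x) volume t₀ t := by
  obtain ⟨C, hC⟩ := ha.hom.exists_symNorm_le hψ
  rw [intervalIntegrable_iff]
  have : IsFiniteMeasure (volume.restrict (Set.uIoc t₀ t)) := ⟨by simp [Set.uIoc]⟩
  refine Integrable.mono' (g := fun _ => C * (besF ψ q).toReal) (integrable_const _)
    (measurable_multF_slice_time ha.cont hq x).aestronglyMeasurable ?_
  filter_upwards [ae_restrict_mem measurableSet_uIoc] with s hs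
  exact norm_multF_poisson_le hψ ha hC ((le_min h₀ h).trans_lt hs.1) hq hb x

lemma poisson_sub [Nonempty (Fin d)] (hq : BM q) (x : Rd d) {t₀ t : ℝ} (h₀ : 0 < t₀)
    (h : t₀ ≤ t) : multF (poissonSym t₀) q x - multF (poissonSym t) q x =
      ∫ s in t₀..t, multF (fun ζ => absSym ζ * poissonSym s ζ) q x := by
  have ha := deg1_absSym (d := d)
  obtain ⟨C, hC⟩ := ha.hom.exists_symNorm_le hψ
  have ht := h₀.trans_le h
  rw [intervalIntegral.integral_of_le h]
  rw [← multF_integral (n := fun s ζ => absSym ζ * poissonSym s ζ)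
    (M := poissonSym t₀ + fun ζ => (-1) * poissonSym t ζ) (measurable_mul_poissonSym ha.cont)
    ?_ ?_ ?_ hq x]
  · rw [multF_add_sym (l1_poissonSym h₀) ((l1_poissonSym ht).const_mul _) hq, Pi.add_apply,
      multF_const_mul_sym]
    ring
  · have h1 := (integrable_const (1 : ℝ) (μ := volume.restrict (Set.Ioc t₀ t))).mul_prod
      (integrable_norm_mul_poisson (d := d) h₀)
    refine h1.mono' (measurable_mul_poissonSym ha.cont).aestronglyMeasurable ?_
    have hae : ∀ᵐ p : ℝ × Rd d ∂((volume.restrict (Set.Ioc t₀ t)).prod volume), t₀ ≤ p.1 := by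
      have h1 : ∀ᵐ s : ℝ ∂(volume.restrict (Set.Ioc t₀ t)), t₀ ≤ s := by
        filter_upwards [ae_restrict_mem measurableSet_Ioc] with s hs using hs.1.le
      exact Measure.quasiMeasurePreserving_fst.ae h1
    filter_upwards [hae] with p hp
    refine (ha.norm_mul_poisson_le p.1 p.2).trans ?_
    rw [one_mul]
    gcongr
  · intro ζ
    rw [integral_abs_mul_poissonSym h, Pi.add_apply]
    ring
  · refine (setLIntegral_mono (g := fun _ => (∑' j, ofReal (C * decay 1 j t₀)) *
      symNorm (dyadicSym ψ 0)) measurable_const fun s hs => ?_).trans_lt ?_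
    · refine (ha.symNorm_le hψ hC (h₀.trans hs.1)).trans ?_
      gcongr with j
      · exact hC.1
      · exact decay_anti 1 j hs.1.le
    · have h1 : ∑' j, ofReal (C * decay 1 j t₀) < ⊤ :=
        ((summable_decay h₀).mul_left C).tsum_ofReal_lt_top
      have h2 := (hψ.dyadic_smooth 0).l1.symNorm_lt_top
      rw [setLIntegral_const, Real.volume_Ioc]
      finiteness

lemma ae_sub_poisson_one [Nonempty (Fin d)] (hq : BM q) (hb : besF ψ q < ⊤) :
    ∀ᵐ x, q x - multF (poissonSym 1) q x =
      ∫ s in (0 : ℝ)..1, multF (fun ζ => absSym ζ * poissonSym s ζ) q x := by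
  have ha := deg1_absSym (d := d)
  obtain ⟨C, hC⟩ := ha.hom.exists_symNorm_le hψ
  set g : Rd d → ℂ := fun x => multF (poissonSym 1) q x +
    ∫ s in (0 : ℝ)..1, multF (fun ζ => absSym ζ * poissonSym s ζ) q x with hg
  set l : ℕ → ℝ := fun n => 1 / ((n : ℝ) + 1) with hl
  have hl0 : ∀ n, 0 < l n := fun n => by simp only [hl]; positivity
  have hl1 : ∀ n, l n ≤ 1 := fun n => by
    simp only [hl]
    rw [div_le_one (by positivity)]
    linarith [(Nat.cast_nonneg n : (0 : ℝ) ≤ n)]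
  have hlt : Tendsto l atTop (𝓝 0) := tendsto_one_div_add_atTop_nhds_zero_nat
  set B := C * (besF ψ q).toReal with hB
  have hclose : ∀ n x, ‖multF (poissonSym (l n)) q x - g x‖ ≤ B * l n := by
    intro n x
    have h1 := poisson_sub hψ hq x (hl0 n) (hl1 n)
    have h2 := intervalIntegral.integral_add_adjacent_intervals
      (intervalIntegrable_multF_poisson hψ ha hq hb x le_rfl (hl0 n).le)
      (intervalIntegrable_multF_poisson hψ ha hq hb x (hl0 n).le zero_le_one)
    have h3 : multF (poissonSym (l n)) q x - g x =
        -∫ s in (0 : ℝ)..l n, multF (fun ζ => absSym ζ * poissonSym s ζ) q x := by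
      rw [hg]
      simp only [← h2]
      linear_combination h1
    rw [h3, norm_neg]
    refine (intervalIntegral.norm_integral_le_of_norm_le_const (C := B) fun s hs => ?_).trans_eq ?_
    · rw [Set.uIoc_of_le (hl0 n).le] at hs
      exact norm_multF_poisson_le hψ ha hC hs.1 hq hb x
    · rw [sub_zero, abs_of_pos (hl0 n)]
  have hlim : ∀ x, Tendsto (fun n => multF (poissonSym (l n)) q x) atTop (𝓝 (g x)) := by
    intro x
    rw [tendsto_iff_norm_sub_tendsto_zero]
    refine squeeze_zero (fun n => norm_nonneg _) (fun n => hclose n x) ?_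
    simpa using hlt.const_mul B
  have hgm : Measurable g := measurable_of_tendsto_metrizable
    (fun n => (BM.multF (l1_poissonSym (hl0 n)) hq).meas) (tendsto_pi_nhds.2 hlim)
  have hqb := norm_le_supN hq.fin
  set A := (symNorm (poissonSym 1 : Rd d → ℂ)).toReal * (supN q).toReal with hA
  have hPb : ∀ n x, ‖multF (poissonSym (l n)) q x‖ ≤ A := by
    intro n x
    have h1 := (le_supN _ x).trans (supN_multF_le (l1_poissonSym (d := d) (hl0 n)).int q)
    rw [symNorm_poissonSym (hl0 n)] at h1
    rw [← toReal_enorm, hA, ← ENNReal.toReal_mul]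
    have h2 := (l1_poissonSym (d := d) one_pos).symNorm_lt_top
    have h3 := hq.fin
    exact toReal_mono (by finiteness) h1
  have hgb : ∀ x, ‖g x‖ ≤ A := fun x =>
    le_of_tendsto (hlim x).norm (.of_forall fun n => hPb n x)
  have hloc : ∀ {u : Rd d → ℂ} {M : ℝ}, Measurable u → (∀ x, ‖u x‖ ≤ M) →
      LocallyIntegrable u := fun {u M} hu hM =>
    (locallyIntegrable_const M).mono hu.aestronglyMeasurable
      (.of_forall fun x => (hM x).trans (le_abs_self M))
  have hae : q =ᵐ[volume] g := by
    refine ae_eq_of_integral_contDiff_smul_eq (hloc hq.meas hqb) (hloc hgm hgb)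
      fun χ hχ hχc => ?_
    have h1 := tendsto_integral_mul_multF (l1_poissonSym (d := d) one_pos) hχ.continuous hχc hq
      hl0 hlt
    have h2 : ∀ n, (fun ζ : Rd d => poissonSym 1 (l n • ζ)) = poissonSym (l n) := fun n => by
      ext ζ; rw [poissonSym_scale 1 (hl0 n), one_mul]
    simp only [h2] at h1
    have h3 : Tendsto (fun n => ∫ x, (χ x : ℂ) * multF (poissonSym (l n)) q x) atTop
        (𝓝 (∫ x, (χ x : ℂ) * g x)) := by
      refine tendsto_integral_of_dominated_convergence (fun x => ‖χ x‖ * A) (fun n => ?_) ?_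
        (fun n => .of_forall fun x => ?_) (.of_forall fun x => ?_)
      · exact ((Complex.continuous_ofReal.comp hχ.continuous).measurable.mul
          (BM.multF (l1_poissonSym (hl0 n)) hq).meas).aestronglyMeasurable
      · exact (hχ.continuous.integrable_of_hasCompactSupport hχc).norm.mul_const _
      · rw [norm_mul, norm_real]
        gcongr
        exact hPb n x
      · exact (hlim x).const_mul _
    have h4 := tendsto_nhds_unique h1 h3
    have h5 : (poissonSym 1 (0 : Rd d) : ℂ) = 1 := by simp [poissonSym]
    rw [h5, one_mul] at h4
    simpa only [Complex.real_smul] using h4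
  filter_upwards [hae] with x hx
  rw [hx, hg]
  ring

lemma sub_poisson_of_one [Nonempty (Fin d)] (hq : BM q) (hb : besF ψ q < ⊤) {x : Rd d}
    (hx : q x - multF (poissonSym 1) q x =
      ∫ s in (0 : ℝ)..1, multF (fun ζ => absSym ζ * poissonSym s ζ) q x) {t : ℝ} (ht : 0 < t) :
    q x - multF (poissonSym t) q x =
      ∫ s in (0 : ℝ)..t, multF (fun ζ => absSym ζ * poissonSym s ζ) q x := by
  have ha := deg1_absSym (d := d)
  have h2 := intervalIntegral.integral_add_adjacent_intervals
    (intervalIntegrable_multF_poisson hψ ha hq hb x le_rfl zero_le_one)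
    (intervalIntegrable_multF_poisson hψ ha hq hb x zero_le_one ht.le)
  rw [← h2, ← hx]
  rcases le_total t 1 with h | h
  · rw [intervalIntegral.integral_symm, ← poisson_sub hψ hq x ht h]
    ring
  · rw [← poisson_sub hψ hq x one_pos h]
    ring

end poisson

/-! ## The gradient of the Duhamel term -/

/-- `∫_0^z exp(-|z-z'||D|) q(z') dz'`. -/
def pot (q : Rd d → ℝ → ℂ) (x : Rd d) (z : ℝ) : ℂ :=
  ∫ z' in (0 : ℝ)..z, multF (poissonSym |z - z'|) (at' q z') x

section half

variable {σ : ℝ} (hσ : σ = 1 ∨ σ = -1)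

include hσ

omit hσ in
lemma below_slice (σ z : ℝ) : {y | (z, y) ∈ below σ} = {y | σ * 0 < σ * y ∧ σ * y < σ * z} := by
  simp [below]

lemma integral_between (g : ℝ → ℂ) {z' z : ℝ} (h : σ * z' ≤ σ * z) :
    ∫ y in {y | σ * z' < σ * y ∧ σ * y < σ * z}, g y = σ * ∫ y in z'..z, g y := by
  rcases hσ with rfl | rfl
  · have e : {y | (1 : ℝ) * z' < 1 * y ∧ 1 * y < 1 * z} = Set.Ioo z' z := by
      ext y; simp
    rw [e, intervalIntegral.integral_of_le (by linarith), integral_Ioc_eq_integral_Ioo]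
    simp
  · have e : {y | (-1 : ℝ) * z' < -1 * y ∧ -1 * y < -1 * z} = Set.Ioo z z' := by
      ext y; simp [and_comm]
    rw [e, intervalIntegral.integral_symm, intervalIntegral.integral_of_le (by linarith),
      integral_Ioc_eq_integral_Ioo]
    simp

lemma integral_below (g : ℝ → ℂ) {z : ℝ} (h : z ∈ side σ) :
    ∫ y in (0 : ℝ)..z, g y = σ * ∫ y in {y | (z, y) ∈ below σ}, g y := by
  have hz : 0 < σ * z := h
  rw [below_slice, integral_between hσ g (by simpa using hz.le), ← mul_assoc]
  rcases hσ with rfl | rfl <;> simp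

lemma integral_between_abs (g : ℝ → ℂ) {z' z : ℝ} (h : σ * z' ≤ σ * z) :
    ∫ y in {y | σ * z' < σ * y ∧ σ * y < σ * z}, g |y - z'| = ∫ s in (0 : ℝ)..|z - z'|, g s := by
  rw [integral_between hσ _ h]
  rcases hσ with rfl | rfl
  · have h' : z' ≤ z := by linarith
    rw [abs_of_nonneg (sub_nonneg.2 h')]
    have e : ∫ y in z'..z, g |y - z'| = ∫ y in z'..z, g (y - z') := by
      refine intervalIntegral.integral_congr fun y hy => ?_
      rw [Set.uIcc_of_le h'] at hy
      simp only [abs_of_nonneg (sub_nonneg.2 hy.1)]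
    rw [e, intervalIntegral.integral_comp_sub_right (fun s => g s) z']
    simp
  · have h' : z ≤ z' := by linarith
    rw [abs_of_nonpos (sub_nonpos.2 h'), neg_sub, intervalIntegral.integral_symm]
    have e : ∫ y in z..z', g |y - z'| = ∫ y in z..z', g (z' - y) := by
      refine intervalIntegral.integral_congr fun y hy => ?_
      rw [Set.uIcc_of_le h'] at hy
      simp only [abs_of_nonpos (sub_nonpos.2 hy.2), neg_sub]
    rw [e, intervalIntegral.integral_comp_sub_left (fun s => g s) z']
    simp

lemma volume_below_slice_le (z : ℝ) : volume {y | (z, y) ∈ below σ} ≤ ofReal |z| := by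
  rcases hσ with rfl | rfl
  · calc volume {y | (z, y) ∈ below 1} ≤ volume (Set.Ioo 0 z) :=
          measure_mono fun y hy => by simpa [below] using hy
      _ ≤ _ := by rw [Real.volume_Ioo, sub_zero]; exact ofReal_le_ofReal (le_abs_self z)
  · calc volume {y | (z, y) ∈ below (-1)} ≤ volume (Set.Ioo z 0) :=
          measure_mono fun y hy => by simpa [below, and_comm] using hy
      _ ≤ _ := by rw [Real.volume_Ioo, zero_sub]; exact ofReal_le_ofReal (neg_le_abs z)

end half

section pot

variable {ψ : Rd d → ℝ} (hψ : IsCutoff ψ) {q : Rd d → ℝ → ℂ} {σ : ℝ} (hσ : σ = 1 ∨ σ = -1)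

lemma one_mul_poissonSym (t : ℝ) :
    (fun ζ : Rd d => (1 : Rd d → ℂ) ζ * poissonSym t ζ) = poissonSym t := by
  ext ζ; simp

lemma measurable_slice_poisson (hq : JM q) (x : Rd d) (z : ℝ) :
    Measurable fun τ => multF (poissonSym |z - τ|) (at' q τ) x := by
  have h := measurable_slice_multF_poisson (a := 1) hq continuous_one x z
  simpa only [one_mul_poissonSym] using h

lemma supN_multF_poissonSym_le [Nonempty (Fin d)] {t : ℝ} (ht : 0 < t) (g : Rd d → ℂ) :
    supN (multF (poissonSym t) g) ≤ symNorm (poissonSym 1 : Rd d → ℂ) * supN g := by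
  rw [← symNorm_poissonSym ht]
  exact supN_multF_le (l1_poissonSym (d := d) ht).int g

include hσ in
lemma integrable_slice_poisson [Nonempty (Fin d)] (hq : JM q) (x : Rd d) (z : ℝ) :
    IntegrableOn (fun τ => multF (poissonSym |z - τ|) (at' q τ) x) {y | (z, y) ∈ below σ} := by
  have hfin : IsFiniteMeasure (volume.restrict {y | (z, y) ∈ below σ}) :=
    ⟨by
      rw [Measure.restrict_apply_univ]
      exact (volume_below_slice_le hσ z).trans_lt ofReal_lt_top⟩
  have h1 := (l1_poissonSym (d := d) one_pos).symNorm_lt_top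
  have h2 := hq.fin
  refine Integrable.mono' (integrable_const (symNorm (poissonSym 1 : Rd d → ℂ) * sN q).toReal)
    (measurable_slice_poisson hq x z).aestronglyMeasurable (ae_restrict_of_ae ?_)
  filter_upwards [ae_pos_abs_sub z] with τ hτ
  rw [← toReal_enorm]
  refine toReal_mono (by finiteness) ((le_supN _ x).trans
    ((supN_multF_poissonSym_le hτ _).trans ?_))
  gcongr
  exact supN_at_le q τ

include hψ in
lemma ae_besF_lt_top (hq : JM q) (hc : cl ψ pw q < ⊤) : ∀ᵐ τ, besF ψ (at' q τ) < ⊤ :=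
  ae_lt_top (measurable_besF hψ hq) (by rw [lintegral_besF hψ hq]; exact hc.ne)

include hψ in
lemma ae_sub_poisson [Nonempty (Fin d)] (hq : JM q) (hc : cl ψ pw q < ⊤) :
    ∀ᵐ x, ∀ᵐ τ, ∀ t, 0 < t → q x τ - multF (poissonSym t) (at' q τ) x =
      ∫ s in (0 : ℝ)..t, multF (fun ζ => absSym ζ * poissonSym s ζ) (at' q τ) x := by
  have hb := ae_besF_lt_top hψ hq hc
  have h1 : ∀ᵐ x, ∀ᵐ τ, q x τ - multF (poissonSym 1) (at' q τ) x =
      ∫ s in (0 : ℝ)..1, multF (fun ζ => absSym ζ * poissonSym s ζ) (at' q τ) x := by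
    rw [Measure.ae_ae_comm]
    · filter_upwards [hb] with τ hτ
      exact ae_sub_poisson_one hψ (hq.bm τ) hτ
    · refine measurableSet_eq_fun (hq.meas.sub
        (measurable_multF_slice (l1_poissonSym one_pos) hq.meas)) ?_
      simp only [intervalIntegral.integral_of_le zero_le_one]
      exact (measurable_multF_time (deg1_absSym (d := d)).cont hq.meas).stronglyMeasurable.integral_prod_right'.measurable
  filter_upwards [h1] with x hx
  filter_upwards [hx, hb] with τ hτ hτ' t ht
  exact sub_poisson_of_one hψ (hq.bm τ) hτ' hτ ht

include hψ hσ in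
/-- The vertical derivative of the Duhamel term, in integrated form. -/
lemma ae_pot_eq [Nonempty (Fin d)] (hq : JM q) (hc : cl ψ pw q < ⊤) :
    ∀ᵐ x, ∀ z ∈ side σ, pot q x z =
      σ * ∫ y in {y | (z, y) ∈ below σ}, (q x y - layer (below σ) absSym q x y) := by
  have ha := deg1_absSym (d := d)
  obtain ⟨C, hC⟩ := ha.hom.exists_symNorm_le hψ
  filter_upwards [ae_sub_poisson hψ hq hc] with x hx z hz
  have hz' : 0 < σ * z := hz
  set k : ℝ → ℝ → ℂ := fun τ y => multF (fun ζ => absSym ζ * poissonSym |y - τ| ζ) (at' q τ) x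
    with hk
  have hSz : MeasurableSet {y | (z, y) ∈ below σ} := measurable_prodMk_left (measurableSet_below σ)
  have hfin : IsFiniteMeasure (volume.restrict {y | (z, y) ∈ below σ}) :=
    ⟨by
      rw [Measure.restrict_apply_univ]
      exact (volume_below_slice_le hσ z).trans_lt ofReal_lt_top⟩
  have hkm : Measurable (Function.uncurry k) := by
    have h := measurable_multF_poisson ha.cont hq.meas
    have h2 : Measurable fun p : ℝ × ℝ => ((x, p.2), p.1) := by fun_prop
    have h3 := h.comp h2
    simp only [Function.comp_def] at h3
    exact h3
  set T : Set (ℝ × ℝ) := {p | σ * p.1 < σ * p.2} with hT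
  have hTm : MeasurableSet T := measurableSet_lt
    (by fun_prop : Measurable fun p : ℝ × ℝ => σ * p.1)
    (by fun_prop : Measurable fun p : ℝ × ℝ => σ * p.2)
  set μ := volume.restrict {y | (z, y) ∈ below σ} with hμ
  have hint : Integrable (T.indicator (Function.uncurry k)) (μ.prod μ) := by
    refine ⟨(hkm.indicator hTm).aestronglyMeasurable, ?_⟩
    refine lt_of_le_of_lt (b := ∫⁻ p, ofReal C * besF ψ (at' q p.1) ∂(μ.prod μ)) ?_ ?_
    · refine lintegral_mono fun p => ?_
      rw [enorm_indicator_eq_indicator_enorm]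
      refine Set.indicator_apply_le' (fun hp => ?_) fun _ => zero_le
      have hne : 0 < |p.2 - p.1| := by
        refine abs_pos.2 (sub_ne_zero.2 fun h => ?_)
        have h3 : σ * p.1 < σ * p.2 := hp
        rw [h] at h3
        exact lt_irrefl _ h3
      exact (le_supN _ x).trans (supN_multF_poisson_le hψ ha hC hne (hq.bm p.1))
    · have hm : Measurable fun τ => ofReal C * besF ψ (at' q τ) :=
        (measurable_besF hψ hq).const_mul _
      have hm' : Measurable fun p : ℝ × ℝ => ofReal C * besF ψ (at' q p.1) :=
        hm.comp measurable_fst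
      rw [lintegral_prod _ hm'.aemeasurable]
      simp only [lintegral_const]
      rw [lintegral_mul_const _ hm, lintegral_const_mul _ (measurable_besF hψ hq)]
      have h1 : ∫⁻ τ, besF ψ (at' q τ) ∂μ ≤ cl ψ pw q :=
        (setLIntegral_le_lintegral _ _).trans_eq (lintegral_besF hψ hq)
      have h2 := h1.trans_lt hc
      have h3 := measure_lt_top μ Set.univ
      finiteness
  have hswap := integral_integral_swap (f := fun τ y => T.indicator (Function.uncurry k) (τ, y)) hint
  have hqi : Integrable (fun y => q x y) μ :=
    Integrable.mono' (integrable_const (sN q).toReal)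
      (hq.meas.comp (measurable_const.prodMk measurable_id)).aestronglyMeasurable
      (.of_forall fun y => by
        rw [← toReal_enorm]
        exact toReal_mono hq.fin.ne (le_sN q x y))
  have hleft : ∀ᵐ τ ∂μ, multF (poissonSym |z - τ|) (at' q τ) x =
      q x τ - ∫ y, T.indicator (Function.uncurry k) (τ, y) ∂μ := by
    rw [hμ, ae_restrict_iff' hSz]
    filter_upwards [hx] with τ hτ hmem
    have hlt : σ * τ < σ * z := hmem.2
    have hpos : 0 < |z - τ| := by
      refine abs_pos.2 (sub_ne_zero.2 fun h => ?_)
      rw [h] at hlt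
      exact lt_irrefl _ hlt
    have e : ∫ y, T.indicator (Function.uncurry k) (τ, y) ∂volume.restrict {y | (z, y) ∈ below σ} =
        ∫ y in {y | σ * τ < σ * y ∧ σ * y < σ * z}, k τ y := by
      have hB : MeasurableSet {y | σ * τ < σ * y ∧ σ * y < σ * z} :=
        (measurableSet_lt measurable_const (by fun_prop : Measurable fun y : ℝ => σ * y)).inter
          (measurableSet_lt (by fun_prop : Measurable fun y : ℝ => σ * y) measurable_const)
      rw [← integral_indicator hSz, ← integral_indicator hB]
      congr 1 with y
      have hm1 : 0 < σ * τ := hmem.1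
      by_cases h1 : σ * τ < σ * y
      · by_cases h2 : σ * y < σ * z
        · have hy : y ∈ {y | (z, y) ∈ below σ} := ⟨hm1.trans h1, h2⟩
          have hy' : y ∈ {y | σ * τ < σ * y ∧ σ * y < σ * z} := ⟨h1, h2⟩
          have hy'' : (τ, y) ∈ T := h1
          rw [Set.indicator_of_mem hy, Set.indicator_of_mem hy', Set.indicator_of_mem hy'']
          rfl
        · have hy : y ∉ {y | (z, y) ∈ below σ} := fun h => h2 h.2
          have hy' : y ∉ {y | σ * τ < σ * y ∧ σ * y < σ * z} := fun h => h2 h.2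
          rw [Set.indicator_of_notMem hy, Set.indicator_of_notMem hy']
      · have hy' : y ∉ {y | σ * τ < σ * y ∧ σ * y < σ * z} := fun h => h1 h.1
        have hy'' : (τ, y) ∉ T := h1
        rw [Set.indicator_of_notMem hy']
        refine Set.indicator_apply_eq_zero.2 fun _ => ?_
        rw [Set.indicator_of_notMem hy'']
    rw [e, integral_between_abs hσ
      (fun s => multF (fun ζ => absSym ζ * poissonSym s ζ) (at' q τ) x) hlt.le, ← hτ _ hpos]
    ring
  have hright : ∀ᵐ y ∂μ, ∫ τ, T.indicator (Function.uncurry k) (τ, y) ∂μ =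
      layer (below σ) absSym q x y := by
    rw [hμ, ae_restrict_iff' hSz]
    refine .of_forall fun y hy => ?_
    have hB : MeasurableSet {τ | (y, τ) ∈ below σ} :=
      measurable_prodMk_left (measurableSet_below σ)
    rw [layer, ← integral_indicator hSz, ← integral_indicator hB]
    congr 1 with τ
    by_cases h1 : (y, τ) ∈ below σ
    · have hτ : τ ∈ {τ | (y, τ) ∈ below σ} := h1
      have hτ' : τ ∈ {y | (z, y) ∈ below σ} := ⟨h1.1, h1.2.trans hy.2⟩
      have hτ'' : (τ, y) ∈ T := h1.2
      rw [Set.indicator_of_mem hτ, Set.indicator_of_mem hτ', Set.indicator_of_mem hτ'']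
      rfl
    · have hτ : τ ∉ {τ | (y, τ) ∈ below σ} := h1
      rw [Set.indicator_of_notMem hτ]
      refine Set.indicator_apply_eq_zero.2 fun h2 => ?_
      have hτ'' : (τ, y) ∉ T := fun h3 => h1 ⟨h2.1, h3⟩
      rw [Set.indicator_of_notMem hτ'']
  rw [pot, integral_below hσ _ hz]
  congr 1
  rw [integral_congr_ae hleft, integral_sub hqi hint.integral_prod_left, hswap,
    integral_congr_ae hright, integral_sub hqi]
  exact hint.integral_prod_right.congr hright

lemma hasDerivAt_of_hasLineDerivAt {f : Rd d → ℂ} {f' : ℂ} {x e : Rd d} {t : ℝ}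
    (h : HasLineDerivAt ℝ f f' (x + t • e) e) : HasDerivAt (fun s : ℝ => f (x + s • e)) f' t := by
  have h1 : HasDerivAt (fun s : ℝ => f (x + t • e + s • e)) f' (t - t) := by
    rw [sub_self]; exact h
  have h2 := h1.comp_sub_const t t
  refine h2.congr_of_eventuallyEq (.of_forall fun s => ?_)
  simp only
  rw [add_assoc, ← add_smul]
  congr 3
  ring

include hψ hσ in
lemma hasDerivAt_pot [Nonempty (Fin d)] (hq : JM q) (hc : cl ψ pw q < ⊤) (k : Fin d) (x : Rd d)
    {z : ℝ} (hz : z ∈ side σ) (t : ℝ) :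
    HasDerivAt (fun s : ℝ => pot q (x + s • EuclideanSpace.single k (1 : ℝ)) z)
      (σ * layer (below σ) (gradSym k) q (x + t • EuclideanSpace.single k (1 : ℝ)) z) t := by
  set e : Rd d := EuclideanSpace.single k (1 : ℝ) with he
  have ha := deg1_gradSym k
  obtain ⟨C, hC⟩ := ha.hom.exists_symNorm_le hψ
  have hSz : MeasurableSet {y | (z, y) ∈ below σ} := measurable_prodMk_left (measurableSet_below σ)
  have hpot : ∀ y, pot q y z = σ * ∫ τ in {τ | (z, τ) ∈ below σ},
      multF (poissonSym |z - τ|) (at' q τ) y := fun y => integral_below hσ _ hz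
  simp only [hpot]
  refine HasDerivAt.const_mul _ ?_
  have hbi : Integrable (fun τ => C * (besF ψ (at' q τ)).toReal) := by
    refine (integrable_toReal_of_lintegral_ne_top (measurable_besF hψ hq).aemeasurable ?_).const_mul C
    rw [lintegral_besF hψ hq]; exact hc.ne
  have h1 : ∀ᵐ τ ∂volume.restrict {τ | (z, τ) ∈ below σ}, ∀ s ∈ (Set.univ : Set ℝ),
      ‖multF (fun ζ => gradSym k ζ * poissonSym |z - τ| ζ) (at' q τ) (x + s • e)‖ ≤
        C * (besF ψ (at' q τ)).toReal := by
    refine ae_restrict_of_ae ?_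
    filter_upwards [ae_pos_abs_sub z, ae_besF_lt_top hψ hq hc] with τ hτ hb s _
    exact norm_multF_poisson_le hψ ha hC hτ (hq.bm τ) hb _
  have h2 : ∀ᵐ τ ∂volume.restrict {τ | (z, τ) ∈ below σ}, ∀ s ∈ (Set.univ : Set ℝ),
      HasDerivAt (fun s : ℝ => multF (poissonSym |z - τ|) (at' q τ) (x + s • e))
        (multF (fun ζ => gradSym k ζ * poissonSym |z - τ| ζ) (at' q τ) (x + s • e)) s := by
    refine ae_restrict_of_ae ?_
    filter_upwards [ae_pos_abs_sub z] with τ hτ s _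
    have hl : L1Sym fun ζ => dirSym e ζ * poissonSym |z - τ| ζ := by
      have := ha.l1 hψ hτ
      rwa [gradSym_eq_dirSym] at this
    have h1 := hasLineDerivAt_multF (l1_poissonSym hτ) hl (hq.bm τ) (x + s • e)
    rw [he, ← gradSym_eq_dirSym] at h1
    exact hasDerivAt_of_hasLineDerivAt h1
  have h3 := hasDerivAt_integral_of_dominated_loc_of_deriv_le
    (F := fun (s : ℝ) τ => multF (poissonSym |z - τ|) (at' q τ) (x + s • e)) (x₀ := t)
    (F' := fun s τ => multF (fun ζ => gradSym k ζ * poissonSym |z - τ| ζ) (at' q τ) (x + s • e))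
    univ_mem (.of_forall fun s =>
      (measurable_slice_poisson hq (x + s • e) z).aestronglyMeasurable)
    (integrable_slice_poisson hσ hq (x + t • e) z)
    (measurable_slice_multF_poisson hq ha.cont (x + t • e) z).aestronglyMeasurable h1
    hbi.restrict h2
  exact h3.2

end pot

/-! ## The gradient of the harmonic extension -/

section harm

variable {ψ : Rd d → ℝ} (hψ : IsCutoff ψ) {f : TempModPoly d} (hf : bes ψ pw f < ⊤)

lemma integrable_toReal_sN_harmB (hψ : IsCutoff ψ) (hf : bes ψ pw f < ⊤) {a : Rd d → ℂ}
    (ha : Deg1 a) : Summable fun j => (sN (harmB ψ a f j)).toReal := by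
  obtain ⟨C, hC⟩ := ha.hom.exists_symNorm_le hψ
  exact ENNReal.summable_toReal
    ((tsum_sN_harmB_le hψ ha weight_pw hC).trans_lt (by finiteness)).ne

include hψ

lemma blockC_poisson (t : ℝ) (j : ℤ) : blockC ψ (poissonSym t) j f =
    multF (fun ζ => (1 : Rd d → ℂ) ζ * poissonSym t ζ * fatSym ψ j ζ)
      (multC (dyadicSym ψ j) f) := by
  rw [← multC_poisson_block hψ homog_one]
  simp only [blockC, Pi.one_apply, one_mul]

omit hψ in
lemma blockC_one (j : ℤ) : blockC ψ 1 j f = multC (dyadicSym ψ j) f := by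
  simp only [blockC, Pi.one_apply, one_mul]

include hf

lemma hasDerivAt_blockC_poisson (k : Fin d) (j : ℤ) (x : Rd d) (z t : ℝ) :
    HasDerivAt (fun s : ℝ => blockC ψ (poissonSym |z|) j f (x + s • EuclideanSpace.single k (1 : ℝ)))
      (harmB ψ (gradSym k) f j (x + t • EuclideanSpace.single k (1 : ℝ)) z) t := by
  set e : Rd d := EuclideanSpace.single k (1 : ℝ) with he
  have hb := bm_multC hψ weight_pw hf j
  have h1 : (fun ζ : Rd d => dirSym e ζ * ((1 : Rd d → ℂ) ζ * poissonSym |z| ζ * fatSym ψ j ζ)) =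
      fun ζ => gradSym k ζ * poissonSym |z| ζ * fatSym ψ j ζ := by
    ext ζ
    rw [gradSym_eq_dirSym, Pi.one_apply, he]
    ring
  have hl : L1Sym fun ζ : Rd d =>
      dirSym e ζ * ((1 : Rd d → ℂ) ζ * poissonSym |z| ζ * fatSym ψ j ζ) := by
    rw [h1]; exact ((homog_gradSym k).smoothSym_fat hψ |z| j).l1
  have h2 := hasLineDerivAt_multF (homog_one.smoothSym_fat hψ |z| j).l1 hl hb (x + t • e)
  rw [h1, ← blockC_poisson hψ, ← multC_poisson_block hψ (homog_gradSym k)] at h2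
  exact hasDerivAt_of_hasLineDerivAt h2

lemma blockC_poisson_eq_sub (j : ℤ) (x : Rd d) (z : ℝ) :
    blockC ψ (poissonSym |z|) j f x = blockC ψ 1 j f x -
      ∫ s in (0 : ℝ)..|z|, harmB ψ absSym f j x s := by
  have ha := deg1_absSym (d := d)
  obtain ⟨C, hC⟩ := ha.hom.exists_symNorm_le hψ
  have hb := bm_multC hψ weight_pw hf j
  have hz := abs_nonneg z
  have h0 : blockC ψ 1 j f = blockC ψ (poissonSym 0) j f := by
    rw [poissonSym_zero]
  have hl := fun t => (homog_one.smoothSym_fat hψ t j (d := d)).l1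
  have hfat := (ha.hom.smoothSym_fat hψ 0 j).l1
  have key := multF_integral (ν := volume.restrict (Set.Ioc 0 |z|))
    (n := fun s ζ => absSym ζ * poissonSym s ζ * fatSym ψ j ζ)
    (M := (fun ζ => (1 : Rd d → ℂ) ζ * poissonSym 0 ζ * fatSym ψ j ζ) +
      fun ζ => (-1) * ((1 : Rd d → ℂ) ζ * poissonSym |z| ζ * fatSym ψ j ζ))
    ((measurable_mul_poissonSym ha.cont).mul
      ((hψ.fat_smooth j).smooth.continuous.measurable.comp measurable_snd)) ?_ ?_ ?_ hb x
  · rw [multF_add_sym (hl 0) ((hl |z|).const_mul _) hb, Pi.add_apply, multF_const_mul_sym,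
      ← blockC_poisson hψ, ← blockC_poisson hψ, ← h0] at key
    rw [intervalIntegral.integral_of_le hz]
    have e : ∫ s in Set.Ioc 0 |z|, harmB ψ absSym f j x s =
        ∫ s in Set.Ioc 0 |z|, multF (fun ζ => absSym ζ * poissonSym s ζ * fatSym ψ j ζ)
          (multC (dyadicSym ψ j) f) x := by
      refine setIntegral_congr_fun measurableSet_Ioc fun s hs => ?_
      simp only [harmB]
      rw [multC_poisson_block hψ ha.hom, abs_of_pos hs.1]
    rw [e, ← key]
    ring
  · have h1 := (integrable_const (1 : ℝ) (μ := volume.restrict (Set.Ioc 0 |z|))).mul_prod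
      hfat.int.norm
    refine h1.mono' ((measurable_mul_poissonSym ha.cont).mul
      ((hψ.fat_smooth j).smooth.continuous.measurable.comp measurable_snd)).aestronglyMeasurable ?_
    have hae : ∀ᵐ p : ℝ × Rd d ∂((volume.restrict (Set.Ioc 0 |z|)).prod volume), 0 ≤ p.1 := by
      have h1 : ∀ᵐ s : ℝ ∂(volume.restrict (Set.Ioc 0 |z|)), 0 ≤ s := by
        filter_upwards [ae_restrict_mem measurableSet_Ioc] with s hs using hs.1.le
      exact Measure.quasiMeasurePreserving_fst.ae h1
    filter_upwards [hae] with p hp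
    simp only [Function.uncurry, poissonSym_zero, Pi.one_apply, mul_one, one_mul, norm_mul]
    calc ‖absSym p.2‖ * ‖poissonSym p.1 p.2‖ * ‖fatSym ψ j p.2‖
        ≤ ‖absSym p.2‖ * 1 * ‖fatSym ψ j p.2‖ := by gcongr; exact norm_poissonSym_le hp p.2
      _ = _ := by rw [mul_one]
  · intro ζ
    rw [integral_mul_const, integral_abs_mul_poissonSym hz, Pi.add_apply, Pi.one_apply]
    ring
  · refine (setLIntegral_mono (g := fun _ => ofReal (C * decay 1 j 0)) measurable_const
      fun s hs => ?_).trans_lt ?_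
    · refine (hC.2 j s hs.1.le).trans (ofReal_le_ofReal ?_)
      exact mul_le_mul_of_nonneg_left (decay_anti 1 j hs.1.le) hC.1
    · rw [setLIntegral_const, Real.volume_Ioc]
      finiteness

lemma norm_harmB_le (j : ℤ) (x : Rd d) (z : ℝ) {a : Rd d → ℂ} (ha : Deg1 a) :
    ‖harmB ψ a f j x z‖ ≤ (sN (harmB ψ a f j)).toReal := by
  rw [← toReal_enorm]
  exact toReal_mono (jm_harmB hψ ha weight_pw hf j).fin.ne (le_sN _ x z)

lemma summable_harm (x : Rd d) (z : ℝ) :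
    Summable fun j => blockC ψ (poissonSym |z|) j f x - blockC ψ 1 j f 0 := by
  have h1 : Summable fun j => blockC ψ 1 j f x - blockC ψ 1 j f 0 := by
    obtain ⟨C, hC, h⟩ := exists_blocks_lip hψ
    refine Summable.of_enorm (lt_of_le_of_lt (b := ∑' j, ofReal (C * ‖x‖) *
      (pw j * (supN (multC (dyadicSym ψ (j - 1)) f) + supN (multC (dyadicSym ψ j) f) +
        supN (multC (dyadicSym ψ (j + 1)) f)))) ?_ ?_).ne
    · refine tsum_le_tsum fun j => ?_
      simp only [blockC_one]
      exact h _ (blocks_multC hψ weight_pw hf) j x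
    · rw [ENNReal.tsum_mul_left]
      exact mul_lt_top ofReal_lt_top
        (tsum_pw_neighbours_lt_top (a := fun j => supN (multC (dyadicSym ψ j) f)) hf)
  have h2 : Summable fun j => ∫ s in (0 : ℝ)..|z|, harmB ψ absSym f j x s := by
    refine Summable.of_norm_bounded
      ((integrable_toReal_sN_harmB hψ hf deg1_absSym).mul_right |z|) fun j => ?_
    refine (intervalIntegral.norm_integral_le_of_norm_le_const fun s _ =>
      norm_harmB_le hψ hf j x s deg1_absSym).trans_eq ?_
    rw [sub_zero, abs_abs]
  refine (h1.sub h2).congr fun j => ?_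
  rw [blockC_poisson_eq_sub hψ hf j x z]
  ring

lemma hasDerivAt_harm (k : Fin d) (x : Rd d) (z t : ℝ) :
    HasDerivAt (fun s : ℝ => harm ψ f (x + s • EuclideanSpace.single k (1 : ℝ)) z)
      (harmF ψ (gradSym k) f (x + t • EuclideanSpace.single k (1 : ℝ)) z) t :=
  hasDerivAt_tsum (integrable_toReal_sN_harmB hψ hf (deg1_gradSym k))
    (fun j t => (hasDerivAt_blockC_poisson hψ hf k j x z t).sub_const _)
    (fun j _ => norm_harmB_le hψ hf j _ z (deg1_gradSym k))
    (y₀ := 0) (summable_harm hψ hf _ z) t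

lemma harm_eq_sub (x : Rd d) (z : ℝ) :
    harm ψ f x z = harm ψ f x 0 - ∫ s in (0 : ℝ)..|z|, harmF ψ absSym f x s := by
  have ha := deg1_absSym (d := d)
  have hs := integrable_toReal_sN_harmB hψ hf ha
  have h1 : HasSum (fun j => ∫ s in (0 : ℝ)..|z|, harmB ψ absSym f j x s)
      (∫ s in (0 : ℝ)..|z|, harmF ψ absSym f x s) := by
    refine intervalIntegral.hasSum_integral_of_dominated_convergence
      (fun j _ => (sN (harmB ψ absSym f j)).toReal) (fun j => ?_) (fun j => ?_) ?_ ?_ ?_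
    · exact ((jm_harmB hψ ha weight_pw hf j).meas.comp
        (measurable_const.prodMk measurable_id)).aestronglyMeasurable
    · exact .of_forall fun s _ => norm_harmB_le hψ hf j x s ha
    · exact .of_forall fun s _ => hs
    · exact intervalIntegrable_const
    · refine .of_forall fun s _ => ?_
      exact (Summable.of_norm_bounded hs fun j => norm_harmB_le hψ hf j x s ha).hasSum
  have h2 := summable_harm hψ hf x 0
  rw [harm, harm, ← h1.tsum_eq, ← h2.tsum_sub h1.summable]
  refine tsum_congr fun j => ?_
  rw [blockC_poisson_eq_sub hψ hf j x z, blockC_poisson_eq_sub hψ hf j x 0]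
  simp only [abs_zero, intervalIntegral.integral_same]
  ring

lemma harm_eq_below {σ : ℝ} (hσ : σ = 1 ∨ σ = -1) (x : Rd d) {z : ℝ} (hz : z ∈ side σ) :
    harm ψ f x z = harm ψ f x 0 - ∫ y in {y | (z, y) ∈ below σ}, harmF ψ absSym f x y := by
  have hz' : 0 < σ * z := hz
  have h := integral_between_abs hσ (fun s => harmF ψ absSym f x s) (z' := 0) (z := z)
    (by simpa using hz'.le)
  rw [harm_eq_sub hψ hf, ← sub_zero |z|]
  rw [sub_zero z] at h
  rw [sub_zero, ← h, below_slice]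
  congr 2 with y
  simp [harmF]

end harm

lemma smooth_dir_mul {m : Rd d → ℂ} (hm : SmoothSym m) (e : Rd d) :
    SmoothSym (fun ζ => dirSym e ζ * m ζ) :=
  SmoothSym.mul_left (a := dirSym e)
    (contDiff_const.mul (contDiff_inner_ofReal e)) hm

lemma hasDerivAt_ker {m : Rd d → ℂ} (hm : SmoothSym m) (e y : Rd d) (t : ℝ) :
    HasDerivAt (fun s : ℝ => ker m (y + s • e))
      (ker (fun ζ => dirSym e ζ * m ζ) (y + t • e)) t := by
  apply hasDerivAt_of_hasLineDerivAt
  have hd : DifferentiableAt ℝ (⇑(𝓕⁻ hm.scaled : 𝓢(Rd d, ℂ))) (y + t • e) :=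
    (𝓕⁻ hm.scaled : 𝓢(Rd d, ℂ)).differentiableAt
  have h := hd.hasFDerivAt.hasLineDerivAt e
  rw [← SchwartzMap.lineDerivOp_apply_eq_fderiv, SchwartzMap.lineDerivOp_fourierInv_eq] at h
  rw [hm.ker_eq, (smooth_dir_mul hm e).ker_eq]
  suffices hsc : (smooth_dir_mul hm e).scaled = (2 * π * I : ℂ) •
      SchwartzMap.smulLeftCLM ℂ (fun y : Rd d => inner ℝ y e) hm.scaled by rw [hsc]; exact h
  ext ξ
  have hg : (fun y : Rd d => inner ℝ y e).HasTemperateGrowth := by fun_prop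
  rw [smul_apply, SchwartzMap.smulLeftCLM_apply_apply hg]
  change dirSym e ((2 * π) • ξ) * m ((2 * π) • ξ) =
    (2 * π * I : ℂ) • ((inner ℝ ξ e : ℝ) • m ((2 * π) • ξ))
  rw [dirSym, real_inner_smul_right, real_inner_comm]
  simp only [smul_eq_mul, Complex.real_smul]
  push_cast
  ring

lemma exists_lipschitz_bound {w : Rd d → ℂ} {L : ℝ≥0} (hw : LipschitzWith L w) :
    ∃ B : ℝ, 0 ≤ B ∧ ∀ y, ‖w y‖ ≤ B * wt 1 y := by
  refine ⟨‖w 0‖ + L, by positivity, fun y => ?_⟩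
  have h1 := hw.dist_le_mul y 0
  rw [dist_zero_right, dist_eq_norm] at h1
  have h2 := norm_le_norm_add_norm_sub' (w y) (w 0)
  have h3 : ‖y‖ ≤ wt 1 y := by rw [wt, pow_one]; nlinarith [sq_nonneg (‖y‖ - 1), norm_nonneg y]
  nlinarith [one_le_wt 1 y, norm_nonneg (w 0), L.2, mul_le_mul_of_nonneg_left h3 L.2]

lemma exists_ker_decay {m : Rd d → ℂ} (hm : SmoothSym m) (x : Rd d) {w : Rd d → ℂ} {L : ℝ≥0}
    (hw : LipschitzWith L w) : ∃ b : Rd d → ℝ, Integrable b ∧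
      ∀ a : Rd d, ‖a‖ ≤ 1 → ∀ y, ‖ker m (x - y + a) * w y‖ ≤ b y := by
  obtain ⟨B, hB, hwB⟩ := exists_lipschitz_bound hw
  obtain ⟨A, hA, hk⟩ := exists_wt_bound (𝓕⁻ hm.scaled : 𝓢(Rd d, ℂ)) (d + 2) 0
  set D : ℝ := 2 ^ (d + 2) * (2 ^ (d + 2) * 2 ^ (d + 2) * wt (d + 2) x) with hD
  have hwt := wt_pos (d + 2) x
  refine ⟨fun y => A * D * B * (1 + ‖y‖ ^ 2) ^ (-(2 * (d + 1 : ℝ)) / 2),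
    (integrable_rpow_neg_one_add_norm_sq (by simp; linarith)).const_mul _, fun a ha y => ?_⟩
  have h1 : wt (d + 2) y ≤ D * wt (d + 2) (x - y + a) := by
    have e1 : y = (x + a) + -(x - y + a) := by abel
    have e2 : wt (d + 2) (-(x - y + a)) = wt (d + 2) (x - y + a) := by rw [wt, norm_neg, wt]
    have h2 := wt_add_le (d + 2) (x + a) (-(x - y + a))
    rw [← e1, e2] at h2
    have h3 := wt_add_le (d + 2) x a
    have h4 : wt (d + 2) a ≤ 2 ^ (d + 2) := by
      rw [wt]; gcongr; nlinarith [norm_nonneg a]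
    have h5 : wt (d + 2) (x + a) ≤ 2 ^ (d + 2) * 2 ^ (d + 2) * wt (d + 2) x := by
      refine h3.trans ?_
      nlinarith [mul_le_mul_of_nonneg_left h4 (by positivity : 0 ≤ 2 ^ (d + 2) * wt (d + 2) x)]
    refine h2.trans ?_
    rw [hD]
    have := (wt_pos (d + 2) (x - y + a)).le
    gcongr
  have h2 := hk (x - y + a)
  rw [norm_iteratedFDeriv_zero, ← hm.ker_eq] at h2
  have hpos : 0 < 1 + ‖y‖ ^ 2 := by positivity
  have h3 : (1 + ‖y‖ ^ 2) ^ (-(2 * (d + 1 : ℝ)) / 2) = wt 1 y / wt (d + 2) y := by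
    rw [wt, wt, eq_div_iff (by positivity), ← Real.rpow_natCast _ (d + 2), ← Real.rpow_add hpos,
      ← Real.rpow_natCast _ 1]
    congr 1
    push_cast
    ring
  beta_reduce
  rw [h3, norm_mul, mul_div_assoc', le_div_iff₀ (wt_pos _ _)]
  calc ‖ker m (x - y + a)‖ * ‖w y‖ * wt (d + 2) y
      ≤ ‖ker m (x - y + a)‖ * (B * wt 1 y) * (D * wt (d + 2) (x - y + a)) := by
        have := (wt_pos (d + 2) y).le
        have := (wt_pos 1 y).le
        gcongr
        exact hwB y
    _ = (wt (d + 2) (x - y + a) * ‖ker m (x - y + a)‖) * (D * B * wt 1 y) := by ring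
    _ ≤ A * (D * B * wt 1 y) := by
        have := (wt_pos 1 y).le
        gcongr
    _ = _ := by ring

lemma integrable_ker_mul_lipschitz {m : Rd d → ℂ} (hm : SmoothSym m) {w : Rd d → ℂ} {L : ℝ≥0}
    (hw : LipschitzWith L w) (x : Rd d) : Integrable fun y => ker m (x - y) * w y := by
  obtain ⟨b, hb, h⟩ := exists_ker_decay hm x hw
  refine hb.mono' (((continuous_ker hm.l1.int).comp (by fun_prop)).mul
    hw.continuous).aestronglyMeasurable (.of_forall fun y => ?_)
  simpa using h 0 (by simp) y

lemma multF_lineDeriv {m : Rd d → ℂ} (hm : SmoothSym m) {w : Rd d → ℂ} {L : ℝ≥0}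
    (hw : LipschitzWith L w) {e : Rd d} (he : ‖e‖ ≤ 1) (x : Rd d) :
    multF m (fun y => lineDeriv ℝ w y e) x = multF (fun ζ => dirSym e ζ * m ζ) w x := by
  obtain ⟨b, hb, hbd⟩ := exists_ker_decay (smooth_dir_mul hm e) x hw
  have hkc := continuous_ker hm.l1.int
  have hkc' := continuous_ker (smooth_dir_mul hm e).l1.int
  have h1 := (hasDerivAt_integral_of_dominated_loc_of_deriv_le (μ := volume)
    (F := fun (t : ℝ) y => ker m (x - y + t • e) * w y)
    (F' := fun (t : ℝ) y => ker (fun ζ => dirSym e ζ * m ζ) (x - y + t • e) * w y)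
    (x₀ := 0) (bound := b)
    (Metric.ball_mem_nhds 0 one_pos)
    (.of_forall fun t =>
      ((hkc.comp (by fun_prop)).mul hw.continuous).aestronglyMeasurable)
    (by simpa using integrable_ker_mul_lipschitz hm hw x)
    ((hkc'.comp (by fun_prop)).mul hw.continuous).aestronglyMeasurable
    (.of_forall fun y t ht => by
      have := hbd (t • e) (by
        rw [norm_smul]; rw [mem_ball_zero_iff] at ht
        nlinarith [norm_nonneg e, norm_nonneg t]) y
      simpa using this) hb
    (.of_forall fun y t _ =>
      (hasDerivAt_ker hm e (x - y) t).mul_const (w y))).2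
  have h2 := (hasDerivAt_integral_of_dominated_loc_of_lip (μ := volume)
    (F := fun (t : ℝ) y => ker m (x - y) * w (y + t • e))
    (F' := fun y => ker m (x - y) * lineDeriv ℝ w y e)
    (x₀ := 0) (bound := fun y => ‖ker m (x - y)‖ * (L * ‖e‖)) (s := Set.univ) univ_mem
    (.of_forall fun t => ((hkc.comp (by fun_prop)).mul
      (hw.continuous.comp (by fun_prop))).aestronglyMeasurable)
    (by simpa using integrable_ker_mul_lipschitz hm hw x)
    ((hkc.comp (by fun_prop)).aestronglyMeasurable.mul
      (measurable_lineDeriv hw.continuous).aestronglyMeasurable)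
    (.of_forall fun y => by
      refine LipschitzOnWith.of_dist_le_mul fun t _ s _ => ?_
      rw [dist_eq_norm, ← mul_sub, norm_mul, Real.coe_nnabs, abs_of_nonneg (by positivity),
        mul_assoc]
      gcongr
      rw [← dist_eq_norm]
      refine (hw.dist_le_mul _ _).trans (le_of_eq ?_)
      rw [dist_add_left, dist_eq_norm, ← sub_smul, norm_smul, dist_eq_norm]
      ring)
    (((hm.l1.kint.comp_sub_left x).norm).mul_const _)
    (by
      filter_upwards [hw.ae_differentiableAt (μ := volume)] with y hy
      have h3 : HasDerivAt (fun t : ℝ => w (y + t • e)) (lineDeriv ℝ w y e) 0 := by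
        have := hy.lineDifferentiableAt (𝕜 := ℝ) (v := e)
        exact this.hasLineDerivAt
      exact h3.const_mul _)).2
  have h3 : (fun t : ℝ => ∫ y, ker m (x - y) * w (y + t • e)) =
      fun t : ℝ => ∫ y, ker m (x - y + t • e) * w y := by
    ext t
    rw [← integral_sub_right_eq_self _ (t • e)]
    congr 1 with y
    rw [sub_add_cancel]
    congr 2
    abel
  rw [h3] at h2
  have h4 := h2.unique h1
  simp only [zero_smul, add_zero] at h4
  exact h4

lemma bm_lineDeriv {w : Rd d → ℂ} {L : ℝ≥0} (hw : LipschitzWith L w) (e : Rd d) :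
    BM (fun y => lineDeriv ℝ w y e) :=
  BM.of_bound (measurable_lineDeriv hw.continuous) (M := L * ‖e‖) fun _ =>
    norm_lineDeriv_le_of_lipschitz ℝ hw

lemma sum_multF_lineDeriv {m : Fin d → Rd d → ℂ} (hm : ∀ l, SmoothSym (m l)) {w : Rd d → ℂ}
    {L : ℝ≥0} (hw : LipschitzWith L w) (x : Rd d) :
    ∑ l, multF (m l) (fun y => lineDeriv ℝ w y (EuclideanSpace.single l 1)) x =
      multF (fun ζ => ∑ l, gradSym l ζ * m l ζ) w x := by
  have hs : ∀ l, SmoothSym (fun ζ => gradSym l ζ * m l ζ) := fun l => by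
    simp only [gradSym_eq_dirSym]; exact smooth_dir_mul (hm l) _
  have h1 : ∀ s : Finset (Fin d), ker (fun ζ => ∑ l ∈ s, gradSym l ζ * m l ζ) =
      fun y => ∑ l ∈ s, ker (fun ζ => gradSym l ζ * m l ζ) y := by
    classical
    intro s
    induction s using Finset.induction_on with
    | empty =>
      have : ker (fun _ : Rd d => (0 : ℂ)) = fun _ => 0 := by
        simpa using ker_const_mul 0 (0 : Rd d → ℂ)
      simpa using this
    | insert l s hl ih =>
      simp only [sum_insert hl]
      have := ker_add (hs l).l1.int (m₂ := fun ζ => ∑ l ∈ s, gradSym l ζ * m l ζ)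
        (integrable_finsetSum _ fun i _ => (hs i).l1.int)
      rw [ih] at this
      exact this
  rw [multF_eq, h1]
  simp only [sum_mul]
  rw [integral_finsetSum _ fun l _ => integrable_ker_mul_lipschitz (hs l) hw x]
  refine sum_congr rfl fun l _ => ?_
  rw [multF_lineDeriv (hm l) hw (by simp), ← gradSym_eq_dirSym, multF_eq]

/-- The symbol of the Riesz transform `-∂_l |D|⁻¹`. -/
def rieszSym (l : Fin d) : Rd d → ℂ := fun ζ => -(gradSym l ζ * absSym⁻¹ ζ)

lemma homog_rieszSym (l : Fin d) : Homog 0 (rieszSym l) := by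
  have h := (homog_gradSym l).mul (Homog.inv_abs (d := d))
  refine ⟨fun ζ hζ => (h.smooth ζ hζ).neg, fun t ht ζ => ?_⟩
  have := h.scale t ht ζ
  simp only [rieszSym, Pi.mul_apply] at this ⊢
  rw [this]
  simp

lemma sum_grad_mul_rieszSym (ζ : Rd d) : ∑ l, gradSym l ζ * rieszSym l ζ = absSym ζ := by
  have h1 : ∑ l, gradSym l ζ * rieszSym l ζ = (∑ l, ((ζ l : ℝ) : ℂ) ^ 2) * absSym⁻¹ ζ := by
    rw [sum_mul]
    refine sum_congr rfl fun l _ => ?_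
    rw [rieszSym, gradSym]
    linear_combination -(((ζ l : ℝ) : ℂ) ^ 2) * absSym⁻¹ ζ * Complex.I_sq
  have h2 : (∑ l, ((ζ l : ℝ) : ℂ) ^ 2) = absSym ζ ^ 2 := by
    rw [absSym, ← Complex.ofReal_pow, EuclideanSpace.norm_sq_eq]
    simp
  rw [h1, h2, Pi.inv_apply]
  rcases eq_or_ne ζ 0 with rfl | h
  · simp [absSym]
  · field_simp [absSym_ne_zero h]

lemma blockF_abs_lipschitz {ψ : Rd d → ℝ} (hψ : IsCutoff ψ) {w : Rd d → ℂ} {L : ℝ≥0}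
    (hw : LipschitzWith L w) (j : ℤ) (x : Rd d) : blockF ψ absSym j w x =
      ∑ l, multF (fun ζ => rieszSym l ζ * dyadicSym ψ j ζ)
        (fun y => lineDeriv ℝ w y (EuclideanSpace.single l 1)) x := by
  rw [sum_multF_lineDeriv (fun l => (homog_rieszSym l).l1_dyadic hψ j) hw, blockF]
  congr 1 with ζ
  rw [← sum_grad_mul_rieszSym, sum_mul]
  exact sum_congr rfl fun l _ => mul_assoc _ _ _

lemma multF_dyadic_lineDeriv {ψ : Rd d → ℝ} (hψ : IsCutoff ψ) {w : Rd d → ℂ} {L : ℝ≥0}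
    (hw : LipschitzWith L w) (k : Fin d) (j : ℤ) :
    multF (dyadicSym ψ j) (fun y => lineDeriv ℝ w y (EuclideanSpace.single k 1)) =
      multF (fun ζ => -rieszSym k ζ * fatSym ψ j ζ) (blockF ψ absSym j w) := by
  ext x
  have hm' : SmoothSym (fun ζ => -rieszSym k ζ * fatSym ψ j ζ) := by
    have h := ((homog_rieszSym k).smoothSym_fat hψ 0 j).mul_left (a := fun _ => -1) contDiff_const
    convert h using 1
    ext ζ
    simp [poissonSym_zero]
  have hr := fun l => (homog_rieszSym l).l1_dyadic hψ j
  have hb := fun l => bm_lineDeriv hw (EuclideanSpace.single l (1 : ℝ))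
  rw [multF_eq _ (blockF ψ absSym j w)]
  simp only [blockF_abs_lipschitz hψ hw j, mul_sum]
  rw [integral_finsetSum _ fun l _ => integrable_multF hm'.l1 (BM.multF (hr l).l1 (hb l)) x]
  have h1 : ∀ l, ∫ y, ker (fun ζ => -rieszSym k ζ * fatSym ψ j ζ) (x - y) *
      multF (fun ζ => rieszSym l ζ * dyadicSym ψ j ζ)
        (fun y => lineDeriv ℝ w y (EuclideanSpace.single l 1)) y =
      multF ((fun ζ => -rieszSym k ζ * fatSym ψ j ζ) * fun ζ => rieszSym l ζ * dyadicSym ψ j ζ)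
        (fun y => lineDeriv ℝ w y (EuclideanSpace.single l 1)) x := fun l => by
    rw [← multF_comp hm'.l1 (hr l).l1 (hb l), multF_eq]
  simp only [h1]
  rw [sum_multF_lineDeriv (fun l => hm'.mul (hr l)) hw,
    multF_lineDeriv (hψ.dyadic_smooth j) hw (by simp), ← gradSym_eq_dirSym]
  congr 1 with ζ
  have h2 : ∑ l, gradSym l ζ * (((fun ζ => -rieszSym k ζ * fatSym ψ j ζ) *
      fun ζ => rieszSym l ζ * dyadicSym ψ j ζ) ζ) =
      -rieszSym k ζ * absSym ζ * (fatSym ψ j ζ * dyadicSym ψ j ζ) := by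
    rw [← sum_grad_mul_rieszSym, mul_sum, sum_mul]
    exact sum_congr rfl fun l _ => by simp only [Pi.mul_apply]; ring
  rw [h2, hψ.fat_mul_dyadic, rieszSym, neg_neg, Pi.inv_apply]
  rcases eq_or_ne ζ 0 with rfl | h
  · simp [absSym, gradSym]
  · rw [mul_assoc (gradSym k ζ), inv_mul_cancel₀ (absSym_ne_zero h), mul_one]

/-- The gradient of `v`, extended by zero. -/
def grad (σ : ℝ) (v : Rd d → ℝ → ℂ) : Fld d
  | some k => ind σ (dx k v)
  | none => ind σ (dz v)

lemma isOpen_side (σ : ℝ) : IsOpen (side σ) := isOpen_lt continuous_const (by fun_prop)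

section lipschitz
variable {σ : ℝ} {v : Rd d → ℝ → ℂ} {L : ℝ≥0}
  (hv : LipschitzOnWith L (fun p : Rd d × ℝ => v p.1 p.2) (Set.univ ×ˢ side σ))
include hv

lemma lipschitz_slice {z : ℝ} (hz : z ∈ side σ) : LipschitzWith L fun x => v x z :=
  LipschitzWith.of_dist_le_mul fun x y => by
    have := hv.dist_le_mul (x, z) (by simp [hz]) (y, z) (by simp [hz])
    simpa [Prod.dist_eq] using this

lemma jm_grad (i : Option (Fin d)) : JM (grad σ v i) := by
  obtain ⟨g, hg, hgv⟩ := hv.extend_finite_dimension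
  set L' := lipschitzExtensionConstant ℂ * L
  have hgc := hg.continuous
  have hgv' : ∀ x, ∀ z ∈ side σ, v x z = g (x, z) := fun x z hz =>
    hgv (x := (x, z)) ⟨Set.mem_univ x, hz⟩
  rcases i with _ | k
  · have hd : grad σ v none = ind σ fun x z => deriv (fun s => g (x, s)) z := by
      ext x z
      by_cases hz : z ∈ side σ
      · rw [grad, ind_of_mem hz, ind_of_mem hz]
        refine EventuallyEq.deriv_eq ?_
        filter_upwards [(isOpen_side σ).mem_nhds hz] with s hs using hgv' x s hs
      · rw [grad, ind_of_notMem hz, ind_of_notMem hz]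
    rw [hd]
    refine JM.ind ⟨measurable_deriv_with_param (f := fun x s => g (x, s)) hgc,
      (sN_le (M := (L' : ℝ≥0∞)) fun x z => ?_).trans_lt ENNReal.coe_lt_top⟩
    rw [← ofReal_norm, ← ENNReal.ofReal_coe_nnreal]
    refine ofReal_le_ofReal (norm_deriv_le_of_lipschitz (LipschitzWith.of_dist_le_mul
      fun s t => ?_))
    simpa [Prod.dist_eq] using hg.dist_le_mul (x, s) (x, t)
  · have hd : grad σ v (some k) = ind σ fun x z =>
        lineDeriv ℝ g (x, z) (EuclideanSpace.single k 1, 0) := by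
      ext x z
      by_cases hz : z ∈ side σ
      · rw [grad, ind_of_mem hz, ind_of_mem hz]
        simp only [dx, lineDeriv, hgv' _ z hz]
        simp
      · rw [grad, ind_of_notMem hz, ind_of_notMem hz]
    rw [hd]
    refine JM.ind ⟨measurable_lineDeriv (f := g) hgc,
      (sN_le (M := (L' : ℝ≥0∞)) fun x z => ?_).trans_lt ENNReal.coe_lt_top⟩
    rw [← ofReal_norm, ← ENNReal.ofReal_coe_nnreal]
    refine ofReal_le_ofReal ?_
    simpa using norm_lineDeriv_le_of_lipschitz (x₀ := (x, z))
      (v := ((EuclideanSpace.single k 1, 0) : Rd d × ℝ)) ℝ hg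

omit hv in
lemma cheminLerner_eq {ψ : Rd d → ℝ} {m : Rd d → ℂ} {u g : Rd d → ℝ → ℂ}
    (h : ∀ j, ∀ z ∈ side σ, supN (blockF ψ m j (at' u z)) = bl ψ g j z)
    (h0 : ∀ j, ∀ z ∉ side σ, bl ψ g j z = 0) : cheminLerner ψ σ m u = cl ψ pw g := by
  rw [cheminLerner, cl]
  congr 1 with j
  rw [pw_eq, ← lintegral_indicator (measurableSet_side σ)]
  congr 2 with z
  by_cases hz : z ∈ side σ
  · rw [Set.indicator_of_mem hz, ← h j z hz]; rfl
  · rw [Set.indicator_of_notMem hz, h0 j z hz]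

omit hv in
lemma bl_ind_of_notMem {ψ : Rd d → ℝ} {f : Rd d → ℝ → ℂ} {z : ℝ} (hz : z ∉ side σ) (j : ℤ) :
    bl ψ (ind σ f) j z = 0 := by
  have : at' (ind σ f) z = 0 := funext fun x => ind_of_notMem hz x
  rw [bl, this]
  simp [supN, multF_eq]

omit hv in
lemma at_ind {f : Rd d → ℝ → ℂ} {z : ℝ} (hz : z ∈ side σ) : at' (ind σ f) z = at' f z :=
  funext fun x => ind_of_mem hz x

omit hv in
lemma cheminLerner_dz (ψ : Rd d → ℝ) : cheminLerner ψ σ 1 (dz v) = cl ψ pw (grad σ v none) :=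
  cheminLerner_eq (fun j z hz => by rw [bl, grad, at_ind hz, blockF_one])
    fun j z hz => bl_ind_of_notMem hz j

omit hv in
lemma riesz_bound_zero {ψ : Rd d → ℝ} {C : ℝ} {k : Fin d} (hC : BlockBound ψ 0 (rieszSym k) C)
    (j : ℤ) : symNorm (fun ζ => rieszSym k ζ * fatSym ψ j ζ) ≤ ofReal C := by
  have := hC.2 j 0 le_rfl
  simpa [poissonSym_zero, decay_zero_right] using this

lemma supN_block_abs_le {ψ : Rd d → ℝ} (hψ : IsCutoff ψ) {C : ℝ}
    (hC : ∀ k : Fin d, BlockBound ψ 0 (rieszSym k) C) {z : ℝ} (hz : z ∈ side σ) (j : ℤ) :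
    supN (blockF ψ absSym j (at' v z)) ≤
      ofReal C * ∑ k, bl ψ (grad σ v (some k)) j z := by
  refine iSup_le fun x => ?_
  rw [show blockF ψ absSym j (at' v z) x = _ from
    blockF_abs_lipschitz hψ (lipschitz_slice hv hz) j x, mul_sum]
  refine (enorm_sum_le _ _).trans (sum_le_sum fun k _ => ?_)
  have hb := bm_lineDeriv (lipschitz_slice hv hz) (EuclideanSpace.single k (1 : ℝ))
  refine (le_supN _ x).trans ?_
  have h := supN_multF_block_le hψ (homog_rieszSym k) (hC k) le_rfl j hb
  simp only [poissonSym_zero, decay_zero_right, zero_mul, zpow_zero, mul_one, Pi.one_apply] at h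
  rw [bl, grad, at_ind hz]
  exact h

lemma cheminLerner_abs_le {ψ : Rd d → ℝ} (hψ : IsCutoff ψ) {C : ℝ}
    (hC : ∀ k : Fin d, BlockBound ψ 0 (rieszSym k) C) : cheminLerner ψ σ absSym v ≤
      ofReal C * ∑ k, cl ψ pw (grad σ v (some k)) := by
  rw [cheminLerner]
  simp only [cl]
  rw [← Summable.tsum_finsetSum fun _ _ => ENNReal.summable, ← ENNReal.tsum_mul_left]
  refine tsum_le_tsum fun j => ?_
  rw [← mul_sum, pw_eq, mul_left_comm, ← lintegral_finsetSum _ fun k _ =>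
    measurable_bl hψ (jm_grad hv (some k)) j, ← lintegral_const_mul' _ _ ENNReal.ofReal_ne_top]
  exact mul_le_mul' le_rfl ((setLIntegral_mono' (measurableSet_side σ) fun z hz =>
    supN_block_abs_le hv hψ hC hz j).trans (setLIntegral_le_lintegral _ _))

lemma cl_grad_le {ψ : Rd d → ℝ} (hψ : IsCutoff ψ) {C : ℝ} {k : Fin d}
    (hC : BlockBound ψ 0 (rieszSym k) C) :
    cl ψ pw (grad σ v (some k)) ≤ ofReal C * cheminLerner ψ σ absSym v := by
  rw [cheminLerner, cl, ← ENNReal.tsum_mul_left]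
  refine tsum_le_tsum fun j => ?_
  rw [pw_eq, mul_left_comm, ← lintegral_const_mul' _ _ ENNReal.ofReal_ne_top,
    ← lintegral_indicator (measurableSet_side σ)]
  gcongr with z
  by_cases hz : z ∈ side σ
  · rw [Set.indicator_of_mem hz, bl, grad, at_ind hz]
    have h1 := multF_dyadic_lineDeriv hψ (lipschitz_slice hv hz) k j
    change multF (dyadicSym ψ j) (at' (dx k v) z) = _ at h1
    have h2 : multF (fun ζ => -rieszSym k ζ * fatSym ψ j ζ) (blockF ψ absSym j fun x => v x z) =
        fun x => -1 * multF (fun ζ => rieszSym k ζ * fatSym ψ j ζ)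
          (blockF ψ absSym j fun x => v x z) x := by
      ext x
      rw [← multF_const_mul_sym]
      simp
    have hi : SmoothSym (fun ζ => rieszSym k ζ * fatSym ψ j ζ) := by
      simpa [poissonSym_zero] using (homog_rieszSym k).smoothSym_fat hψ 0 j
    rw [h1, h2, supN_const_mul, enorm_neg, enorm_one, one_mul]
    exact (supN_multF_le hi.l1.int _).trans (mul_le_mul' (riesz_bound_zero hC j) le_rfl)
  · rw [Set.indicator_of_notMem hz, grad, bl_ind_of_notMem hz]

end lipschitz

lemma MemV.good_grad {ψ : Rd d → ℝ} (hψ : IsCutoff ψ) {σ : ℝ} {v : Rd d → ℝ → ℂ}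
    (hv : MemV ψ σ v) (i : Option (Fin d)) : Good ψ pw (grad σ v i) := by
  obtain ⟨L, hL⟩ := hv.lipschitz
  refine ⟨jm_grad hL i, ENNReal.add_lt_top.2 ⟨(jm_grad hL i).fin, ?_⟩⟩
  rcases i with _ | k
  · rw [← cheminLerner_dz]; exact hv.dz_cheminLerner
  · obtain ⟨C, hC⟩ := exists_blockBound_of_homog hψ (homog_rieszSym (d := d))
    exact (cl_grad_le hL hψ (hC k)).trans_lt
      (mul_lt_top ofReal_lt_top hv.absD_cheminLerner)

lemma memV_of_grad {ψ : Rd d → ℝ} (hψ : IsCutoff ψ) {σ : ℝ} {v : Rd d → ℝ → ℂ} {L : ℝ≥0}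
    (hL : LipschitzOnWith L (fun p : Rd d × ℝ => v p.1 p.2) (Set.univ ×ˢ side σ))
    (hg : ∀ i, Good ψ pw (grad σ v i)) {B : ℝ≥0∞} (hB : B < ⊤)
    (hb : ∀ k, ∀ z ∈ side σ, ∑' j, bl ψ (grad σ v (some k)) j z ≤ B) : MemV ψ σ v := by
  obtain ⟨C, hC⟩ := exists_blockBound_of_homog hψ (homog_rieszSym (d := d))
  refine ⟨⟨L, hL⟩, ⟨(ofReal C * ∑ _k : Fin d, B).toReal, fun z hz x => ?_⟩, ?_, ?_⟩
  · rw [← toReal_enorm]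
    refine toReal_mono (mul_lt_top ofReal_lt_top
      (ENNReal.sum_lt_top.2 fun _ _ => hB)).ne (enorm_tsum_le_tsum_enorm.trans ?_)
    calc _ ≤ ∑' j, ofReal C * ∑ k, bl ψ (grad σ v (some k)) j z :=
          tsum_le_tsum fun j =>
            (le_supN _ x).trans (supN_block_abs_le hL hψ hC hz j)
      _ ≤ _ := by
          rw [ENNReal.tsum_mul_left, Summable.tsum_finsetSum fun _ _ => ENNReal.summable]
          gcongr with k
          exact hb k z hz
  · refine (cheminLerner_abs_le hL hψ hC).trans_lt (mul_lt_top ofReal_lt_top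
      (ENNReal.sum_lt_top.2 fun k _ => (hg _).cl_lt_top weight_pw))
  · rw [cheminLerner_dz]; exact (hg _).cl_lt_top weight_pw

/-- The gradient of the harmonic extension of `f`. -/
def data (ψ : Rd d → ℝ) (σ : ℝ) (f : TempModPoly d) : Fld d
  | some k => ind σ (harmF ψ (gradSym k) f)
  | none => ind σ ((-σ : ℂ) • harmF ψ absSym f)

/-- The gradient of `pot q`. -/
def gradPot (σ : ℝ) (q : Rd d → ℝ → ℂ) : Fld d
  | some k => ind σ ((σ : ℂ) • layer (below σ) (gradSym k) q)
  | none => ind σ (q - layer (below σ) absSym q)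

/-- The function with gradient `data ψ σ f + gradPot σ q`. -/
def field (ψ : Rd d → ℝ) (f : TempModPoly d) (q : Rd d → ℝ → ℂ) (x : Rd d) (z : ℝ) : ℂ :=
  harm ψ f x z + pot q x z

lemma gradOp_eq (σ : ℝ) (h U : Fld d) : gradOp σ h U = gradPot σ (qt σ h U) := by
  ext (_ | k) <;> rfl

lemma enorm_sign {σ : ℝ} (hσ : σ = 1 ∨ σ = -1) : ‖(σ : ℂ)‖ₑ = 1 := by
  rcases hσ with rfl | rfl <;> simp

section data
variable {ψ : Rd d → ℝ} (hψ : IsCutoff ψ) {σ : ℝ} (hσ : σ = 1 ∨ σ = -1) {wg : ℤ → ℝ≥0∞}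
  {K : ℝ≥0∞} (hwg : Weight wg K) {f : TempModPoly d} (hf : bes ψ wg f < ⊤) {C : ℝ}
  (hC : ∀ i : Option (Fin d), BlockBound ψ 1 (symb i) C)
include hψ hσ hwg hf hC

lemma good_data (i : Option (Fin d)) : Good ψ wg (data ψ σ f i) ∧
    nN ψ wg (data ψ σ f i) ≤ harmC ψ K C * bes ψ wg f := by
  have h := fun i => nN_harmF_le hψ (deg1_symb i) hwg hf (hC i)
  have hl : harmC ψ K C * bes ψ wg f < ⊤ := mul_lt_top (harmC_lt_top hψ hwg) hf
  rcases i with _ | k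
  · have h1 : nN ψ wg (data ψ σ f none) ≤ harmC ψ K C * bes ψ wg f := by
      refine nN_ind_le.trans ((nN_smul_le _ _).trans ?_)
      rw [enorm_neg, enorm_sign hσ, one_mul]
      exact (h none).2
    exact ⟨⟨((h none).1.smul _).ind, h1.trans_lt hl⟩, h1⟩
  · have h1 : nN ψ wg (data ψ σ f (some k)) ≤ harmC ψ K C * bes ψ wg f :=
      nN_ind_le.trans (h (some k)).2
    exact ⟨⟨(h (some k)).1.ind, h1.trans_lt hl⟩, h1⟩

lemma nF_data_le : nF ψ wg (data ψ σ f) ≤ (d + 1) * (harmC ψ K C * bes ψ wg f) := by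
  refine (sum_le_sum fun i _ => (good_data hψ hσ hwg hf hC i).2).trans (le_of_eq ?_)
  simp [Finset.sum_const, Fintype.card_option]

end data

section bl
variable {ψ : Rd d → ℝ} (hψ : IsCutoff ψ) {a : Rd d → ℂ} (ha : Deg1 a) {C : ℝ}
  (hC : BlockBound ψ 1 a C)
include hψ ha hC

lemma tsum_bl_layer_le {S : Set (ℝ × ℝ)} {q : Rd d → ℝ → ℂ} (hq : JM q) (hc : cl ψ pw q < ⊤)
    (z : ℝ) : ∑' j, bl ψ (layer S a q) j z ≤ ofReal C * cl ψ pw q := by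
  rw [cl, ← ENNReal.tsum_mul_left]
  refine tsum_le_tsum fun j => (bl_layer_le hψ ha hC hq hc j z).trans ?_
  rw [← mul_assoc, ← lintegral_const_mul _ (measurable_bl hψ hq j)]
  refine lintegral_mono fun τ => mul_le_mul' ?_ le_rfl
  rw [pw, ← ofReal_mul hC.1]
  refine ofReal_le_ofReal (mul_le_mul_of_nonneg_left ?_ hC.1)
  simpa using decay_le 1 j (abs_nonneg (z - τ))

lemma tsum_bl_harmF_le {f : TempModPoly d} (hf : bes ψ pw f < ⊤) (z : ℝ) :
    ∑' j, bl ψ (harmF ψ a f) j z ≤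
      3 * symNorm (dyadicSym ψ 0) * (ofReal C * bes ψ pw f) := by
  have hs := tsum_sN_harmB_le hψ ha (u := f) weight_pw hC
  rw [harmF_eq]
  refine (tsum_le_tsum fun j => bl_tsum_le hψ
    (jm_harmB hψ ha weight_pw hf) (hs.trans_lt (mul_lt_top ofReal_lt_top hf))
    j z).trans ?_
  rw [ENNReal.tsum_comm]
  refine le_trans (tsum_le_tsum fun i => ?_)
    ((ENNReal.tsum_mul_left (a := 3 * symNorm (dyadicSym ψ 0))).le.trans (mul_le_mul' le_rfl hs))
  rw [tsum_eq_sum (s := {i - 1, i, i + 1})]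
  · rw [sum_insert (by simp; lia), sum_insert (by simp), Finset.sum_singleton]
    have h1 : ∀ j, bl ψ (harmB ψ a f i) j z ≤
        symNorm (dyadicSym ψ 0) * sN (harmB ψ a f i) := fun j => by
      refine (supN_multF_le (hψ.dyadic_smooth j).l1.int _).trans ?_
      rw [symNorm_dyadic]
      exact mul_le_mul' le_rfl (supN_at_le _ _)
    refine (add_le_add (h1 _) (add_le_add (h1 _) (h1 _))).trans (le_of_eq ?_)
    ring
  · intro k hk
    simp only [Finset.mem_insert, Finset.mem_singleton, not_or] at hk
    exact bl_harmB_far hψ ha weight_pw hf (by lia) (by lia) (by lia) z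

end bl

section field
variable [Nonempty (Fin d)] {ψ : Rd d → ℝ} (hψ : IsCutoff ψ) {σ : ℝ} (hσ : σ = 1 ∨ σ = -1)
  {f : TempModPoly d} (hf : bes ψ pw f < ⊤) {q : Rd d → ℝ → ℂ} (hq : Good ψ pw q)
include hψ hq

omit [Nonempty (Fin d)] in
lemma good_gradPot (i : Option (Fin d)) : Good ψ pw (gradPot σ q i) := by
  rcases i with _ | k
  · exact ((Good.sub hψ hq (Good.layer hψ weight_pw (measurableSet_below σ) none hq))).ind
  · exact ((Good.layer hψ weight_pw (measurableSet_below σ) (some k) hq).smul _).ind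

include hσ hf

omit [Nonempty (Fin d)] in
lemma good_dataPot (i : Option (Fin d)) : Good ψ pw ((data ψ σ f + gradPot σ q) i) := by
  obtain ⟨C, hC⟩ := exists_blockBound hψ (d := d)
  exact Good.add hψ (good_data hψ hσ weight_pw hf hC i).1 (good_gradPot hψ hq i)

lemma hasDerivAt_field (k : Fin d) (x : Rd d) {z : ℝ} (hz : z ∈ side σ) (t : ℝ) :
    HasDerivAt (fun s : ℝ => field ψ f q (x + s • EuclideanSpace.single k (1 : ℝ)) z)
      ((data ψ σ f + gradPot σ q) (some k) (x + t • EuclideanSpace.single k (1 : ℝ)) z) t := by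
  have h := (hasDerivAt_harm hψ hf k x z t).add
    (hasDerivAt_pot hψ hσ hq.jm (hq.cl_lt_top weight_pw) k x hz t)
  refine h.congr_deriv ?_
  simp only [Pi.add_apply, data, gradPot, ind_of_mem hz, Pi.smul_apply, smul_eq_mul]

lemma grad_field_some (k : Fin d) :
    grad σ (field ψ f q) (some k) = (data ψ σ f + gradPot σ q) (some k) := by
  ext x z
  by_cases hz : z ∈ side σ
  · rw [grad, ind_of_mem hz, dx, lineDeriv]
    have := (hasDerivAt_field hψ hσ hf hq k x hz 0).deriv
    simpa using this
  · simp only [Pi.add_apply, data, gradPot, grad, ind_of_notMem hz, add_zero]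

lemma ae_field_eq : ∀ᵐ x, ∀ z ∈ side σ, field ψ f q x z = harm ψ f x 0 +
    ∫ y in (0 : ℝ)..z, (data ψ σ f + gradPot σ q) none x y := by
  filter_upwards [ae_pot_eq hψ hσ hq.jm (hq.cl_lt_top weight_pw)] with x hx z hz
  obtain ⟨C, hC⟩ := exists_blockBound hψ (d := d)
  have hσ2 : (σ : ℂ) * σ = 1 := by rcases hσ with rfl | rfl <;> simp
  have hfin : volume {y | (z, y) ∈ below σ} < ⊤ :=
    (volume_below_slice_le hσ z).trans_lt ofReal_lt_top
  have hint : ∀ g : Rd d → ℝ → ℂ, JM g → IntegrableOn (fun y => g x y) {y | (z, y) ∈ below σ} :=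
    fun g hg => Measure.integrableOn_of_bounded hfin.ne
      (hg.meas.comp (by fun_prop : Measurable fun y : ℝ => (x, y))).aestronglyMeasurable
      (M := (sN g).toReal) (.of_forall fun y => by
        rw [← toReal_enorm]; exact toReal_mono hg.fin.ne (le_sN g x y))
  have hh := (nN_harmF_le hψ deg1_absSym weight_pw hf (hC none)).1
  have hq1 := hq.jm.sub (jm_layer hψ deg1_absSym (measurableSet_below σ) hq.jm
    (hq.cl_lt_top weight_pw))
  have hms : MeasurableSet {y | (z, y) ∈ below σ} :=
    (measurableSet_below σ).preimage (by fun_prop : Measurable fun y : ℝ => (z, y))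
  have h1 : ∫ y in {y | (z, y) ∈ below σ}, (data ψ σ f + gradPot σ q) none x y =
      ∫ y in {y | (z, y) ∈ below σ}, (-σ * harmF ψ absSym f x y +
        (q x y - layer (below σ) absSym q x y)) := by
    refine setIntegral_congr_fun hms fun y hy => ?_
    have hy' : y ∈ side σ := hy.1
    simp only [Pi.add_apply, data, gradPot, ind_of_mem hy', Pi.smul_apply, smul_eq_mul,
      Pi.sub_apply]
  rw [field, hx z hz, harm_eq_below hψ hf hσ x hz, integral_below hσ _ hz, h1,
    integral_add (g := fun y => q x y - layer (below σ) absSym q x y)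
      ((hint _ hh).const_mul _) (hint _ hq1), integral_const_mul]
  linear_combination (∫ y in {y | (z, y) ∈ below σ}, harmF ψ absSym f x y) * hσ2

lemma lipschitz_field : ∃ L : ℝ≥0,
    LipschitzOnWith L (fun p : Rd d × ℝ => field ψ f q p.1 p.2) (Set.univ ×ˢ side σ) := by
  have hg := good_dataPot hψ hσ hf hq
  set Φ := data ψ σ f + gradPot σ q with hΦ
  set M : ℝ := ∑ i, (sN (Φ i)).toReal with hM
  have hb : ∀ i x z, ‖Φ i x z‖ ≤ M := fun i x z => by
    refine le_trans ?_ (single_le_sum (f := fun i => (sN (Φ i)).toReal)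
      (fun _ _ => toReal_nonneg) (Finset.mem_univ i))
    rw [← toReal_enorm]
    exact toReal_mono (hg i).jm.fin.ne (le_sN _ x z)
  have hM0 : 0 ≤ M := (norm_nonneg _).trans (hb none 0 0)
  have h1 : ∀ k x s, ∀ z ∈ side σ, ‖field ψ f q (x + s • EuclideanSpace.single k (1 : ℝ)) z -
      field ψ f q x z‖ ≤ M * |s| := fun k x s z hz => by
    have := Convex.norm_image_sub_le_of_norm_hasDerivWithin_le (s := Set.univ) (C := M)
      (fun t _ => (hasDerivAt_field hψ hσ hf hq k x hz t).hasDerivWithinAt)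
      (fun t _ => hb _ _ _) convex_univ (Set.mem_univ 0) (Set.mem_univ s)
    simpa using this
  have h2 : ∀ (x y : Rd d), ∀ z ∈ side σ, ‖field ψ f q (x + y) z - field ψ f q x z‖ ≤
      M * d * ‖y‖ := fun x y z hz => by
    classical
    have h3 : ∀ s : Finset (Fin d), ‖field ψ f q (x + ∑ k ∈ s, y k •
        EuclideanSpace.single k (1 : ℝ)) z - field ψ f q x z‖ ≤ ∑ k ∈ s, M * ‖y‖ := by
      intro s
      induction s using Finset.induction_on with
      | empty => simp
      | insert k s hk ih =>
        rw [sum_insert hk, sum_insert hk, add_comm (y k • _), ← add_assoc]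
        refine (norm_sub_le_norm_sub_add_norm_sub _ _ _).trans (add_le_add ((h1 k _ _ z hz).trans
          ?_) ih)
        exact mul_le_mul_of_nonneg_left (PiLp.norm_apply_le y k) hM0
    have h4 := h3 Finset.univ
    have h5 : ∑ k, y k • EuclideanSpace.single k (1 : ℝ) = y := by
      ext i
      simp [Pi.single_apply]
    rw [h5] at h4
    simpa [mul_assoc, mul_comm, mul_left_comm] using h4
  have h3 : ∀ z ∈ side σ, Continuous fun x => field ψ f q x z := fun z hz =>
    (LipschitzWith.of_dist_le_mul (K := (M * d).toNNReal) fun x y => by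
      rw [dist_eq_norm, dist_eq_norm, Real.coe_toNNReal _ (by positivity)]
      simpa using h2 y (x - y) z hz).continuous
  have h4 : ∀ x, ∀ z ∈ side σ, ∀ z' ∈ side σ,
      ‖field ψ f q x z - field ψ f q x z'‖ ≤ M * |z - z'| := by
    intro x z hz z' hz'
    have hdense : Dense {x | ∀ z ∈ side σ, field ψ f q x z = harm ψ f x 0 +
        ∫ y in (0 : ℝ)..z, Φ none x y} := Measure.dense_of_ae (ae_field_eq hψ hσ hf hq)
    refine (isClosed_le ((h3 z hz).sub (h3 z' hz')).norm continuous_const).closure_subset_iff.2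
      (fun x hx => ?_) (hdense x)
    have hI : ∀ a b, IntervalIntegrable (fun y => Φ none x y) volume a b := fun a b =>
      (intervalIntegrable_const (c := M)).mono_fun'
        ((hg none).jm.meas.comp (by fun_prop : Measurable fun y : ℝ => (x, y))).aestronglyMeasurable
        (.of_forall fun y => hb _ _ _)
    change ‖field ψ f q x z - field ψ f q x z'‖ ≤ _
    rw [hx z hz, hx z' hz', add_sub_add_left_eq_sub,
      intervalIntegral.integral_interval_sub_left (hI _ _) (hI _ _)]
    exact intervalIntegral.norm_integral_le_of_norm_le_const fun y _ => hb _ _ _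
  refine ⟨(M * d + M).toNNReal, LipschitzOnWith.of_dist_le_mul fun p hp p' hp' => ?_⟩
  rw [Real.coe_toNNReal _ (by positivity), dist_eq_norm]
  calc _ ≤ ‖field ψ f q p.1 p.2 - field ψ f q p'.1 p.2‖ +
        ‖field ψ f q p'.1 p.2 - field ψ f q p'.1 p'.2‖ :=
        norm_sub_le_norm_sub_add_norm_sub _ _ _
    _ ≤ M * d * ‖p.1 - p'.1‖ + M * |p.2 - p'.2| := by
        refine add_le_add ?_ (h4 _ _ hp.2 _ hp'.2)
        simpa using h2 p'.1 (p.1 - p'.1) p.2 hp.2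
    _ ≤ M * d * dist p p' + M * dist p p' := by
        have e1 : ‖p.1 - p'.1‖ ≤ dist p p' := by
          rw [← dist_eq_norm, Prod.dist_eq]; exact le_max_left _ _
        have e2 : |p.2 - p'.2| ≤ dist p p' := by
          rw [← Real.dist_eq, Prod.dist_eq]; exact le_max_right _ _
        gcongr
    _ = _ := by ring

lemma aeq_grad_field : AEq (grad σ (field ψ f q)) (data ψ σ f + gradPot σ q) := by
  rintro (_ | k)
  · obtain ⟨L, hL⟩ := lipschitz_field hψ hσ hf hq
    have hg := good_dataPot hψ hσ hf hq none
    set Φ := data ψ σ f + gradPot σ q with hΦ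
    have hm : MeasurableSet {p : Rd d × ℝ | grad σ (field ψ f q) none p.1 p.2 = Φ none p.1 p.2} :=
      measurableSet_eq_fun (jm_grad hL none).meas hg.jm.meas
    refine (Measure.ae_ae_comm (μ := volume) (ν := volume)
      (p := fun x z => grad σ (field ψ f q) none x z = Φ none x z) hm).1 ?_
    filter_upwards [ae_field_eq hψ hσ hf hq] with x hx
    have hI : LocallyIntegrable (fun y => Φ none x y) volume := by
      refine (locallyIntegrable_const (sN (Φ none)).toReal).mono
        (hg.jm.meas.comp (by fun_prop : Measurable fun y : ℝ => (x, y))).aestronglyMeasurable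
        (.of_forall fun y => ?_)
      rw [norm_of_nonneg toReal_nonneg, ← toReal_enorm]
      exact toReal_mono hg.jm.fin.ne (le_sN _ x y)
    filter_upwards [LocallyIntegrable.ae_hasDerivAt_integral hI] with z hz
    by_cases hzs : z ∈ side σ
    · rw [grad, ind_of_mem hzs, dz, ← ((hz 0).const_add (harm ψ f x 0)).deriv]
      refine EventuallyEq.deriv_eq ?_
      filter_upwards [(isOpen_side σ).mem_nhds hzs] with s hs using hx s hs
    · simp only [hΦ, Pi.add_apply, data, gradPot, grad, ind_of_notMem hzs, add_zero]
  · rw [grad_field_some hψ hσ hf hq]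
    exact .of_forall fun z => EventuallyEq.rfl

lemma memV_field : MemV ψ σ (field ψ f q) := by
  obtain ⟨L, hL⟩ := lipschitz_field hψ hσ hf hq
  obtain ⟨C, hC⟩ := exists_blockBound hψ (d := d)
  have hc := hq.cl_lt_top weight_pw
  refine memV_of_grad hψ hL (fun i => ?_) (B := 3 * symNorm (dyadicSym ψ 0) *
    (ofReal C * bes ψ pw f) + ofReal C * cl ψ pw q) ?_ fun k z hz => ?_
  · have hae := aeq_grad_field hψ hσ hf hq i
    have hg := good_dataPot hψ hσ hf hq i
    refine ⟨jm_grad hL i, ENNReal.add_lt_top.2 ⟨(jm_grad hL i).fin, ?_⟩⟩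
    refine lt_of_le_of_lt (le_of_eq ?_) (hg.cl_lt_top weight_pw)
    rw [cl, cl]
    congr 1 with j
    congr 1
    refine lintegral_congr_ae ?_
    filter_upwards [hae] with z hz
    rw [bl, bl, multF_congr_ae _ hz]
  · refine ENNReal.add_lt_top.2 ⟨mul_lt_top (mul_lt_top (by simp)
      (hψ.dyadic_smooth 0).l1.symNorm_lt_top) ?_, ?_⟩
    · exact mul_lt_top ofReal_lt_top hf
    · exact mul_lt_top ofReal_lt_top hc
  · rw [grad_field_some hψ hσ hf hq]
    refine le_trans ?_ (add_le_add (tsum_bl_harmF_le hψ (deg1_gradSym k) (hC (some k)) hf z)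
      (tsum_bl_layer_le hψ (deg1_gradSym k) (hC (some k)) (S := below σ) hq.jm hc z))
    rw [← ENNReal.tsum_add]
    refine tsum_le_tsum fun j => ?_
    have hl := (hψ.dyadic_smooth j).l1
    have h1 := (nN_harmF_le hψ (deg1_gradSym k) weight_pw hf (hC (some k))).1
    have h2 := jm_layer hψ (deg1_gradSym k) (measurableSet_below σ) hq.jm hc
    have h3 : at' ((data ψ σ f + gradPot σ q) (some k)) z = at' (harmF ψ (gradSym k) f) z +
        at' ((σ : ℂ) • layer (below σ) (gradSym k) q) z := by
      ext x
      simp only [at', Pi.add_apply, data, gradPot, ind_of_mem hz]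
    rw [bl, h3, multF_add hl (h1.bm z) ((h2.smul _).bm z)]
    refine (supN_add_le _ _).trans (add_le_add le_rfl ?_)
    have h4 : multF (dyadicSym ψ j) (at' ((σ : ℂ) • layer (below σ) (gradSym k) q) z) =
        fun x => (σ : ℂ) * multF (dyadicSym ψ j) (at' (layer (below σ) (gradSym k) q) z) x :=
      funext fun x => multF_const_mul _ _ _ _
    rw [h4, supN_const_mul, enorm_sign hσ, one_mul]
    rfl

end field

lemma Qa_eq (ψ : Rd d → ℝ) {σ : ℝ} (η : TempModPoly d) (v : Rd d → ℝ → ℂ) (x : Rd d) {z : ℝ}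
    (hz : z ∈ side σ) : Qa ψ σ η v x z = qa (data ψ σ η) (grad σ v) x z := by
  simp only [Qa, qa, coef, Pi.sub_apply, Pi.mul_apply, Finset.sum_apply, data, grad,
    ind_of_mem hz, Pi.smul_apply, smul_eq_mul]
  rfl

lemma Qvec_eq (ψ : Rd d → ℝ) {σ : ℝ} (η : TempModPoly d) (v : Rd d → ℝ → ℂ) (k : Fin d) (x : Rd d)
    {z : ℝ} (hz : z ∈ side σ) :
    Qvec ψ σ η v k x z = qv (data ψ σ η) (grad σ v) k x z := by
  simp only [Qvec, qv, Pi.sub_apply, Pi.mul_apply, data, grad, ind_of_mem hz, Pi.smul_apply,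
    smul_eq_mul]
  rfl

lemma grad_congr {σ : ℝ} {v v' : Rd d → ℝ → ℂ} {c : ℂ}
    (h : ∀ x, ∀ z ∈ side σ, v x z = v' x z + c) : grad σ v = grad σ v' := by
  ext i x z
  by_cases hz : z ∈ side σ
  · rcases i with _ | k
    · rw [grad, grad, ind_of_mem hz, ind_of_mem hz, dz, dz]
      refine (EventuallyEq.deriv_eq (f := fun s => v' x s + c) ?_).trans (deriv_add_const c)
      filter_upwards [(isOpen_side σ).mem_nhds hz] with s hs using h x s hs
    · rw [grad, grad, ind_of_mem hz, ind_of_mem hz, dx, dx, lineDeriv, lineDeriv]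
      simp only [h _ z hz, deriv_add_const]
  · rcases i with _ | k <;> rw [grad, grad, ind_of_notMem hz, ind_of_notMem hz]

lemma pot_congr {q q' : Rd d → ℝ → ℂ} (h : ∀ᵐ z, at' q z =ᵐ[volume] at' q' z) :
    pot q = pot q' := by
  ext x z
  refine intervalIntegral.integral_congr_ae ?_
  filter_upwards [h] with τ hτ _ using by rw [multF_congr_ae _ hτ]

lemma nN_mono {ψ : Rd d → ℝ} {w w' : ℤ → ℝ≥0∞} (h : ∀ j, w j ≤ w' j) (f : Rd d → ℝ → ℂ) :
    nN ψ w f ≤ nN ψ w' f :=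
  add_le_add le_rfl (tsum_le_tsum fun j => mul_le_mul' (h j) le_rfl)

section remainder
variable {ψ : Rd d → ℝ} (hψ : IsCutoff ψ) {σ : ℝ} (hσ : σ = 1 ∨ σ = -1)
  {η f : TempModPoly d} {wg : ℤ → ℝ≥0∞} {K ε : ℝ≥0∞} (hwg : Weight wg K)
  (hs : Small ψ wg K (data ψ σ η) ε) {v : Rd d → ℝ → ℂ} {U : Fld d}
include hψ

include hwg hs in
lemma wField_eq (hv : ∀ i, Good ψ wg (grad σ v i)) (x : Rd d) {z : ℝ} (hz : 0 ≤ σ * z) :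
    wField ψ σ η v x z = wOp σ (data ψ σ η) (grad σ v) x z := by
  set h := data ψ σ η
  have hside : ∀ τ, (z, τ) ∈ beyond σ → τ ∈ side σ := fun τ hτ => by
    have h1 : 0 < σ * (τ - z) := hτ
    change 0 < σ * τ
    linarith
  have hms : MeasurableSet {τ | (z, τ) ∈ beyond σ} :=
    (measurableSet_beyond σ).preimage (by fun_prop : Measurable fun τ : ℝ => (z, τ))
  have h1 : ∫ τ in {τ : ℝ | 0 < σ * (τ - z)}, source ψ σ η v |z - τ| x τ =
      ∫ τ in {τ | (z, τ) ∈ beyond σ},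
        (∑ k, multF (fun ζ => gradSym k ζ * poissonSym |z - τ| ζ) (at' (qv h (grad σ v) k) τ) x +
          σ * multF (fun ζ => absSym ζ * poissonSym |z - τ| ζ) (at' (qa h (grad σ v)) τ) x) := by
    refine setIntegral_congr_fun hms fun τ hτ => ?_
    simp only [source, Qvec_eq ψ η v _ _ (hside τ hτ), Qa_eq ψ η v _ (hside τ hτ)]
    rfl
  have hi := fun k => (integrable_multF_poisson hψ (deg1_gradSym k)
    (hs.good_qv hψ hwg hv k).jm ((hs.good_qv hψ hwg hv k).cl_lt_top hwg) x z).integrableOn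
      (s := {τ | (z, τ) ∈ beyond σ})
  have hi' := (integrable_multF_poisson hψ deg1_absSym
    (hs.good_qa hψ hwg hv).jm ((hs.good_qa hψ hwg hv).cl_lt_top hwg) x z).integrableOn
      (s := {τ | (z, τ) ∈ beyond σ})
  rw [wField, h1, integral_add (integrable_finsetSum _ fun k _ => hi k) (hi'.const_mul _),
    integral_finsetSum _ fun k _ => hi k, integral_const_mul]
  simp only [wOp, Pi.smul_apply, Pi.add_apply, Finset.sum_apply, smul_eq_mul, layer]

include hσ hwg hs in
lemma opT_eq (hv : ∀ i, Good ψ wg (grad σ v i)) (x : Rd d) {z : ℝ} (hz : z ∈ side σ) :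
    opT ψ σ η f v x z = field ψ f (qt σ (data ψ σ η) (grad σ v)) x z := by
  rw [opT, field, pot, integral_below hσ _ hz, integral_below hσ _ hz]
  congr 2
  refine setIntegral_congr_fun ((measurableSet_below σ).preimage
    (by fun_prop : Measurable fun y : ℝ => (z, y))) fun y hy => ?_
  have hy' : y ∈ side σ := hy.1
  have h1 : (fun y' => wField ψ σ η v y' y + Qa ψ σ η v y' y) =
      at' (qt σ (data ψ σ η) (grad σ v)) y := by
    ext y'
    rw [wField_eq hψ hwg hs hv y' (le_of_lt hy'), Qa_eq ψ η v y' hy']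
    rfl
  simp only [h1]

include hσ
variable [Nonempty (Fin d)] (hs' : Small ψ pw K (data ψ σ η) ε) (hK : Weight pw K)
  (hf : bes ψ pw f < ⊤)
include hs' hK hf

lemma isRemainder_of_solution (hU : ∀ i, Good ψ pw (U i))
    (hUe : AEq U (data ψ σ f + gradOp σ (data ψ σ η) U)) :
    IsRemainder ψ σ η f (at' (wOp σ (data ψ σ η) U) 0) := by
  have hq := hs'.good_qt (σ := σ) hψ hK hU
  set v := field ψ f (qt σ (data ψ σ η) U) with hv
  have hm : MemV ψ σ v := memV_field hψ hσ hf hq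
  have hae : AEq (grad σ v) U := by
    refine (aeq_grad_field hψ hσ hf hq).trans (AEq.symm ?_)
    rw [← gradOp_eq]
    exact hUe
  refine ⟨v, ⟨hm, 0, fun x z hz => ?_⟩, fun x => ?_⟩
  · rw [opT_eq hψ hσ hK hs' (hm.good_grad hψ) x hz, add_zero, field, pot_congr hae.qt]
    rfl
  · rw [wField_eq hψ hK hs' (hm.good_grad hψ) x (by simp), hae.wOp]
    rfl

lemma IsRemainder.exists_solution {R : Rd d → ℂ} (hR : IsRemainder ψ σ η f R) :
    ∃ U : Fld d, (∀ i, Good ψ pw (U i)) ∧ AEq U (data ψ σ f + gradOp σ (data ψ σ η) U) ∧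
      R = at' (wOp σ (data ψ σ η) U) 0 := by
  obtain ⟨v, ⟨hm, c, hc⟩, hR⟩ := hR
  have hU := hm.good_grad hψ
  refine ⟨grad σ v, hU, ?_, funext fun x => ?_⟩
  · have h1 : grad σ v = grad σ (field ψ f (qt σ (data ψ σ η) (grad σ v))) :=
      grad_congr (c := c) fun x z hz => by
        rw [hc x z hz, opT_eq hψ hσ hK hs' hU x hz]
    rw [gradOp_eq]
    nth_rewrite 1 [h1]
    exact aeq_grad_field hψ hσ hf (hs'.good_qt hψ hK hU)
  · rw [hR, wField_eq hψ hK hs' hU x (by simp)]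
    rfl

omit hf in
/-- Remainders are additive. -/
lemma IsRemainder.add {g : TempModPoly d} {R S : Rd d → ℂ} (hf : bes ψ pw f < ⊤)
    (hg : bes ψ pw g < ⊤) (hfg : bes ψ pw (f + g) < ⊤)
    (hd : data ψ σ (f + g) = data ψ σ f + data ψ σ g)
    (hR : IsRemainder ψ σ η f R) (hS : IsRemainder ψ σ η g S) :
    IsRemainder ψ σ η (f + g) (R + S) := by
  obtain ⟨U, hU, hUe, rfl⟩ := hR.exists_solution hψ hσ hs' hK hf
  obtain ⟨V, hV, hVe, rfl⟩ := hS.exists_solution hψ hσ hs' hK hg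
  have h1 := isRemainder_of_solution (U := U + V) hψ hσ hs' hK hfg
    (fun i => Good.add hψ (hU i) (hV i)) (by
      rw [hd, hs'.gradOp_add hψ hK hU hV]
      convert hUe.add hVe using 1
      abel)
  rw [hs'.wOp_add hψ hK hU hV] at h1
  exact h1

end remainder

/-- `u ↦ (m(D)u)(x)` as a linear functional. -/
def multCL (m : Rd d → ℂ) (x : Rd d) : TempModPoly d →ₗ[ℂ] ℂ where
  toFun u := multC m u x
  map_add' u v := by
    simp only [multC, pairHat]
    split_ifs
    · exact map_add _ _ _
    · simp
  map_smul' c u := by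
    simp only [multC, pairHat]
    split_ifs
    · exact map_smul _ _ _
    · simp

lemma multC_add (m : Rd d → ℂ) (u v : TempModPoly d) :
    multC m (u + v) = multC m u + multC m v := funext fun x => map_add (multCL m x) u v

lemma multC_smul (m : Rd d → ℂ) (c : ℂ) (u : TempModPoly d) :
    multC m (c • u) = fun x => c * multC m u x := funext fun x => map_smul (multCL m x) c u

section bes
variable {ψ : Rd d → ℝ} {wg : ℤ → ℝ≥0∞} {u v : TempModPoly d}

lemma bes_add_le : bes ψ wg (u + v) ≤ bes ψ wg u + bes ψ wg v := by
  rw [bes, bes, bes, ← ENNReal.tsum_add]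
  refine tsum_le_tsum fun j => ?_
  rw [multC_add, ← mul_add]
  exact mul_le_mul' le_rfl (supN_add_le _ _)

lemma bes_sub_le : bes ψ wg (u - v) ≤ bes ψ wg u + bes ψ wg v := by
  rw [bes, bes, bes, ← ENNReal.tsum_add]
  refine tsum_le_tsum fun j => ?_
  have h : multC (dyadicSym ψ j) (u - v) = multC (dyadicSym ψ j) u + fun x =>
      -1 * multC (dyadicSym ψ j) v x := by
    rw [sub_eq_add_neg, multC_add, ← multC_smul, neg_one_smul]
  rw [h, ← mul_add]
  refine mul_le_mul' le_rfl ((supN_add_le _ _).trans (le_of_eq ?_))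
  rw [supN_const_mul, enorm_neg, enorm_one, one_mul]

lemma bes_smul (c : ℂ) : bes ψ wg (c • u) = ‖c‖ₑ * bes ψ wg u := by
  rw [bes, bes, ← ENNReal.tsum_mul_left]
  congr 1 with j
  rw [multC_smul, supN_const_mul, mul_left_comm]

lemma bes_mono {w w' : ℤ → ℝ≥0∞} (h : ∀ j, w j ≤ w' j) : bes ψ w u ≤ bes ψ w' u :=
  tsum_le_tsum fun j => mul_le_mul' (h j) le_rfl

end bes

section real
variable {ψ : Rd d → ℝ} (hψ : IsCutoff ψ) {a : Rd d → ℂ} (ha : Deg1 a) {f g : TempModPoly d}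
include hψ ha

lemma summable_harmB (hf : bes ψ pw f < ⊤) (x : Rd d) (z : ℝ) :
    Summable fun j => harmB ψ a f j x z := by
  obtain ⟨C, hC⟩ := ha.hom.exists_symNorm_le hψ
  exact Summable.of_enorm (((tsum_le_tsum fun j => le_sN _ x z).trans
    (tsum_sN_harmB_le hψ ha weight_pw ⟨hC.1, hC.2⟩)).trans_lt
      (mul_lt_top ofReal_lt_top hf)).ne

lemma harmF_add (hf : bes ψ pw f < ⊤) (hg : bes ψ pw g < ⊤) :
    harmF ψ a (f + g) = harmF ψ a f + harmF ψ a g := by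
  ext x z
  simp only [harmF_eq, Pi.add_apply]
  rw [← (summable_harmB hψ ha hf x z).tsum_add (summable_harmB hψ ha hg x z)]
  simp only [harmB, multC_add, Pi.add_apply]

lemma star_harmF (hh : Herm a) (hf : IsReal f) : star (harmF ψ a f) = harmF ψ a f := by
  ext x z
  simp only [Pi.star_apply, harmF_eq, tsum_star]
  congr 1 with j
  exact multC_star_of_isReal (ha.hom.smoothSym_dyadic hψ |z| j)
    (Homog.eventually_zero hψ (fun ζ => a ζ * poissonSym |z| ζ) j)
    ((hh.mul (herm_poissonSym _)).mul (herm_dyadicSym hψ j)) hf x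

end real

lemma star_ind (σ : ℝ) (f : Rd d → ℝ → ℂ) : star (ind σ f) = ind σ (star f) := by
  ext x z
  by_cases hz : z ∈ side σ
  · simp only [Pi.star_apply, ind_of_mem hz]
  · simp only [Pi.star_apply, ind_of_notMem hz, star_zero]

section star
variable {ψ : Rd d → ℝ} (hψ : IsCutoff ψ) {σ : ℝ} {h U : Fld d}

lemma star_smul_real (f : Rd d → ℝ → ℂ) : star ((σ : ℂ) • f) = (σ : ℂ) • star f := by
  ext x z
  simp

lemma star_layer {a : Rd d → ℂ} (hh : Herm a) (S : Set (ℝ × ℝ)) (q : Rd d → ℝ → ℂ) :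
    star (layer S a q) = layer S a (star q) := by
  ext x z
  simp only [Pi.star_apply, layer]
  refine (integral_conj (𝕜 := ℂ)).symm.trans (integral_congr_ae (.of_forall fun τ => ?_))
  exact (hh.mul (herm_poissonSym _)).star_multF _ x

variable (hh : star h = h)
include hh

lemma star_qa : star (qa h U) = qa h (star U) := by
  have h1 : ∀ i, star (h i) = h i := fun i => congrFun hh i
  have h2 : star (coef h) = coef h := by
    ext x z
    have h3 : ∀ i, (starRingEnd ℂ) (h i x z) = h i x z := fun i => congrFun (congrFun (h1 i) x) z
    simp [coef, h3]
  rw [qa, star_sub, star_sum, star_mul', h2]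
  simp only [star_mul', h1]
  rfl

lemma star_qv (k : Fin d) : star (qv h U k) = qv h (star U) k := by
  have h1 : ∀ i, star (h i) = h i := fun i => congrFun hh i
  rw [qv, star_sub, star_mul', star_mul', h1, h1]
  rfl

lemma star_wOp : star (wOp σ h U) = wOp σ h (star U) := by
  have h1 : (-(σ : ℂ)) = ((-σ : ℝ) : ℂ) := by simp
  rw [wOp, wOp, h1, star_smul_real, star_add, star_smul_real, star_sum, star_layer herm_absSym,
    star_qa hh]
  simp only [star_layer (herm_gradSym _), star_qv hh]

lemma star_gradOp : star (gradOp σ h U) = gradOp σ h (star U) := by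
  have h1 : star (qt σ h U) = qt σ h (star U) := by
    rw [qt, star_add, star_wOp hh, star_qa hh]; rfl
  funext i
  rcases i with _ | k
  · change star (ind σ _) = _
    rw [star_ind, star_sub, star_layer herm_absSym, h1]; rfl
  · change star (ind σ _) = _
    rw [star_ind, star_smul_real, star_layer (herm_gradSym k), h1]; rfl

omit hh
include hψ

lemma Good.star {wg : ℤ → ℝ≥0∞} {f : Rd d → ℝ → ℂ} (hf : Good ψ wg f) : Good ψ wg (star f) := by
  have h1 : sN (Star.star f) = sN f := by
    simp only [sN, supN, at', Pi.star_apply, RCLike.star_def, RCLike.enorm_conj]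
  have h2 : ∀ j z, bl ψ (Star.star f) j z = bl ψ f j z := fun j z => by
    simp only [bl, supN]
    congr 1 with x
    rw [show at' (Star.star f) z = fun y => Star.star (at' f z y) from rfl,
      ← (herm_dyadicSym hψ j).star_multF, RCLike.star_def, RCLike.enorm_conj]
  refine ⟨⟨?_, h1.trans_lt hf.jm.fin⟩, ?_⟩
  · exact (continuous_star (R := ℂ)).measurable.comp hf.jm.meas
  · have h3 : nN ψ wg (Star.star f) = nN ψ wg f := by simp only [nN, cl, h1, h2]
    exact h3.trans_lt hf.fin

lemma star_data {f : TempModPoly d} (hf : IsReal f) : star (data ψ σ f) = data ψ σ f := by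
  have h1 : (-(σ : ℂ)) = ((-σ : ℝ) : ℂ) := by simp
  funext i
  rcases i with _ | k
  · change star (ind σ _) = ind σ _
    rw [star_ind, h1, star_smul_real, star_harmF hψ deg1_absSym herm_absSym hf]
  · change star (ind σ _) = ind σ _
    rw [star_ind, star_harmF hψ (deg1_gradSym k) (herm_gradSym k) hf]

lemma data_add {f g : TempModPoly d} (hf : bes ψ pw f < ⊤) (hg : bes ψ pw g < ⊤) :
    data ψ σ (f + g) = data ψ σ f + data ψ σ g := by
  funext i
  rcases i with _ | k
  · change ind σ _ = ind σ _ + ind σ _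
    rw [harmF_add hψ deg1_absSym hf hg, smul_add, ind_add]
  · change ind σ _ = ind σ _ + ind σ _
    rw [harmF_add hψ (deg1_gradSym k) hf hg, ind_add]

end star

section inverse
variable {ψ : Rd d → ℝ} (hψ : IsCutoff ψ) {wg : ℤ → ℝ≥0∞}

/-- The norm of `|D|⁻¹R`. -/
def invN (ψ : Rd d → ℝ) (wg : ℤ → ℝ≥0∞) (R : Rd d → ℂ) : ℝ≥0∞ :=
  ∑' j, wg j * supN (blockF ψ absSym⁻¹ j R)

lemma invN_smul_le (c : ℂ) (R : Rd d → ℂ) : invN ψ wg (c • R) ≤ ‖c‖ₑ * invN ψ wg R := by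
  rw [invN, invN, ← ENNReal.tsum_mul_left]
  refine tsum_le_tsum fun j => le_of_eq ?_
  have : blockF ψ absSym⁻¹ j (c • R) = fun x => c * blockF ψ absSym⁻¹ j R x :=
    funext fun x => multF_const_mul _ _ _ x
  rw [this, supN_const_mul, mul_left_comm]

include hψ

lemma smooth_inv_dyadic (j : ℤ) : SmoothSym fun ζ => absSym⁻¹ ζ * dyadicSym ψ j ζ :=
  (Homog.inv_abs (d := d)).l1_dyadic hψ j

lemma invN_add_le {R S : Rd d → ℂ} (hR : BM R) (hS : BM S) :
    invN ψ wg (R + S) ≤ invN ψ wg R + invN ψ wg S := by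
  rw [invN, invN, invN, ← ENNReal.tsum_add]
  refine tsum_le_tsum fun j => ?_
  rw [blockF, multF_add (smooth_inv_dyadic hψ j).l1 hR hS, ← mul_add]
  exact mul_le_mul' le_rfl (supN_add_le _ _)

lemma invN_sum_le {s : Finset (Fin d)} {f : Fin d → Rd d → ℝ → ℂ} (hf : ∀ i ∈ s, JM (f i))
    (z : ℝ) : invN ψ wg (at' (∑ i ∈ s, f i) z) ≤ ∑ i ∈ s, invN ψ wg (at' (f i) z) := by
  classical
  induction s using Finset.induction_on with
  | empty =>
    have : at' (∑ i ∈ (∅ : Finset (Fin d)), f i) z = (0 : ℂ) • (0 : Rd d → ℂ) := by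
      ext; simp [at']
    rw [this]
    exact (invN_smul_le _ _).trans (by simp)
  | insert i s hi ih =>
    rw [sum_insert hi, sum_insert hi]
    have h1 := fun j hj => hf j (Finset.mem_insert_of_mem hj)
    exact (invN_add_le hψ ((hf i (Finset.mem_insert_self _ _)).bm z)
      ((JM.sum h1).bm z)).trans (add_le_add le_rfl (ih h1))

lemma invN_layer_le {a : Rd d → ℂ} (ha : Deg1 a) {C : ℝ} (hC : BlockBound ψ 0 (absSym⁻¹ * a) C)
    {S : Set (ℝ × ℝ)} {q : Rd d → ℝ → ℂ} (hq : JM q) (hc : cl ψ pw q < ⊤) (z : ℝ) :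
    invN ψ wg (at' (layer S a q) z) ≤ ofReal C * cl ψ wg q := by
  rw [invN, cl, ← ENNReal.tsum_mul_left]
  refine tsum_le_tsum fun j => ?_
  rw [mul_left_comm, ← lintegral_const_mul _ (measurable_bl hψ hq j)]
  refine mul_le_mul' le_rfl (iSup_le fun x => ?_)
  have hom : Homog 0 ((absSym⁻¹ : Rd d → ℂ) * a) := by
    simpa using (Homog.inv_abs (d := d)).mul ha.hom
  rw [blockF, multF_layer hψ ha (smooth_inv_dyadic hψ j).l1 hq hc x z]
  refine (enorm_integral_le_lintegral_enorm _).trans ((setLIntegral_le_lintegral _ _).trans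
    (lintegral_mono fun τ => (le_supN _ x).trans ?_))
  have h1 := supN_multF_block_le hψ hom hC (abs_nonneg (z - τ)) j (hq.bm τ)
  have h2 : (fun ζ => absSym⁻¹ ζ * dyadicSym ψ j ζ * (a ζ * poissonSym |z - τ| ζ)) =
      fun ζ => ((absSym⁻¹ : Rd d → ℂ) * a) ζ * poissonSym |z - τ| ζ * dyadicSym ψ j ζ := by
    ext ζ; simp only [Pi.mul_apply]; ring
  rw [h2]
  refine h1.trans (mul_le_mul' (ofReal_le_ofReal ?_) le_rfl)
  have := decay_le 0 j (abs_nonneg (z - τ))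
  simp only [zero_mul, zpow_zero] at this
  exact mul_le_of_le_one_right hC.1 this

lemma Small.invN_wOp_le {K ε : ℝ≥0∞} (hwg : Weight wg K) {h U : Fld d} {σ : ℝ}
    (hσ : ‖(σ : ℂ)‖ₑ = 1) {C : ℝ}
    (hC : ∀ i : Option (Fin d), BlockBound ψ 0 (absSym⁻¹ * symb i) C) (hs : Small ψ wg K h ε)
    (hU : ∀ i, Good ψ wg (U i)) (z : ℝ) : invN ψ wg (at' (wOp σ h U) z) ≤
      ofReal C * ((d + 1) * (qC ψ K * ε * nF ψ wg U)) := by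
  have gv := hs.good_qv hψ hwg hU
  have ga := hs.good_qa hψ hwg hU
  have j1 := fun k => jm_layer hψ (deg1_gradSym k) (measurableSet_beyond σ) (gv k).jm
    ((gv k).cl_lt_top hwg)
  have j2 := jm_layer hψ deg1_absSym (measurableSet_beyond σ) ga.jm (ga.cl_lt_top hwg)
  have hcl : ∀ q : Rd d → ℝ → ℂ, cl ψ wg q ≤ nN ψ wg q := fun q => le_add_self
  refine (invN_smul_le (-σ : ℂ) (at' (∑ k, layer (beyond σ) (gradSym k) (qv h U k) +
    (σ : ℂ) • layer (beyond σ) absSym (qa h U)) z)).trans ?_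
  rw [enorm_neg, hσ, one_mul]
  refine (invN_add_le hψ ((JM.sum fun k _ => j1 k).bm z) ((j2.smul _).bm z)).trans ?_
  refine (add_le_add (invN_sum_le hψ (fun k _ => j1 k) z)
    (invN_smul_le (σ : ℂ) (at' (layer (beyond σ) absSym (qa h U)) z))).trans ?_
  rw [hσ, one_mul]
  refine (add_le_add (sum_le_sum fun k _ => (invN_layer_le hψ (deg1_gradSym k)
    (hC (some k)) (gv k).jm ((gv k).cl_lt_top hwg) z).trans (mul_le_mul' le_rfl
      ((hcl _).trans (hs.qv_le hψ hwg hU k)))) ((invN_layer_le hψ deg1_absSym (hC none) ga.jm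
        (ga.cl_lt_top hwg) z).trans (mul_le_mul' le_rfl
      ((hcl _).trans (hs.qa_le hψ hwg hU))))).trans (le_of_eq ?_)
  rw [Finset.sum_const, Finset.card_univ, Fintype.card_fin, nsmul_eq_mul]
  ring

lemma blocks_of_bm {R : Rd d → ℂ} (hR : BM R) : Blocks ψ fun j => blockF ψ absSym⁻¹ j R := by
  have hs := fun j => (smooth_inv_dyadic hψ j).l1
  have hd := fun j => (hψ.dyadic_smooth j).l1
  have hcomp : ∀ j k, multF (dyadicSym ψ k) (blockF ψ absSym⁻¹ j R) =
      multF (dyadicSym ψ k * fun ζ => absSym⁻¹ ζ * dyadicSym ψ j ζ) R := fun j k =>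
    multF_comp (hd k) (hs j) hR
  refine ⟨fun j => BM.multF (hs j) hR, fun k x => ?_, fun j k x h1 h2 h3 => ?_⟩
  · have l := fun j => (hd k).mul (hs j)
    simp only [hcomp]
    have h1 := multF_add_sym ((l (k - 1)).add (l k)) (l (k + 1)) hR
    rw [multF_add_sym (l (k - 1)) (l k) hR] at h1
    have h2 := congrFun h1 x
    simp only [Pi.add_apply] at h2
    rw [← h2, blockF]
    congr 1 with ζ
    have := hψ.sum_dyadic_mul k ζ
    simp only [Pi.add_apply, Pi.mul_apply]
    linear_combination -(absSym⁻¹ ζ) * this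
  · have h4 : (dyadicSym ψ k * fun ζ => absSym⁻¹ ζ * dyadicSym ψ j ζ) = 0 := by
      ext ζ
      have := congrFun (dyadic_mul_far hψ h1 h2 h3) ζ
      simp only [Pi.mul_apply, Pi.zero_apply] at this ⊢
      linear_combination absSym⁻¹ ζ * this
    rw [hcomp, h4, multF_zero_sym]; rfl

lemma exists_inverse_class {K : ℝ≥0∞} (hwg : Weight wg K) {R : Rd d → ℂ} (hR : BM R)
    (hfin : invN ψ wg R < ⊤) (hreal : ∀ x, star (R x) = R x) : ∃ t : TempModPoly d, IsReal t ∧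
      bes ψ wg t = invN ψ wg R ∧ ∀ j, multC (dyadicSym ψ j) t = blockF ψ absSym⁻¹ j R := by
  obtain ⟨t, h1, h2⟩ := exists_class hψ (blocks_of_bm hψ hR)
    ((tsum_le_tsum fun j => mul_le_mul' (hwg.pw_le j) le_rfl).trans_lt hfin)
  refine ⟨t, h2 fun j x => ?_, ?_, h1⟩
  · rw [blockF, (herm_inv_absSym.mul (herm_dyadicSym hψ j)).star_multF]
    simp only [hreal]
  · simp only [bes, invN, h1]

end inverse

lemma IsReal.add {u v : TempModPoly d} (hu : IsReal u) (hv : IsReal v) : IsReal (u + v) := by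
  obtain ⟨S, rfl, hS⟩ := hu
  obtain ⟨T, rfl, hT⟩ := hv
  refine ⟨S + T, rfl, fun χ hχ => ?_⟩
  change (S χ + T χ).im = 0
  rw [Complex.add_im, hS χ hχ, hT χ hχ, add_zero]

lemma IsReal.smul {u : TempModPoly d} (hu : IsReal u) (c : ℝ) : IsReal ((c : ℂ) • u) := by
  obtain ⟨S, rfl, hS⟩ := hu
  refine ⟨(c : ℂ) • S, rfl, fun χ hχ => ?_⟩
  change ((c : ℂ) * S χ).im = 0
  simp [hS χ hχ]

lemma IsReal.sub {u v : TempModPoly d} (hu : IsReal u) (hv : IsReal v) : IsReal (u - v) := by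
  have := hu.add (hv.smul (-1))
  simpa [sub_eq_add_neg] using this

lemma eq_of_blocks {ψ : Rd d → ℝ} (hψ : IsCutoff ψ) {u v : TempModPoly d}
    (h : ∀ j x, multC (dyadicSym ψ j) u x = multC (dyadicSym ψ j) v x) : u = v := by
  refine sub_eq_zero.1 (eq_zero_of_blocks hψ fun j x => ?_)
  have h1 : multC (dyadicSym ψ j) (u - v) x = _ := map_sub (multCL (dyadicSym ψ j) x) u v
  rw [h1]
  exact sub_eq_zero.2 (h j x)

lemma eq_zero_of_bes {ψ : Rd d → ℝ} (hψ : IsCutoff ψ) {wg : ℤ → ℝ≥0∞} (hwg : ∀ j, wg j ≠ 0)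
    {u : TempModPoly d} (h : bes ψ wg u = 0) : u = 0 := by
  rw [bes, ENNReal.tsum_eq_zero] at h
  exact eq_zero_of_blocks hψ fun j x =>
    eq_zero_of_supN ((mul_eq_zero.1 (h j)).resolve_left (hwg j)) x

lemma bes_complete {ψ : Rd d → ℝ} (hψ : IsCutoff ψ) {wg : ℤ → ℝ≥0∞} {K : ℝ≥0∞}
    (hwg : Weight wg K) {X : ℕ → TempModPoly d} (hX : ∀ n, IsReal (X n) ∧ bes ψ wg (X n) < ⊤)
    (hs : ∑' n, bes ψ wg (X n) < ⊤) : ∃ s : TempModPoly d, (IsReal s ∧ bes ψ wg s < ⊤) ∧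
      ∀ M, bes ψ wg (s - ∑ n ∈ Finset.range M, X n) ≤ ∑' n, bes ψ wg (X (n + M)) := by
  set H : ℤ → ℕ → Rd d → ℂ := fun j n => multC (dyadicSym ψ j) (X n) with hH
  set h : ℤ → Rd d → ℂ := fun j y => ∑' n, H j n y with hh
  have hsw : ∑' j, wg j * ∑' n, supN (H j n) = ∑' n, bes ψ wg (X n) := by
    simp only [← ENNReal.tsum_mul_left, bes]
    exact ENNReal.tsum_comm
  have hw0 : ∀ j, wg j ≠ 0 := fun j h0 =>
    pw_ne_zero j (le_antisymm ((hwg.pw_le j).trans h0.le) bot_le)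
  have hfin : ∀ j, ∑' n, supN (H j n) < ⊤ := fun j => by
    have h1 := (ENNReal.le_tsum (f := fun j => wg j * ∑' n, supN (H j n)) j).trans_lt
      (hsw.trans_lt hs)
    exact lt_top_iff_ne_top.2 fun h2 => by
      simp only [h2, ENNReal.mul_top (hw0 j), lt_self_iff_false] at h1
  have hbm : ∀ j n, BM (H j n) := fun j n => bm_multC hψ hwg (hX n).2 j
  have hsum : ∀ j y, Summable fun n => H j n y := fun j y =>
    Summable.of_enorm ((tsum_le_tsum fun n => le_supN _ y).trans_lt (hfin j)).ne
  have hle : ∀ j, supN (h j) ≤ ∑' n, supN (H j n) := fun j => iSup_le fun y =>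
    enorm_tsum_le_tsum_enorm.trans (tsum_le_tsum fun n => le_supN _ y)
  have hF : ∀ k j y, HasSum (fun n => multF (dyadicSym ψ k) (H j n) y)
      (multF (dyadicSym ψ k) (h j) y) := fun k j y => by
    have hl := (hψ.dyadic_smooth k).l1
    rw [hh, multF_tsum_fun hl (hbm j) (hfin j) y]
    refine Summable.hasSum (Summable.of_enorm (lt_of_le_of_lt (tsum_le_tsum fun n =>
      (le_supN _ y).trans (supN_multF_le hl.int _)) ?_).ne)
    rw [ENNReal.tsum_mul_left]
    exact mul_lt_top hl.symNorm_lt_top (hfin j)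
  have hb := fun n => blocks_multC hψ hwg (hX n).2
  have hblocks : Blocks ψ h := by
    refine ⟨fun j => ⟨?_, (hle j).trans_lt (hfin j)⟩, fun k y => ?_, fun j k y h1 h2 h3 => ?_⟩
    · refine measurable_of_tendsto_metrizable' atTop
        (f := fun (N : Finset ℕ) (y : Rd d) => ∑ n ∈ N, H j n y)
        (fun N => Finset.measurable_sum _ fun n _ => (hbm j n).meas)
        (tendsto_pi_nhds.2 fun y => (hsum j y).hasSum)
    · refine HasSum.unique (f := fun n => H k n y) (hsum k y).hasSum ?_
      convert ((hF k (k - 1) y).add (hF k k y)).add (hF k (k + 1) y) using 2 with n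
      exact (hb n).near k y
    · refine HasSum.unique (hF k j y) ?_
      convert hasSum_zero using 2 with n
      exact (hb n).far j k y h1 h2 h3
  obtain ⟨s, hs1, hs2⟩ := exists_class hψ hblocks ((tsum_le_tsum fun j =>
    mul_le_mul' (hwg.pw_le j) (hle j)).trans_lt (hsw.trans_lt hs))
  refine ⟨s, ⟨hs2 fun j y => ?_, ?_⟩, fun M => ?_⟩
  · rw [hh, tsum_star]
    congr 1 with n
    have hd : SmoothSym (dyadicSym ψ j) := hψ.dyadic_smooth j
    exact multC_star_of_isReal hd (hψ.dyadic_eventually_zero j) (herm_dyadicSym hψ j) (hX n).1 y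
  · refine lt_of_le_of_lt (tsum_le_tsum fun j => ?_) (hsw.trans_lt hs)
    rw [hs1]
    exact mul_le_mul' le_rfl (hle j)
  · have h1 : ∀ j y, multC (dyadicSym ψ j) (s - ∑ n ∈ Finset.range M, X n) y =
        ∑' n, H j (n + M) y := fun j y => by
      have h2 : multC (dyadicSym ψ j) (s - ∑ n ∈ Finset.range M, X n) y = _ :=
        map_sub (multCL (dyadicSym ψ j) y) s _
      rw [h2, map_sum]
      change multC (dyadicSym ψ j) s y - ∑ n ∈ Finset.range M, H j n y = _
      rw [hs1]
      change (∑' n, H j n y) - _ = _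
      rw [← (hsum j y).sum_add_tsum_nat_add M, add_sub_cancel_left]
    simp only [bes]
    rw [ENNReal.tsum_comm]
    refine tsum_le_tsum fun j => ?_
    rw [ENNReal.tsum_mul_left]
    refine mul_le_mul' le_rfl (iSup_le fun y => ?_)
    rw [h1]
    exact enorm_tsum_le_tsum_enorm.trans (tsum_le_tsum fun n => le_supN _ y)

/-! ### Besov norms -/

/-- The weight of `Ḃ^s`. -/
def sw (s : ℝ) (j : ℤ) : ℝ≥0∞ := (2 : ℝ≥0∞) ^ (s * j)

lemma besovNorm_one (ψ : Rd d → ℝ) (s : ℝ) (u : TempModPoly d) :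
    besovNorm ψ 1 s u = bes ψ (sw s) u := by
  simp only [besovNorm, bes, sw, blockC_one]
  rfl

lemma sw_one : sw 1 = pw := by
  ext j
  rw [sw, one_mul, pw_eq]

lemma sw_ne_zero (s : ℝ) (j : ℤ) : sw s j ≠ 0 := by
  simp [sw, ENNReal.rpow_eq_zero_iff]

lemma sw_ne_top (s : ℝ) (j : ℤ) : sw s j ≠ ⊤ := by
  simp [sw, ENNReal.rpow_eq_top_iff]

lemma sw_mul (s : ℝ) (i j : ℤ) : sw s (i + j) = sw s i * sw s j := by
  rw [sw, sw, sw, ← ENNReal.rpow_add _ _ (by simp) (by simp)]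
  push_cast
  rw [mul_add]

lemma sw_add (s t : ℝ) (j : ℤ) : sw (s + t) j = sw s j * sw t j := by
  rw [sw, sw, sw, ← ENNReal.rpow_add _ _ (by simp) (by simp), add_mul]

lemma weight_add {r : ℝ} (hr : 0 ≤ r) (δ : ℝ≥0∞) :
    Weight (fun j => pw j + δ * sw (1 + r) j) (sw (1 + r) 1) := by
  have hs : ∀ n : ℕ, sw (1 + r) (-n) ≤ pw (-n) := fun n => by
    rw [← sw_one, sw, sw]
    refine ENNReal.rpow_le_rpow_of_exponent_le (by norm_num) ?_
    push_cast
    nlinarith [(Nat.cast_nonneg n : (0 : ℝ) ≤ n)]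
  have h2 : pw 1 ≤ sw (1 + r) 1 := by
    rw [← sw_one, sw, sw]
    exact ENNReal.rpow_le_rpow_of_exponent_le (by norm_num) (by push_cast; linarith)
  refine ⟨fun j => le_self_add, fun j n => ?_, fun j => ?_, (sw_ne_top _ _).lt_top⟩
  · rw [sub_eq_neg_add, pw_add, sw_mul, mul_add, mul_left_comm]
    exact add_le_add le_rfl (mul_le_mul' (hs n) le_rfl)
  · rw [add_comm j, pw_add, sw_mul, mul_add, mul_left_comm]
    exact add_le_add (mul_le_mul' h2 le_rfl) le_rfl

lemma weight_pw_sw {r : ℝ} (hr : 0 ≤ r) : Weight pw (sw (1 + r) 1) := by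
  simpa using weight_add hr 0

lemma bes_weight_add {ψ : Rd d → ℝ} {r : ℝ} {δ : ℝ≥0∞} (u : TempModPoly d) :
    bes ψ (fun j => pw j + δ * sw (1 + r) j) u = bes ψ pw u + δ * bes ψ (sw (1 + r)) u := by
  simp only [bes, add_mul, mul_assoc]
  rw [ENNReal.tsum_add, ENNReal.tsum_mul_left]

lemma besovNorm_abs {ψ : Rd d → ℝ} (hψ : IsCutoff ψ) : ∃ C : ℝ≥0∞, C < ⊤ ∧
    ∀ (s : ℝ) (u : TempModPoly d), besovNorm ψ absSym s u ≤ C * bes ψ (sw (1 + s)) u ∧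
      bes ψ (sw (1 + s)) u ≤ C * besovNorm ψ absSym s u := by
  obtain ⟨C, hC, hC'⟩ := (homog_absSym (d := d)).exists_symNorm_le hψ
  obtain ⟨C₁, hC₁, hC₁'⟩ := (Homog.inv_abs (d := d)).exists_symNorm_le hψ
  have hpw : ∀ j, ofReal ((2 : ℝ) ^ (-j)) * sw 1 j = 1 := fun j => by
    rw [sw_one, ← pw_zero, ← neg_add_cancel j, pw_add]; rfl
  refine ⟨ofReal C + ofReal C₁, by simp, fun s u => ⟨?_, ?_⟩⟩
  · rw [besovNorm, bes, ← ENNReal.tsum_mul_left]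
    refine tsum_le_tsum fun j => ?_
    have h1 := multC_poisson_block hψ (homog_absSym (d := d)) 0 j u
    have h2 := hC' j 0 le_rfl
    have hi := ((homog_absSym (d := d)).smoothSym_fat hψ 0 j).l1.int
    simp only [poissonSym_zero, Pi.one_apply, mul_one] at h1 h2 hi
    have h3 : supN (blockC ψ absSym j u) ≤
        ofReal (C * decay 1 j 0) * supN (multC (dyadicSym ψ j) u) := by
      rw [blockC, h1]
      exact (supN_multF_le hi _).trans (mul_le_mul' h2 le_rfl)
    rw [decay_zero_right, ofReal_mul hC, one_mul,
      show ofReal ((2 : ℝ) ^ j) = sw 1 j by rw [sw_one]; rfl] at h3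
    calc sw s j * supN (blockC ψ absSym j u)
        ≤ sw s j * (ofReal C * sw 1 j * supN (multC (dyadicSym ψ j) u)) :=
          mul_le_mul' le_rfl h3
      _ = ofReal C * (sw (1 + s) j * supN (multC (dyadicSym ψ j) u)) := by
          rw [sw_add]; ring
      _ ≤ _ := mul_le_mul' le_self_add le_rfl
  · rw [besovNorm, bes, ← ENNReal.tsum_mul_left]
    refine tsum_le_tsum fun j => ?_
    have h2 := hC₁' j 0 le_rfl
    have hi := (Homog.inv_abs (d := d)).smoothSym_fat hψ 0 j
    simp only [poissonSym_zero, Pi.one_apply, mul_one] at h2 hi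
    have h1 : multC (dyadicSym ψ j) u =
        multF (fun ζ => absSym⁻¹ ζ * fatSym ψ j ζ) (blockC ψ absSym j u) := by
      rw [blockC, ← multC_mul hi ((homog_absSym (d := d)).l1_dyadic hψ j)
        (Homog.eventually_zero hψ _ j)]
      congr 1 with ζ
      have h4 := hψ.fat_mul_dyadic j ζ
      simp only [Pi.mul_apply, Pi.inv_apply]
      rcases eq_or_ne ζ 0 with rfl | h
      · rw [(hψ.dyadic_eventually_zero j).self_of_nhds]; simp
      · field_simp [absSym_ne_zero h]
        rw [mul_comm, h4]
    have h3 : supN (multC (dyadicSym ψ j) u) ≤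
        ofReal (C₁ * decay (-1) j 0) * supN (blockC ψ absSym j u) := by
      rw [h1]
      exact (supN_multF_le hi.l1.int _).trans (mul_le_mul' h2 le_rfl)
    rw [decay_zero_right, ofReal_mul hC₁, neg_one_mul] at h3
    calc sw (1 + s) j * supN (multC (dyadicSym ψ j) u)
        ≤ sw (1 + s) j * (ofReal C₁ * ofReal (2 ^ (-j)) *
            supN (blockC ψ absSym j u)) := mul_le_mul' le_rfl h3
      _ = ofReal C₁ * (ofReal (2 ^ (-j)) * sw 1 j) *
            (sw s j * supN (blockC ψ absSym j u)) := by rw [sw_add]; ring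
      _ ≤ _ := by
          rw [hpw, mul_one]
          exact mul_le_mul' le_add_self le_rfl

/-- `t = |D|⁻¹ R^±(η) f`. -/
structure IsInvRem (ψ : Rd d → ℝ) (σ : ℝ) (η f t : TempModPoly d) : Prop where
  ex : ∃ R, IsRemainder ψ σ η f R
  bm : ∀ R, IsRemainder ψ σ η f R → BM R
  eq : ∀ R, IsRemainder ψ σ η f R → ∀ j, multC (dyadicSym ψ j) t = blockF ψ absSym⁻¹ j R

/-- The constant in the bound of `|D|⁻¹R`. -/
def invC (d : ℕ) (ψ : Rd d → ℝ) (K : ℝ≥0∞) (C C₀ : ℝ) : ℝ≥0∞ :=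
  ofReal C₀ * ((d + 1) * (qC ψ K * (2 * ((d + 1) * harmC ψ K C))))

lemma invC_lt_top {ψ : Rd d → ℝ} (hψ : IsCutoff ψ) {K : ℝ≥0∞} (hK : Weight pw K) (C C₀ : ℝ) :
    invC d ψ K C C₀ < ⊤ := by
  have := algC_lt_top hψ hK
  have := harmC_lt_top (C := C) hψ hK
  rw [invC, qC]
  finiteness

section inverse
variable [Nonempty (Fin d)] {ψ : Rd d → ℝ} (hψ : IsCutoff ψ) {σ : ℝ} (hσ : σ = 1 ∨ σ = -1)
  {η f g : TempModPoly d} {wg : ℤ → ℝ≥0∞} {K ε : ℝ≥0∞} (hwg : Weight wg K) (hK : Weight pw K)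
  {C C₀ : ℝ} (hC : ∀ i : Option (Fin d), BlockBound ψ 1 (symb i) C)
  (hs : Small ψ wg K (data ψ σ η) ε)
include hψ hσ hwg hK hC hs

lemma exists_isInvRem (hC₀ : ∀ i : Option (Fin d), BlockBound ψ 0 (absSym⁻¹ * symb i) C₀)
    (hc : contrC ψ K C * ε ≤ 2⁻¹) (hη : IsReal η) (hf : IsReal f) (hfin : bes ψ wg f < ⊤) :
    ∃ t, IsInvRem ψ σ η f t ∧ IsReal t ∧ bes ψ wg t ≤ invC d ψ K C C₀ * ε * bes ψ wg f := by
  have hσ' := enorm_sign hσ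
  have hpw : bes ψ pw f < ⊤ := (bes_mono hwg.pw_le).trans_lt hfin
  have hs' : Small ψ pw K (data ψ σ η) ε :=
    ⟨hs.jm, fun i => (nN_mono hwg.pw_le _).trans (hs.le i), hs.small⟩
  have hgood : ∀ {F : Rd d → ℝ → ℂ}, Good ψ wg F → Good ψ pw F := fun hF =>
    ⟨hF.jm, (nN_mono hwg.pw_le _).trans_lt hF.fin⟩
  obtain ⟨U, hU, hUe, hUn⟩ := hs.exists_solution hψ hwg hσ' hC hc
    fun i => (good_data hψ hσ hwg hfin hC i).1
  have hstar : wOp σ (data ψ σ η) (star U) = wOp σ (data ψ σ η) U := by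
    refine AEq.wOp (hs.unique hψ hwg hσ' hC hc (fun i => (hU i).star hψ) hU (AEq.of_eq ?_)
      (AEq.of_eq hUe))
    nth_rewrite 1 [hUe]
    rw [star_add, star_data hψ hf, star_gradOp (star_data hψ hη)]
  set R := at' (wOp σ (data ψ σ η) U) 0 with hR
  have hbm : BM R := (hs.good_wOp hψ hwg hU).jm.bm 0
  have hreal : ∀ x, star (R x) = R x := fun x => by
    have h1 := congrFun (congrFun (star_wOp (σ := σ) (U := U) (star_data (σ := σ) hψ hη)) x) 0
    rw [hstar] at h1
    exact h1
  have hn : invN ψ wg R ≤ invC d ψ K C C₀ * ε * bes ψ wg f := by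
    refine (hs.invN_wOp_le hψ hwg hσ' hC₀ hU 0).trans ?_
    calc _ ≤ ofReal C₀ * ((d + 1) * (qC ψ K * ε *
          (2 * ((d + 1) * (harmC ψ K C * bes ψ wg f))))) := by
          gcongr
          exact hUn.trans (mul_le_mul' le_rfl (nF_data_le hψ hσ hwg hfin hC))
      _ = _ := by rw [invC]; ring
  have hlt : invC d ψ K C C₀ * ε * bes ψ wg f < ⊤ :=
    mul_lt_top (mul_lt_top (invC_lt_top hψ hK C C₀) hs.eps_lt_top) hfin
  obtain ⟨t, ht, htn, hte⟩ := exists_inverse_class hψ hwg hbm (hn.trans_lt hlt) hreal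
  have huniq : ∀ S, IsRemainder ψ σ η f S → S = R := fun S hS => by
    obtain ⟨V, hV, hVe, rfl⟩ := hS.exists_solution hψ hσ hs' hK hpw
    rw [hR, AEq.wOp (hs'.unique hψ hK hσ' hC hc hV (fun i => hgood (hU i)) hVe (AEq.of_eq hUe))]
  refine ⟨t, ⟨⟨R, isRemainder_of_solution hψ hσ hs' hK hpw (fun i => hgood (hU i))
    (AEq.of_eq hUe)⟩, fun S hS => by rw [huniq S hS]; exact hbm, fun S hS j => ?_⟩, ht,
    htn.trans_le hn⟩
  rw [huniq S hS, hte]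

omit hC in
lemma IsInvRem.add {t t' : TempModPoly d} (hf : bes ψ wg f < ⊤)
    (hg : bes ψ wg g < ⊤) (ht : IsInvRem ψ σ η f t) (ht' : IsInvRem ψ σ η g t')
    {t'' : TempModPoly d} (h'' : IsInvRem ψ σ η (f + g) t'') : t'' = t + t' := by
  have hpw : ∀ {u : TempModPoly d}, bes ψ wg u < ⊤ → bes ψ pw u < ⊤ := fun hu =>
    (bes_mono hwg.pw_le).trans_lt hu
  have hs' : Small ψ pw K (data ψ σ η) ε :=
    ⟨hs.jm, fun i => (nN_mono hwg.pw_le _).trans (hs.le i), hs.small⟩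
  obtain ⟨R, hR⟩ := ht.ex
  obtain ⟨S, hS⟩ := ht'.ex
  have h1 := hR.add hψ hσ hs' hK (hpw hf) (hpw hg) (bes_add_le.trans_lt
    (ENNReal.add_lt_top.2 ⟨hpw hf, hpw hg⟩)) (data_add hψ (hpw hf) (hpw hg)) hS
  refine eq_of_blocks hψ fun j x => ?_
  rw [h''.eq _ h1, multC_add, ht.eq R hR, ht'.eq S hS, blockF,
    multF_add (smooth_inv_dyadic hψ j).l1 (ht.bm R hR) (ht'.bm S hS)]
  rfl

end inverse

/-- The two-phase map in terms of `|D|⁻¹R^±`. -/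
lemma twoPhaseMap_iff {ψ : Rd d → ℝ} (hψ : IsCutoff ψ) {μp μm ρp ρm : ℝ}
    {η g h tp tm tη : TempModPoly d} (hp : IsInvRem ψ 1 η g tp) (hm : IsInvRem ψ (-1) η g tm)
    (hη : IsInvRem ψ 1 η η tη) : TwoPhaseMap ψ μp μm ρp ρm η g h ↔
      h = (((ρm - ρp) * μm / (μp + μm) : ℝ) : ℂ) • (η - tη) +
        (((μm / (μp + μm) : ℝ) : ℂ) • tp - ((μp / (μp + μm) : ℝ) : ℂ) • tm) := by
  have h0 : ∀ j x, blockC ψ (absSym⁻¹ * absSym) j η x = multC (dyadicSym ψ j) η x := fun j x => by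
    rw [blockC]
    congr 1 with ζ
    simp only [Pi.mul_apply, Pi.inv_apply]
    rcases eq_or_ne ζ 0 with rfl | h
    · rw [(hψ.dyadic_eventually_zero j).self_of_nhds]; simp
    · rw [inv_mul_cancel₀ (absSym_ne_zero h), one_mul]
  have hb : ∀ j x, multC (dyadicSym ψ j) ((((ρm - ρp) * μm / (μp + μm) : ℝ) : ℂ) • (η - tη) +
        (((μm / (μp + μm) : ℝ) : ℂ) • tp - ((μp / (μp + μm) : ℝ) : ℂ) • tm)) x =
      1 / (μp + μm) * (μm * multC (dyadicSym ψ j) tp x - μp * multC (dyadicSym ψ j) tm x) -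
        (ρm - ρp) * μm / (μp + μm) *
          (-1 * multC (dyadicSym ψ j) η x + multC (dyadicSym ψ j) tη x) := fun j x => by
    change multCL (dyadicSym ψ j) x _ = 1 / (μp + μm) * (μm * multCL (dyadicSym ψ j) x tp -
      μp * multCL (dyadicSym ψ j) x tm) - (ρm - ρp) * μm / (μp + μm) *
          (-1 * multCL (dyadicSym ψ j) x η + multCL (dyadicSym ψ j) x tη)
    simp only [map_add, map_sub, map_smul, smul_eq_mul]
    push_cast
    ring
  constructor
  · rintro ⟨Rp, Rm, Rη, h1, h2, h3, h4⟩
    refine eq_of_blocks hψ fun j x => ?_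
    have h5 := h4 j x
    rw [blockC_one, blockDN, h0, ← hp.eq _ h1, ← hm.eq _ h2, ← hη.eq _ h3] at h5
    rw [hb, h5]
    push_cast
    ring
  · rintro rfl
    obtain ⟨Rp, h1⟩ := hp.ex
    obtain ⟨Rm, h2⟩ := hm.ex
    obtain ⟨Rη, h3⟩ := hη.ex
    refine ⟨Rp, Rm, Rη, h1, h2, h3, fun j x => ?_⟩
    rw [blockC_one, blockDN, h0, ← hp.eq _ h1, ← hm.eq _ h2, ← hη.eq _ h3, hb]
    push_cast
    ring

/-- The weight balancing `Ḃ^1` against `Ḃ^{1+r}` at a given class. -/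
lemma exists_balanced_weight {ψ : Rd d → ℝ} (hψ : IsCutoff ψ) {r : ℝ} {η : TempModPoly d}
    (h1 : bes ψ pw η < ⊤) (h2 : bes ψ (sw (1 + r)) η < ⊤) : ∃ δ : ℝ≥0∞, δ ≠ 0 ∧ δ ≠ ⊤ ∧
      bes ψ (fun j => pw j + δ * sw (1 + r) j) η ≤ 2 * bes ψ pw η ∧
      bes ψ (fun j => pw j + δ * sw (1 + r) j) η ≤ 2 * (δ * bes ψ (sw (1 + r)) η) := by
  by_cases h0 : η = 0
  · have h : ∀ w, bes ψ w (0 : TempModPoly d) = 0 := fun w => by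
      simpa using bes_smul (ψ := ψ) (wg := w) (u := (0 : TempModPoly d)) 0
    refine ⟨1, one_ne_zero, ENNReal.one_ne_top, ?_, ?_⟩ <;> rw [h0, h] <;> exact bot_le
  · have e1 : bes ψ pw η ≠ 0 := fun h => h0 (eq_zero_of_bes hψ pw_ne_zero h)
    have e2 : bes ψ (sw (1 + r)) η ≠ 0 := fun h => h0 (eq_zero_of_bes hψ (sw_ne_zero _) h)
    have e3 : bes ψ pw η / bes ψ (sw (1 + r)) η * bes ψ (sw (1 + r)) η = bes ψ pw η :=
      ENNReal.div_mul_cancel e2 h2.ne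
    refine ⟨bes ψ pw η / bes ψ (sw (1 + r)) η, ENNReal.div_ne_zero.2 ⟨e1, h2.ne⟩,
      ENNReal.div_ne_top h1.ne e2, ?_, ?_⟩ <;>
      rw [bes_weight_add, e3, two_mul]

/-- The operators `|D|⁻¹R^±(η)` are linear contractions if `η` is small. -/
lemma exists_invRem_operator [Nonempty (Fin d)] {ψ : Rd d → ℝ} (hψ : IsCutoff ψ) {σ : ℝ}
    (hσ : σ = 1 ∨ σ = -1) {η : TempModPoly d} {wg : ℤ → ℝ≥0∞} {K ε : ℝ≥0∞} (hwg : Weight wg K)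
    (hK : Weight pw K) {C C₀ : ℝ} (hC : ∀ i : Option (Fin d), BlockBound ψ 1 (symb i) C)
    (hs : Small ψ wg K (data ψ σ η) ε)
    (hC₀ : ∀ i : Option (Fin d), BlockBound ψ 0 (absSym⁻¹ * symb i) C₀)
    (hc : contrC ψ K C * ε ≤ 2⁻¹) (hi : invC d ψ K C C₀ * ε ≤ 2⁻¹) (hη : IsReal η) :
    ∃ T : TempModPoly d → TempModPoly d,
      (∀ f, IsReal f ∧ bes ψ wg f < ⊤ → IsInvRem ψ σ η f (T f) ∧ IsReal (T f) ∧
        bes ψ wg (T f) ≤ 2⁻¹ * bes ψ wg f) ∧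
      ∀ f g, IsReal f ∧ bes ψ wg f < ⊤ → IsReal g ∧ bes ψ wg g < ⊤ → T (f + g) = T f + T g := by
  have h : ∀ f, IsReal f ∧ bes ψ wg f < ⊤ → ∃ t, IsInvRem ψ σ η f t ∧ IsReal t ∧
      bes ψ wg t ≤ 2⁻¹ * bes ψ wg f := fun f hf => by
    obtain ⟨t, h1, h2, h3⟩ := exists_isInvRem hψ hσ hwg hK hC hs hC₀ hc hη hf.1 hf.2
    exact ⟨t, h1, h2, h3.trans (mul_le_mul' hi le_rfl)⟩
  choose! T hT using h
  exact ⟨T, hT, fun f g hf hg => IsInvRem.add hψ hσ hwg hK hs hf.2 hg.2 (hT f hf).1 (hT g hg).1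
    (hT (f + g) ⟨hf.1.add hg.1, bes_add_le.trans_lt (ENNReal.add_lt_top.2 ⟨hf.2, hg.2⟩)⟩).1⟩

section fixed
variable {ψ : Rd d → ℝ} (hψ : IsCutoff ψ) {η : TempModPoly d} {wg : ℤ → ℝ≥0∞}
  {K : ℝ≥0∞} (hwg : Weight wg K) {P : TempModPoly d → Prop}
  (hP : ∀ u, P u ↔ IsReal u ∧ bes ψ wg u < ⊤)
  {Tp Tm : TempModPoly d → TempModPoly d}
  (hTp : ∀ f, IsReal f ∧ bes ψ wg f < ⊤ → IsInvRem ψ 1 η f (Tp f) ∧ IsReal (Tp f) ∧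
    bes ψ wg (Tp f) ≤ 2⁻¹ * bes ψ wg f)
  (hTm : ∀ f, IsReal f ∧ bes ψ wg f < ⊤ → IsInvRem ψ (-1) η f (Tm f) ∧ IsReal (Tm f) ∧
    bes ψ wg (Tm f) ≤ 2⁻¹ * bes ψ wg f)
  (hpa : ∀ f g, IsReal f ∧ bes ψ wg f < ⊤ → IsReal g ∧ bes ψ wg g < ⊤ → Tp (f + g) = Tp f + Tp g)
  (hma : ∀ f g, IsReal f ∧ bes ψ wg f < ⊤ → IsReal g ∧ bes ψ wg g < ⊤ → Tm (f + g) = Tm f + Tm g)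
  (hη : P η) {μp μm : ℝ} (ρp ρm : ℝ) (hμp : 0 < μp) (hμm : 0 < μm)
include hψ hwg hP hTp hTm hpa hma hη hμp hμm

theorem twoPhaseMap_solvable :
    (∀ g, P g → ∃ h, P h ∧ TwoPhaseMap ψ μp μm ρp ρm η g h ∧
      ∀ h', TwoPhaseMap ψ μp μm ρp ρm η g h' → h' = h) ∧
    ∃ f, P f ∧ TwoPhaseMap ψ μp μm ρp ρm η f f ∧
      (∀ f', P f' → TwoPhaseMap ψ μp μm ρp ρm η f' f' → f' = f) ∧
      bes ψ wg f ≤ 4 * ofReal |ρm - ρp| * bes ψ wg η := by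
  have hadd : ∀ u v, P u → P v → P (u + v) := fun u v hu hv => by
    rw [hP] at *
    exact ⟨hu.1.add hv.1, bes_add_le.trans_lt (ENNReal.add_lt_top.2 ⟨hu.2, hv.2⟩)⟩
  have hsub : ∀ u v, P u → P v → P (u - v) := fun u v hu hv => by
    rw [hP] at *
    exact ⟨hu.1.sub hv.1, bes_sub_le.trans_lt (ENNReal.add_lt_top.2 ⟨hu.2, hv.2⟩)⟩
  have hsmul : ∀ (c : ℝ) u, P u → P ((c : ℂ) • u) := fun c u hu => by
    rw [hP] at *
    rw [bes_smul]
    exact ⟨hu.1.smul c, mul_lt_top enorm_lt_top hu.2⟩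
  have hneg : ∀ u : TempModPoly d, -u = ((-1 : ℝ) : ℂ) • u := fun u => by simp
  have h0 : P 0 := by simpa using hsmul 0 η hη
  have hT : ∀ f, P f → P (Tp f) ∧ P (Tm f) := fun f hf => by
    rw [hP] at *
    have hh : 2⁻¹ * bes ψ wg f < ⊤ := mul_lt_top (by simp) hf.2
    rw [hP]
    exact ⟨⟨(hTp f hf).2.1, (hTp f hf).2.2.trans_lt hh⟩,
      ⟨(hTm f hf).2.1, (hTm f hf).2.2.trans_lt hh⟩⟩
  have hμ : 0 < μp + μm := add_pos hμp hμm
  set b := (((ρm - ρp) * μm / (μp + μm) : ℝ) : ℂ) • (η - Tp η) with hb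
  set A : TempModPoly d → TempModPoly d := fun f =>
    ((μm / (μp + μm) : ℝ) : ℂ) • Tp f - ((μp / (μp + μm) : ℝ) : ℂ) • Tm f with hA
  have hη' := (hP η).1 hη
  have hiff : ∀ g h, P g → (TwoPhaseMap ψ μp μm ρp ρm η g h ↔ h = b + A g) := fun g h hg =>
    twoPhaseMap_iff hψ (hTp g ((hP g).1 hg)).1 (hTm g ((hP g).1 hg)).1 (hTp η hη').1
  have hPb : P b := hsmul _ _ (hsub _ _ hη (hT η hη).1)
  have hPA : ∀ f, P f → P (A f) := fun f hf =>
    hsub _ _ (hsmul _ _ (hT f hf).1) (hsmul _ _ (hT f hf).2)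
  have hen : ∀ c : ℝ, 0 ≤ c → ‖(c : ℂ)‖ₑ = ofReal c := fun c hc => by
    rw [← ofReal_norm, norm_real, norm_of_nonneg hc]
  have hAle : ∀ f, P f → bes ψ wg (A f) ≤ 2⁻¹ * bes ψ wg f := fun f hf => by
    refine bes_sub_le.trans ?_
    rw [bes_smul, bes_smul, hen _ (by positivity), hen _ (by positivity)]
    refine (add_le_add (mul_le_mul' le_rfl (hTp f ((hP f).1 hf)).2.2)
      (mul_le_mul' le_rfl (hTm f ((hP f).1 hf)).2.2)).trans (le_of_eq ?_)
    rw [← add_mul, ← ENNReal.ofReal_add (by positivity) (by positivity), ← add_div,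
      add_comm μm, div_self hμ.ne', ENNReal.ofReal_one, one_mul]
  have hble : bes ψ wg b ≤ 2 * ofReal |ρm - ρp| * bes ψ wg η := by
    have hc : ‖(((ρm - ρp) * μm / (μp + μm) : ℝ) : ℂ)‖ₑ ≤ ofReal |ρm - ρp| := by
      rw [← ofReal_norm, norm_real, Real.norm_eq_abs, abs_div, abs_mul, abs_of_pos hμm,
        abs_of_pos hμ]
      refine ofReal_le_ofReal ((div_le_iff₀ hμ).2 ?_)
      exact mul_le_mul_of_nonneg_left (by linarith) (abs_nonneg _)
    have h2 : (2⁻¹ : ℝ≥0∞) ≤ 1 := ENNReal.inv_le_one.2 (by norm_num)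
    rw [hb, bes_smul]
    calc _ ≤ ofReal |ρm - ρp| * (bes ψ wg η + 1 * bes ψ wg η) :=
          mul_le_mul' hc (bes_sub_le.trans (add_le_add le_rfl
            ((hTp η hη').2.2.trans (mul_le_mul' h2 le_rfl))))
      _ = _ := by ring
  obtain ⟨f, hf, hfe, hfn, hfu⟩ := exists_fixedPoint P (bes ψ wg) A (fun x hx => ((hP x).1 hx).2)
    h0 hadd (fun x hx => by rw [hneg]; exact hsmul _ x hx) (fun _ _ _ _ => bes_add_le)
    (fun x _ => by rw [hneg, bes_smul]; simp)
    (fun x _ hx => eq_zero_of_bes hψ (fun j hj => pw_ne_zero j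
      (le_antisymm ((hwg.pw_le j).trans hj.le) bot_le)) hx)
    (fun X hX hs => by
      simp only [hP] at hX ⊢
      exact bes_complete hψ hwg hX hs)
    hPA (fun x y hx hy => by
      simp only [hA, hpa x y ((hP x).1 hx) ((hP y).1 hy), hma x y ((hP x).1 hx) ((hP y).1 hy),
        smul_add]
      abel) hAle hPb
  refine ⟨fun g hg => ⟨b + A g, hadd _ _ hPb (hPA g hg), (hiff g _ hg).2 rfl,
    fun h' hh => (hiff g h' hg).1 hh⟩, f, hf, (hiff f f hf).2 hfe,
    fun f' hf' h' => hfu f' hf' ((hiff f' f' hf').1 h'), ?_⟩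
  calc _ ≤ 2 * (2 * ofReal |ρm - ρp| * bes ψ wg η) := hfn.trans (mul_le_mul' le_rfl hble)
    _ = _ := by ring

end fixed

end Muskat

end

open Muskat in
theorem proposition4p3 {d : ℕ} (hd : 1 ≤ d) (ψ : Rd d → ℝ) (hψ : IsCutoff ψ) (r : ℝ) (hr : 0 ≤ r) :
    ∃ c : ℝ, 0 < c ∧ ∃ C : ℝ, 0 < C ∧
      ∀ μp μm ρp ρm : ℝ, 0 < μp → 0 < μm →
        ∀ η : TempModPoly d, MemSpace ψ r η → besovNorm ψ absSym 0 η < ENNReal.ofReal c →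
          (∀ g, MemSpace ψ r g → ∃ h, MemSpace ψ r h ∧ TwoPhaseMap ψ μp μm ρp ρm η g h ∧
            ∀ h', TwoPhaseMap ψ μp μm ρp ρm η g h' → h' = h) ∧
          (∃! f, MemSpace ψ r f ∧ TwoPhaseMap ψ μp μm ρp ρm η f f) ∧
          ∀ f, MemSpace ψ r f → TwoPhaseMap ψ μp μm ρp ρm η f f →
            besovNorm ψ absSym r f ≤
              ENNReal.ofReal (C * |ρm - ρp|) * besovNorm ψ absSym r η := by
  have : Nonempty (Fin d) := ⟨⟨0, hd⟩⟩
  obtain ⟨C, hC⟩ := exists_blockBound hψ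
  have hom₀ : ∀ i : Option (Fin d), Homog 0 ((absSym⁻¹ : Rd d → ℂ) * symb i) := fun i => by
    simpa using (Homog.inv_abs (d := d)).mul (deg1_symb i).hom
  obtain ⟨C₀, hC₀⟩ := exists_blockBound_of_homog hψ hom₀
  obtain ⟨Cb, hCb, hbn⟩ := besovNorm_abs hψ
  set K := sw (1 + r) 1
  have hK : Weight pw K := weight_pw_sw hr
  set S := algC ψ K + contrC ψ K C + invC d ψ K C C₀ with hS
  set Z := S * (harmC ψ K C * (2 * Cb)) + 1 with hZ
  have hZt : Z < ⊤ := by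
    have h1 := algC_lt_top hψ hK
    have h2 := contrC_lt_top (C := C) hψ hK
    have h3 := invC_lt_top hψ hK C C₀
    have h4 := harmC_lt_top (C := C) hψ hK
    rw [hZ, hS]
    finiteness
  have hZ0 : Z ≠ 0 := by rw [hZ]; simp
  have hc0 : (2 * Z)⁻¹ ≠ 0 := ENNReal.inv_ne_zero.2 (ENNReal.mul_ne_top (by simp) hZt.ne)
  have hct : (2 * Z)⁻¹ ≠ ⊤ := ENNReal.inv_ne_top.2 (mul_ne_zero (by simp) hZ0)
  have h8 : 8 * Cb * Cb ≠ ⊤ := by finiteness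
  refine ⟨((2 * Z)⁻¹).toReal, ENNReal.toReal_pos hc0 hct, (8 * Cb * Cb).toReal + 1, by positivity,
    fun μp μm ρp ρm hμp hμm η hη hsmall => ?_⟩
  rw [ENNReal.ofReal_toReal hct] at hsmall
  have hpw : ∀ u, besovNorm ψ 1 1 u = bes ψ pw u := fun u => by rw [besovNorm_one, sw_one]
  obtain ⟨δ, hδ0, hδt, hδ1, hδ2⟩ := exists_balanced_weight hψ (r := r) (η := η)
    (by rw [← hpw]; exact hη.base) (by rw [← besovNorm_one]; exact hη.high)
  set wg : ℤ → ℝ≥0∞ := fun j => pw j + δ * sw (1 + r) j with hwgd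
  have hwg : Weight wg K := weight_add hr δ
  have hP : ∀ u, MemSpace ψ r u ↔ IsReal u ∧ bes ψ wg u < ⊤ := fun u => by
    rw [hwgd, bes_weight_add, ENNReal.add_lt_top, ← hpw, ← besovNorm_one]
    constructor
    · rintro ⟨h1, h2, h3⟩
      exact ⟨h1, h2, ENNReal.mul_lt_top hδt.lt_top h3⟩
    · rintro ⟨h1, h2, h3⟩
      exact ⟨h1, h2, lt_of_not_ge fun h => by
        rw [top_le_iff.1 h, ENNReal.mul_top hδ0] at h3
        exact lt_irrefl _ h3⟩
  have hη' := (hP η).1 hη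
  set ε := harmC ψ K C * bes ψ wg η with hε
  have hle : ∀ X, X ≤ S → X * ε ≤ 2⁻¹ := fun X hX => by
    have h1 : bes ψ wg η ≤ 2 * (Cb * (2 * Z)⁻¹) := by
      refine hδ1.trans (mul_le_mul' le_rfl ?_)
      have h2 := (hbn 0 η).2
      rw [add_zero, sw_one] at h2
      exact h2.trans (mul_le_mul' le_rfl hsmall.le)
    calc X * ε ≤ S * (harmC ψ K C * (2 * (Cb * (2 * Z)⁻¹))) :=
          mul_le_mul' hX (mul_le_mul' le_rfl h1)
      _ = S * (harmC ψ K C * (2 * Cb)) * (2 * Z)⁻¹ := by ring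
      _ ≤ Z * (2 * Z)⁻¹ := mul_le_mul' le_self_add le_rfl
      _ = 2⁻¹ := by
          rw [ENNReal.mul_inv (Or.inl (by simp)) (Or.inl (by simp)), mul_left_comm,
            ENNReal.mul_inv_cancel hZ0 hZt.ne, mul_one]
  have hsm : ∀ σ : ℝ, σ = 1 ∨ σ = -1 → Small ψ wg K (data ψ σ η) ε := fun σ hσ =>
    ⟨fun i => (good_data hψ hσ hwg hη'.2 hC i).1.jm,
      fun i => (good_data hψ hσ hwg hη'.2 hC i).2, hle _ (le_self_add.trans le_self_add)⟩
  have hop := fun σ (hσ : σ = 1 ∨ σ = -1) => exists_invRem_operator hψ hσ hwg hK hC (hsm σ hσ) hC₀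
    (hle _ (le_add_self.trans le_self_add)) (hle _ le_add_self) hη'.1
  obtain ⟨Tp, hTp, hpa⟩ := hop 1 (Or.inl rfl)
  obtain ⟨Tm, hTm, hma⟩ := hop (-1) (Or.inr rfl)
  obtain ⟨h1, f, hf, hff, hfu, hfn⟩ := twoPhaseMap_solvable hψ hwg hP hTp hTm hpa hma hη ρp ρm
    hμp hμm
  refine ⟨h1, ⟨f, ⟨hf, hff⟩, fun f' h => hfu f' h.1 h.2⟩, fun f' hf' hff' => ?_⟩
  rw [hfu f' hf' hff']
  have h2 : δ * bes ψ (sw (1 + r)) f ≤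
      δ * (8 * ENNReal.ofReal |ρm - ρp| * bes ψ (sw (1 + r)) η) := by
    calc _ ≤ bes ψ wg f := by rw [hwgd, bes_weight_add]; exact le_add_self
      _ ≤ 4 * ENNReal.ofReal |ρm - ρp| * (2 * (δ * bes ψ (sw (1 + r)) η)) :=
          hfn.trans (mul_le_mul' le_rfl hδ2)
      _ = _ := by ring
  have h3 := (ENNReal.mul_le_mul_iff_right hδ0 hδt).1 h2
  calc besovNorm ψ absSym r f ≤ Cb * bes ψ (sw (1 + r)) f := (hbn r f).1
    _ ≤ Cb * (8 * ENNReal.ofReal |ρm - ρp| * (Cb * besovNorm ψ absSym r η)) :=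
        mul_le_mul' le_rfl (h3.trans (mul_le_mul' le_rfl (hbn r η).2))
    _ = 8 * Cb * Cb * ENNReal.ofReal |ρm - ρp| * besovNorm ψ absSym r η := by ring
    _ ≤ _ := by
        rw [ENNReal.ofReal_mul (by positivity)]
        gcongr
        exact (ENNReal.ofReal_toReal h8).symm.le.trans (ENNReal.ofReal_le_ofReal (by linarith))
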